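/- **Theorem.** Let $0<q<1$, $T>0$, $N>0$, $\kappa>0$ be real numbers. For $t\in[0,T]$ put $b_t(z)=q^{-z}+\kappa^2q^{z-t}$, $I_t=[t-T,N]$ and $J_t=b_t(I_t)\subset\mathbb R$. Call a family $(\rho_t)_{0\le t\le T}$ of measures on $\mathbb R$ *admissible* if each $\rho_t$ has total mass $N$, is supported on $I_t$, and has a density, also denoted $\rho_t(s)$, with $0\le\rho_t(s)\le1$. Fix $\rho_0$, and assume that for some real $r$ the measure $\rho_0$ is supported on $(-\infty,r]$ and $\kappa^2>q^{-N-r}$. For an admissible family starting from this $\rho_0$ let, for $z\in\mathbb C$ with $b_t(z)\notin J_t$, $$f_t(z)=\exp\left(-\int_{t-T}^{N}\frac{b_t'(z)\,(1-\rho_t(s))}{b_t(z)-b_t(s)}\,ds\right),$$ and let $\mathbb D_t^\circ=\{z:\ 0<\Im z<-\pi/\ln q,\ \Re z<t/2-\log_q\kappa\}$. Consider three descriptions of the family. (A) *(Burgers-type PDE.)* For all $0\le t<T$ and all $z$ with $b_t(z)\notin J_t$ and $b_t'(z)\ne0$: $f_t(z)\neq 1$, the function $f$ is differentiable in $t$ (one-sidedly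 at $t=0$) and in $z$, and $$\frac{\partial_t f_t(z)}{f_t(z)}+\frac{\partial_z(1-f_t(z))}{1-f_t(z)}=\ln(q)\,\frac{\kappa^2q^{z-t}+q^{-z}}{\kappa^2q^{z-t}-q^{-z}},$$ that is, $\partial_t\ln f_t(z)+\partial_z\ln(1-f_t(z))$ equals the right-hand side. (B) *(Implicit equation.)* For all $0<t<T$ and $z\in\mathbb D_t^\circ$ there is a unique $u\in\mathbb D_0^\circ$ with $$q^{-z}+\kappa^2q^{z-t}=\frac{q^{-u}-f_0(u)\kappa^2q^u-q^{-t}\bigl(f_0(u)q^{-u}-\kappa^2q^u\bigr)}{1-f_0(u)}$$ and $$\Im\left[q^{-u}+\kappa^2q^u-(q^{-t}-1)\frac{f_0(u)q^{-u}-\kappa^2q^u}{1-f_0(u)}\right]<0,$$ and for this $u$ $$f_t(z)=\frac{(q^{-u}+\kappa^2q^u)-(q^{-z}+\kappa^2q^z)}{(q^{-u}+\kappa^2q^u)-(q^{-z+t}+\kappa^2q^{z-t})}.$$ (C) *(Functional relation.)* For each $0\le t<T$ there is a holomorphic function $\mathcal S_t$ on $\mathbb C\setminus J_t$ such that, for all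 $z$ with $b_t(z)\notin J_t$ and $b_t'(z)\neq0$, one has $f_t(z)\ne1$ and $$\mathcal S_t(b_t(z))=q^t\,\frac{f_t(z)q^{-z}-\kappa^2q^{z-t}}{1-f_t(z)}.$$ There are a finite measure $\mu_t$ on $\mathbb R$ supported on the compact set $J_t$ and a constant $C_t\in\mathbb R$ with $$\mathcal S_t(w)=\frac{w}{q^{-T}-q^{-t}}+C_t-\int_{\mathbb R}\frac{d\mu_t(s)}{w-s},\qquad w\in\mathbb C\setminus J_t .$$ Moreover $\mathcal S_t$ has a two-sided functional inverse $\mathcal S_t^{(-1)}$ near $\infty$ with $\mathcal S_t^{(-1)}(v)=(q^{-T}-q^{-t})v+o(v)$ as $v\to\infty$, and for all sufficiently large $|v|$ (how large may depend on $t$) $$\mathcal S_t^{(-1)}(v)+q^{-t}v=\mathcal S_0^{(-1)}(v)+v .$$ Then for every admissible family starting from $\rho_0$ the descriptions (A), (B) and (C) are equivalent. Moreover, if two admissible families $(\rho_t)$ and $(\sigma_t)$ with $\sigma_0=\rho_0$ each satisfy at least one of (A), (B), (C), not necessarily the same one, then $\rho_t=\sigma_t$ for all $0\le t\le T$. -/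

import Mathlib

open Set Filter MeasureTheory Asymptotics

namespace LimitShape

/-- The density of a measure of total mass `N`, supported on `[t - T, N]`, with density at
most `1`. -/
structure IsAdmissible (T N t : ℝ) (ρ : ℝ → ℝ) : Prop where
  measurable : Measurable ρ
  nonneg : ∀ s, 0 ≤ ρ s
  le_one : ∀ s, ρ s ≤ 1
  support : ∀ s, s ∉ Icc (t - T) N → ρ s = 0
  mass : ∫ s, ρ s = N

/-- `b_t(z) = q^{-z} + κ² q^{z-t}`. -/
noncomputable def b (q κ t : ℝ) (z : ℂ) : ℂ :=
  (q : ℂ) ^ (-z) + (κ : ℂ) ^ 2 * (q : ℂ) ^ (z - t)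

/-- The set `b_t([t - T, N])`, a compact subset of the real line inside `ℂ`. -/
def cut (q κ T N t : ℝ) : Set ℂ :=
  (fun s : ℝ => b q κ t s) '' Icc (t - T) N

/-- The complex slope
`f_t(z) = exp (- ∫_{t-T}^{N} b_t'(z) (1 - ρ_t(s)) / (b_t(z) - b_t(s)) ds)`. -/
noncomputable def slope (q κ T N : ℝ) (ρ : ℝ → ℝ → ℝ) (t : ℝ) (z : ℂ) : ℂ :=
  Complex.exp (-∫ s in (t - T)..N,
    deriv (b q κ t) z * ((1 - ρ t s : ℝ) : ℂ) / (b q κ t z - b q κ t s))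

/-- The first integral `q^t (f q^{-z} - κ² q^{z-t}) / (1 - f)`. -/
noncomputable def firstIntegral (q κ t : ℝ) (z f : ℂ) : ℂ :=
  (q : ℂ) ^ (t : ℂ) * (f * (q : ℂ) ^ (-z) - (κ : ℂ) ^ 2 * (q : ℂ) ^ (z - t)) / (1 - f)

/-- The open half-strip `0 < Im z < -π / ln q`, `Re z < t/2 - log_q κ`. -/
def halfStrip (q κ t : ℝ) : Set ℂ :=
  {z | 0 < z.im ∧ z.im < -Real.pi / Real.log q ∧ z.re < t / 2 - Real.logb q κ}

/-- The equation
`∂_t ln f_t(z) + ∂_z ln (1 - f_t(z)) = ln q (κ² q^{z-t} + q^{-z}) / (κ² q^{z-t} - q^{-z})`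
for `0 ≤ t < T` and all `z` with `b_t(z) ∉ b_t([t - T, N])`. The critical points of `b_t`, at
which `f_t = 1` and the right-hand side has a pole, are left out. The time derivative is
one-sided at `t = 0`. -/
def BurgersDescription (q κ T N : ℝ) (ρ : ℝ → ℝ → ℝ) : Prop :=
  ∀ t ∈ Ico 0 T, ∀ z : ℂ, b q κ t z ∉ cut q κ T N t → deriv (b q κ t) z ≠ 0 →
    slope q κ T N ρ t z ≠ 1 ∧
    DifferentiableWithinAt ℝ (fun τ => slope q κ T N ρ τ z) (Ico 0 T) t ∧
    DifferentiableAt ℂ (slope q κ T N ρ t) z ∧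
    derivWithin (fun τ => slope q κ T N ρ τ z) (Ico 0 T) t / slope q κ T N ρ t z
        + logDeriv (fun ζ => 1 - slope q κ T N ρ t ζ) z
      = Real.log q * ((κ : ℂ) ^ 2 * (q : ℂ) ^ (z - t) + (q : ℂ) ^ (-z))
          / ((κ : ℂ) ^ 2 * (q : ℂ) ^ (z - t) - (q : ℂ) ^ (-z))

/-- `u` solves the implicit equation at `(t, z)` and lies on the distinguished branch; here
`f₀` is the complex slope at time `0`. -/
def IsBranch (q κ : ℝ) (f₀ : ℂ → ℂ) (t : ℝ) (z u : ℂ) : Prop :=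
  b q κ t z
      = ((q : ℂ) ^ (-u) - f₀ u * (κ : ℂ) ^ 2 * (q : ℂ) ^ u
          - (q : ℂ) ^ (-t : ℂ) * (f₀ u * (q : ℂ) ^ (-u) - (κ : ℂ) ^ 2 * (q : ℂ) ^ u))
        / (1 - f₀ u) ∧
  u ∈ halfStrip q κ 0 ∧
  ((q : ℂ) ^ (-u) + (κ : ℂ) ^ 2 * (q : ℂ) ^ u
      - ((q : ℂ) ^ (-t : ℂ) - 1)
        * ((f₀ u * (q : ℂ) ^ (-u) - (κ : ℂ) ^ 2 * (q : ℂ) ^ u) / (1 - f₀ u))).im < 0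

/-- For `0 < t < T` and `z` in the half-strip at time `t`, the implicit equation has a unique
solution `u` on the distinguished branch, and
`f_t(z) = ((q^{-u} + κ² q^u) - (q^{-z} + κ² q^z)) /
  ((q^{-u} + κ² q^u) - (q^{-z+t} + κ² q^{z-t}))`. -/
def ImplicitDescription (q κ T N : ℝ) (ρ : ℝ → ℝ → ℝ) : Prop :=
  ∀ t ∈ Ioo 0 T, ∀ z ∈ halfStrip q κ t,
    (∃! u : ℂ, IsBranch q κ (slope q κ T N ρ 0) t z u) ∧
    ∀ u : ℂ, IsBranch q κ (slope q κ T N ρ 0) t z u →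
      slope q κ T N ρ t z
        = (((q : ℂ) ^ (-u) + (κ : ℂ) ^ 2 * (q : ℂ) ^ u)
            - ((q : ℂ) ^ (-z) + (κ : ℂ) ^ 2 * (q : ℂ) ^ z))
          / (((q : ℂ) ^ (-u) + (κ : ℂ) ^ 2 * (q : ℂ) ^ u)
            - ((q : ℂ) ^ (-z + t) + (κ : ℂ) ^ 2 * (q : ℂ) ^ (z - t)))

/-- `S` is the holomorphic function on `ℂ \ b_t([t - T, N])` with
`S(b_t(z)) = q^t (f_t(z) q^{-z} - κ² q^{z-t}) / (1 - f_t(z))`. At the critical points of `b_t`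
the right-hand side reads `0 / 0`, and `S` is determined there by holomorphy. -/
def IsTransform (q κ T N : ℝ) (ρ : ℝ → ℝ → ℝ) (t : ℝ) (S : ℂ → ℂ) : Prop :=
  DifferentiableOn ℂ S (cut q κ T N t)ᶜ ∧
  ∀ z : ℂ, b q κ t z ∉ cut q κ T N t → deriv (b q κ t) z ≠ 0 →
    slope q κ T N ρ t z ≠ 1 ∧
    S (b q κ t z) = firstIntegral q κ t z (slope q κ T N ρ t z)

/-- `S(w) = w / (q^{-T} - q^{-t}) + C - ∫ dμ(s) / (w - s)` off `b_t([t - T, N])`, for a real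
constant `C` and a finite measure `μ` on `ℝ` carried by the compact set `b_t([t - T, N])`. -/
def HasNevanlinnaForm (q κ T N t : ℝ) (S : ℂ → ℂ) : Prop :=
  ∃ (μ : Measure ℝ) (C : ℝ), IsFiniteMeasure μ ∧ μ {s : ℝ | (s : ℂ) ∉ cut q κ T N t} = 0 ∧
    ∀ w : ℂ, w ∉ cut q κ T N t →
      S w = w / ((q : ℂ) ^ (-T : ℂ) - (q : ℂ) ^ (-t : ℂ)) + C - ∫ s : ℝ, 1 / (w - s) ∂μ

/-- `G` is the functional inverse of `S` near infinity, with `G(v) = c v + o(v)`. -/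
def IsInverseAtInfinity (S G : ℂ → ℂ) (c : ℂ) : Prop :=
  (∀ᶠ v in Bornology.cobounded ℂ, S (G v) = v) ∧
  (∀ᶠ w in Bornology.cobounded ℂ, G (S w) = w) ∧
  (fun v => G v - c * v) =o[Bornology.cobounded ℂ] (fun v => v)

/-- The functions `S_t`, `0 ≤ t < T`, have the Nevanlinna form, and their functional inverses
at infinity satisfy `S_t^{(-1)}(v) + q^{-t} v = S_0^{(-1)}(v) + v`. -/
def InvariantDescription (q κ T N : ℝ) (ρ : ℝ → ℝ → ℝ) : Prop :=
  ∃ S G : ℝ → ℂ → ℂ,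
    ∀ t ∈ Ico 0 T,
      IsTransform q κ T N ρ t (S t) ∧
      HasNevanlinnaForm q κ T N t (S t) ∧
      IsInverseAtInfinity (S t) (G t) ((q : ℂ) ^ (-T : ℂ) - (q : ℂ) ^ (-t : ℂ)) ∧
      ∀ᶠ v in Bornology.cobounded ℂ, G t v + (q : ℂ) ^ (-t : ℂ) * v = G 0 v + v

end LimitShape

open Set Filter MeasureTheory Asymptotics
open scoped Topology ComplexConjugate

namespace LimitShape

/-! ### Schwarz-type formula on the disc. -/

section

/-! Put L = -ln q, k = κ², p = k e^{Lt}, x = q^{-z} = e^{Lz} and h = 1 - ρ. Then b_t(z) = x + p/x is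
a Joukowski map, and ln f_t is -L(x - p/x) times the Cauchy transform of h ds along the nodes
b_t(s). Replacing x by p/x inverts f_t and leaves the first integral unchanged, so the first
integral is a function S_t of w = b_t(z), holomorphic off the cut (`exists_transform`). In these
terms (A) is the inviscid equation ∂_t S = L e^{Lt} S ∂_w S, with characteristics w = u - (e^{Lt} -
1) S_0(u). Each of the three descriptions is shown to be equivalent to `Subordinated`: for nonreal w
the point u = w + (e^{Lt} - 1) S_t(w) lies in the half-plane of w, and S_0(u) = S_t(w).

Characteristics can be inverted because S_0 is a Nevanlinna function: Im S_0 has the sign of Im w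
(`transform_im_nonpos`). This is where κ² > q^{-N-r} enters. By a bathtub argument
(`exists_extremal`), among the densities that give the exponent a prescribed imaginary part, the
indicator of an initial interval makes |f| smallest, and smallest |f| is the worst case for the
sign; for that density S_0 is an explicit rational function of w with at most one finite pole.
`herglotz_repr` turns the sign into S_0(w) = w/c + C - ∫ dμ(s)/(w - s) with c = e^{LT} - 1. For 0 ≤
β < c and w in the lower half-plane, u - β S_0(u) = w then has exactly one solution u there
(`subordination_exists`, `subordination_unique`); the upper half-plane follows by conjugation.

Equivalences. From (A): along a characteristic, S_t minus its initial value solves a linear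
homogeneous differential equation, so it vanishes by Gronwall's inequality; the separate derivatives
in (A) are first upgraded to a joint one (`hasFDerivWithinAt_of_bounded`). To (A): subordination
presents S_t near any time as S_{t₀} composed with an implicit function. (B): b_t maps the
half-strip bijectively onto the lower half-plane, the implicit equation is the characteristic
through b_t(z), and the formula for f_t says S_t(b_t(z)) = S_0(b_0(u)). (C): the functional relation
is subordination at w = S_t^{(-1)}(v) for large v; the identity theorem carries it from a
neighbourhood of infinity to the half-plane.

Uniqueness. Subordination determines S_t, hence f_t, hence its exponent, whose imaginary part is
confined to a single branch, hence the Cauchy transform of h_t along the nodes. The map s ↦ b_t(s)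
folds at e^{2Ls} = p, so this transform alone mixes two points s. Above the fold f_t has positive
real boundary values (`Subordinated.exists_tendsto_fx`), which forces h_t to be locally 0 or 1
there, with the same choice for both families. Below the fold the nodes are injective and the
moments determine the rest. -/

/-- A conjugation-symmetric function on the unit disc vanishing at the origin, recovered from its
imaginary part on a circle. -/
theorem disc_kernel_repr {g : ℂ → ℂ} (hg : DifferentiableOn ℂ g (Metric.ball 0 1)) (g0 : g 0 = 0)
    (hconj : ∀ ζ ∈ Metric.ball (0 : ℂ) 1, g (conj ζ) = conj (g ζ)) {r : ℝ} (hr0 : 0 < r)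
    (hr1 : r < 1) {ζ : ℂ} (hζ : ‖ζ‖ < 1) :
    g (r * ζ) = (1 / Real.pi : ℝ) * ∫ θ in (0 : ℝ)..2 * Real.pi,
      (((g (r * Complex.exp (θ * Complex.I))).im * Real.sin θ : ℝ) : ℂ) *
        (ζ / (1 - 2 * ζ * Real.cos θ + ζ ^ 2)) := by
  set F : ℂ → ℂ := fun η => g (r * η) with hF
  have hmem : ∀ η : ℂ, ‖η‖ ≤ 1 → (r : ℂ) * η ∈ Metric.ball (0 : ℂ) 1 := by
    intro η hη
    rw [mem_ball_zero_iff, norm_mul, Complex.norm_real, Real.norm_of_nonneg hr0.le]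
    nlinarith [norm_nonneg η]
  have hrpos : 1 < 1 / r := by rw [lt_div_iff₀ hr0]; linarith
  have hFd : DifferentiableOn ℂ F (Metric.ball 0 (1 / r)) := by
    refine hg.comp (by fun_prop) ?_
    intro η hη
    rw [mem_ball_zero_iff, lt_div_iff₀ hr0] at hη
    rw [mem_ball_zero_iff, norm_mul, Complex.norm_real, Real.norm_of_nonneg hr0.le]
    linarith
  have hne : ∀ η : ℂ, ‖η‖ ≤ 1 → 1 - ζ * η ≠ 0 := by
    intro η hη h
    have h1 : ζ * η = 1 := by linear_combination -h
    have h2 : ‖ζ‖ * ‖η‖ = 1 := by rw [← norm_mul, h1, norm_one]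
    nlinarith [norm_nonneg η, norm_nonneg ζ]
  have hFc : DiffContOnCl ℂ F (Metric.ball 0 1) :=
    hFd.diffContOnCl_ball (Metric.closedBall_subset_ball hrpos)
  have hinv : DiffContOnCl ℂ (fun η => (1 - ζ * η)⁻¹) (Metric.ball 0 1) := by
    refine DifferentiableOn.diffContOnCl ?_
    rw [closure_ball _ one_ne_zero]
    intro η hη
    exact ((by fun_prop : DifferentiableAt ℂ (fun η => 1 - ζ * η) η).inv
      (hne η (by simpa using hη))).differentiableWithinAt
  -- Cauchy's formula is used twice: for F with pole ζ, and for F(η)/(1 - ζη) with pole 0, where F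
  -- vanishes. The difference of the two kernels is -2i sin θ times `k`.
  have c1 := hFc.circleIntegral_sub_inv_smul (mem_ball_zero_iff.2 hζ)
  have c2 := (hinv.smul hFc).circleIntegral_sub_inv_smul (w := 0)
    (Metric.mem_ball_self one_pos)
  rw [circleIntegral] at c1 c2
  set e : ℝ → ℂ := fun θ => Complex.exp (θ * Complex.I) with he
  have hen : ∀ θ, ‖e θ‖ = 1 := fun θ => Complex.norm_exp_ofReal_mul_I θ
  have hec : Continuous e := by fun_prop
  have hFe : Continuous fun θ => F (e θ) := by
    refine continuous_iff_continuousAt.2 fun θ => ?_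
    have h1 : ContinuousAt F (e θ) := by
      refine (hFd.differentiableAt (Metric.isOpen_ball.mem_nhds ?_)).continuousAt
      rw [mem_ball_zero_iff, hen]; exact hrpos
    exact ContinuousAt.comp (f := e) (g := F) h1 hec.continuousAt
  have hne1 : ∀ θ, e θ - ζ ≠ 0 := by
    intro θ h
    have := hen θ
    rw [sub_eq_zero.1 h] at this; linarith
  have hne2 : ∀ θ, 1 - ζ * e θ ≠ 0 := fun θ => hne _ (hen θ).le
  have hpos : ∀ θ, e θ ≠ 0 := fun θ => Complex.exp_ne_zero _
  have hcos : ∀ θ, e θ + (e θ)⁻¹ = 2 * Real.cos θ := by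
    intro θ
    simp only [he, ← Complex.exp_neg]
    rw [Complex.ofReal_cos, Complex.cos]
    ring_nf
  have hsin : ∀ θ, (e θ)⁻¹ - e θ = -2 * Complex.I * Real.sin θ := by
    intro θ
    simp only [he, ← Complex.exp_neg]
    rw [Complex.ofReal_sin, Complex.sin]
    ring_nf
    rw [Complex.I_sq]; ring
  have hden : ∀ θ : ℝ, 1 - 2 * ζ * Real.cos θ + ζ ^ 2 = (e θ - ζ) * (1 - ζ * e θ) * (e θ)⁻¹ := by
    intro θ
    have := hcos θ
    field_simp [hpos θ] at this ⊢
    linear_combination ζ * this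
  have hden0 : ∀ θ : ℝ, 1 - 2 * ζ * Real.cos θ + ζ ^ 2 ≠ 0 := by
    intro θ
    rw [hden]
    exact mul_ne_zero (mul_ne_zero (hne1 θ) (hne2 θ)) (inv_ne_zero (hpos θ))
  set k : ℝ → ℂ := fun θ => ζ / (1 - 2 * ζ * Real.cos θ + ζ ^ 2) with hk
  have hkc : Continuous k := by
    refine continuous_const.div (by fun_prop) hden0
  have d1 : (∫ θ in (0 : ℝ)..2 * Real.pi, F (e θ) * (-2 * Complex.I * Real.sin θ * k θ))
      = 2 * Real.pi * F ζ := by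
    have e1 : (∫ θ in (0 : ℝ)..2 * Real.pi, Complex.I * (e θ * (e θ - ζ)⁻¹ * F (e θ)))
        = 2 * Real.pi * Complex.I * F ζ := by
      rw [← smul_eq_mul (2 * Real.pi * Complex.I), ← c1]
      congr 1; ext θ
      simp only [deriv_circleMap, circleMap, smul_eq_mul, he]
      push_cast
      ring_nf
    have e2 : (∫ θ in (0 : ℝ)..2 * Real.pi, Complex.I * ((1 - ζ * e θ)⁻¹ * F (e θ))) = 0 := by
      have : (0 : ℂ) = (2 * Real.pi * Complex.I) •
          (1 - ζ * 0)⁻¹ • F 0 := by simp [hF, g0]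
      rw [this, ← c2]
      congr 1; ext θ
      have := hpos θ
      simp only [he] at this
      simp only [deriv_circleMap, circleMap, smul_eq_mul, he, zero_add,
        Complex.ofReal_one, one_mul, sub_zero]
      field_simp
    have e3 : (∫ θ in (0 : ℝ)..2 * Real.pi, Complex.I * (e θ * (e θ - ζ)⁻¹ * F (e θ)))
        - (∫ θ in (0 : ℝ)..2 * Real.pi, Complex.I * ((1 - ζ * e θ)⁻¹ * F (e θ)))
        = Complex.I * ∫ θ in (0 : ℝ)..2 * Real.pi,
          F (e θ) * (-2 * Complex.I * Real.sin θ * k θ) := by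
      rw [← intervalIntegral.integral_sub, ← intervalIntegral.integral_const_mul]
      · congr 1; ext θ
        rw [← hsin, hk]
        simp only [hden]
        have := hne1 θ
        have := hne2 θ
        rw [mul_comm] at this
        have := hpos θ
        field_simp
        ring
      · refine Continuous.intervalIntegrable ?_ _ _
        exact continuous_const.mul ((hec.mul ((hec.sub continuous_const).inv₀ hne1)).mul hFe)
      · refine Continuous.intervalIntegrable ?_ _ _
        exact continuous_const.mul
          (((continuous_const.sub (continuous_const.mul hec)).inv₀ hne2).mul hFe)
    rw [e1, e2, sub_zero] at e3
    have := mul_left_cancel₀ Complex.I_ne_zero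
      (show Complex.I * (2 * Real.pi * F ζ) = Complex.I * _ by rw [← e3]; ring)
    rw [this]
  -- The reflection θ ↦ 2π - θ conjugates F and changes the sign of sin θ, so replacing F by its
  -- conjugate negates the integral; subtracting leaves only Im F.
  have hrefl : ∀ θ : ℝ, F (e (2 * Real.pi - θ)) = conj (F (e θ)) := by
    intro θ
    have h1 : e (2 * Real.pi - θ) = conj (e θ) := by
      simp only [he]
      rw [← Complex.exp_conj]
      simp only [map_mul, Complex.conj_ofReal, Complex.conj_I]
      rw [show ((2 * Real.pi - θ : ℝ) : ℂ) * Complex.I = 2 * Real.pi * Complex.I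
        + θ * (-Complex.I) by push_cast; ring, Complex.exp_add, Complex.exp_two_pi_mul_I, one_mul]
    rw [h1]
    have := hconj _ (hmem (e θ) (hen θ).le)
    simpa [hF] using this
  have d2 : (∫ θ in (0 : ℝ)..2 * Real.pi, conj (F (e θ)) * (-2 * Complex.I * Real.sin θ * k θ))
      = - ∫ θ in (0 : ℝ)..2 * Real.pi, F (e θ) * (-2 * Complex.I * Real.sin θ * k θ) := by
    have := intervalIntegral.integral_comp_sub_left (a := 0) (b := 2 * Real.pi)
      (fun θ => F (e θ) * (-2 * Complex.I * Real.sin θ * k θ)) (2 * Real.pi)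
    rw [sub_self, sub_zero] at this
    rw [← this, ← intervalIntegral.integral_neg]
    congr 1; ext θ
    rw [hrefl]
    simp only [hk, Real.cos_two_pi_sub, Real.sin_two_pi_sub]
    push_cast; ring
  have hkc' : Continuous fun θ : ℝ => -2 * Complex.I * Real.sin θ * k θ := by fun_prop
  have d3 : (∫ θ in (0 : ℝ)..2 * Real.pi, F (e θ) * (-2 * Complex.I * Real.sin θ * k θ))
      - (∫ θ in (0 : ℝ)..2 * Real.pi, conj (F (e θ)) * (-2 * Complex.I * Real.sin θ * k θ))
      = 4 * ∫ θ in (0 : ℝ)..2 * Real.pi, (((F (e θ)).im * Real.sin θ : ℝ) : ℂ) * k θ := by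
    rw [← intervalIntegral.integral_sub, ← intervalIntegral.integral_const_mul]
    · congr 1; ext θ
      have : F (e θ) - conj (F (e θ)) = 2 * (F (e θ)).im * Complex.I := by
        rw [Complex.sub_conj]; push_cast; ring
      rw [← sub_mul, this]
      push_cast
      linear_combination (-4 * (F (e θ)).im * Complex.sin θ * k θ) * Complex.I_sq
    · exact (hFe.mul hkc').intervalIntegrable _ _
    · exact ((Complex.continuous_conj.comp hFe).mul hkc').intervalIntegrable _ _
  rw [d2, d1] at d3
  have hpi : (Real.pi : ℂ) ≠ 0 := by exact_mod_cast Real.pi_ne_zero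
  have : F ζ = (1 / Real.pi : ℝ) *
      ∫ θ in (0 : ℝ)..2 * Real.pi, (((F (e θ)).im * Real.sin θ : ℝ) : ℂ) * k θ := by
    push_cast at d3 ⊢
    field_simp
    linear_combination d3 / 4
  exact this

end

/-! ### Joukowski roots, weak limits and the Herglotz representation. -/

section

/-- The two roots have product `p`, so one of them has norm at most `√p`. This choice of root pulls
statements about w back to the coordinate x. -/
theorem exists_joukowski_root (v : ℂ) {p : ℝ} (hp : 0 < p) :
    ∃ x : ℂ, x ≠ 0 ∧ x + p / x = v ∧ ‖x‖ ^ 2 ≤ p := by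
  have hp' : (p : ℂ) ≠ 0 := by exact_mod_cast hp.ne'
  obtain ⟨s, hs⟩ := IsAlgClosed.exists_eq_mul_self (v ^ 2 - 4 * p)
  have key : ∀ s : ℂ, v ^ 2 - 4 * p = s * s → (v + s) / 2 ≠ 0 ∧
      (v + s) / 2 + p / ((v + s) / 2) = v ∧ p / ((v + s) / 2) = (v - s) / 2 := by
    intro s hs
    have hne : (v + s) / 2 ≠ 0 := by
      intro h
      have : (v + s) / 2 * (v - s) = 2 * p := by linear_combination hs / 2
      rw [h, zero_mul] at this
      exact hp' (by linear_combination -this / 2)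
    have hdiv : p / ((v + s) / 2) = (v - s) / 2 := by
      rw [div_eq_iff hne]; linear_combination -hs / 4
    exact ⟨hne, by rw [hdiv]; ring, hdiv⟩
  obtain ⟨h1, h2, h3⟩ := key s hs
  rcases le_total (‖(v + s) / 2‖ ^ 2) p with h | h
  · exact ⟨_, h1, h2, h⟩
  · obtain ⟨g1, g2, -⟩ := key (-s) (by linear_combination hs)
    refine ⟨_, g1, g2, ?_⟩
    rw [← sub_eq_add_neg, ← h3, norm_div, div_pow, Complex.norm_real, Real.norm_of_nonneg hp.le,
      div_le_iff₀ (by positivity)]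
    nlinarith

theorem joukowski_of_norm_sq_eq {x : ℂ} {p : ℝ} (hp : 0 < p) (hx : ‖x‖ ^ 2 = p) :
    (p : ℂ) / x = conj x := by
  have hx0 : x ≠ 0 := by rintro rfl; simp at hx; linarith
  rw [div_eq_iff hx0, mul_comm, Complex.mul_conj, Complex.normSq_eq_norm_sq, hx]

theorem joukowski_im (x : ℂ) (p : ℝ) :
    (x + p / x).im = x.im * (1 - p / ‖x‖ ^ 2) := by
  rw [Complex.add_im, Complex.div_im]
  simp [Complex.normSq_eq_norm_sq]
  ring

/-- Weak compactness for push-forwards of continuous densities into a compact interval. -/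
theorem exists_weak_limit_of_density {ι : Type*} {𝓕 : Filter ι} [𝓕.NeBot] {A B a b M : ℝ}
    (hAB : A ≤ B) (hab : a ≤ b) {c : ℝ → ℝ} (hc : Continuous c) (hcm : ∀ θ, c θ ∈ Icc A B)
    {d : ι → ℝ → ℝ} (hd : ∀ᶠ r in 𝓕, Continuous (d r) ∧ (∀ θ, 0 ≤ d r θ) ∧
      ∫ θ in a..b, d r θ ≤ M) :
    ∃ (μ : Measure ℝ) (l : Filter ι), IsFiniteMeasure μ ∧ μ (Icc A B)ᶜ = 0 ∧ l.NeBot ∧ l ≤ 𝓕 ∧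
      ∀ F : ℝ → ℂ, ContinuousOn F (Icc A B) →
        Tendsto (fun r => ∫ θ in a..b, (d r θ : ℂ) * F (c θ)) l (𝓝 (∫ s, F s ∂μ)) := by
  classical
  set D : ι → Measure ℝ := fun r =>
    ((volume.restrict (Ioc a b)).withDensity fun θ => ((d r θ).toNNReal : ENNReal)).map c with hD
  have hmass : ∀ r, Continuous (d r) → (∀ θ, 0 ≤ d r θ) →
      D r univ = ENNReal.ofReal (∫ θ in a..b, d r θ) := by
    intro r h1 h2
    rw [hD, Measure.map_apply hc.measurable MeasurableSet.univ, preimage_univ,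
      withDensity_apply _ MeasurableSet.univ, Measure.restrict_univ,
      intervalIntegral.integral_of_le hab, ofReal_integral_eq_lintegral_ofReal]
    · rfl
    · exact (h1.integrableOn_Icc.mono_set Ioc_subset_Icc_self)
    · exact Eventually.of_forall h2
  -- Finiteness is available only eventually along 𝓕; the default value 0 elsewhere does not affect
  -- the limit.
  set m : ι → FiniteMeasure ℝ := fun r => if h : IsFiniteMeasure (D r) then ⟨D r, h⟩ else 0 with hm
  have hmD : ∀ r, Continuous (d r) → (∀ θ, 0 ≤ d r θ) → (m r : Measure ℝ) = D r := by
    intro r h1 h2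
    have : IsFiniteMeasure (D r) := ⟨by rw [hmass r h1 h2]; exact ENNReal.ofReal_lt_top⟩
    have h3 : m r = ⟨D r, this⟩ := dif_pos this
    rw [h3]; rfl
  have hDsupp : ∀ r, D r (Icc A B)ᶜ = 0 := by
    intro r
    rw [hD, Measure.map_apply hc.measurable measurableSet_Icc.compl]
    have : c ⁻¹' (Icc A B)ᶜ = ∅ := by
      ext θ
      simpa using hcm θ
    rw [this, measure_empty]
  have hcomp := isCompact_setOfPred_finiteMeasure_le_of_isCompact (E := ℝ) M.toNNReal
    (isCompact_Icc (a := A) (b := B))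
  -- Finite measures on [A, B] of mass at most M form a compact set, so an ultrafilter finer than 𝓕
  -- converges without extracting a sequence.
  set U : Ultrafilter ι := Ultrafilter.of 𝓕 with hU
  have hUle : (U : Filter ι) ≤ 𝓕 := Ultrafilter.of_le 𝓕
  have hmem : {μ : FiniteMeasure ℝ | μ.mass ≤ M.toNNReal ∧ μ (Icc A B)ᶜ = 0} ∈ U.map m := by
    rw [Ultrafilter.mem_map]
    refine hUle ?_
    filter_upwards [hd] with r hr
    refine ⟨?_, ?_⟩
    · rw [← ENNReal.coe_le_coe, FiniteMeasure.ennreal_mass, hmD r hr.1 hr.2.1,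
        hmass r hr.1 hr.2.1]
      exact ENNReal.ofReal_le_ofReal hr.2.2
    · rw [FiniteMeasure.null_iff_toMeasure_null, hmD r hr.1 hr.2.1]
      exact hDsupp r
  obtain ⟨μ, hμ, hlim⟩ := hcomp.ultrafilter_le_nhds' _ hmem
  have hμ0 : (μ : Measure ℝ) (Icc A B)ᶜ = 0 := by
    rw [← FiniteMeasure.null_iff_toMeasure_null]; exact hμ.2
  refine ⟨μ, U, inferInstance, hμ0, inferInstance, hUle, ?_⟩
  intro F hF
  -- F is continuous only on [A, B]. Composing with the projection onto [A, B] gives a bounded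
  -- continuous test function with the same integrals.
  set P : ℝ → ℝ := fun s => (projIcc A B hAB s : ℝ) with hP
  have hPc : Continuous P := continuous_subtype_val.comp continuous_projIcc
  have hPm : ∀ s, P s ∈ Icc A B := fun s => (projIcc A B hAB s).2
  have hPe : ∀ s ∈ Icc A B, P s = s := fun s hs => by
    simp only [hP, projIcc_of_mem hAB hs]
  have hFP : Continuous fun s => F (P s) :=
    hF.comp_continuous hPc hPm
  obtain ⟨Cb, hCb⟩ := isCompact_Icc.exists_bound_of_continuousOn hF
  set f : BoundedContinuousFunction ℝ ℂ :=
    BoundedContinuousFunction.ofNormedAddCommGroup (fun s => F (P s)) hFP Cb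
      (fun s => hCb _ (hPm s)) with hf
  have key : Tendsto m U (𝓝 μ) := hlim
  have key2 := (FiniteMeasure.tendsto_iff_forall_integral_rclike_tendsto ℂ).1 key f
  have e1 : ∫ s, f s ∂(μ : Measure ℝ) = ∫ s, F s ∂(μ : Measure ℝ) := by
    refine integral_congr_ae ?_
    have : ∀ᵐ s ∂(μ : Measure ℝ), s ∈ Icc A B := hμ0
    filter_upwards [this] with s hs
    simp only [hf, BoundedContinuousFunction.coe_ofNormedAddCommGroup, hPe s hs]
  rw [e1] at key2
  refine key2.congr' ?_
  filter_upwards [hUle hd] with r hr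
  rw [hmD r hr.1 hr.2.1, hD, integral_map hc.measurable.aemeasurable
    f.continuous.aestronglyMeasurable, integral_withDensity_eq_integral_smul
    (hr.1.measurable.real_toNNReal), intervalIntegral.integral_of_le hab]
  refine integral_congr_ae (Eventually.of_forall fun θ => ?_)
  simp only [hf, BoundedContinuousFunction.coe_ofNormedAddCommGroup, hPe _ (hcm θ)]
  rw [NNReal.smul_def, Real.coe_toNNReal _ (hr.2.1 θ)]
  simp

/-- **Herglotz representation** for a function that is holomorphic off a compact interval. -/
theorem herglotz_repr {A B a C : ℝ} (hAB : A < B) {S : ℂ → ℂ}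
    (hS : DifferentiableOn ℂ S ((fun s : ℝ => (s : ℂ)) '' Icc A B)ᶜ)
    (hconj : ∀ w, w ∉ (fun s : ℝ => (s : ℂ)) '' Icc A B → S (conj w) = conj (S w))
    (hpos : ∀ w : ℂ, 0 < w.im → 0 ≤ (S w).im)
    (hlim : Tendsto (fun w => S w - a * w - C) (Bornology.cobounded ℂ) (𝓝 0)) :
    ∃ μ : Measure ℝ, IsFiniteMeasure μ ∧ μ (Icc A B)ᶜ = 0 ∧
      ∀ w, w ∉ (fun s : ℝ => (s : ℂ)) '' Icc A B → S w = a * w + C - ∫ s : ℝ, 1 / (w - s) ∂μ := by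
  set K : Set ℂ := (fun s : ℝ => (s : ℂ)) '' Icc A B with hK
  have hKc : IsCompact K := isCompact_Icc.image Complex.continuous_ofReal
  -- J maps the punctured unit disc onto the complement of [A, B], with 0 going to infinity and
  -- e^{iθ} to c θ. The scale is (B - A)/4 because ζ + 1/ζ covers [-2, 2] on the circle.
  set m : ℝ := (A + B) / 2 with hm
  set ρ : ℝ := (B - A) / 4 with hρ
  have hρ0 : 0 < ρ := by rw [hρ]; linarith
  have hρ' : (ρ : ℂ) ≠ 0 := by exact_mod_cast hρ0.ne'
  set J : ℂ → ℂ := fun ζ => m + ρ * (ζ + ((1 : ℝ) : ℂ) / ζ) with hJ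
  set c : ℝ → ℝ := fun θ => m + 2 * ρ * Real.cos θ with hc
  have hcmem : ∀ θ, c θ ∈ Icc A B := by
    intro θ
    have := Real.neg_one_le_cos θ
    have := Real.cos_le_one θ
    simp only [hc, hm, hρ, mem_Icc]
    constructor <;> nlinarith
  have hJK : ∀ ζ : ℂ, ζ ≠ 0 → ‖ζ‖ < 1 → J ζ ∉ K := by
    rintro ζ h0 h1 ⟨s, hs, hsJ⟩
    have him := congrArg Complex.im hsJ
    have hre := congrArg Complex.re hsJ
    simp only [hJ, Complex.ofReal_im, Complex.ofReal_re, Complex.add_im, Complex.add_re,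
      Complex.re_ofReal_mul, Complex.im_ofReal_mul] at him hre
    rw [← Complex.add_im, joukowski_im] at him
    have hn : 0 < ‖ζ‖ ^ 2 := by positivity
    have hn1 : 1 < 1 / ‖ζ‖ ^ 2 := by
      rw [lt_div_iff₀ hn]; nlinarith [norm_nonneg ζ]
    have hi : ζ.im = 0 := by
      have : ρ * (1 - 1 / ‖ζ‖ ^ 2) * ζ.im = 0 := by linear_combination -him
      rcases mul_eq_zero.1 this with h | h
      · exfalso; nlinarith
      · exact h
    obtain ⟨y, rfl⟩ : ∃ y : ℝ, ζ = y := ⟨ζ.re, Complex.ext rfl (by simp [hi])⟩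
    rw [← Complex.ofReal_div, Complex.ofReal_re, Complex.ofReal_re] at hre
    have hy0 : y ≠ 0 := by exact_mod_cast h0
    rw [Complex.norm_real, Real.norm_eq_abs] at h1
    have hs1 : ((s - m) / ρ) ^ 2 ≤ 4 := by
      rw [div_pow, div_le_iff₀ (by positivity)]
      have h1 := hs.1
      have h2 := hs.2
      simp only [hm, hρ]
      nlinarith
    have hs2 : (s - m) / ρ = y + 1 / y := by rw [div_eq_iff hρ0.ne']; linarith
    rw [hs2] at hs1
    have hs3 : (y + 1 / y) ^ 2 = 4 + (y - 1 / y) ^ 2 := by field_simp; ring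
    have hs4 : y - 1 / y = 0 := by nlinarith [sq_nonneg (y - 1 / y)]
    have : y ^ 2 = 1 := by field_simp at hs4; linarith
    have := (sq_lt_one_iff_abs_lt_one y).2 h1
    linarith
  have hJs : ∀ w, w ∉ K → ∃ ζ : ℂ, ζ ≠ 0 ∧ ‖ζ‖ < 1 ∧ J ζ = w := by
    intro w hw
    obtain ⟨ζ, h0, h1, h2⟩ := exists_joukowski_root ((w - m) / ρ) one_pos
    have hJw : J ζ = w := by simp only [hJ, h1]; field_simp; ring
    refine ⟨ζ, h0, ?_, hJw⟩
    by_contra hlt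
    have h3 : ‖ζ‖ = 1 := by nlinarith [norm_nonneg ζ]
    have h4 : ((1 : ℝ) : ℂ) / ζ = conj ζ := joukowski_of_norm_sq_eq one_pos (by rw [h3]; norm_num)
    apply hw
    refine ⟨m + 2 * ρ * ζ.re, ?_, ?_⟩
    · have := abs_le.1 ((Complex.abs_re_le_norm ζ).trans h3.le)
      simp only [hm, hρ, mem_Icc]
      constructor <;> nlinarith [this.1, this.2]
    · rw [← hJw]
      simp only [hJ, h4, Complex.add_conj]
      push_cast; ring
  -- By `hlim` the singularity at ζ = 0 is removable, with value 0.
  set g : ℂ → ℂ := fun ζ => if ζ = 0 then 0 else S (J ζ) - a * J ζ - C with hg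
  have hJd : ∀ ζ : ℂ, ζ ≠ 0 → DifferentiableAt ℂ J ζ := by
    intro ζ h
    exact (differentiableAt_const _).add ((differentiableAt_const _).mul
      (differentiableAt_id.add ((differentiableAt_const _).div differentiableAt_id h)))
  have hSd : ∀ w, w ∉ K → DifferentiableAt ℂ S w := fun w hw =>
    hS.differentiableAt (hKc.isClosed.isOpen_compl.mem_nhds hw)
  have hgd : DifferentiableOn ℂ g (Metric.ball 0 1) := by
    refine (Complex.differentiableOn_compl_singleton_and_continuousAt_iff (c := 0)
      (Metric.ball_mem_nhds _ one_pos)).1 ⟨?_, ?_⟩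
    · intro ζ hζ
      have h0 : ζ ≠ 0 := hζ.2
      have h1 : ‖ζ‖ < 1 := by simpa using hζ.1
      have : DifferentiableAt ℂ (fun ζ => S (J ζ) - a * J ζ - C) ζ := by
        have := DifferentiableAt.comp ζ (hSd _ (hJK ζ h0 h1)) (hJd ζ h0)
        exact (this.sub ((differentiableAt_const _).mul (hJd ζ h0))).sub
          (differentiableAt_const _)
      refine (this.congr_of_eventuallyEq ?_).differentiableWithinAt
      filter_upwards [isOpen_ne.mem_nhds h0] with η hη
      simp only [hg]
      rw [if_neg hη]
    · rw [continuousAt_iff_punctured_nhds]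
      simp only [hg, if_pos rfl]
      have hJt : Tendsto J (𝓝[≠] 0) (Bornology.cobounded ℂ) := by
        have h1 : Tendsto (fun ζ : ℂ => ‖ζ⁻¹‖) (𝓝[≠] 0) atTop :=
          tendsto_norm_atTop_iff_cobounded.2 tendsto_inv₀_nhdsNE_zero
        refine (tendsto_norm_atTop_iff_cobounded.1 ?_)
        refine tendsto_atTop_mono' _ ?_
          (tendsto_atTop_add_const_right _ (-(|m| + ρ)) (h1.const_mul_atTop hρ0))
        filter_upwards [nhdsWithin_le_nhds (Metric.ball_mem_nhds (0 : ℂ) one_pos)] with ζ hζ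
        have : J ζ = ρ * ζ⁻¹ + (m + ρ * ζ) := by simp only [hJ]; push_cast; ring
        rw [this]
        have h2 := norm_sub_le_norm_add ((ρ : ℂ) * ζ⁻¹) (m + ρ * ζ)
        have h3 := norm_add_le (m : ℂ) (ρ * ζ)
        rw [mem_ball_zero_iff] at hζ
        rw [norm_mul, Complex.norm_real, Complex.norm_real, Real.norm_of_nonneg hρ0.le,
          Real.norm_eq_abs] at h3
        rw [norm_mul (ρ : ℂ), Complex.norm_real, Real.norm_of_nonneg hρ0.le] at h2
        nlinarith
      refine (hlim.comp hJt).congr' ?_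
      filter_upwards [self_mem_nhdsWithin] with ζ hζ
      have hζ' : ζ ≠ 0 := hζ
      rw [if_neg hζ']; rfl
  have hJconj : ∀ ζ, J (conj ζ) = conj (J ζ) := by
    intro ζ; simp [hJ]
  have hgconj : ∀ ζ ∈ Metric.ball (0 : ℂ) 1, g (conj ζ) = conj (g ζ) := by
    intro ζ hζ
    by_cases h0 : ζ = 0
    · simp [hg, h0]
    · have h1 : conj ζ ≠ 0 := by simpa using h0
      simp only [hg, if_neg h0, if_neg h1, hJconj]
      rw [hconj _ (hJK ζ h0 (by simpa using hζ))]
      simp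
  have hrepr := fun {r : ℝ} (h0 : 0 < r) (h1 : r < 1) {ζ : ℂ} (hζ : ‖ζ‖ < 1) =>
    disc_kernel_repr hgd (by simp [hg]) hgconj h0 h1 hζ
  set e : ℝ → ℝ → ℂ := fun r θ => r * Complex.exp (θ * Complex.I) with he
  have hen : ∀ r θ, 0 < r → ‖e r θ‖ = r := by
    intro r θ hr
    rw [he, norm_mul, Complex.norm_exp_ofReal_mul_I, mul_one, Complex.norm_real,
      Real.norm_of_nonneg hr.le]
  have he0 : ∀ r θ, 0 < r → e r θ ≠ 0 := fun r θ hr => by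
    rw [← norm_pos_iff, hen r θ hr]; exact hr
  have hJim : ∀ r θ, 0 < r → (J (e r θ)).im = ρ * (r - 1 / r) * Real.sin θ := by
    intro r θ hr
    simp only [hJ, Complex.add_im, Complex.ofReal_im, Complex.im_ofReal_mul]
    rw [← Complex.add_im, joukowski_im, hen r θ hr]
    have : (e r θ).im = r * Real.sin θ := by
      simp only [he, Complex.im_ofReal_mul, Complex.exp_ofReal_mul_I_im]
    rw [this]; field_simp; ring
  -- For r < 1 the map J exchanges the half-planes, since r - 1/r < 0; this is the source of the
  -- minus sign that makes `d` nonnegative.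
  set d : ℝ → ℝ → ℝ := fun r θ => -(ρ / Real.pi) * (S (J (e r θ))).im * Real.sin θ with hd
  have hSre : ∀ w, w ∉ K → w.im < 0 → (S w).im ≤ 0 := by
    intro w hw hwi
    have h1 := hpos (conj w) (by simpa using hwi)
    rw [hconj w hw] at h1
    simpa using h1
  have hd0 : ∀ r θ, 0 < r → r < 1 → 0 ≤ d r θ := by
    intro r θ h0 h1
    have hk : J (e r θ) ∉ K := hJK _ (he0 r θ h0) (by rw [hen r θ h0]; exact h1)
    have hr' : r - 1 / r < 0 := by
      have : 1 < 1 / r := by rw [lt_div_iff₀ h0]; linarith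
      linarith
    have hJi := hJim r θ h0
    have hpi := Real.pi_pos
    have h2 : (S (J (e r θ))).im * Real.sin θ ≤ 0 := by
      rcases lt_trichotomy (Real.sin θ) 0 with h | h | h
      · have : 0 < (J (e r θ)).im := by
          rw [hJi]; exact mul_pos_of_neg_of_neg (by nlinarith) h
        exact mul_nonpos_of_nonneg_of_nonpos (hpos _ this) h.le
      · rw [h, mul_zero]
      · have : (J (e r θ)).im < 0 := by
          rw [hJi]; exact mul_neg_of_neg_of_pos (by nlinarith) h
        exact mul_nonpos_of_nonpos_of_nonneg (hSre _ hk this) h.le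
    have : 0 ≤ ρ / Real.pi := by positivity
    simp only [hd]
    nlinarith
  have hdc : ∀ r, 0 < r → r < 1 → Continuous (d r) := by
    intro r h0 h1
    have : Continuous fun θ => S (J (e r θ)) := by
      refine continuous_iff_continuousAt.2 fun θ => ?_
      have hk : J (e r θ) ∉ K := hJK _ (he0 r θ h0) (by rw [hen r θ h0]; exact h1)
      have h2 : ContinuousAt (e r) θ := by simp only [he]; fun_prop
      exact ContinuousAt.comp (f := fun θ => J (e r θ)) (hSd _ hk).continuousAt
        (ContinuousAt.comp (f := e r) (hJd _ (he0 r θ h0)).continuousAt h2)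
    exact (continuous_const.mul (Complex.continuous_im.comp this)).mul Real.continuous_sin
  have hker : ∀ (ζ : ℂ) (θ : ℝ), ζ ≠ 0 →
      ζ / (1 - 2 * ζ * Real.cos θ + ζ ^ 2) = ρ / (J ζ - c θ) := by
    intro ζ θ h0
    have : J ζ - c θ = ρ * ((1 - 2 * ζ * Real.cos θ + ζ ^ 2) / ζ) := by
      simp only [hJ, hc]; push_cast; field_simp; ring
    rw [this, div_mul_eq_div_div, div_self hρ', one_div_div]
  have hJc : ∀ (ζ : ℂ) (θ : ℝ), ζ ≠ 0 → ‖ζ‖ < 1 → J ζ - c θ ≠ 0 := by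
    intro ζ θ h0 h1 h
    exact hJK ζ h0 h1 ⟨c θ, hcmem θ, (sub_eq_zero.1 h).symm⟩
  have hcc : Continuous c := by simp only [hc]; fun_prop
  have hkc : ∀ ζ : ℂ, ζ ≠ 0 → ‖ζ‖ < 1 → Continuous fun θ => 1 / (J ζ - c θ) := by
    intro ζ h0 h1
    refine continuous_const.div (by fun_prop) fun θ => hJc ζ θ h0 h1
  -- The second integral comes from Im(a J) on the circle of radius r; its coefficient contains r -
  -- 1/r and disappears as r → 1.
  have hmain : ∀ (r : ℝ) (ζ : ℂ), 0 < r → r < 1 → ζ ≠ 0 → ‖ζ‖ < 1 →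
      g (r * ζ) = -(∫ θ in (0 : ℝ)..2 * Real.pi, (d r θ : ℂ) * (1 / (J ζ - c θ)))
        - (a * ρ ^ 2 * (r - 1 / r) / Real.pi : ℝ) *
          ∫ θ in (0 : ℝ)..2 * Real.pi, ((Real.sin θ ^ 2 : ℝ) : ℂ) * (1 / (J ζ - c θ)) := by
    intro r ζ h0 h1 h2 h3
    rw [hrepr h0 h1 h3, ← intervalIntegral.integral_const_mul, ← intervalIntegral.integral_neg,
      ← intervalIntegral.integral_const_mul, ← intervalIntegral.integral_sub]
    · congr 1; ext θ
      have hgi : (g (e r θ)).im = (S (J (e r θ))).im - a * (ρ * (r - 1 / r) * Real.sin θ) := by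
        simp only [hg, if_neg (he0 r θ h0), Complex.sub_im, Complex.im_ofReal_mul,
          Complex.ofReal_im, hJim r θ h0, sub_zero]
      have hpi : (Real.pi : ℂ) ≠ 0 := by exact_mod_cast Real.pi_ne_zero
      rw [hker ζ θ h2, show (r * Complex.exp (θ * Complex.I)) = e r θ from rfl, hgi]
      have := hJc ζ θ h2 h3
      simp only [hd]
      push_cast
      field_simp
    · refine Continuous.intervalIntegrable ?_ _ _
      exact ((Complex.continuous_ofReal.comp (hdc r h0 h1)).mul (hkc ζ h2 h3)).neg
    · refine Continuous.intervalIntegrable ?_ _ _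
      exact continuous_const.mul ((by fun_prop : Continuous fun θ : ℝ =>
        ((Real.sin θ ^ 2 : ℝ) : ℂ)).mul (hkc ζ h2 h3))
  have hgc : ∀ ζ : ℂ, ‖ζ‖ < 1 → Tendsto (fun r : ℝ => g (r * ζ)) (𝓝[<] 1) (𝓝 (g ζ)) := by
    intro ζ hζ
    have h1 : ContinuousAt g ζ := (hgd.differentiableAt
      (Metric.isOpen_ball.mem_nhds (by simpa using hζ))).continuousAt
    have h2 : Tendsto (fun r : ℝ => (r : ℂ) * ζ) (𝓝[<] 1) (𝓝 ζ) := by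
      have : Continuous fun r : ℝ => (r : ℂ) * ζ := by fun_prop
      simpa using (this.tendsto 1).mono_left nhdsWithin_le_nhds
    exact h1.tendsto.comp h2
  have hEc : ∀ z : ℂ, Tendsto (fun r : ℝ => ((a * ρ ^ 2 * (r - 1 / r) / Real.pi : ℝ) : ℂ) * z)
      (𝓝[<] 1) (𝓝 0) := by
    intro z
    have : ContinuousAt (fun r : ℝ => ((a * ρ ^ 2 * (r - 1 / r) / Real.pi : ℝ) : ℂ) * z) 1 := by
      have : ContinuousAt (fun r : ℝ => a * ρ ^ 2 * (r - 1 / r) / Real.pi) 1 := by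
        have : ContinuousAt (fun r : ℝ => 1 / r) 1 := by
          simp only [one_div]
          exact continuousAt_inv₀ (one_ne_zero (α := ℝ))
        fun_prop
      exact (Complex.continuous_ofReal.continuousAt.comp this).mul continuousAt_const
    simpa using this.tendsto.mono_left nhdsWithin_le_nhds
  have hr01 : ∀ᶠ r : ℝ in 𝓝[<] 1, 0 < r ∧ r < 1 := by
    filter_upwards [self_mem_nhdsWithin, nhdsWithin_le_nhds (lt_mem_nhds one_pos)] with r h1 h2
    exact ⟨h2, h1⟩
  have hdlim : ∀ ζ : ℂ, ζ ≠ 0 → ‖ζ‖ < 1 → Tendsto (fun r =>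
      ∫ θ in (0 : ℝ)..2 * Real.pi, (d r θ : ℂ) * (1 / (J ζ - c θ))) (𝓝[<] 1) (𝓝 (-g ζ)) := by
    intro ζ h0 h1
    have := ((hgc ζ h1).add (hEc (∫ θ in (0 : ℝ)..2 * Real.pi,
      ((Real.sin θ ^ 2 : ℝ) : ℂ) * (1 / (J ζ - c θ))))).neg
    rw [add_zero] at this
    refine this.congr' ?_
    filter_upwards [hr01] with r hr
    rw [hmain r ζ hr.1 hr.2 h0 h1]
    ring
  -- J(1/2) = m + 5ρ/2 is real and to the right of B = m + 2ρ. The kernel there is at least 2/(9ρ),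
  -- so convergence at this one point bounds the masses.
  have hhalf0 : ((1 / 2 : ℝ) : ℂ) ≠ 0 := by norm_num
  have hhalf1 : ‖((1 / 2 : ℝ) : ℂ)‖ < 1 := by rw [Complex.norm_real]; norm_num
  have hJhalf : J ((1 / 2 : ℝ) : ℂ) = ((m + 5 / 2 * ρ : ℝ) : ℂ) := by
    simp only [hJ]; push_cast; ring
  have hmassb : ∀ᶠ r in 𝓝[<] (1 : ℝ), Continuous (d r) ∧ (∀ θ, 0 ≤ d r θ) ∧
      ∫ θ in (0 : ℝ)..2 * Real.pi, d r θ ≤ 9 / 2 * ρ * (‖-g ((1 / 2 : ℝ) : ℂ)‖ + 1) := by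
    have h1 := (hdlim _ hhalf0 hhalf1).norm
    filter_upwards [hr01, h1.eventually (gt_mem_nhds (lt_add_one _))] with r hr h2
    refine ⟨hdc r hr.1 hr.2, fun θ => hd0 r θ hr.1 hr.2, ?_⟩
    have hdcr := hdc r hr.1 hr.2
    have h3 : (∫ θ in (0 : ℝ)..2 * Real.pi, (d r θ : ℂ) * (1 / (J ((1 / 2 : ℝ) : ℂ) - c θ)))
        = ((∫ θ in (0 : ℝ)..2 * Real.pi, d r θ * (1 / (m + 5 / 2 * ρ - c θ)) : ℝ) : ℂ) := by
      rw [← intervalIntegral.integral_ofReal]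
      congr 1; ext θ
      rw [hJhalf]; push_cast; ring
    rw [h3, Complex.norm_real] at h2
    have hb : ∀ θ, 0 < m + 5 / 2 * ρ - c θ ∧ m + 5 / 2 * ρ - c θ ≤ 9 / 2 * ρ := by
      intro θ
      have := Real.neg_one_le_cos θ
      have := Real.cos_le_one θ
      simp only [hc]
      constructor <;> nlinarith
    have h4 : ∫ θ in (0 : ℝ)..2 * Real.pi, d r θ ≤
        ∫ θ in (0 : ℝ)..2 * Real.pi, 9 / 2 * ρ * (d r θ * (1 / (m + 5 / 2 * ρ - c θ))) := by
      refine intervalIntegral.integral_mono_on (by positivity) (hdcr.intervalIntegrable _ _) ?_ ?_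
      · refine Continuous.intervalIntegrable ?_ _ _
        exact continuous_const.mul (hdcr.mul (continuous_const.div (by fun_prop)
          fun θ => (hb θ).1.ne'))
      · intro θ _
        have h5 : 1 ≤ 9 / 2 * ρ * (1 / (m + 5 / 2 * ρ - c θ)) := by
          rw [mul_one_div, le_div_iff₀ (hb θ).1, one_mul]
          exact (hb θ).2
        have := hd0 r θ hr.1 hr.2
        nlinarith
    rw [intervalIntegral.integral_const_mul] at h4
    refine h4.trans ?_
    have := (le_abs_self _).trans h2.le
    gcongr
  obtain ⟨μ, l, hfin, hμ0, hl, hl1, hlim2⟩ := exists_weak_limit_of_density hAB.le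
    (by positivity : (0 : ℝ) ≤ 2 * Real.pi) hcc hcmem hmassb
  refine ⟨μ, hfin, hμ0, ?_⟩
  intro w hw
  obtain ⟨ζ, h0, h1, hζw⟩ := hJs w hw
  have h2 : ContinuousOn (fun s : ℝ => 1 / (w - s)) (Icc A B) := by
    refine continuousOn_const.div (by fun_prop) ?_
    intro s hs h
    exact hw ⟨s, hs, (sub_eq_zero.1 h).symm⟩
  have h3 := hlim2 _ h2
  have h4 := (hdlim ζ h0 h1).mono_left hl1
  rw [hζw] at h4
  have h5 := tendsto_nhds_unique h3 h4
  rw [h5]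
  simp only [hg, if_neg h0, hζw]
  ring

end

/-! ### Nevanlinna functions and the equation u - β S(u) = w. -/

section

/-- The compact interval `[A, B]` of the real line inside `ℂ`. -/
def seg (A B : ℝ) : Set ℂ := (fun s : ℝ => (s : ℂ)) '' Icc A B

theorem isCompact_seg (A B : ℝ) : IsCompact (seg A B) :=
  isCompact_Icc.image Complex.continuous_ofReal

theorem notMem_seg_of_im_ne {A B : ℝ} {w : ℂ} (hw : w.im ≠ 0) : w ∉ seg A B := by
  rintro ⟨s, -, rfl⟩; simp at hw

theorem ofReal_mem_seg {A B x : ℝ} : (x : ℂ) ∈ seg A B ↔ x ∈ Icc A B := by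
  constructor
  · rintro ⟨s, hs, h⟩
    have : s = x := Complex.ofReal_injective h
    rwa [← this]
  · intro h; exact ⟨x, h, rfl⟩

theorem sub_ne_zero_of_notMem_seg {A B : ℝ} {w : ℂ} (hw : w ∉ seg A B) {s : ℝ}
    (hs : s ∈ Icc A B) : w - s ≠ 0 := fun h => hw ⟨s, hs, (sub_eq_zero.1 h).symm⟩

theorem exists_ball_far_from_seg {A B : ℝ} {w : ℂ} (hw : w ∉ seg A B) :
    ∃ δ > 0, ∀ u ∈ Metric.ball w δ, u ∉ seg A B ∧ ∀ s ∈ Icc A B, δ ≤ ‖u - s‖ := by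
  obtain ⟨ε, hε, h⟩ := Metric.isOpen_iff.1 (isCompact_seg A B).isClosed.isOpen_compl w hw
  have hfar : ∀ u ∈ Metric.ball w (ε / 2), ∀ s ∈ Icc A B, ε / 2 ≤ ‖u - s‖ := by
    intro u hu s hs
    by_contra hlt
    push Not at hlt
    have h1 : (s : ℂ) ∈ Metric.ball w ε := by
      rw [Metric.mem_ball, dist_comm, dist_eq_norm]
      rw [Metric.mem_ball, dist_comm, dist_eq_norm] at hu
      calc ‖w - s‖ = ‖(w - u) + (u - s)‖ := by ring_nf
        _ ≤ ‖w - u‖ + ‖u - s‖ := norm_add_le _ _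
        _ < ε := by linarith
    exact h h1 ⟨s, hs, rfl⟩
  refine ⟨ε / 2, by positivity, fun u hu => ⟨?_, hfar u hu⟩⟩
  exact h (Metric.ball_subset_ball (by linarith) hu)

section Cauchy

variable {A B : ℝ} {μ : Measure ℝ}

theorem ae_mem_of_carrier (hμ : μ (Icc A B)ᶜ = 0) : ∀ᵐ s ∂μ, s ∈ Icc A B := hμ

theorem integrable_of_continuousOn_carrier [IsFiniteMeasure μ] (hμ : μ (Icc A B)ᶜ = 0)
    {E : Type*} [NormedAddCommGroup E] [NormedSpace ℝ E] {F : ℝ → E}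
    (hF : ContinuousOn F (Icc A B)) : Integrable F μ := by
  have h1 : IntegrableOn F (Icc A B) μ := hF.integrableOn_compact isCompact_Icc
  rwa [IntegrableOn, Measure.restrict_eq_self_of_ae_mem (ae_mem_of_carrier hμ)] at h1

/-- The function `w / c + C - ∫ dμ(s) / (w - s)`. -/
noncomputable def nev (c C : ℝ) (μ : Measure ℝ) (w : ℂ) : ℂ :=
  w / c + C - ∫ s : ℝ, 1 / (w - s) ∂μ

/-- The integral `∫ dμ(s) / |w - s|²`. -/
noncomputable def energy (μ : Measure ℝ) (w : ℂ) : ℝ := ∫ s : ℝ, 1 / ‖w - s‖ ^ 2 ∂μ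

theorem continuousOn_inv_sub {w : ℂ} (hw : w ∉ seg A B) :
    ContinuousOn (fun s : ℝ => 1 / (w - s)) (Icc A B) :=
  continuousOn_const.div (by fun_prop) fun _ hs => sub_ne_zero_of_notMem_seg hw hs

theorem continuousOn_inv_sub_mul {w u : ℂ} (hw : w ∉ seg A B) (hu : u ∉ seg A B) :
    ContinuousOn (fun s : ℝ => 1 / ((w - s) * (u - s))) (Icc A B) :=
  continuousOn_const.div (by fun_prop) fun _ hs =>
    mul_ne_zero (sub_ne_zero_of_notMem_seg hw hs) (sub_ne_zero_of_notMem_seg hu hs)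

theorem continuousOn_inv_norm_sq {w : ℂ} (hw : w ∉ seg A B) :
    ContinuousOn (fun s : ℝ => 1 / ‖w - s‖ ^ 2) (Icc A B) :=
  continuousOn_const.div (by fun_prop) fun _ hs =>
    (pow_pos (norm_pos_iff.2 (sub_ne_zero_of_notMem_seg hw hs)) 2).ne'

theorem energy_nonneg (μ : Measure ℝ) (w : ℂ) : 0 ≤ energy μ w :=
  integral_nonneg fun _ => by positivity

variable [IsFiniteMeasure μ] (hμ : μ (Icc A B)ᶜ = 0) {c C : ℝ}

include hμ in
theorem nev_sub_nev {w u : ℂ} (hw : w ∉ seg A B) (hu : u ∉ seg A B) :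
    nev c C μ w - nev c C μ u = (w - u) * (1 / c + ∫ s : ℝ, 1 / ((w - s) * (u - s)) ∂μ) := by
  have h1 : (∫ s : ℝ, 1 / (w - s) ∂μ) - ∫ s : ℝ, 1 / (u - s) ∂μ
      = -((w - u) * ∫ s : ℝ, 1 / ((w - s) * (u - s)) ∂μ) := by
    rw [← integral_sub (integrable_of_continuousOn_carrier hμ (continuousOn_inv_sub hw))
      (integrable_of_continuousOn_carrier hμ (continuousOn_inv_sub hu)), ← integral_const_mul,
      ← integral_neg]
    refine integral_congr_ae ?_
    filter_upwards [ae_mem_of_carrier hμ] with s hs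
    have := sub_ne_zero_of_notMem_seg hw hs
    have := sub_ne_zero_of_notMem_seg hu hs
    field_simp
    ring
  simp only [nev]
  linear_combination -h1

include hμ in
theorem nev_im {w : ℂ} (hw : w ∉ seg A B) :
    (nev c C μ w).im = w.im * (1 / c + energy μ w) := by
  have h1 : (∫ s : ℝ, 1 / (w - s) ∂μ).im = -(w.im * energy μ w) := by
    rw [← Complex.imCLM_apply, ← ContinuousLinearMap.integral_comp_comm _
      (integrable_of_continuousOn_carrier hμ (continuousOn_inv_sub hw)), energy,
      ← integral_const_mul, ← integral_neg]
    congr 1; ext s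
    rw [Complex.imCLM_apply, one_div, Complex.inv_im, Complex.normSq_eq_norm_sq]
    simp; ring
  simp only [nev, Complex.sub_im, Complex.add_im, h1, Complex.ofReal_im, Complex.div_ofReal_im]
  ring

include hμ in
-- The inequality 2/(ab) ≤ 1/a² + 1/b² under the integral. It bounds a divided difference of `nev`
-- by the two energies, which the imaginary parts control.
theorem norm_integral_inv_mul_le {w u : ℂ} (hw : w ∉ seg A B) (hu : u ∉ seg A B) :
    ‖∫ s : ℝ, 1 / ((w - s) * (u - s)) ∂μ‖ ≤ (energy μ w + energy μ u) / 2 := by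
  have h1 : (energy μ w + energy μ u) / 2
      = ∫ s : ℝ, (1 / ‖w - s‖ ^ 2 + 1 / ‖u - s‖ ^ 2) / 2 ∂μ := by
    rw [integral_div, integral_add, energy, energy]
    · exact integrable_of_continuousOn_carrier hμ (continuousOn_inv_norm_sq hw)
    · exact integrable_of_continuousOn_carrier hμ (continuousOn_inv_norm_sq hu)
  rw [h1]
  refine norm_integral_le_of_norm_le ?_ ?_
  · exact ((integrable_of_continuousOn_carrier hμ (continuousOn_inv_norm_sq hw)).add
      (integrable_of_continuousOn_carrier hμ (continuousOn_inv_norm_sq hu))).div_const 2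
  · refine Eventually.of_forall fun s => ?_
    rw [norm_div, norm_mul, norm_one]
    have := sq_nonneg (1 / ‖w - s‖ - 1 / ‖u - s‖)
    have e : 1 / (‖w - s‖ * ‖u - s‖) = 1 / ‖w - s‖ * (1 / ‖u - s‖) := by
      rw [one_div_mul_one_div]
    rw [e]
    have e1 : 1 / ‖w - s‖ ^ 2 = (1 / ‖w - s‖) ^ 2 := by rw [one_div_pow]
    have e2 : 1 / ‖u - s‖ ^ 2 = (1 / ‖u - s‖) ^ 2 := by rw [one_div_pow]
    rw [e1, e2]
    nlinarith

include hμ in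
theorem tendsto_integral_inv_mul {w : ℂ} (hw : w ∉ seg A B) :
    Tendsto (fun u : ℂ => ∫ s : ℝ, 1 / ((u - s) * (w - s)) ∂μ) (𝓝 w)
      (𝓝 (∫ s : ℝ, 1 / ((w - s) * (w - s)) ∂μ)) := by
  obtain ⟨δ, hδ, hball⟩ := exists_ball_far_from_seg hw
  refine tendsto_integral_filter_of_dominated_convergence (fun _ => 1 / (δ * δ)) ?_ ?_
    (integrable_const _) ?_
  · filter_upwards [Metric.ball_mem_nhds w hδ] with u hu
    exact (integrable_of_continuousOn_carrier hμ
      (continuousOn_inv_sub_mul (hball u hu).1 hw)).aestronglyMeasurable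
  · filter_upwards [Metric.ball_mem_nhds w hδ] with u hu
    filter_upwards [ae_mem_of_carrier hμ] with s hs
    rw [norm_div, norm_mul, norm_one]
    have h1 := (hball u hu).2 s hs
    have h2 := (hball w (Metric.mem_ball_self hδ)).2 s hs
    gcongr
  · filter_upwards [ae_mem_of_carrier hμ] with s hs
    have h2 := sub_ne_zero_of_notMem_seg hw hs
    have : ContinuousAt (fun u : ℂ => 1 / ((u - s) * (w - s))) w :=
      continuousAt_const.div (by fun_prop) (mul_ne_zero h2 h2)
    exact this.tendsto

include hμ in
theorem tendsto_energy {w : ℂ} (hw : w ∉ seg A B) :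
    Tendsto (energy μ) (𝓝 w) (𝓝 (energy μ w)) := by
  obtain ⟨δ, hδ, hball⟩ := exists_ball_far_from_seg hw
  refine tendsto_integral_filter_of_dominated_convergence (fun _ => 1 / δ ^ 2) ?_ ?_
    (integrable_const _) ?_
  · filter_upwards [Metric.ball_mem_nhds w hδ] with u hu
    exact (integrable_of_continuousOn_carrier hμ
      (continuousOn_inv_norm_sq (hball u hu).1)).aestronglyMeasurable
  · filter_upwards [Metric.ball_mem_nhds w hδ] with u hu
    filter_upwards [ae_mem_of_carrier hμ] with s hs
    rw [norm_div, norm_one, norm_pow, norm_norm]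
    have h1 := (hball u hu).2 s hs
    gcongr
  · filter_upwards [ae_mem_of_carrier hμ] with s hs
    have h2 := norm_pos_iff.2 (sub_ne_zero_of_notMem_seg hw hs)
    have : ContinuousAt (fun u : ℂ => 1 / ‖u - s‖ ^ 2) w :=
      continuousAt_const.div (by fun_prop) (pow_pos h2 2).ne'
    exact this.tendsto

include hμ in
theorem hasDerivAt_nev {w : ℂ} (hw : w ∉ seg A B) :
    HasDerivAt (nev c C μ) (1 / c + ∫ s : ℝ, 1 / ((w - s) * (w - s)) ∂μ) w := by
  rw [hasDerivAt_iff_tendsto_slope]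
  have := ((tendsto_integral_inv_mul hμ hw).const_add (1 / (c : ℂ))).mono_left
    (nhdsWithin_le_nhds (s := {w}ᶜ))
  refine this.congr' ?_
  have h1 : ∀ᶠ u in 𝓝[≠] w, u ∉ seg A B :=
    nhdsWithin_le_nhds ((isCompact_seg A B).isClosed.isOpen_compl.mem_nhds hw)
  filter_upwards [h1, self_mem_nhdsWithin] with u hu hne
  have hne' : u - w ≠ 0 := sub_ne_zero.2 hne
  rw [slope_def_field, nev_sub_nev hμ hu hw, mul_div_cancel_left₀ _ hne']

include hμ in
/-! ### Subordination -/

variable {β : ℝ}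

include hμ in
theorem im_sub_nev {u : ℂ} (hu : u ∉ seg A B) :
    (u - β * nev c C μ u).im = u.im * (1 - β / c - β * energy μ u) := by
  rw [Complex.sub_im, Complex.im_ofReal_mul, nev_im hμ hu]; ring

/-- To be used with `im_sub_nev`: keeping u and u - β S(u) in one half-plane forces the factor 1 -
β/c - β·energy to be positive. -/
theorem pos_factor_of_im {u w : ℂ} {E : ℝ} (hu : 0 < u.im * w.im)
    (h : w.im = u.im * E) : 0 < E := by
  rw [h] at hu
  by_contra hE
  push Not at hE
  nlinarith [sq_nonneg u.im]

include hμ in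
-- If it vanished, 1 - β/c would equal β times the off-diagonal integral, whose norm is at most the
-- mean of the two energies; the mean of the two hypotheses excludes this.
theorem factor_ne_zero (hβ0 : 0 ≤ β) {u v : ℂ} (hu : u ∉ seg A B) (hv : v ∉ seg A B)
    (h1 : 0 < 1 - β / c - β * energy μ u) (h2 : 0 < 1 - β / c - β * energy μ v) :
    (1 : ℂ) - β * (1 / c + ∫ s : ℝ, 1 / ((u - s) * (v - s)) ∂μ) ≠ 0 := by
  intro h
  have h3 : ((1 - β / c : ℝ) : ℂ) = β * ∫ s : ℝ, 1 / ((u - s) * (v - s)) ∂μ := by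
    push_cast; linear_combination h
  have h4 := congrArg norm h3
  rw [norm_mul, Complex.norm_real, Complex.norm_real, Real.norm_of_nonneg hβ0] at h4
  have h5 := norm_integral_inv_mul_le hμ hu hv
  have h6 := le_abs_self (1 - β / c)
  rw [← Real.norm_eq_abs] at h6
  nlinarith

include hμ in
/-- Uniqueness in the subordination equation. -/
theorem subordination_unique (hβ0 : 0 ≤ β) {u v w : ℂ}
    (hu : 0 < u.im * w.im) (hv : 0 < v.im * w.im) (hHu : u - β * nev c C μ u = w)
    (hHv : v - β * nev c C μ v = w) : u = v := by
  have hu' : u ∉ seg A B := notMem_seg_of_im_ne (by rintro h; simp [h] at hu)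
  have hv' : v ∉ seg A B := notMem_seg_of_im_ne (by rintro h; simp [h] at hv)
  have h1 := pos_factor_of_im hu (by rw [← im_sub_nev hμ hu', hHu])
  have h2 := pos_factor_of_im hv (by rw [← im_sub_nev hμ hv', hHv])
  have h3 := factor_ne_zero hμ hβ0 hu' hv' h1 h2
  have h4 := nev_sub_nev (c := c) (C := C) hμ hu' hv'
  have h5 : (u - v) * ((1 : ℂ) - β * (1 / c + ∫ s : ℝ, 1 / ((u - s) * (v - s)) ∂μ)) = 0 := by
    linear_combination hHu - hHv + β * h4
  rcases mul_eq_zero.1 h5 with h | h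
  · exact sub_eq_zero.1 h
  · exact absurd h h3

include hμ in
theorem subordination_deriv_ne_zero (hβ0 : 0 ≤ β) {u : ℂ} (hu : u ∉ seg A B)
    (h1 : 0 < 1 - β / c - β * energy μ u) : (1 : ℂ) - β * deriv (nev c C μ) u ≠ 0 := by
  rw [(hasDerivAt_nev hμ hu).deriv]
  exact factor_ne_zero hμ hβ0 hu hu h1 h1

include hμ in
theorem differentiableOn_nev : DifferentiableOn ℂ (nev c C μ) (seg A B)ᶜ :=
  fun _ hw => (hasDerivAt_nev hμ hw).differentiableAt.differentiableWithinAt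

include hμ in
theorem analyticAt_nev {w : ℂ} (hw : w ∉ seg A B) : AnalyticAt ℂ (nev c C μ) w :=
  (differentiableOn_nev hμ).analyticAt ((isCompact_seg A B).isClosed.isOpen_compl.mem_nhds hw)

theorem isPreconnected_lowerHalfPlane : IsPreconnected {w : ℂ | w.im < 0} :=
  (convex_halfSpace_im_lt 0).isPreconnected

include hμ in
/-- Existence in the subordination equation, on the lower half-plane. -/
theorem subordination_exists (hc : 0 < c) (hβ0 : 0 ≤ β) (hβc : β < c) {w : ℂ} (hw : w.im < 0) :
    ∃ u : ℂ, u.im < 0 ∧ u - β * nev c C μ u = w := by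
  set H : ℂ → ℂ := fun u => u - β * nev c C μ u with hH
  set α : ℝ := 1 - β / c with hα
  have hα0 : 0 < α := by rw [hα, sub_pos, div_lt_one hc]; exact hβc
  have hseg : ∀ u : ℂ, u.im < 0 → u ∉ seg A B := fun u hu => notMem_seg_of_im_ne hu.ne
  have hHd : ∀ u : ℂ, u.im < 0 → DifferentiableAt ℂ H u := fun u hu =>
    differentiableAt_id.sub ((differentiableAt_const _).mul
      (hasDerivAt_nev hμ (hseg u hu)).differentiableAt)
  -- Connectedness argument: the attained values in the lower half-plane form an open set by the
  -- inverse function theorem, a nonempty one, and a relatively closed one because preimages of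
  -- points near w stay in a compact set.
  set R : Set ℂ := {w | w.im < 0 ∧ ∃ u : ℂ, u.im < 0 ∧ H u = w} with hR
  have hsub : {w : ℂ | w.im < 0} ⊆ R := by
    refine isPreconnected_lowerHalfPlane.subset_of_closure_inter_subset ?_ ?_ ?_
    · rw [isOpen_iff_mem_nhds]
      rintro w ⟨hw, u, hu, rfl⟩
      have hfac := pos_factor_of_im (mul_pos_of_neg_of_neg hu hw) (im_sub_nev hμ (hseg u hu))
      have hne := subordination_deriv_ne_zero (C := C) hμ hβ0 (hseg u hu) hfac
      have hs : HasStrictDerivAt H (1 - β * deriv (nev c C μ) u) u :=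
        (hasStrictDerivAt_id u).sub
          ((analyticAt_nev hμ (hseg u hu)).hasStrictDerivAt.const_mul (β : ℂ))
      have hmap := hs.map_nhds_eq hne
      have h1 : H '' {u | u.im < 0} ∈ 𝓝 (H u) := by
        rw [← hmap]
        exact image_mem_map ((isOpen_lt Complex.continuous_im continuous_const).mem_nhds hu)
      filter_upwards [h1, (isOpen_lt Complex.continuous_im continuous_const).mem_nhds hw]
        with w h2 h3
      obtain ⟨u, hu, rfl⟩ := h2
      exact ⟨h3, u, hu, rfl⟩
    -- At u = -iy the energy is at most μ(ℝ)/y², so for large y the factor is positive and H(u)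
    -- stays in the lower half-plane.
    · obtain ⟨y, hy0, hy⟩ : ∃ y : ℝ, 0 < y ∧ β * μ.real univ / y ^ 2 < α := by
        have h1 : Tendsto (fun y : ℝ => β * μ.real univ / y ^ 2) atTop (𝓝 0) :=
          tendsto_const_nhds.div_atTop (tendsto_pow_atTop two_ne_zero)
        obtain ⟨y, h2, h3⟩ := ((h1.eventually (gt_mem_nhds hα0)).and (eventually_gt_atTop 0)).exists
        exact ⟨y, h3, h2⟩
      have hu : (-(y * Complex.I)).im < 0 := by simpa using hy0
      refine ⟨H (-(y * Complex.I)), ?_, ?_, _, hu, rfl⟩ <;>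
      · change (H _).im < 0
        simp only [hH]
        rw [im_sub_nev hμ (hseg _ hu)]
        refine mul_neg_of_neg_of_pos hu ?_
        have h1 : energy μ (-(y * Complex.I)) ≤ μ.real univ / y ^ 2 := by
          have : μ.real univ / y ^ 2 = ∫ _ : ℝ, 1 / y ^ 2 ∂μ := by
            rw [integral_const, smul_eq_mul]; ring
          rw [this]
          refine integral_mono (integrable_of_continuousOn_carrier hμ
            (continuousOn_inv_norm_sq (hseg _ hu))) (integrable_const _) fun s => ?_
          have h2 := Complex.abs_im_le_norm (-(y * Complex.I) - s)
          simp at h2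
          rw [abs_of_pos hy0] at h2
          simp only
          gcongr
        have h2 : β * energy μ (-(y * Complex.I)) ≤ β * μ.real univ / y ^ 2 := by
          rw [mul_div_assoc]; gcongr
        linarith
    · rintro w ⟨hwc, hw⟩
      have hw : w.im < 0 := hw
      refine ⟨hw, ?_⟩
      -- For u in the lower half-plane, α Im u ≤ Im H(u); values with imaginary part below Im w / 2
      -- therefore come from Im u ≤ -η. There the Cauchy integral is at most μ(ℝ)/η, and Q is the
      -- resulting bound on ‖u‖.
      set η : ℝ := -w.im / 2 / α with hη
      have hη0 : 0 < η := div_pos (by linarith) hα0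
      set Q : ℝ := (‖w‖ + 1 + β * |C| + β * (μ.real univ / η)) / α with hQ
      set Z : Set ℂ := {u : ℂ | u.im ≤ -η} ∩ Metric.closedBall 0 Q with hZ
      have hZc : IsCompact Z := (isCompact_closedBall _ _).inter_left
        (isClosed_le Complex.continuous_im continuous_const)
      have hZi : ∀ u ∈ Z, u.im < 0 := fun u hu => by
        have : u.im ≤ -η := hu.1
        linarith
      have hHZ : IsCompact (H '' Z) := hZc.image_of_continuousOn fun u hu =>
        (hHd u (hZi u hu)).continuousAt.continuousWithinAt
      suffices h : w ∈ H '' Z by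
        obtain ⟨u, hu, h⟩ := h
        exact ⟨u, hZi u hu, h⟩
      rw [← hHZ.isClosed.closure_eq]
      have hnb : {v : ℂ | v.im < w.im / 2} ∩ Metric.ball w 1 ∈ 𝓝 w := by
        refine inter_mem ((isOpen_lt Complex.continuous_im continuous_const).mem_nhds ?_)
          (Metric.ball_mem_nhds w one_pos)
        change w.im < w.im / 2
        linarith
      rw [mem_closure_iff_nhds] at hwc ⊢
      intro t ht
      obtain ⟨v, ⟨hvt, hv1, hv2⟩, hvi, u, hu, rfl⟩ := hwc _ (inter_mem ht hnb)
      refine ⟨H u, hvt, u, ⟨?_, ?_⟩, rfl⟩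
      · change u.im ≤ -η
        have h1 : (H u).im < w.im / 2 := hv1
        have h2 : (H u).im = u.im * (α - β * energy μ u) := im_sub_nev hμ (hseg u hu)
        have h3 := energy_nonneg μ u
        have h4 : α * u.im ≤ w.im / 2 := by
          have : 0 ≤ β * energy μ u := mul_nonneg hβ0 h3
          nlinarith
        rw [hη, le_neg, div_le_iff₀ hα0]
        linarith
      · have hui : u.im ≤ -η := by
          have h1 : (H u).im < w.im / 2 := hv1
          have h2 : (H u).im = u.im * (α - β * energy μ u) := im_sub_nev hμ (hseg u hu)
          have h3 := energy_nonneg μ u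
          have h4 : α * u.im ≤ w.im / 2 := by
            have : 0 ≤ β * energy μ u := mul_nonneg hβ0 h3
            nlinarith
          rw [hη, le_neg, div_le_iff₀ hα0]
          linarith
        rw [mem_closedBall_zero_iff, hQ, le_div_iff₀ hα0]
        have h1 : ‖∫ s : ℝ, 1 / (u - s) ∂μ‖ ≤ μ.real univ / η := by
          have h2 : ∀ s : ℝ, ‖1 / (u - s)‖ ≤ 1 / η := by
            intro s
            rw [norm_div, norm_one]
            have h3 := Complex.abs_im_le_norm (u - s)
            rw [Complex.sub_im, Complex.ofReal_im, sub_zero, abs_of_neg hu] at h3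
            gcongr
            linarith
          have h3 := norm_integral_le_of_norm_le_const (μ := μ) (Eventually.of_forall h2)
          calc _ ≤ _ := h3
            _ = _ := by ring
        have h2 : (α : ℂ) * u = H u + β * C - β * ∫ s : ℝ, 1 / (u - s) ∂μ := by
          simp only [hH, nev, hα]; push_cast; ring
        have h3 := congrArg norm h2
        rw [norm_mul, Complex.norm_real, Real.norm_of_nonneg hα0.le] at h3
        have h4 : ‖H u‖ ≤ ‖w‖ + 1 := by
          have : ‖H u - w‖ < 1 := by rwa [Metric.mem_ball, dist_eq_norm] at hv2
          have := norm_le_norm_add_norm_sub' (H u) w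
          linarith
        have h5 := norm_sub_le (H u + β * C) (β * ∫ s : ℝ, 1 / (u - s) ∂μ)
        have h6 := norm_add_le (H u) (β * C : ℂ)
        rw [norm_mul, Complex.norm_real, Complex.norm_real, Real.norm_of_nonneg hβ0,
          Real.norm_eq_abs] at h6
        rw [norm_mul (β : ℂ), Complex.norm_real, Real.norm_of_nonneg hβ0] at h5
        have h7 := mul_le_mul_of_nonneg_left h1 hβ0
        linarith
  exact (hsub hw).2

end Cauchy

end

/-! ### Implicit functions of a real and a complex variable. -/

section

/-- The real-linear map `(t, z) ↦ t a + c z`. -/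
noncomputable def linPair (a c : ℂ) : ℝ × ℂ →L[ℝ] ℂ :=
  (ContinuousLinearMap.fst ℝ ℝ ℂ).smulRight a + c • ContinuousLinearMap.snd ℝ ℝ ℂ

@[simp] theorem linPair_apply (a c : ℂ) (y : ℝ × ℂ) : linPair a c y = y.1 * a + c * y.2 := by
  simp [linPair]

theorem linPair_ext {f : ℝ × ℂ →L[ℝ] ℂ} {a c : ℂ} (h : ∀ t z, f (t, z) = t * a + c * z) :
    f = linPair a c := by
  ext y
  · simp [h]
  · simp [h]

theorem exists_implicit {Ψ : ℝ × ℂ → ℂ} {t₀ : ℝ} {u₀ a c : ℂ}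
    (h : HasStrictFDerivAt Ψ (linPair a c) (t₀, u₀)) (hc : c ≠ 0) :
    ∃ g : ℝ × ℂ → ℂ, g (t₀, Ψ (t₀, u₀)) = u₀ ∧
      HasStrictFDerivAt g (linPair (-a / c) (1 / c)) (t₀, Ψ (t₀, u₀)) ∧
      ∀ᶠ y in 𝓝 (t₀, Ψ (t₀, u₀)), Ψ (y.1, g y) = y.2 := by
  set w₀ := Ψ (t₀, u₀) with hw₀
  -- The target value w joins t as a parameter, so that the solution is differentiable in (t, w)
  -- jointly; derivatives are real-linear because t is real.
  set F : (ℝ × ℂ) × ℂ → ℂ := fun x => Ψ (x.1.1, x.2) - x.1.2 with hF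
  have hπ : HasStrictFDerivAt (fun x : (ℝ × ℂ) × ℂ => (x.1.1, x.2))
      (((ContinuousLinearMap.fst ℝ ℝ ℂ).comp (ContinuousLinearMap.fst ℝ (ℝ × ℂ) ℂ)).prod
        (ContinuousLinearMap.snd ℝ (ℝ × ℂ) ℂ)) ((t₀, w₀), u₀) :=
    (((ContinuousLinearMap.fst ℝ ℝ ℂ).comp (ContinuousLinearMap.fst ℝ (ℝ × ℂ) ℂ)).prod
        (ContinuousLinearMap.snd ℝ (ℝ × ℂ) ℂ)).hasStrictFDerivAt
  have hσ : HasStrictFDerivAt (fun x : (ℝ × ℂ) × ℂ => x.1.2)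
      ((ContinuousLinearMap.snd ℝ ℝ ℂ).comp (ContinuousLinearMap.fst ℝ (ℝ × ℂ) ℂ))
        ((t₀, w₀), u₀) :=
    ((ContinuousLinearMap.snd ℝ ℝ ℂ).comp (ContinuousLinearMap.fst ℝ (ℝ × ℂ) ℂ)).hasStrictFDerivAt
  have hFd := (HasStrictFDerivAt.comp (g := Ψ) (x := ((t₀, w₀), u₀)) h hπ).sub hσ
  set F' := (linPair a c).comp (((ContinuousLinearMap.fst ℝ ℝ ℂ).comp
    (ContinuousLinearMap.fst ℝ (ℝ × ℂ) ℂ)).prod (ContinuousLinearMap.snd ℝ (ℝ × ℂ) ℂ)) -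
    (ContinuousLinearMap.snd ℝ ℝ ℂ).comp (ContinuousLinearMap.fst ℝ (ℝ × ℂ) ℂ) with hF'
  have hFd' : HasStrictFDerivAt F F' ((t₀, w₀), u₀) := hFd
  have hinr : ∀ z, (F' ∘L .inr ℝ (ℝ × ℂ) ℂ) z = c * z := by intro z; simp [hF']
  have hinl : ∀ y, (F' ∘L .inl ℝ (ℝ × ℂ) ℂ) y = y.1 * a - y.2 := by intro y; simp [hF']
  have hinv : (F' ∘L .inr ℝ (ℝ × ℂ) ℂ).IsInvertible := by
    refine ContinuousLinearMap.IsInvertible.of_inverse (g := c⁻¹ • ContinuousLinearMap.id ℝ ℂ) ?_ ?_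
    · ext z
      rw [ContinuousLinearMap.comp_apply, hinr]; simp [hc]
    · ext z
      rw [ContinuousLinearMap.comp_apply, hinr]; simp [hc]
  refine ⟨hFd'.implicitFunctionOfProdDomain hinv, ?_, ?_, ?_⟩
  · exact (hFd'.eventually_apply_eq_iff_implicitFunctionOfProdDomain hinv).self_of_nhds.1 rfl
  · have h1 := hFd'.hasStrictFDerivAt_implicitFunctionOfProdDomain hinv
    refine h1.congr_fderiv (linPair_ext fun t z => ?_)
    have h2 : (F' ∘L .inr ℝ (ℝ × ℂ) ℂ).inverse = c⁻¹ • ContinuousLinearMap.id ℝ ℂ := by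
      refine ContinuousLinearMap.inverse_eq ?_ ?_
      · ext z
        rw [ContinuousLinearMap.comp_apply, hinr]; simp [hc]
      · ext z
        rw [ContinuousLinearMap.comp_apply, hinr]; simp [hc]
    rw [h2]
    change -((c⁻¹ • ContinuousLinearMap.id ℝ ℂ) ((F' ∘L .inl ℝ (ℝ × ℂ) ℂ) (t, z))) = _
    rw [hinl]
    simp
    field_simp
    ring
  · have h1 := hFd'.eventually_apply_implicitFunctionOfProdDomain hinv
    filter_upwards [h1] with y hy
    have h2 : Ψ (y.1, hFd'.implicitFunctionOfProdDomain hinv y) - y.2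
      = Ψ (t₀, u₀) - w₀ := hy
    rw [← hw₀, sub_self] at h2
    exact sub_eq_zero.1 h2

/-- The equation `u - β S(u) = w` determines `u` as a smooth function of `(β, w)`. -/
theorem exists_subordination_chart {S : ℂ → ℂ} {β : ℝ} {u : ℂ} (hS : AnalyticAt ℂ S u)
    (hne : 1 - β * deriv S u ≠ 0) :
    ∃ g : ℝ × ℂ → ℂ, g (β, u - β * S u) = u ∧
      HasStrictFDerivAt g (linPair (S u / (1 - β * deriv S u))
        (1 / (1 - β * deriv S u))) (β, u - β * S u) ∧
      ∀ᶠ y in 𝓝 (β, u - β * S u), g y - y.1 * S (g y) = y.2 := by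
  have hSd : HasStrictFDerivAt (fun y : ℝ × ℂ => S y.2) (linPair 0 (deriv S u)) (β, u) := by
    have h2 := (hS.hasStrictDerivAt.hasStrictFDerivAt).restrictScalars ℝ
    have h3 := HasStrictFDerivAt.comp (x := ((β, u) : ℝ × ℂ)) h2
      (hasStrictFDerivAt_snd (𝕜 := ℝ) (E := ℝ) (F := ℂ))
    refine h3.congr_fderiv (linPair_ext fun t z => ?_)
    simp [mul_comm]
  have h2 : HasStrictFDerivAt (fun y : ℝ × ℂ => (y.1 : ℂ)) (linPair 1 0) (β, u) := by
    have := (Complex.ofRealCLM.comp (ContinuousLinearMap.fst ℝ ℝ ℂ)).hasStrictFDerivAt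
      (x := ((β, u) : ℝ × ℂ))
    refine this.congr_fderiv (linPair_ext fun t z => ?_)
    simp
  have h3 : HasStrictFDerivAt (fun y : ℝ × ℂ => y.2 - y.1 * S y.2)
      (linPair (-S u) (1 - β * deriv S u)) (β, u) := by
    have := (hasStrictFDerivAt_snd (𝕜 := ℝ) (E := ℝ) (F := ℂ) (p := (β, u))).sub (h2.mul hSd)
    refine this.congr_fderiv (linPair_ext fun t z => ?_)
    simp
    ring
  obtain ⟨g, g1, g2, g3⟩ := exists_implicit h3 hne
  refine ⟨g, g1, ?_, g3⟩
  simpa using! g2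

end

section

/-! ### The kernel in the coordinate `x = q^{-z}` -/

/-- `x + p / x`. -/
noncomputable def jk (p : ℝ) (x : ℂ) : ℂ := x + p / x

/-- `x - p / x`. -/
noncomputable def dk (p : ℝ) (x : ℂ) : ℂ := x - p / x

/-- `e^{L s} + p e^{-L s}`. -/
noncomputable def node (L p s : ℝ) : ℝ := Real.exp (L * s) + p / Real.exp (L * s)

/-- `∫ h(s) / (w - b(s)) ds`. -/
noncomputable def ct (L p lo hi : ℝ) (h : ℝ → ℝ) (w : ℂ) : ℂ :=
  ∫ s in lo..hi, (h s : ℂ) * (1 / (w - node L p s))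

/-- The exponent of the complex slope. -/
noncomputable def expo (L p lo hi : ℝ) (h : ℝ → ℝ) (x : ℂ) : ℂ :=
  -(L * dk p x * ct L p lo hi h (jk p x))

/-- `L (x - p / x) / (x + p / x - b(s))`. -/
noncomputable def ker (L p : ℝ) (x : ℂ) (s : ℝ) : ℂ := L * dk p x / (jk p x - node L p s)

/-- The image of an interval under `b`. -/
def nodes (L p lo hi : ℝ) : Set ℂ := (fun s : ℝ => (node L p s : ℂ)) '' Icc lo hi

/-- A measurable function with values in `[0, 1]`. -/
structure IsDensity (h : ℝ → ℝ) : Prop where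
  measurable : Measurable h
  nonneg : ∀ s, 0 ≤ h s
  le_one : ∀ s, h s ≤ 1

variable {L p lo hi : ℝ} {h : ℝ → ℝ}

theorem continuous_node : Continuous (node L p) := by
  unfold node
  exact (by fun_prop : Continuous fun s => Real.exp (L * s)).add
    (continuous_const.div (by fun_prop) fun s => (Real.exp_pos _).ne')

theorem IsDensity.intervalIntegrable (hh : IsDensity h) (lo hi : ℝ) :
    IntervalIntegrable h volume lo hi := by
  rw [intervalIntegrable_iff]
  refine Measure.integrableOn_of_bounded (M := 1) (by simp) hh.measurable.aestronglyMeasurable ?_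
  refine Eventually.of_forall fun s => ?_
  rw [Real.norm_of_nonneg (hh.nonneg s)]; exact hh.le_one s

theorem IsDensity.intervalIntegrable_mul (hh : IsDensity h) {k : ℝ → ℂ}
    (hk : ContinuousOn k (uIcc lo hi)) :
    IntervalIntegrable (fun s => (h s : ℂ) * k s) volume lo hi :=
  (IntervalIntegrable.mul_continuousOn (f := fun s => (h s : ℂ))
    ⟨(hh.intervalIntegrable lo hi).1.ofReal, (hh.intervalIntegrable lo hi).2.ofReal⟩ hk)

theorem IsDensity.intervalIntegrable_mul_real (hh : IsDensity h) {k : ℝ → ℝ}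
    (hk : ContinuousOn k (uIcc lo hi)) :
    IntervalIntegrable (fun s => h s * k s) volume lo hi :=
  (hh.intervalIntegrable lo hi).mul_continuousOn hk

theorem jk_sub_node (p : ℝ) {x : ℂ} (hx : x ≠ 0) (s : ℝ) : jk p x - node L p s =
    (x - Real.exp (L * s)) * (x * Real.exp (L * s) - p) / (x * Real.exp (L * s)) := by
  have hy : (Real.exp (L * s) : ℂ) ≠ 0 := by exact_mod_cast (Real.exp_pos _).ne'
  simp only [jk, node, Complex.ofReal_add, Complex.ofReal_div]
  field_simp
  ring

theorem jk_sub_node_ne_zero_of_im {x : ℂ} (hx : x.im ≠ 0) (s : ℝ) : jk p x - node L p s ≠ 0 := by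
  have hx0 : x ≠ 0 := by rintro rfl; simp at hx
  have hy : (Real.exp (L * s) : ℂ) ≠ 0 := by exact_mod_cast (Real.exp_pos _).ne'
  rw [jk_sub_node p hx0]
  refine div_ne_zero (mul_ne_zero ?_ ?_) (mul_ne_zero hx0 hy)
  · intro h
    have := congrArg Complex.im h
    simp only [Complex.sub_im, Complex.ofReal_im, Complex.zero_im] at this
    exact hx (by linarith)
  · intro h
    have := congrArg Complex.im h
    simp only [Complex.sub_im, Complex.ofReal_im, Complex.zero_im, Complex.mul_im,
      Complex.ofReal_re, mul_zero, zero_add, sub_zero] at this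
    rcases mul_eq_zero.1 this with h | h
    · exact hx h
    · exact (Real.exp_pos _).ne' h

theorem expo_eq_integral_ker (x : ℂ) :
    expo L p lo hi h x = -∫ s in lo..hi, (h s : ℂ) * ker L p x s := by
  rw [expo, ct, ← intervalIntegral.integral_const_mul]
  congr 2; ext s
  rw [ker]; ring

theorem continuousOn_ker {x : ℂ} {s : Set ℝ} (hx : ∀ u ∈ s, jk p x - node L p u ≠ 0) :
    ContinuousOn (ker L p x) s := by
  unfold ker
  exact continuousOn_const.div (continuous_const.sub
    (Complex.continuous_ofReal.comp continuous_node)).continuousOn hx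

/-- The positive weight with `Im ker = -Im x · weight`. -/
noncomputable def wt (L p : ℝ) (x : ℂ) (s : ℝ) : ℝ :=
  L * Real.exp (L * s) * (1 / Complex.normSq (x - Real.exp (L * s)) +
    p / Complex.normSq x / Complex.normSq (p / x - Real.exp (L * s)))

/-- Partial fractions in y = e^{Ls} with poles x and p/x. These lie in opposite half-planes and
enter with opposite signs, so their contributions to the imaginary part add. -/
theorem ker_eq {x : ℂ} (hx : x.im ≠ 0) (s : ℝ) : ker L p x s =
    L * Real.exp (L * s) * (1 / (x - Real.exp (L * s)) - 1 / (p / x - Real.exp (L * s))) := by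
  have hx0 : x ≠ 0 := by rintro rfl; simp at hx
  have hy : (Real.exp (L * s) : ℂ) ≠ 0 := by exact_mod_cast (Real.exp_pos _).ne'
  have h1 := jk_sub_node_ne_zero_of_im (L := L) (p := p) hx s
  rw [jk_sub_node p hx0] at h1
  have h2 : x - Real.exp (L * s) ≠ 0 := by
    intro h; rw [h] at h1; simp at h1
  have h3 : x * Real.exp (L * s) - p ≠ 0 := by
    intro h; rw [h] at h1; simp at h1
  have h4 : p / x - Real.exp (L * s) = -(x * Real.exp (L * s) - p) / x := by field_simp; ring
  rw [ker, jk_sub_node p hx0, dk, h4]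
  field_simp
  ring

theorem ker_im {x : ℂ} (hx : x.im ≠ 0) (s : ℝ) : (ker L p x s).im = -(x.im * wt L p x s) := by
  rw [ker_eq hx, ← Complex.ofReal_mul, Complex.im_ofReal_mul, wt, Complex.sub_im, one_div, one_div,
    Complex.inv_im, Complex.inv_im, Complex.sub_im, Complex.sub_im, Complex.div_im]
  generalize Real.exp (L * s) = y
  simp
  ring

theorem wt_pos (hL : 0 < L) (hp : 0 < p) {x : ℂ} (hx : x.im ≠ 0) (s : ℝ) : 0 < wt L p x s := by
  have h1 : x - Real.exp (L * s) ≠ 0 := by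
    intro h
    have := congrArg Complex.im h
    simp only [Complex.sub_im, Complex.ofReal_im, Complex.zero_im] at this
    exact hx (by linarith)
  have h2 : 0 < Complex.normSq (x - Real.exp (L * s)) := Complex.normSq_pos.2 h1
  have h3 := Complex.normSq_nonneg (p / x - Real.exp (L * s))
  have h4 := Complex.normSq_nonneg x
  have := Real.exp_pos (L * s)
  unfold wt
  positivity

theorem continuous_wt {x : ℂ} (hx : x.im ≠ 0) : Continuous (wt L p x) := by
  have h1 : Continuous fun s => (ker L p x s).im := Complex.continuous_im.comp
    (continuousOn_univ.1 (continuousOn_ker fun u _ => jk_sub_node_ne_zero_of_im hx u))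
  have h2 : wt L p x = fun s => -(ker L p x s).im / x.im := by
    ext s; rw [ker_im hx]; field_simp
  rw [h2]
  fun_prop

theorem hasDerivAt_exp_mul (L s : ℝ) :
    HasDerivAt (fun s => Real.exp (L * s)) (L * Real.exp (L * s)) s := by
  have := ((hasDerivAt_id s).const_mul L).exp
  simpa [mul_comm] using this

/-- Im x times the weight is the derivative of a difference of two arctangents, each of variation
less than π. This confines the argument of f to one branch. -/
theorem integral_wt_bound {x : ℂ} (hp : 0 < p) (hx : x.im ≠ 0) :
    |x.im * ∫ s in lo..hi, wt L p x s| < 2 * Real.pi := by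
  have hx0 : x ≠ 0 := by rintro rfl; simp at hx
  have hx' : ((p : ℂ) / x).im ≠ 0 := by
    rw [Complex.div_im]
    have : Complex.normSq x ≠ 0 := (Complex.normSq_pos.2 hx0).ne'
    simpa using ⟨⟨hp.ne', hx⟩, hx0⟩
  have hat : ∀ (v : ℂ) (_ : v.im ≠ 0) (s : ℝ),
      HasDerivAt (fun s => Real.arctan ((Real.exp (L * s) - v.re) / v.im))
        (L * Real.exp (L * s) * (v.im / Complex.normSq (v - Real.exp (L * s)))) s := by
    intro v hv s
    have h1 := (((hasDerivAt_exp_mul L s).sub_const v.re).div_const v.im).arctan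
    convert h1 using 1
    have h2 : Complex.normSq (v - Real.exp (L * s))
        = v.im ^ 2 + (Real.exp (L * s) - v.re) ^ 2 := by
      rw [Complex.normSq_apply, Complex.sub_re, Complex.sub_im, Complex.ofReal_re,
        Complex.ofReal_im]; ring
    rw [h2]
    have h3 : v.im ^ 2 + (Real.exp (L * s) - v.re) ^ 2 ≠ 0 := by positivity
    have h4 : 1 + ((Real.exp (L * s) - v.re) / v.im) ^ 2 ≠ 0 := by positivity
    field_simp
  have hderiv : ∀ s, HasDerivAt (fun s => Real.arctan ((Real.exp (L * s) - x.re) / x.im)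
      - Real.arctan ((Real.exp (L * s) - ((p : ℂ) / x).re) / ((p : ℂ) / x).im))
      (x.im * wt L p x s) s := by
    intro s
    convert! (hat x hx s).sub (hat _ hx' s) using 1
    have : ((p : ℂ) / x).im = -(p * x.im / Complex.normSq x) := by
      rw [Complex.div_im]; simp
    rw [this, wt]
    ring
  have hint := intervalIntegral.integral_eq_sub_of_hasDerivAt (a := lo) (b := hi)
    (fun s _ => hderiv s) ((continuous_const.mul (continuous_wt hx)).intervalIntegrable _ _)
  rw [intervalIntegral.integral_const_mul] at hint
  rw [hint, abs_lt]
  constructor <;>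
  · linarith [Real.arctan_lt_pi_div_two ((Real.exp (L * hi) - x.re) / x.im),
      Real.neg_pi_div_two_lt_arctan ((Real.exp (L * hi) - x.re) / x.im),
      Real.arctan_lt_pi_div_two ((Real.exp (L * lo) - x.re) / x.im),
      Real.neg_pi_div_two_lt_arctan ((Real.exp (L * lo) - x.re) / x.im),
      Real.arctan_lt_pi_div_two ((Real.exp (L * hi) - ((p : ℂ) / x).re) / ((p : ℂ) / x).im),
      Real.neg_pi_div_two_lt_arctan ((Real.exp (L * hi) - ((p : ℂ) / x).re) / ((p : ℂ) / x).im),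
      Real.arctan_lt_pi_div_two ((Real.exp (L * lo) - ((p : ℂ) / x).re) / ((p : ℂ) / x).im),
      Real.neg_pi_div_two_lt_arctan ((Real.exp (L * lo) - ((p : ℂ) / x).re) / ((p : ℂ) / x).im)]

theorem expo_im (hh : IsDensity h) {x : ℂ} (hx : x.im ≠ 0) :
    (expo L p lo hi h x).im = x.im * ∫ s in lo..hi, h s * wt L p x s := by
  have hk : ContinuousOn (ker L p x) (uIcc lo hi) :=
    continuousOn_ker fun u _ => jk_sub_node_ne_zero_of_im hx u
  rw [expo_eq_integral_ker, Complex.neg_im, ← Complex.imCLM_apply,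
    ← ContinuousLinearMap.intervalIntegral_comp_comm _ (hh.intervalIntegrable_mul hk),
    ← intervalIntegral.integral_const_mul, ← intervalIntegral.integral_neg]
  congr 1; ext s
  rw [Complex.imCLM_apply, Complex.im_ofReal_mul, ker_im hx]; ring

/-- A positive continuous weight has a positive integral against a density of positive mass. -/
theorem integral_density_mul_pos (hh : IsDensity h) (hlh : lo ≤ hi)
    (hm : 0 < ∫ s in lo..hi, h s) {k : ℝ → ℝ} (hk : ContinuousOn k (Icc lo hi))
    (hpos : ∀ s ∈ Icc lo hi, 0 < k s) : 0 < ∫ s in lo..hi, h s * k s := by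
  obtain ⟨s₀, hs₀, hmin⟩ := isCompact_Icc.exists_isMinOn (nonempty_Icc.2 hlh) hk
  have h1 : k s₀ * ∫ s in lo..hi, h s ≤ ∫ s in lo..hi, h s * k s := by
    rw [← intervalIntegral.integral_const_mul]
    refine intervalIntegral.integral_mono_on hlh ((hh.intervalIntegrable _ _).const_mul _)
      (hh.intervalIntegrable_mul_real (by rwa [uIcc_of_le hlh])) ?_
    intro s hs
    have h2 := hmin hs
    simp only [mem_ofPred_eq] at h2
    nlinarith [hh.nonneg s]
  have := hpos s₀ hs₀
  nlinarith

/-- The constraint 0 ≤ h ≤ 1 places the imaginary part between 0 and its value for h = 1, which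
`integral_wt_bound` keeps below 2π in modulus. -/
theorem expo_im_range (hL : 0 < L) (hp : 0 < p) (hh : IsDensity h) (hlh : lo ≤ hi) {x : ℂ}
    (hx : x.im ≠ 0) : 0 ≤ x.im * (expo L p lo hi h x).im ∧
      |(expo L p lo hi h x).im| < 2 * Real.pi ∧
      (0 < ∫ s in lo..hi, h s → 0 < x.im * (expo L p lo hi h x).im) := by
  have hw := fun s => wt_pos (s := s) hL hp hx
  have hc := continuous_wt (L := L) (p := p) hx
  have h0 : 0 ≤ ∫ s in lo..hi, h s * wt L p x s :=
    intervalIntegral.integral_nonneg hlh fun s _ => mul_nonneg (hh.nonneg s) (hw s).le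
  have h1 : ∫ s in lo..hi, h s * wt L p x s ≤ ∫ s in lo..hi, wt L p x s := by
    refine intervalIntegral.integral_mono_on hlh (hh.intervalIntegrable_mul_real hc.continuousOn)
      (hc.intervalIntegrable _ _) fun s _ => ?_
    have := hh.le_one s
    nlinarith [hw s]
  rw [expo_im hh hx]
  refine ⟨by nlinarith [mul_self_nonneg x.im], ?_, fun hm => ?_⟩
  · refine lt_of_le_of_lt ?_ (integral_wt_bound (L := L) (lo := lo) (hi := hi) hp hx)
    rw [abs_mul, abs_mul, abs_of_nonneg h0, abs_of_nonneg (h0.trans h1)]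
    gcongr
  · have := integral_density_mul_pos hh hlh hm hc.continuousOn fun s _ => hw s
    have h2 : 0 < x.im * x.im := mul_self_pos.2 hx
    nlinarith

theorem exp_expo_ne_one_of_im (hL : 0 < L) (hp : 0 < p) (hh : IsDensity h) (hlh : lo ≤ hi)
    (hm : 0 < ∫ s in lo..hi, h s) {x : ℂ} (hx : x.im ≠ 0) :
    Complex.exp (expo L p lo hi h x) ≠ 1 := by
  obtain ⟨-, h1, h2⟩ := expo_im_range hL hp hh hlh hx
  have h2 := h2 hm
  intro he
  obtain ⟨n, hn⟩ := Complex.exp_eq_one_iff.1 he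
  have h3 : (expo L p lo hi h x).im = n * (2 * Real.pi) := by rw [hn]; simp
  rw [h3] at h1 h2
  have hpi := Real.pi_pos
  rw [abs_mul, abs_of_pos (by positivity : 0 < 2 * Real.pi)] at h1
  have h4 : |(n : ℝ)| < 1 := by nlinarith
  have h5 : n = 0 := by
    have : |n| < 1 := by exact_mod_cast h4
    exact Int.abs_lt_one_iff.1 this
  rw [h5] at h2
  simp at h2

/-- Closed form of the exponential for the constant density `1`. -/
theorem exp_integral_ker {x : ℂ} (hx : x ≠ 0) (hlh : lo ≤ hi)
    (hx1 : ∀ s ∈ Icc lo hi, jk p x - node L p s ≠ 0) :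
    Complex.exp (-∫ s in lo..hi, ker L p x s) *
        ((x - Real.exp (L * lo)) * (p - x * Real.exp (L * hi)))
      = (x - Real.exp (L * hi)) * (p - x * Real.exp (L * lo)) := by
  have hne : ∀ s ∈ Icc lo hi, x - Real.exp (L * s) ≠ 0 ∧ x * Real.exp (L * s) - p ≠ 0 := by
    intro s hs
    have h1 := hx1 s hs
    rw [jk_sub_node p hx] at h1
    constructor
    · intro h; rw [h] at h1; simp at h1
    · intro h; rw [h] at h1; simp at h1
  have hcont : ContinuousOn (ker L p x) (Icc lo hi) := continuousOn_ker hx1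
  have hmeas : Measurable (ker L p x) := by
    have := (continuous_node (L := L) (p := p)).measurable
    unfold ker
    fun_prop
  have hcat : ∀ s ∈ Icc lo hi, ContinuousAt (ker L p x) s := by
    intro s hs
    unfold ker
    refine continuousAt_const.div ?_ (hx1 s hs)
    exact (continuous_const.sub (Complex.continuous_ofReal.comp continuous_node)).continuousAt
  set E : ℝ → ℂ := fun s => ∫ u in lo..s, ker L p x u with hE
  have hEd : ∀ s ∈ Icc lo hi, HasDerivAt E (ker L p x s) s := by
    intro s hs
    refine intervalIntegral.integral_hasDerivAt_right ?_
      ⟨univ, univ_mem, hmeas.aestronglyMeasurable.restrict⟩ (hcat s hs)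
    refine ContinuousOn.intervalIntegrable (hcont.mono ?_)
    rw [uIcc_of_le hs.1]
    exact Icc_subset_Icc_right hs.2
  -- The closed form is obtained without choosing a logarithm: this product has zero derivative in
  -- the upper limit of integration.
  set G : ℝ → ℂ := fun s => Complex.exp (-E s) *
    ((p - x * Real.exp (L * s)) / (x - Real.exp (L * s))) with hG
  have hGd : ∀ s ∈ Icc lo hi, HasDerivAt G 0 s := by
    intro s hs
    obtain ⟨h1, h2⟩ := hne s hs
    have hy := (hasDerivAt_exp_mul L s).ofReal_comp
    have hy0 : (Real.exp (L * s) : ℂ) ≠ 0 := by exact_mod_cast (Real.exp_pos _).ne'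
    have h3 := ((hEd s hs).neg.cexp).mul
      (((hy.const_mul x).const_sub (p : ℂ)).div (hy.const_sub x) h1)
    refine h3.congr_deriv ?_
    rw [ker, jk_sub_node p hx, dk]
    simp only [Complex.ofReal_mul, Pi.neg_apply, Pi.div_apply]
    field_simp
    ring
  have hconst : G hi = G lo := by
    refine constant_of_has_deriv_right_zero (a := lo) (b := hi)
      (fun s hs => (hGd s hs).continuousAt.continuousWithinAt)
      (fun s hs => (hGd s ⟨hs.1, hs.2.le⟩).hasDerivWithinAt) hi ⟨hlh, le_rfl⟩
  simp only [hG, hE, intervalIntegral.integral_same, neg_zero, Complex.exp_zero, one_mul] at hconst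
  have h1 := (hne hi ⟨hlh, le_rfl⟩).1
  have h2 := (hne lo ⟨le_rfl, hlh⟩).1
  rw [mul_div_assoc', div_eq_div_iff h1 h2] at hconst
  linear_combination hconst

end

/-! ### Descent along x ↦ x + p/x, and Cauchy transforms along the nodes. -/

section

theorem jk_div {p : ℝ} (hp : 0 < p) {x : ℂ} (hx : x ≠ 0) : jk p (p / x) = jk p x := by
  have : (p : ℂ) ≠ 0 := by exact_mod_cast hp.ne'
  simp only [jk]; field_simp; ring

theorem dk_div {p : ℝ} (hp : 0 < p) {x : ℂ} (hx : x ≠ 0) : dk p (p / x) = -dk p x := by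
  have : (p : ℂ) ≠ 0 := by exact_mod_cast hp.ne'
  simp only [dk]; field_simp; ring

theorem jk_eq_iff {p : ℝ} (hp : 0 < p) {x u : ℂ} (hx : x ≠ 0) (hu : u ≠ 0) :
    jk p x = jk p u ↔ x = u ∨ x = p / u := by
  constructor
  · intro h
    have h1 : (x - u) * (x * u - p) = 0 := by
      simp only [jk] at h
      field_simp at h
      linear_combination h
    rcases mul_eq_zero.1 h1 with h2 | h2
    · exact Or.inl (sub_eq_zero.1 h2)
    · right; rw [eq_div_iff hu]; exact sub_eq_zero.1 h2
  · rintro (rfl | rfl)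
    · rfl
    · exact jk_div hp hu

theorem hasStrictDerivAt_jk (p : ℝ) {x : ℂ} (hx : x ≠ 0) :
    HasStrictDerivAt (jk p) (dk p x / x) x := by
  have h1 := (hasStrictDerivAt_id x).add ((hasStrictDerivAt_inv hx).const_mul (p : ℂ))
  have h2 : (id + fun y : ℂ => (p : ℂ) * y⁻¹) = jk p := by
    ext y; simp [jk, div_eq_mul_inv]
  have h3 : HasStrictDerivAt (jk p) (1 + p * -(x ^ 2)⁻¹) x := by rw [← h2]; exact h1
  refine h3.congr_deriv ?_
  rw [dk]; field_simp; ring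

theorem dk_sq (p : ℝ) {x : ℂ} (hx : x ≠ 0) : dk p x ^ 2 = jk p x ^ 2 - 4 * p := by
  simp only [dk, jk]; field_simp; ring

/-- An invariant function of `x` descends along `x ↦ x + p / x`. -/
theorem exists_descend {p : ℝ} (hp : 0 < p) {K : Set ℂ} (hK : IsClosed K) {F : ℂ → ℂ}
    (hF : ∀ x, x ≠ 0 → jk p x ∉ K → DifferentiableAt ℂ F x)
    (hsym : ∀ x, x ≠ 0 → jk p x ∉ K → F (p / x) = F x) :
    ∃ S : ℂ → ℂ, DifferentiableOn ℂ S Kᶜ ∧ ∀ x, x ≠ 0 → jk p x ∉ K → S (jk p x) = F x := by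
  have hroot : ∀ w : ℂ, ∃ x : ℂ, x ≠ 0 ∧ jk p x = w ∧ ‖x‖ ^ 2 ≤ p :=
    fun w => exists_joukowski_root w hp
  choose ϱ h0 hϱ hn using hroot
  have hS : ∀ x, x ≠ 0 → jk p x ∉ K → F (ϱ (jk p x)) = F x := by
    intro x hx hxK
    rcases (jk_eq_iff hp (h0 _) hx).1 (hϱ (jk p x)) with h | h
    · rw [h]
    · rw [h, hsym x hx hxK]
  refine ⟨fun w => F (ϱ w), ?_, hS⟩
  -- The chosen root ϱ need not be continuous. Away from critical values a local inverse g replaces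
  -- it: F∘ϱ = F∘g by the symmetry of F.
  have hreg : ∀ w, w ∉ K → dk p (ϱ w) ≠ 0 → DifferentiableAt ℂ (fun w => F (ϱ w)) w := by
    intro w hw hd
    have hs := hasStrictDerivAt_jk p (h0 w)
    have hne : dk p (ϱ w) / ϱ w ≠ 0 := div_ne_zero hd (h0 w)
    set g := hs.localInverse (jk p) _ _ hne with hg
    have hgd : HasStrictDerivAt g (dk p (ϱ w) / ϱ w)⁻¹ (jk p (ϱ w)) := hs.to_localInverse hne
    have hgr : ∀ᶠ v in 𝓝 (jk p (ϱ w)), jk p (g v) = v :=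
      (hs.hasStrictFDerivAt_equiv hne).eventually_right_inverse
    have hg0 : g (jk p (ϱ w)) = ϱ w :=
      (hs.hasStrictFDerivAt_equiv hne).localInverse_apply_image
    rw [hϱ w] at hgd hgr hg0
    have hFd : DifferentiableAt ℂ F (g w) := by
      rw [hg0]; exact hF _ (h0 w) (by rwa [hϱ w])
    have hcomp : DifferentiableAt ℂ (fun v => F (g v)) w :=
      DifferentiableAt.comp w hFd hgd.hasDerivAt.differentiableAt
    refine hcomp.congr_of_eventuallyEq ?_
    have hg1 : ∀ᶠ v in 𝓝 w, g v ≠ 0 :=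
      hgd.hasDerivAt.continuousAt.eventually_ne (by rw [hg0]; exact h0 w)
    filter_upwards [hgr, hg1, hK.isOpen_compl.mem_nhds hw] with v h1 h2 h3
    have := hS (g v) h2 (by rw [h1]; exact h3)
    rw [h1] at this
    exact this
  intro w hw
  by_cases hd : dk p (ϱ w) = 0
  · have hsq : w ^ 2 = 4 * p := by
      have := dk_sq p (h0 w)
      rw [hd, hϱ w] at this
      linear_combination -this
    have hp' : (p : ℂ) ≠ 0 := by exact_mod_cast hp.ne'
    have hw0 : w ≠ 0 := by
      rintro rfl
      apply hp'
      linear_combination -hsq / 4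
    have hx0 : ϱ w * 2 = w := by
      have h1 := hϱ w
      simp only [jk] at h1
      simp only [dk] at hd
      linear_combination h1 + hd
    refine (Complex.analyticAt_of_differentiable_on_punctured_nhds_of_continuousAt ?_ ?_
      ).differentiableAt.differentiableWithinAt
    · have hnw : ∀ᶠ v in 𝓝 w, v ≠ -w := by
        refine isOpen_ne.mem_nhds ?_
        intro h
        apply hw0
        linear_combination h / 2
      filter_upwards [nhdsWithin_le_nhds hnw, self_mem_nhdsWithin,
        nhdsWithin_le_nhds (hK.isOpen_compl.mem_nhds hw)] with v h1 h2 h3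
      refine hreg v h3 fun h4 => ?_
      have h5 := dk_sq p (h0 v)
      rw [h4, hϱ v] at h5
      have h6 : (v - w) * (v + w) = 0 := by linear_combination -h5 - hsq
      rcases mul_eq_zero.1 h6 with h7 | h7
      · exact h2 (sub_eq_zero.1 h7)
      · exact h1 (by linear_combination h7)
    · have hxc : ContinuousAt ϱ w := by
        -- At a critical value the double root makes (ϱ v - ϱ w)² proportional to v - w, so every
        -- choice of bounded roots is continuous there and the singularity is removable.
        have hid : ∀ v, (ϱ v - ϱ w) ^ 2 = ϱ v * (v - w) := by
          intro v
          have h1 := hϱ v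
          simp only [jk] at h1
          have h2 := h0 v
          have h3 : ϱ w ^ 2 = p := by
            linear_combination hsq / 4 + (ϱ w * 2 + w) / 4 * hx0
          field_simp at h1
          linear_combination h1 + h3 - ϱ v * hx0
        rw [ContinuousAt, tendsto_iff_norm_sub_tendsto_zero]
        have h1 : Tendsto (fun v => √(√p * ‖v - w‖)) (𝓝 w) (𝓝 0) := by
          have : Continuous fun v : ℂ => √(√p * ‖v - w‖) := by fun_prop
          simpa using this.tendsto w
        refine squeeze_zero (fun _ => norm_nonneg _) (fun v => ?_) h1
        refine Real.le_sqrt_of_sq_le ?_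
        rw [← norm_pow, hid, norm_mul]
        gcongr
        exact Real.le_sqrt_of_sq_le (hn v)
      exact ContinuousAt.comp (f := ϱ) (hF _ (h0 w) (by rwa [hϱ w])).continuousAt hxc
  · exact (hreg w hw hd).differentiableWithinAt

/-! ### The entire function `(1 - e^{-y}) / y` -/

/-- The entire function `(1 - e^{-y}) / y`. -/
noncomputable def phi (y : ℂ) : ℂ := dslope (fun y => 1 - Complex.exp (-y)) 0 y

theorem phi_zero : phi 0 = 1 := by
  have h : HasDerivAt (fun y : ℂ => 1 - Complex.exp (-y)) 1 0 := by
    have := ((hasDerivAt_id (0 : ℂ)).neg.cexp).const_sub 1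
    simpa using! this
  rw [phi, dslope_same, h.deriv]

theorem mul_phi (y : ℂ) : y * phi y = 1 - Complex.exp (-y) := by
  by_cases h : y = 0
  · simp [h]
  · rw [phi, dslope_of_ne _ h, slope_def_field]
    simp only [sub_zero, neg_zero, Complex.exp_zero, sub_self]
    field_simp

theorem differentiable_phi : Differentiable ℂ phi := by
  have : DifferentiableOn ℂ (dslope (fun y : ℂ => 1 - Complex.exp (-y)) 0) univ :=
    (Complex.differentiableOn_dslope univ_mem).2 (by fun_prop)
  exact differentiableOn_univ.1 this

theorem phi_conj (y : ℂ) : phi (conj y) = conj (phi y) := by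
  by_cases h : y = 0
  · simp [h, phi_zero]
  · have h' : conj y ≠ 0 := by simpa using h
    have h1 := mul_phi (conj y)
    have h2 := congrArg conj (mul_phi y)
    simp only [map_mul, map_sub, map_one, ← Complex.exp_conj, map_neg] at h2
    exact mul_left_cancel₀ h' (h1.trans h2.symm)

theorem phi_ofReal_pos (y : ℝ) : ∃ r : ℝ, 0 < r ∧ phi y = r ∧ y * r = 1 - Real.exp (-y) := by
  by_cases h : y = 0
  · exact ⟨1, one_pos, by simp [h, phi_zero], by simp [h]⟩
  · refine ⟨(1 - Real.exp (-y)) / y, ?_, ?_, by field_simp⟩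
    · rcases lt_or_gt_of_ne h with h1 | h1
      · refine div_pos_of_neg_of_neg ?_ h1
        have := Real.one_lt_exp_iff.2 (neg_pos.2 h1)
        linarith
      · refine div_pos ?_ h1
        have := Real.exp_lt_one_iff.2 (neg_lt_zero.2 h1)
        linarith
    · have h' : (y : ℂ) ≠ 0 := by exact_mod_cast h
      have h1 := mul_phi y
      push_cast
      rw [eq_div_iff h', mul_comm, h1]

/-! ### The Cauchy transform of a density along the nodes -/

variable {L p lo hi : ℝ} {h : ℝ → ℝ}

theorem isCompact_nodes : IsCompact (nodes L p lo hi) :=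
  isCompact_Icc.image (Complex.continuous_ofReal.comp continuous_node)

/-- For A < B: equal node values at distinct s and u force e^{Ls} e^{Lu} = p, which cannot hold for
both of two different u with the same s. -/
theorem exists_nodes_eq_seg (hL : L ≠ 0) (hlh : lo ≤ hi) :
    ∃ A B : ℝ, (∀ s ∈ Icc lo hi, node L p s ∈ Icc A B) ∧ nodes L p lo hi = seg A B ∧
      (lo < hi → A < B) := by
  have himg := (continuous_node (L := L) (p := p)).continuousOn (s := Icc lo hi) |>.image_Icc hlh
  set A := sInf (node L p '' Icc lo hi)
  set B := sSup (node L p '' Icc lo hi)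
  have hmem : ∀ s ∈ Icc lo hi, node L p s ∈ Icc A B := fun s hs => by
    rw [← himg]; exact mem_image_of_mem _ hs
  refine ⟨A, B, hmem, ?_, fun hlt => ?_⟩
  · rw [seg, ← himg, image_image]; rfl
  · by_contra hAB
    push Not at hAB
    have hc : ∀ s ∈ Icc lo hi, node L p s = A := fun s hs =>
      le_antisymm ((hmem s hs).2.trans hAB) (hmem s hs).1
    have key : ∀ s ∈ Icc lo hi, ∀ u ∈ Icc lo hi, s ≠ u →
        Real.exp (L * s) * Real.exp (L * u) = p := by
      intro s hs u hu hsu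
      have h1 := (hc s hs).trans (hc u hu).symm
      simp only [node] at h1
      have h2 := Real.exp_pos (L * s)
      have h3 := Real.exp_pos (L * u)
      have h4 : (Real.exp (L * s) - Real.exp (L * u)) *
          (Real.exp (L * s) * Real.exp (L * u) - p) = 0 := by
        field_simp at h1
        linear_combination h1
      rcases mul_eq_zero.1 h4 with h5 | h5
      · exfalso; apply hsu
        have := Real.exp_injective (sub_eq_zero.1 h5)
        exact mul_left_cancel₀ hL this
      · linarith
    have hm1 : (lo + hi) / 2 ∈ Icc lo hi := ⟨by linarith, by linarith⟩
    have h1 := key lo ⟨le_rfl, hlh⟩ _ hm1 (by linarith)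
    have h2 := key lo ⟨le_rfl, hlh⟩ hi ⟨hlh, le_rfl⟩ hlt.ne
    have h3 := mul_left_cancel₀ (Real.exp_pos (L * lo)).ne' (h1.trans h2.symm)
    have h4 := mul_left_cancel₀ hL (Real.exp_injective h3)
    linarith

/-- The measure is the image of h ds under `node`. This makes the results on `nev` available for
`ct`. -/
theorem exists_measure_ct (hh : IsDensity h) (hlh : lo ≤ hi) {A B : ℝ}
    (hAB : ∀ s ∈ Icc lo hi, node L p s ∈ Icc A B) :
    ∃ μ : Measure ℝ, IsFiniteMeasure μ ∧ μ (Icc A B)ᶜ = 0 ∧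
      ∀ w, ct L p lo hi h w = ∫ s : ℝ, 1 / (w - s) ∂μ := by
  set ν : Measure ℝ := (volume.restrict (Ioc lo hi)).withDensity
    fun s => ((h s).toNNReal : ENNReal) with hν
  have hfin : IsFiniteMeasure ν := by
    refine isFiniteMeasure_withDensity (ne_of_lt (lt_of_le_of_lt
      (lintegral_mono (g := fun _ => 1) fun s => ?_) ?_))
    · rw [ENNReal.coe_le_one_iff, Real.toNNReal_le_one]
      exact hh.le_one s
    · simp
  have hnm := (continuous_node (L := L) (p := p)).measurable
  refine ⟨ν.map (node L p), inferInstance, ?_, fun w => ?_⟩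
  · rw [Measure.map_apply hnm measurableSet_Icc.compl]
    refine withDensity_absolutelyContinuous _ _ ?_
    have : ∀ᵐ s ∂volume.restrict (Ioc lo hi), node L p s ∈ Icc A B := by
      filter_upwards [ae_restrict_mem measurableSet_Ioc] with s hs
      exact hAB s (Ioc_subset_Icc_self hs)
    exact this
  · have hm : Measurable fun s : ℝ => 1 / (w - s) := by fun_prop
    rw [integral_map hnm.aemeasurable hm.aestronglyMeasurable,
      integral_withDensity_eq_integral_smul hh.measurable.real_toNNReal, ct,
      intervalIntegral.integral_of_le hlh]
    refine integral_congr_ae (Eventually.of_forall fun s => ?_)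
    simp only [NNReal.smul_def, Real.coe_toNNReal _ (hh.nonneg s), Complex.real_smul]

theorem differentiableAt_ct (hL : L ≠ 0) (hh : IsDensity h) (hlh : lo ≤ hi) {w : ℂ}
    (hw : w ∉ nodes L p lo hi) : DifferentiableAt ℂ (ct L p lo hi h) w := by
  obtain ⟨A, B, hAB, hseg, -⟩ := exists_nodes_eq_seg (p := p) hL hlh
  obtain ⟨μ, hfin, hμ, hct⟩ := exists_measure_ct hh hlh hAB
  rw [hseg] at hw
  have h1 := (hasDerivAt_nev (c := 1) (C := 0) hμ hw).differentiableAt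
  have h2 : ct L p lo hi h = fun w => w - nev 1 0 μ w := by
    ext w; rw [hct, nev]; simp
  rw [h2]
  exact differentiableAt_id.sub h1

theorem ct_conj (w : ℂ) : ct L p lo hi h (conj w) = conj (ct L p lo hi h w) := by
  simp only [ct, intervalIntegral, map_sub, ← integral_conj]
  simp

theorem ct_ofReal (v : ℝ) : ct L p lo hi h v =
    ((∫ s in lo..hi, h s * (1 / (v - node L p s)) : ℝ) : ℂ) := by
  rw [ct, ← intervalIntegral.integral_ofReal]
  congr 1; ext s; push_cast; rfl

theorem ofReal_notMem_nodes {v : ℝ} (hv : (v : ℂ) ∉ nodes L p lo hi) :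
    (∀ s ∈ Icc lo hi, node L p s < v) ∨ ∀ s ∈ Icc lo hi, v < node L p s := by
  by_contra hcon
  push Not at hcon
  obtain ⟨⟨s, hs, h1⟩, ⟨u, hu, h2⟩⟩ := hcon
  have := (isPreconnected_Icc (a := lo) (b := hi)).intermediate_value hu hs
    (continuous_node (L := L) (p := p)).continuousOn
  obtain ⟨m, hm, hmv⟩ := this ⟨h2, h1⟩
  exact hv ⟨m, hm, by simp only; rw [hmv]⟩

theorem jk_mem_nodes (x : ℂ) {s : ℝ} (hs : s ∈ Icc lo hi) (h : jk p x = node L p s) :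
    jk p x ∈ nodes L p lo hi := ⟨s, hs, h.symm⟩

theorem ct_real_sign (hh : IsDensity h) (hlh : lo ≤ hi) {v : ℝ} :
    ((∀ s ∈ Icc lo hi, node L p s < v) →
      0 ≤ ∫ s in lo..hi, h s * (1 / (v - node L p s))) ∧
    ((∀ s ∈ Icc lo hi, v < node L p s) →
      ∫ s in lo..hi, h s * (1 / (v - node L p s)) ≤ 0) ∧
    (0 < (∫ s in lo..hi, h s) → (∀ s ∈ Icc lo hi, node L p s < v) →
      0 < ∫ s in lo..hi, h s * (1 / (v - node L p s))) ∧
    (0 < (∫ s in lo..hi, h s) → (∀ s ∈ Icc lo hi, v < node L p s) →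
      ∫ s in lo..hi, h s * (1 / (v - node L p s)) < 0) := by
  have hneg : (∀ s ∈ Icc lo hi, v < node L p s) → ∫ s in lo..hi, h s * (1 / (v - node L p s))
      = -∫ s in lo..hi, h s * (1 / (node L p s - v)) := by
    intro _
    rw [← intervalIntegral.integral_neg]
    congr 1; ext s
    rw [show v - node L p s = -(node L p s - v) by ring, one_div, one_div, inv_neg, mul_neg]
  have hc := (continuous_node (L := L) (p := p)).continuousOn (s := Icc lo hi)
  refine ⟨fun hv => ?_, fun hv => ?_, fun hm hv => ?_, fun hm hv => ?_⟩
  · refine intervalIntegral.integral_nonneg hlh fun s hs => mul_nonneg (hh.nonneg s) ?_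
    have := hv s hs
    exact one_div_nonneg.2 (by linarith)
  · rw [hneg hv, neg_nonpos]
    refine intervalIntegral.integral_nonneg hlh fun s hs => mul_nonneg (hh.nonneg s) ?_
    have := hv s hs
    exact one_div_nonneg.2 (by linarith)
  · refine integral_density_mul_pos hh hlh hm (continuousOn_const.div
      (continuousOn_const.sub hc) fun s hs => ?_) fun s hs => ?_
    · have := hv s hs; linarith
    · have := hv s hs; exact one_div_pos.2 (by linarith)
  · rw [hneg hv, neg_lt_zero]
    refine integral_density_mul_pos hh hlh hm (continuousOn_const.div
      (hc.sub continuousOn_const) fun s hs => ?_) fun s hs => ?_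
    · have := hv s hs; linarith
    · have := hv s hs; exact one_div_pos.2 (by linarith)

end

section

variable {L p lo hi R : ℝ} {h : ℝ → ℝ}

/-! ### The denominator of the transform -/

/-- The numerator `(x - b) (p - A x)`. -/
noncomputable def nb (p A b : ℝ) (x : ℂ) : ℂ := (x - b) * (p - A * x)

/-- The denominator of the transform, with its zeros at the critical points divided out. -/
noncomputable def den (L p A b : ℝ) (I x : ℂ) : ℂ :=
  -((b - A) * x) + L * I * phi (L * dk p x * I) * nb p A b x

theorem dk_mul_den (L p A b : ℝ) (I : ℂ) {x : ℂ} (hx : x ≠ 0) :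
    dk p x * den L p A b I x =
      nb p b A x - Complex.exp (-(L * dk p x * I)) * nb p A b x := by
  have h1 := mul_phi (L * dk p x * I)
  have h2 : nb p b A x - nb p A b x = -((b - A) * (x * dk p x)) := by
    simp only [nb, dk]; field_simp; ring
  rw [den]
  linear_combination nb p A b x * h1 - h2

theorem phi_neg (y : ℂ) : phi (-y) = Complex.exp y * phi y := by
  by_cases h : y = 0
  · simp [h]
  · have h1 := mul_phi (-y)
    have h2 := mul_phi y
    refine mul_left_cancel₀ h ?_
    have h3 : Complex.exp y * Complex.exp (-y) = 1 := by rw [← Complex.exp_add]; simp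
    rw [neg_neg] at h1
    linear_combination -h1 - Complex.exp y * h2 + h3

theorem nb_div {p : ℝ} (A b : ℝ) {x : ℂ} (hx : x ≠ 0) :
    nb p A b (p / x) = p / x ^ 2 * nb p b A x := by
  simp only [nb]; field_simp

theorem den_div (L : ℝ) {p : ℝ} (hp : 0 < p) (A b : ℝ) (I : ℂ) {x : ℂ} (hx : x ≠ 0) :
    den L p A b I (p / x)
      = p / x ^ 2 * Complex.exp (L * dk p x * I) * den L p A b I x := by
  have h1 := mul_phi (L * dk p x * I)
  have h2 : nb p b A x - nb p A b x = -((b - A) * (x * dk p x)) := by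
    simp only [nb, dk]; field_simp; ring
  have h3 : Complex.exp (L * dk p x * I) * Complex.exp (-(L * dk p x * I)) = 1 := by
    rw [← Complex.exp_add]; simp
  rw [den, den, dk_div hp hx, nb_div A b hx,
    show (L : ℂ) * -dk p x * I = -(L * dk p x * I) by ring, phi_neg]
  set E := Complex.exp (L * dk p x * I)
  set E' := Complex.exp (-(L * dk p x * I))
  have h4 : (p : ℂ) / x = p / x ^ 2 * x := by field_simp
  rw [h4]
  linear_combination (p / x ^ 2 * (L * I * E * phi (L * dk p x * I))) * h2
    - (p / x ^ 2 * E * (b - A) * x) * h1 + (p / x ^ 2 * (b - A) * x) * h3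

theorem den_conj (L p A b : ℝ) (I x : ℂ) :
    den L p A b (conj I) (conj x) = conj (den L p A b I x) := by
  have h1 : dk p (conj x) = conj (dk p x) := by simp [dk]
  simp only [den, nb, h1, map_add, map_neg, map_mul, map_sub, Complex.conj_ofReal, ← phi_conj]

/-- At the critical value 2√p the difference is a perfect square divided by e^{Ls} and has an
elementary antiderivative. It replaces `exp_integral_ker`, which carries no information when x - p/x
= 0. -/
theorem integral_inv_node_sub_crit (hL : 0 < L) (hp : 0 < p) (hlR : lo ≤ R)
    (hA : Real.exp (L * R) < √p) :
    L * ∫ s in lo..R, 1 / (node L p s - 2 * √p)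
      = 1 / (√p - Real.exp (L * R)) - 1 / (√p - Real.exp (L * lo)) := by
  have hy : ∀ s ∈ uIcc lo R, Real.exp (L * s) < √p := fun s hs => by
    rw [uIcc_of_le hlR] at hs
    exact lt_of_le_of_lt (Real.exp_le_exp.2 (mul_le_mul_of_nonneg_left hs.2 hL.le)) hA
  have hsq := Real.mul_self_sqrt hp.le
  have hn : ∀ s, node L p s - 2 * √p = (√p - Real.exp (L * s)) ^ 2 / Real.exp (L * s) := by
    intro s
    have := (Real.exp_pos (L * s)).ne'
    rw [node]; field_simp; nlinarith
  rw [← intervalIntegral.integral_const_mul]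
  refine intervalIntegral.integral_eq_sub_of_hasDerivAt
    (f := fun s => 1 / (√p - Real.exp (L * s))) (fun s hs => ?_) ?_
  · have h1 := sub_pos.2 (hy s hs)
    have := (Real.exp_pos (L * s)).ne'
    have h2 := ((hasDerivAt_exp_mul L s).const_sub (√p)).fun_inv h1.ne'
    simp only [one_div]
    refine h2.congr_deriv ?_
    rw [hn]; field_simp
  · refine ContinuousOn.intervalIntegrable (continuousOn_const.mul (continuousOn_const.div
      ((continuous_node.sub continuous_const).continuousOn) fun s hs => ?_))
    have h1 := sub_pos.2 (hy s hs)
    have := Real.exp_pos (L * s)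
    rw [hn]; positivity

theorem node_sub_eq {x : ℝ} (hx : x ≠ 0) (s : ℝ) : node L p s - (x + p / x) =
    (x - Real.exp (L * s)) * (p - x * Real.exp (L * s)) / (x * Real.exp (L * s)) := by
  have := (Real.exp_pos (L * s)).ne'
  rw [node]; field_simp; ring

/-- Comparison with the density 1 on [lo, R], for which the closed form gives equality. From h ≤ 1
comes -J ≤ J1; the sign of x - p/x turns this into an inequality of exponentials and is divided out
again. -/
theorem den_bound (hL : 0 < L) (hp : 0 < p) (hh : IsDensity h) (hlR : lo ≤ R) {x r : ℝ}
    (hAx : Real.exp (L * R) < x) (hxA : x * Real.exp (L * R) < p)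
    (hr : L * (x - p / x) * (∫ s in lo..R, h s * (1 / (x + p / x - node L p s))) * r
      = 1 - Real.exp (-(L * (x - p / x) *
        (∫ s in lo..R, h s * (1 / (x + p / x - node L p s))))))
    (hr1 : x - p / x = 0 → r = 1) :
    -(L * (∫ s in lo..R, h s * (1 / (x + p / x - node L p s))) * r) *
      ((x - Real.exp (L * lo)) * (p - x * Real.exp (L * R)))
      ≤ (Real.exp (L * R) - Real.exp (L * lo)) * x := by
  set A := Real.exp (L * R)
  set a := Real.exp (L * lo)
  have ha : 0 < a := Real.exp_pos _
  have haA : a ≤ A := Real.exp_le_exp.2 (mul_le_mul_of_nonneg_left hlR hL.le)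
  have hx : 0 < x := lt_trans (Real.exp_pos _) hAx
  have hnpos : ∀ s ∈ Icc lo R, 0 < node L p s - (x + p / x) := by
    intro s hs
    have h1 : Real.exp (L * s) ≤ A := Real.exp_le_exp.2 (mul_le_mul_of_nonneg_left hs.2 hL.le)
    have h2 := Real.exp_pos (L * s)
    rw [node_sub_eq hx.ne']
    have h3 : 0 < x - Real.exp (L * s) := by linarith
    have h4 : 0 < p - x * Real.exp (L * s) := by nlinarith
    positivity
  have hcont : ContinuousOn (fun s => 1 / (node L p s - (x + p / x))) (uIcc lo R) := by
    rw [uIcc_of_le hlR]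
    exact continuousOn_const.div ((continuous_node.sub continuous_const).continuousOn)
      fun s hs => (hnpos s hs).ne'
  set J := ∫ s in lo..R, h s * (1 / (x + p / x - node L p s)) with hJ
  set J1 := ∫ s in lo..R, 1 / (node L p s - (x + p / x)) with hJ1
  have hJJ1 : -J ≤ J1 := by
    rw [hJ, ← intervalIntegral.integral_neg]
    refine intervalIntegral.integral_mono_on hlR ?_ hcont.intervalIntegrable fun s hs => ?_
    · have := (hh.intervalIntegrable_mul_real hcont)
      refine this.congr fun s _ => ?_
      rw [show node L p s - (x + p / x) = -(x + p / x - node L p s) by ring,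
        one_div_neg_eq_neg_one_div, mul_neg]
    · rw [show x + p / x - node L p s = -(node L p s - (x + p / x)) by ring,
        one_div_neg_eq_neg_one_div, mul_neg, neg_neg]
      have h1 := one_div_pos.2 (hnpos s hs)
      have h2 := hh.le_one s
      nlinarith
  have hP : 0 < (x - a) * (p - x * A) := mul_pos (by linarith) (by linarith)
  by_cases hD : x - p / x = 0
  · rw [hr1 hD, mul_one]
    have hxs : x = √p := by
      have : x ^ 2 = p := by field_simp at hD; linarith
      rw [← this, Real.sqrt_sq hx.le]
    have hxx : x * x = p := by rw [hxs, Real.mul_self_sqrt hp.le]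
    have h2 : x + p / x = 2 * √p := by rw [← hxs, ← hxx]; field_simp; ring
    have h1 := integral_inv_node_sub_crit (lo := lo) hL hp hlR (by rw [← hxs]; exact hAx)
    rw [← h2, ← hxs] at h1
    have h3 : 0 < x - A := by linarith
    have h4 : 0 < x - a := by linarith
    have h5 : L * J1 * ((x - a) * (p - x * A)) = (A - a) * x := by
      rw [hJ1, h1, ← hxx]
      change (1 / (x - A) - 1 / (x - a)) * _ = _
      field_simp
      ring
    rw [← h5, ← mul_neg]
    gcongr
  · have hcl := exp_integral_ker (L := L) (p := p) (x := x) (lo := lo) (hi := R)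
      (by exact_mod_cast hx.ne') hlR (by
        intro s hs
        have := hnpos s hs
        rw [jk]
        norm_cast
        linarith)
    have hint : ∫ s in lo..R, ker L p x s = ((-(L * (x - p / x) * J1) : ℝ) : ℂ) := by
      rw [hJ1, ← intervalIntegral.integral_const_mul, ← intervalIntegral.integral_neg,
        ← intervalIntegral.integral_ofReal]
      refine intervalIntegral.integral_congr fun s hs => ?_
      rw [uIcc_of_le hlR] at hs
      have := (hnpos s hs).ne'
      simp only [ker, dk, jk]
      norm_cast
      rw [show x + p / x - node L p s = -(node L p s - (x + p / x)) by ring, div_neg]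
      ring
    rw [hint] at hcl
    have hcl' : Real.exp (L * (x - p / x) * J1) * ((x - a) * (p - x * A))
        = (x - A) * (p - x * a) := by
      rw [← Complex.ofReal_neg, neg_neg, ← Complex.ofReal_exp] at hcl
      exact_mod_cast hcl
    set D := x - p / x with hDdef
    have hxD : x * D = x ^ 2 - p := by rw [hDdef]; field_simp
    have h5 : (Real.exp (L * D * J1) - 1) * ((x - a) * (p - x * A)) = D * ((A - a) * x) := by
      linear_combination hcl' + (-(A - a)) * hxD
    have h6 : D * (-(L * J * r)) = Real.exp (-(L * D * J)) - 1 := by linear_combination -hr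
    rcases lt_or_gt_of_ne hD with hneg | hpos
    · have h7 : Real.exp (L * D * J1) ≤ Real.exp (-(L * D * J)) := by
        rw [Real.exp_le_exp]
        have : L * D < 0 := by nlinarith
        nlinarith
      have h8 : D * ((A - a) * x) ≤ D * (-(L * J * r) * ((x - a) * (p - x * A))) := by
        rw [← h5, ← mul_assoc D, h6]
        gcongr
      nlinarith
    · have h7 : Real.exp (-(L * D * J)) ≤ Real.exp (L * D * J1) := by
        rw [Real.exp_le_exp]
        have : 0 < L * D := by positivity
        nlinarith
      have h8 : D * (-(L * J * r) * ((x - a) * (p - x * A))) ≤ D * ((A - a) * x) := by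
        rw [← h5, ← mul_assoc D, h6]
        gcongr
      exact le_of_mul_le_mul_left h8 hpos

end

/-! ### Nonvanishing of the denominator and construction of the transform. -/

section

variable {L p lo hi R : ℝ} {h : ℝ → ℝ}

theorem jk_ofReal (p x : ℝ) : jk p x = ((x + p / x : ℝ) : ℂ) := by simp [jk]

theorem jk_notMem_nodes_ne {x : ℂ} (hK : jk p x ∉ nodes L p lo R) {s : ℝ}
    (hs : s ∈ Icc lo R) : jk p x - node L p s ≠ 0 := fun h0 =>
  hK (jk_mem_nodes x hs (sub_eq_zero.1 h0))

/-- The density equals `1` on the part of the interval to the right of `R`. -/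
theorem ct_split (hh : IsDensity h) (hlR : lo ≤ R) (hRh : R ≤ hi)
    (h1 : ∀ s ∈ Ioc R hi, h s = 1) {x : ℂ} (hK : jk p x ∉ nodes L p lo hi) :
    expo L p lo hi h x = expo L p lo R h x - ∫ s in R..hi, ker L p x s := by
  have hk : ∀ s ∈ Icc lo hi, jk p x - node L p s ≠ 0 := fun s hs =>
    jk_notMem_nodes_ne hK hs
  have hc := continuousOn_ker hk
  rw [expo_eq_integral_ker, expo_eq_integral_ker,
    ← intervalIntegral.integral_add_adjacent_intervals (b := R)
      (hh.intervalIntegrable_mul (hc.mono (by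
        rw [uIcc_of_le hlR]; exact Icc_subset_Icc_right hRh)))
      (hh.intervalIntegrable_mul (hc.mono (by
        rw [uIcc_of_le hRh]; exact Icc_subset_Icc_left hlR)))]
  have : ∫ s in R..hi, (h s : ℂ) * ker L p x s = ∫ s in R..hi, ker L p x s := by
    refine intervalIntegral.integral_congr_ae (Eventually.of_forall fun s hs => ?_)
    rw [uIoc_of_le hRh] at hs
    rw [h1 s hs]; simp
  rw [this]; ring

/-- The defining relation between the transform's numerator, denominator and the slope. -/
theorem dk_mul_den_eq (hh : IsDensity h) (hlR : lo ≤ R) (hRh : R ≤ hi)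
    (h1 : ∀ s ∈ Ioc R hi, h s = 1) {x : ℂ} (hx : x ≠ 0) (hK : jk p x ∉ nodes L p lo hi) :
    dk p x * den L p (Real.exp (L * R)) (Real.exp (L * hi)) (ct L p lo R h (jk p x)) x
      = nb p (Real.exp (L * hi)) (Real.exp (L * R)) x *
        (1 - Complex.exp (expo L p lo hi h x)) := by
  have hcl := exp_integral_ker (L := L) (p := p) hx hRh fun s hs =>
    jk_notMem_nodes_ne hK ⟨hlR.trans hs.1, hs.2⟩
  rw [dk_mul_den _ _ _ _ _ hx, ct_split hh hlR hRh h1 hK, sub_eq_add_neg (expo L p lo R h x),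
    Complex.exp_add, ← expo]
  simp only [nb]
  linear_combination Complex.exp (expo L p lo R h x) * hcl

theorem nb_ne_zero {A b : ℝ} {s u : ℝ} {x : ℂ} (hx : x ≠ 0) (hA : A = Real.exp (L * s))
    (hb : b = Real.exp (L * u)) (hs : jk p x - node L p s ≠ 0) (hu : jk p x - node L p u ≠ 0) :
    nb p A b x ≠ 0 := by
  rw [jk_sub_node p hx] at hs hu
  refine mul_ne_zero ?_ ?_
  · intro h; apply hu; rw [← hb, h]; simp
  · intro h; apply hs; rw [← hA, show x * A - p = -(p - A * x) by ring, h]; simp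

/-- Parameters of a density for which the transform is everywhere defined. -/
structure Regular (L p lo R hi : ℝ) (h : ℝ → ℝ) : Prop where
  hL : 0 < L
  hp : 0 < p
  dens : IsDensity h
  hlR : lo ≤ R
  hRh : R ≤ hi
  one : ∀ s ∈ Ioc R hi, h s = 1
  mass : 0 < ∫ s in lo..hi, h s
  -- The first alternative serves a general time; the second serves time 0, where the block of ones
  -- over (R, hi] is removed from the cut.
  sub : R = hi ∨ Real.exp (L * R) * Real.exp (L * hi) < p

theorem den_ofReal (L p lo R : ℝ) (h : ℝ → ℝ) (x : ℝ) :
    ∃ r : ℝ, 0 < r ∧ (L * (x - p / x) * (∫ s in lo..R, h s * (1 / (x + p / x - node L p s))) * r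
      = 1 - Real.exp (-(L * (x - p / x) *
        (∫ s in lo..R, h s * (1 / (x + p / x - node L p s)))))) ∧ (x - p / x = 0 → r = 1) ∧
      ∀ A b : ℝ, den L p A b (ct L p lo R h (jk p x)) x
        = ((-((b - A) * x) + L * (∫ s in lo..R, h s * (1 / (x + p / x - node L p s))) * r *
          ((x - b) * (p - A * x)) : ℝ) : ℂ) := by
  rw [jk_ofReal, ct_ofReal]
  set J := ∫ s in lo..R, h s * (1 / (x + p / x - node L p s)) with hJ
  obtain ⟨r, hr0, hr, hrJ⟩ := phi_ofReal_pos (L * (x - p / x) * J)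
  refine ⟨r, hr0, hrJ, fun h0 => ?_, fun A b => ?_⟩
  · have : (L : ℝ) * (x - p / x) * J = 0 := by rw [h0]; ring
    rw [this, Complex.ofReal_zero, phi_zero] at hr
    exact_mod_cast hr.symm
  · have : (L : ℂ) * dk p x * J = ((L * (x - p / x) * J : ℝ) : ℂ) := by simp [dk]
    rw [den, this, hr, nb]
    push_cast; ring

theorem Regular.strict (hreg : Regular L p lo R hi h) :
    Real.exp (L * R) < Real.exp (L * hi) ∨
      (Real.exp (L * R) = Real.exp (L * hi) ∧ 0 < ∫ s in lo..R, h s) := by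
  rcases eq_or_lt_of_le hreg.hRh with h1 | hlt
  · exact Or.inr ⟨by rw [h1], by rw [h1]; exact hreg.mass⟩
  · exact Or.inl (Real.exp_lt_exp.2 (mul_lt_mul_of_pos_left hlt hreg.hL))

/-- Here x + p/x lies to the left of all nodes, so J ≤ 0. For x ≥ b neither term of the denominator
is positive. For x < b the second term is nonnegative, and `den_bound` together with (A - a)(b - x)
< (b - A)(x - a) shows that the first one dominates. -/
theorem den_ofReal_neg (hreg : Regular L p lo R hi h) {x : ℝ} (hAx : Real.exp (L * R) < x)
    (hxA : x * Real.exp (L * R) < p) :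
    ∃ d : ℝ, d < 0 ∧
      den L p (Real.exp (L * R)) (Real.exp (L * hi)) (ct L p lo R h (jk p x)) x = d := by
  have hstrict := hreg.strict
  obtain ⟨hL, hp, hh, hlR, hRh, h1, hm, -⟩ := hreg
  obtain ⟨r, hr0, hrJ, hr1, hden⟩ := den_ofReal L p lo R h x
  obtain ⟨s1, s2, s3, s4⟩ := ct_real_sign (v := x + p / x) (L := L) (p := p) hh hlR
  rw [hden]
  refine ⟨_, ?_, rfl⟩
  have hmono : ∀ {u v : ℝ}, u ≤ v → Real.exp (L * u) ≤ Real.exp (L * v) := fun huv =>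
    Real.exp_le_exp.2 (mul_le_mul_of_nonneg_left huv hL.le)
  have hx0 : 0 < x := (Real.exp_pos _).trans hAx
  have hs : ∀ s ∈ Icc lo R, x + p / x < node L p s := by
    intro s hs
    have h2 := node_sub_eq (L := L) (p := p) hx0.ne' s
    have h3 := hmono hs.2
    have h4 : 0 < p - x * Real.exp (L * s) := by nlinarith
    have h5 : 0 < x - Real.exp (L * s) := by linarith
    have h6 := Real.exp_pos (L * s)
    have : 0 < node L p s - (x + p / x) := by rw [h2]; positivity
    linarith
  have hbd0 := den_bound hL hp hh hlR hAx hxA hrJ hr1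
  set J := ∫ s in lo..R, h s * (1 / (x + p / x - node L p s)) with hJ
  set A := Real.exp (L * R)
  set b := Real.exp (L * hi)
  set a := Real.exp (L * lo) with ha
  have ha0 : 0 < a := Real.exp_pos _
  have hAb' : A ≤ b := hmono hRh
  have haA : a ≤ A := hmono hlR
  have hLr := mul_pos hL hr0
  have hJ0 := s2 hs
  have hJr : L * J * r ≤ 0 := by
    rw [mul_right_comm]
    exact mul_nonpos_of_nonneg_of_nonpos hLr.le hJ0
  rcases le_or_gt b x with hbx | hxb
  · have hP : 0 ≤ (x - b) * (p - A * x) := mul_nonneg (by linarith) (by linarith)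
    rcases hstrict with h6 | ⟨h6, h7⟩
    · nlinarith
    · have hJn := s4 h7 hs
      have : L * J * r < 0 := by
        rw [mul_right_comm]
        exact mul_neg_of_pos_of_neg hLr hJn
      have hP : 0 < (x - b) * (p - A * x) :=
        mul_pos (by rw [← h6]; linarith) (by linarith)
      rw [← h6] at hP ⊢
      nlinarith
  · have hbd := hbd0
    have hxa : 0 < x - a := by linarith
    have h6 : -(L * J * r) * ((x - a) * (p - x * A)) * (b - x) ≤ (A - a) * x * (b - x) := by
      gcongr
    have h7 : (A - a) * (b - x) < (b - A) * (x - a) := by nlinarith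
    have h8 : (-((b - A) * x) + L * J * r * ((x - b) * (p - A * x))) * (x - a) < 0 := by
      nlinarith
    exact neg_of_mul_neg_left h8 hxa.le

/-- A real value off the cut lies to one side of all nodes, which gives J a sign. The delicate case
is x > 0 to the left of the nodes, where the two terms may compete: there A < x < p/A, and
`den_ofReal_neg` applies. -/
theorem den_ofReal_ne_zero (hreg : Regular L p lo R hi h) {x : ℝ} (hx : x ≠ 0)
    (hK : jk p x ∉ nodes L p lo R) :
    den L p (Real.exp (L * R)) (Real.exp (L * hi)) (ct L p lo R h (jk p x)) x ≠ 0 := by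
  have hstrict := hreg.strict
  have hneg := den_ofReal_neg (x := x) hreg
  obtain ⟨hL, hp, hh, hlR, hRh, h1, hm, hsub⟩ := hreg
  have hn := fun s (hs : s ∈ Icc lo R) => jk_notMem_nodes_ne hK hs
  have hlR' : Real.exp (L * lo) ≤ Real.exp (L * R) :=
    Real.exp_le_exp.2 (mul_le_mul_of_nonneg_left hlR hL.le)
  obtain ⟨r, hr0, -, -, hden⟩ := den_ofReal L p lo R h x
  rw [jk_ofReal] at hK
  obtain ⟨s1, s2, s3, s4⟩ := ct_real_sign (v := x + p / x) (L := L) (p := p) hh hlR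
  set J := ∫ s in lo..R, h s * (1 / (x + p / x - node L p s)) with hJ
  have hside := ofReal_notMem_nodes hK
  rcases hsub with rfl | hAb
  · rw [hden]
    have h2 : nb p (Real.exp (L * R)) (Real.exp (L * R)) x ≠ 0 :=
      nb_ne_zero (by exact_mod_cast hx) rfl rfl (hn R ⟨hlR, le_rfl⟩) (hn R ⟨hlR, le_rfl⟩)
    have h3 : J ≠ 0 := by
      rcases hside with hs | hs
      · exact (s3 hm hs).ne'
      · exact (s4 hm hs).ne
    have h4 : (x - Real.exp (L * R)) * (p - Real.exp (L * R) * x) ≠ 0 := by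
      simp only [nb] at h2
      exact_mod_cast h2
    rw [sub_self, zero_mul, neg_zero, zero_add]
    exact_mod_cast mul_ne_zero (mul_ne_zero (mul_ne_zero hL.ne' h3) hr0.ne') h4
  · set A := Real.exp (L * R)
    set b := Real.exp (L * hi)
    set a := Real.exp (L * lo) with ha
    have hA0 : 0 < A := Real.exp_pos _
    have ha0 : 0 < a := Real.exp_pos _
    have hAb' : A ≤ b := Real.exp_le_exp.2 (mul_le_mul_of_nonneg_left hRh hL.le)
    have hsgn : ∀ s ∈ Icc lo R, node L p s - (x + p / x) =
        (x - Real.exp (L * s)) * (p - x * Real.exp (L * s)) / (x * Real.exp (L * s)) :=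
      fun s _ => node_sub_eq hx s
    have hys : ∀ s ∈ Icc lo R, a ≤ Real.exp (L * s) ∧ Real.exp (L * s) ≤ A := fun s hs =>
      ⟨Real.exp_le_exp.2 (mul_le_mul_of_nonneg_left hs.1 hL.le),
        Real.exp_le_exp.2 (mul_le_mul_of_nonneg_left hs.2 hL.le)⟩
    have hnode : ∀ s ∈ Icc lo R, (x - Real.exp (L * s)) * (p - x * Real.exp (L * s)) ≠ 0 := by
      intro s hs h0
      have h2 := hsgn s hs
      rw [h0, zero_div] at h2
      apply hn s hs
      rw [jk_ofReal]
      norm_cast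
      linarith
    rcases lt_or_gt_of_ne hx with hxneg | hxpos
    · have hs : ∀ s ∈ Icc lo R, x + p / x < node L p s := by
        intro s hs
        have h2 : 0 < node L p s := by
          have := Real.exp_pos (L * s)
          rw [node]; positivity
        have h3 : p / x < 0 := div_neg_of_pos_of_neg hp hxneg
        linarith
      have hJ0 := s2 hs
      have hP : (x - b) * (p - A * x) < 0 := mul_neg_of_neg_of_pos (by linarith) (by nlinarith)
      rw [hden]
      norm_cast
      refine ne_of_gt ?_
      rcases hstrict with h5 | ⟨h5, h6⟩
      · have : 0 ≤ L * J * r * ((x - b) * (p - A * x)) := by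
          have : L * J * r ≤ 0 := by
            have := mul_nonneg hL.le hr0.le
            nlinarith
          nlinarith
        nlinarith
      · have hJn := s4 h6 hs
        have : L * J * r < 0 := by
          have := mul_pos hL hr0
          nlinarith
        rw [← h5] at hP ⊢
        nlinarith
    · have hAA : A * A < p := by nlinarith
      have hLr := mul_pos hL hr0
      have hbpos : ∀ s ∈ Icc lo R, 0 < x * Real.exp (L * s) := fun s _ =>
        mul_pos hxpos (Real.exp_pos _)
      have hRm : R ∈ Icc lo R := ⟨hlR, le_rfl⟩
      rcases hside with hs | hs
      · have hJ0 := s1 hs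
        have hP : (x - b) * (p - A * x) < 0 := by
          have h2 : (x - A) * (p - x * A) < 0 := by
            have h3 := hsgn R hRm
            have h4 := hs R hRm
            by_contra h5
            have := div_nonneg (not_lt.1 h5) (hbpos R hRm).le
            linarith
          rcases mul_neg_iff.1 h2 with ⟨h3, h4⟩ | ⟨h3, h4⟩
          · refine mul_neg_of_pos_of_neg ?_ (by linarith)
            nlinarith
          · exact mul_neg_of_neg_of_pos (by linarith) (by linarith)
        rw [hden]
        norm_cast
        refine ne_of_lt ?_
        have h5 : L * J * r * ((x - b) * (p - A * x)) ≤ 0 := by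
          have : 0 ≤ L * J * r := by positivity
          nlinarith
        rcases hstrict with h6 | ⟨h6, h7⟩
        · nlinarith
        · have hJp := s3 h7 hs
          have : 0 < L * J * r := by positivity
          rw [← h6] at hP ⊢
          nlinarith
      · have h2 : 0 < (x - A) * (p - x * A) := by
          have h3 := hsgn R hRm
          have h4 := hs R hRm
          by_contra h5
          have := div_nonpos_of_nonpos_of_nonneg (not_lt.1 h5) (hbpos R hRm).le
          linarith
        have hy : A < x ∧ x * A < p := by
          rcases mul_pos_iff.1 h2 with ⟨h3, h4⟩ | ⟨h3, h4⟩
          · exact ⟨by linarith, by linarith⟩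
          · nlinarith
        obtain ⟨d, hd, hdd⟩ := hneg hy.1 hy.2
        rw [hdd]
        exact_mod_cast hd.ne

theorem nodes_subset (hRh : R ≤ hi) : nodes L p lo R ⊆ nodes L p lo hi :=
  image_mono (Icc_subset_Icc_right hRh)

theorem im_of_dk_eq_zero (hp : 0 < p) {x : ℂ} (hx : x ≠ 0) (hd : dk p x = 0) : x.im = 0 := by
  have h1 : x * x = p := by
    simp only [dk] at hd
    field_simp at hd
    linear_combination hd
  have h2 := congrArg Complex.im h1
  have h3 := congrArg Complex.re h1
  simp only [Complex.mul_im, Complex.mul_re, Complex.ofReal_im, Complex.ofReal_re] at h2 h3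
  by_contra h4
  have h5 : x.re = 0 := by
    have : x.re * x.im = 0 := by linarith
    rcases mul_eq_zero.1 this with h | h
    · exact h
    · exact absurd h h4
  rw [h5] at h3
  nlinarith [mul_self_pos.2 h4]

theorem notMem_nodes_of_im {x : ℂ} (hx : x.im ≠ 0) : jk p x ∉ nodes L p lo hi := by
  rintro ⟨s, -, h⟩
  exact jk_sub_node_ne_zero_of_im hx s (sub_eq_zero.2 h.symm)

/-- Off the real axis the denominator vanishes only if f = 1, which the bound on the argument of f
excludes. -/
theorem den_ne_zero (hreg : Regular L p lo R hi h) {x : ℂ} (hx : x ≠ 0)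
    (hK : jk p x ∉ nodes L p lo R) :
    den L p (Real.exp (L * R)) (Real.exp (L * hi)) (ct L p lo R h (jk p x)) x ≠ 0 := by
  by_cases him : x.im = 0
  · obtain ⟨y, rfl⟩ : ∃ y : ℝ, x = y := ⟨x.re, Complex.ext rfl (by simp [him])⟩
    exact den_ofReal_ne_zero hreg (by exact_mod_cast hx) hK
  · intro h0
    have h1 := dk_mul_den_eq hreg.dens hreg.hlR hreg.hRh hreg.one hx
      (notMem_nodes_of_im (L := L) (p := p) (lo := lo) (hi := hi) him)
    rw [h0, mul_zero] at h1
    rcases mul_eq_zero.1 h1.symm with h2 | h2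
    · exact nb_ne_zero hx rfl rfl (jk_sub_node_ne_zero_of_im him hi)
        (jk_sub_node_ne_zero_of_im him R) h2
    · exact exp_expo_ne_one_of_im hreg.hL hreg.hp hreg.dens (hreg.hlR.trans hreg.hRh)
        hreg.mass him (sub_eq_zero.1 h2).symm

theorem jk_conj (p : ℝ) (x : ℂ) : jk p (conj x) = conj (jk p x) := by simp [jk]

theorem conj_mem_nodes {w : ℂ} : conj w ∈ nodes L p lo hi ↔ w ∈ nodes L p lo hi := by
  constructor <;>
  · rintro ⟨s, hs, h⟩
    refine ⟨s, hs, ?_⟩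
    have := congrArg conj h
    simpa using this

/-- The transform, as a function of `x + p / x`. -/
theorem exists_transform (hreg : Regular L p lo R hi h) :
    ∃ S : ℂ → ℂ, DifferentiableOn ℂ S (nodes L p lo R)ᶜ ∧
      (∀ w, w ∉ nodes L p lo R → S (conj w) = conj (S w)) ∧
      (∀ x, x ≠ 0 → jk p x ∉ nodes L p lo hi → dk p x ≠ 0 →
        Complex.exp (expo L p lo hi h x) ≠ 1 ∧
        S (jk p x) = -x + dk p x / (1 - Complex.exp (expo L p lo hi h x))) ∧
      ∀ x, x ≠ 0 → jk p x ∉ nodes L p lo R →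
        S (jk p x) = -x + nb p (Real.exp (L * hi)) (Real.exp (L * R)) x /
          den L p (Real.exp (L * R)) (Real.exp (L * hi)) (ct L p lo R h (jk p x)) x := by
  have hp := hreg.hp
  set A := Real.exp (L * R) with hA
  set b := Real.exp (L * hi) with hb
  set I : ℂ → ℂ := fun x => ct L p lo R h (jk p x) with hI
  -- This is -x + (x - p/x)/(1 - f) with the common zero at the critical points cancelled; it also
  -- makes sense at the nodes over (R, hi].
  set F : ℂ → ℂ := fun x => -x + nb p b A x / den L p A b (I x) x with hF
  have hden : ∀ x, x ≠ 0 → jk p x ∉ nodes L p lo R → den L p A b (I x) x ≠ 0 :=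
    fun x hx hK => den_ne_zero hreg hx hK
  -- Passing from x to p/x replaces f by 1/f and x - p/x by its negative; the two changes
  -- compensate.
  have hsym : ∀ x, x ≠ 0 → jk p x ∉ nodes L p lo R → F (p / x) = F x := by
    intro x hx hK
    have hd := hden x hx hK
    have hp' : (p : ℂ) ≠ 0 := by exact_mod_cast hp.ne'
    have hI' : I (p / x) = I x := by simp only [hI, jk_div hp hx]
    have he := Complex.exp_ne_zero (L * dk p x * I x)
    simp only [hF]
    rw [hI', den_div L hp A b (I x) hx, nb_div b A hx, mul_assoc,
      mul_div_mul_left _ _ (div_ne_zero hp' (pow_ne_zero 2 hx))]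
    have h1 := dk_mul_den L p A b (I x) hx
    rw [Complex.exp_neg] at h1
    generalize Complex.exp (L * dk p x * I x) = E at h1 he ⊢
    have h2 : dk p x = x - p / x := rfl
    rw [← eq_div_iff hd] at h1
    have h3 : nb p b A x / den L p A b (I x) x
        - nb p A b x / (E * den L p A b (I x) x) = dk p x := by
      rw [h1]; field_simp
    linear_combination -h3 - h2
  obtain ⟨S, hS, hSF⟩ := exists_descend hp (isCompact_nodes (L := L) (lo := lo) (hi := R)).isClosed
    (F := F) (fun x hx hK => by
      have h1 : DifferentiableAt ℂ I x :=
        (differentiableAt_ct hreg.hL.ne' hreg.dens hreg.hlR hK).comp x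
          (hasStrictDerivAt_jk p hx).hasDerivAt.differentiableAt
      have h2 : DifferentiableAt ℂ (dk p) x := by
        unfold dk
        exact differentiableAt_id.sub ((differentiableAt_const _).div differentiableAt_id hx)
      have h3 : ∀ A b : ℝ, DifferentiableAt ℂ (nb p A b) x := by
        intro A b; unfold nb; fun_prop
      have h4 : DifferentiableAt ℂ (fun x => den L p A b (I x) x) x := by
        unfold den
        have := h3 A b
        have h5 : DifferentiableAt ℂ (fun x => phi (L * dk p x * I x)) x :=
          (differentiable_phi _).comp x (by fun_prop)
        fun_prop
      exact differentiableAt_id.neg.add ((h3 b A).div h4 (hden x hx hK))) hsym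
  refine ⟨S, hS, fun w hw => ?_, fun x hx hK hd => ?_, hSF⟩
  · obtain ⟨x, hx, hxw, -⟩ := exists_joukowski_root w hp
    have hxw : jk p x = w := hxw
    have hcx : conj x ≠ 0 := by simpa using hx
    have hw' : jk p (conj x) ∉ nodes L p lo R := by
      rw [jk_conj, hxw, conj_mem_nodes]; exact hw
    rw [← hxw, ← jk_conj, hSF _ hcx hw', hSF x hx (by rwa [hxw])]
    have h1 : I (conj x) = conj (I x) := by simp only [hI, jk_conj, ct_conj]
    simp only [hF, h1, den_conj, map_add, map_neg, map_div₀]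
    simp [nb]
  · have hK' : jk p x ∉ nodes L p lo R := fun h => hK (nodes_subset hreg.hRh h)
    have h1 := dk_mul_den_eq hreg.dens hreg.hlR hreg.hRh hreg.one hx hK
    have h2 := hden x hx hK'
    have h3 := mul_ne_zero hd h2
    rw [h1] at h3
    have h4 := right_ne_zero_of_mul h3
    refine ⟨fun h5 => h4 (by rw [h5, sub_self]), ?_⟩
    rw [hSF x hx hK']
    simp only [hF]
    congr 1
    rw [div_eq_div_iff h2 h4]
    linear_combination -h1

end

/-! ### Behaviour of the transform at infinity. -/

section

open Bornology in
theorem eventually_notMem_of_isCompact {K : Set ℂ} (hK : IsCompact K) :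
    ∀ᶠ w in cobounded ℂ, w ∉ K := hK.isBounded

open Bornology in
/-- A holomorphic function with at most linear growth at infinity. -/
theorem exists_affine_at_infinity {K : Set ℂ} (hK : IsCompact K) {S : ℂ → ℂ} {a : ℝ}
    (hS : DifferentiableOn ℂ S Kᶜ) (hconj : ∀ w, w ∉ K → S (conj w) = conj (S w))
    (hlim : Tendsto (fun w => S w / w) (cobounded ℂ) (𝓝 a)) :
    ∃ C : ℝ, Tendsto (fun w => S w - a * w - C) (cobounded ℂ) (𝓝 0) := by
  classical
  -- In the coordinate ξ = 1/w the function ξ S(1/ξ) extends holomorphically with value a at 0; its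
  -- derivative there is the constant term, which conjugation symmetry makes real.
  set g : ℂ → ℂ := Function.update (fun ξ => ξ * S ξ⁻¹) 0 a with hg
  have hinv : Tendsto (fun ξ : ℂ => ξ⁻¹) (𝓝[≠] 0) (cobounded ℂ) := tendsto_inv₀_nhdsNE_zero
  have hinv' : Tendsto (fun w : ℂ => w⁻¹) (cobounded ℂ) (𝓝[≠] 0) := tendsto_inv₀_cobounded'
  have hgne : ∀ ξ : ℂ, ξ ≠ 0 → g ξ = ξ * S ξ⁻¹ := fun ξ h => by
    rw [hg, Function.update_of_ne h]
  have hg0 : g 0 = a := by simp [hg]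
  have hcont : ContinuousAt g 0 := by
    rw [← continuousWithinAt_compl_self, ContinuousWithinAt, hg0]
    refine (hlim.comp hinv).congr' ?_
    filter_upwards [self_mem_nhdsWithin] with ξ hξ
    rw [hgne ξ hξ, Function.comp_apply, div_inv_eq_mul, mul_comm]
  have hdiff : ∀ᶠ ξ in 𝓝[≠] (0 : ℂ), DifferentiableAt ℂ g ξ := by
    filter_upwards [hinv (eventually_notMem_of_isCompact hK), self_mem_nhdsWithin] with ξ h1 h2
    have h3 : DifferentiableAt ℂ (fun ξ => ξ * S ξ⁻¹) ξ :=
      differentiableAt_id.mul (DifferentiableAt.comp (f := fun ξ : ℂ => ξ⁻¹) ξ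
        ((hS _ h1).differentiableAt (hK.isClosed.isOpen_compl.mem_nhds h1))
        (differentiableAt_inv h2))
    refine h3.congr_of_eventuallyEq ?_
    filter_upwards [isOpen_ne.mem_nhds h2] with η hη using hgne η hη
  have han := (Complex.analyticAt_of_differentiable_on_punctured_nhds_of_continuousAt hdiff
    hcont).differentiableAt.hasDerivAt
  have hsl := (hasDerivAt_iff_tendsto_slope.1 han).comp hinv'
  set c := deriv g 0
  have hT : Tendsto (fun w => S w - a * w) (cobounded ℂ) (𝓝 c) := by
    refine hsl.congr' ?_
    filter_upwards [eventually_ne_cobounded 0] with w hw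
    rw [Function.comp_apply, slope_def_field, hg0, hgne _ (inv_ne_zero hw)]
    field_simp
    simp
  have hcj : Tendsto (fun w : ℂ => conj w) (cobounded ℂ) (cobounded ℂ) := by
    rw [← tendsto_norm_atTop_iff_cobounded]
    simpa using tendsto_norm_cobounded_atTop (E := ℂ)
  have hT2 : Tendsto (fun w => S w - a * w) (cobounded ℂ) (𝓝 (conj c)) := by
    have := (Complex.continuous_conj.tendsto c).comp (hT.comp hcj)
    refine this.congr' ?_
    filter_upwards [eventually_notMem_of_isCompact hK] with w hw
    simp only [Function.comp_apply, map_sub, map_mul, hconj w hw, Complex.conj_conj,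
      Complex.conj_ofReal]
  have hre := Complex.conj_eq_iff_re.1 (tendsto_nhds_unique hT2 hT)
  refine ⟨c.re, ?_⟩
  rw [hre]
  simpa using hT.sub_const c

variable {L p lo hi R : ℝ} {h : ℝ → ℝ}

open Bornology in
theorem tendsto_mul_ct (hh : IsDensity h) (hlh : lo ≤ hi) :
    Tendsto (fun w => w * ct L p lo hi h w) (cobounded ℂ) (𝓝 ((∫ s in lo..hi, h s : ℝ) : ℂ)) := by
  have hc := (continuous_node (L := L) (p := p))
  obtain ⟨B, hB⟩ := (isCompact_Icc (a := lo) (b := hi)).exists_bound_of_continuousOn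
    hc.continuousOn
  have h1 : ∀ w, w * ct L p lo hi h w = ∫ s in lo..hi, (h s : ℂ) * (w * (1 / (w - node L p s))) := by
    intro w
    rw [ct, ← intervalIntegral.integral_const_mul]
    congr 1; ext s; ring
  simp only [h1]
  rw [← intervalIntegral.integral_ofReal]
  have hcg : (cobounded ℂ).IsCountablyGenerated := by
    rw [← comap_norm_atTop (E := ℂ)]; infer_instance
  refine intervalIntegral.tendsto_integral_filter_of_dominated_convergence (fun _ => 2) ?_ ?_
    (intervalIntegrable_const) ?_
  · refine Eventually.of_forall fun w => ?_
    have := hh.measurable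
    have := hc.measurable
    exact Measurable.aestronglyMeasurable (by fun_prop)
  · have hev : ∀ᶠ w in cobounded ℂ, 2 * |B| + 1 ≤ ‖w‖ :=
      tendsto_norm_cobounded_atTop.eventually_ge_atTop _
    filter_upwards [hev] with w hw
    refine Eventually.of_forall fun s hs => ?_
    rw [uIoc_of_le hlh] at hs
    have h2 := (hB s (Ioc_subset_Icc_self hs)).trans (le_abs_self B)
    have h3 : ‖w‖ / 2 ≤ ‖w - node L p s‖ := by
      have := norm_sub_norm_le w (node L p s)
      rw [Complex.norm_real] at this
      linarith [abs_nonneg B]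
    have h4 : 0 < ‖w‖ := by linarith [abs_nonneg B]
    rw [norm_mul, Complex.norm_real, Real.norm_of_nonneg (hh.nonneg s), mul_one_div, norm_div]
    have h5 : ‖w‖ / ‖w - node L p s‖ ≤ 2 := by
      rw [div_le_iff₀ (by linarith)]; linarith
    have := hh.le_one s
    have := hh.nonneg s
    nlinarith [div_nonneg h4.le (norm_nonneg (w - node L p s))]
  · refine Eventually.of_forall fun s _ => ?_
    have h2 : Tendsto (fun w : ℂ => 1 / (1 - node L p s * w⁻¹)) (cobounded ℂ) (𝓝 1) := by
      have : Tendsto (fun w : ℂ => 1 / (1 - node L p s * w⁻¹)) (cobounded ℂ)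
          (𝓝 (1 / (1 - node L p s * 0))) :=
        tendsto_const_nhds.div (tendsto_const_nhds.sub (tendsto_inv₀_cobounded.const_mul _))
          (by simp)
      simpa using this
    have h3 := h2.const_mul (h s : ℂ)
    rw [mul_one] at h3
    refine h3.congr' ?_
    filter_upwards [eventually_ne_cobounded 0, eventually_ne_cobounded (node L p s : ℂ)] with w hw hw2
    have := sub_ne_zero.2 hw2
    have h6 : 1 - (node L p s : ℂ) * w⁻¹ = (w - node L p s) / w := by field_simp
    rw [h6, one_div_div, mul_one_div]

open Bornology in
-- Along the small root, x → 0 and (x - p/x)/w → -1. Hence the exponent tends to L∫h, and only (x -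
-- p/x)/(1 - f) contributes to the limit.
theorem tendsto_transform (hreg : Regular L p lo R hi h) {S : ℂ → ℂ}
    (hS : ∀ x, x ≠ 0 → jk p x ∉ nodes L p lo hi → dk p x ≠ 0 →
        S (jk p x) = -x + dk p x / (1 - Complex.exp (expo L p lo hi h x))) :
    Tendsto (fun w => S w / w) (cobounded ℂ)
      (𝓝 ((1 / (Real.exp (L * ∫ s in lo..hi, h s) - 1) : ℝ) : ℂ)) := by
  have hp := hreg.hp
  set M := ∫ s in lo..hi, h s with hM
  choose ϱ h0 hϱ hn using fun w : ℂ => exists_joukowski_root w hp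
  have hxw : ∀ w, ϱ w * w = ϱ w ^ 2 + p := fun w => by
    have h1 := hϱ w
    have := h0 w
    field_simp at h1
    linear_combination -h1
  have hx0 : Tendsto ϱ (cobounded ℂ) (𝓝 0) := by
    rw [tendsto_zero_iff_norm_tendsto_zero]
    have h1 : Tendsto (fun w : ℂ => 2 * p * ‖w⁻¹‖) (cobounded ℂ) (𝓝 0) := by
      have := (tendsto_inv₀_cobounded (α := ℂ)).norm.const_mul (2 * p)
      simpa using this
    refine squeeze_zero' (Eventually.of_forall fun _ => norm_nonneg _) ?_ h1
    filter_upwards [eventually_ne_cobounded 0] with w hw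
    have h2 : ‖ϱ w‖ * ‖w‖ ≤ 2 * p := by
      rw [← norm_mul, hxw]
      refine (norm_add_le _ _).trans ?_
      rw [norm_pow, Complex.norm_real, Real.norm_of_nonneg hp.le]
      linarith [hn w]
    rw [norm_inv]
    field_simp
    linarith
  have hsq : Tendsto (fun w => ϱ w ^ 2) (cobounded ℂ) (𝓝 0) := by
    simpa using hx0.pow 2
  have hp' : (p : ℂ) ≠ 0 := by exact_mod_cast hp.ne'
  have hdw : Tendsto (fun w => dk p (ϱ w) / w) (cobounded ℂ) (𝓝 (-1)) := by
    have h1 : Tendsto (fun w => (ϱ w ^ 2 - p) / (ϱ w ^ 2 + p)) (cobounded ℂ) (𝓝 ((0 - p) / (0 + p))) :=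
      (hsq.sub_const _).div (hsq.add_const _) (by simpa using hp')
    rw [show ((0 : ℂ) - p) / (0 + p) = -1 by rw [zero_sub, zero_add, neg_div, div_self hp']] at h1
    refine h1.congr' ?_
    filter_upwards [eventually_ne_cobounded 0] with w hw
    rw [← hxw, dk]
    have := h0 w
    field_simp
  have hex : Tendsto (fun w => expo L p lo hi h (ϱ w)) (cobounded ℂ) (𝓝 (L * M)) := by
    have h1 := (hdw.const_mul (L : ℂ)).mul
      (tendsto_mul_ct (L := L) (p := p) hreg.dens (hreg.hlR.trans hreg.hRh))
    have h2 := h1.neg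
    rw [show -((L : ℂ) * -1 * ((∫ s in lo..hi, h s : ℝ) : ℂ)) = L * M by rw [hM]; ring] at h2
    refine h2.congr' ?_
    filter_upwards [eventually_ne_cobounded 0] with w hw
    rw [expo, show jk p (ϱ w) = w from hϱ w]
    field_simp
  have hpos : 0 < Real.exp (L * M) - 1 := by
    have := Real.add_one_lt_exp (mul_pos hreg.hL hreg.mass).ne'
    have := mul_pos hreg.hL hreg.mass
    linarith
  have hne : (1 : ℂ) - Complex.exp (L * M) ≠ 0 := by
    rw [← Complex.ofReal_mul, ← Complex.ofReal_exp]
    norm_cast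
    linarith
  have hfin := ((hx0.mul (tendsto_inv₀_cobounded (α := ℂ))).neg).add
    (hdw.div (((Complex.continuous_exp.tendsto _).comp hex).const_sub 1) hne)
  have hval : -((0 : ℂ) * 0) + -1 / (1 - Complex.exp (L * M))
      = ((1 / (Real.exp (L * M) - 1) : ℝ) : ℂ) := by
    push_cast
    rw [mul_zero, neg_zero, zero_add, ← neg_sub, div_neg, neg_div, neg_neg]
  rw [hval] at hfin
  refine hfin.congr' ?_
  have hdn : ∀ᶠ w in cobounded ℂ, dk p (ϱ w) ≠ 0 := by
    filter_upwards [hdw.eventually_ne (show (-1 : ℂ) ≠ 0 by norm_num)] with w hw h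
    exact hw (by rw [h, zero_div])
  filter_upwards [eventually_ne_cobounded 0, hdn,
    eventually_notMem_of_isCompact (isCompact_nodes (L := L) (p := p) (lo := lo) (hi := hi))]
    with w hw h1 h2
  have h3 := hS (ϱ w) (h0 w) (by rw [show jk p (ϱ w) = w from hϱ w]; exact h2) h1
  rw [show jk p (ϱ w) = w from hϱ w] at h3
  rw [h3]
  simp only [Function.comp_apply]
  rw [add_div, neg_div, div_right_comm, div_eq_mul_inv (ϱ w)]
  rfl

end

section

variable {L p lo hi R : ℝ} {h : ℝ → ℝ}

/-! ### Positivity of the transform -/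

/-- Here S is a quadratic polynomial in w over a linear one. Division gives m1² S = a A m1 w + c +
E/(m1 w - m0) with a A m1 > 0 and E ≤ 0, and each term has nonpositive imaginary part in the lower
half-plane. The condition A b < k fixes the sign of E. -/
theorem extremal_im_nonpos {a y A b k : ℝ} (ha : 0 < a) (hay : a ≤ y) (hyA : y ≤ A) (hAb : A ≤ b)
    (hk : A * b < k) (hm : 0 < b * y - a * A) {w S : ℂ} (hw : w.im < 0)
    (hS : S * ((b * y - a * A : ℝ) * w - ((y - a) * (k + A * b) + (b - A) * (k + a * y) : ℝ))
      = (a * w - (k + a * y)) * (A * w - (k + A * b)) - k * (y - a) * (b - A)) :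
    S.im ≤ 0 := by
  set m1 := b * y - a * A with hm1
  set m0 := (y - a) * (k + A * b) + (b - A) * (k + a * y) with hm0
  set c := -(a * (k + A * b) + A * (k + a * y)) * m1 + a * A * m0 with hc
  set E := -((A - y) * (b - a) * (k - y * b) * (k - a * A) * (y - a) * (b - A)) with hE
  have hE0 : E ≤ 0 := by
    have h1 : y * b ≤ A * b := mul_le_mul_of_nonneg_right hyA (by linarith)
    have h2 : a * A ≤ b * A := mul_le_mul_of_nonneg_right (by linarith) (by linarith)
    have h3 : 0 ≤ A - y := by linarith
    have h4 : 0 ≤ b - a := by linarith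
    have h5 : 0 ≤ k - y * b := by linarith
    have h6 : 0 ≤ k - a * A := by nlinarith
    have h7 : 0 ≤ y - a := by linarith
    have h8 : 0 ≤ b - A := by linarith
    rw [hE]
    have : 0 ≤ (A - y) * (b - a) * (k - y * b) * (k - a * A) * (y - a) * (b - A) := by positivity
    linarith
  set M : ℂ := m1 * w - m0 with hM
  set Z : ℂ := m1 ^ 2 * S - ((a * A * m1 : ℝ) * w + c) with hZ
  have hZM : Z * M = E := by
    have h1 : Z * M = m1 ^ 2 * (S * M) - ((a * A * m1 : ℝ) * w + c) * M := by rw [hZ]; ring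
    rw [h1, hS, hM, hE, hc, hm0, hm1]
    push_cast
    ring
  have hMim : M.im = m1 * w.im := by simp [hM]
  have hn : 0 < Complex.normSq M := by
    rw [Complex.normSq_pos]
    intro h0
    rw [h0] at hMim
    simp only [Complex.zero_im] at hMim
    nlinarith
  have hZim : Z.im * Complex.normSq M = -(E * (m1 * w.im)) := by
    have h1 : Z * Complex.normSq M = E * conj M := by
      rw [← hZM, mul_assoc, Complex.mul_conj]
    have h2 := congrArg Complex.im h1
    rw [Complex.im_mul_ofReal, Complex.im_ofReal_mul, Complex.conj_im, hMim] at h2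
    linarith
  have hZ0 : Z.im ≤ 0 := by
    by_contra hcon
    push Not at hcon
    have h1 := mul_pos hcon hn
    have h2 : 0 ≤ E * (m1 * w.im) := mul_nonneg_of_nonpos_of_nonpos hE0 (by nlinarith)
    linarith
  have hZS : Z.im = m1 ^ 2 * S.im - a * A * m1 * w.im := by
    rw [hZ, ← Complex.ofReal_pow, Complex.sub_im, Complex.im_ofReal_mul, Complex.add_im,
      Complex.im_ofReal_mul, Complex.ofReal_im, add_zero]
  have h3 : 0 < a * A * m1 := by
    have : 0 < A := by linarith
    positivity
  have h4 : m1 ^ 2 * S.im ≤ 0 := by nlinarith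
  by_contra hcon
  push Not at hcon
  have := mul_pos (pow_pos hm 2) hcon
  linarith

theorem exp_ne_one_of_abs_im {z : ℂ} (h0 : z.im ≠ 0) (h1 : |z.im| < 2 * Real.pi) :
    Complex.exp z ≠ 1 := by
  intro he
  obtain ⟨n, hn⟩ := Complex.exp_eq_one_iff.1 he
  have h3 : z.im = n * (2 * Real.pi) := by rw [hn]; simp
  have hpi := Real.pi_pos
  rw [h3, abs_mul, abs_of_pos (by positivity : 0 < 2 * Real.pi)] at h1
  have h4 : |(n : ℝ)| < 1 := by nlinarith
  have h5 : n = 0 := Int.abs_lt_one_iff.1 (by exact_mod_cast h4)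
  rw [h3, h5] at h0
  simp at h0

/-- The numerator of `Im ((f x - k / x) / (1 - f))` decreases when `|f|` increases. -/
theorem im_numerator_nonpos {k : ℝ} (hk : 0 < k) {x f : ℂ} {ϱ : ℝ} (hx : 0 < x.im) (hϱ : 1 ≤ ϱ)
    (h : ((f * x - k / x) * conj (1 - f)).im ≤ 0) :
    ((ϱ * f * x - k / x) * conj (1 - ϱ * f)).im ≤ 0 := by
  have hkx : ((k : ℂ) / x).im < 0 := by
    rw [Complex.div_im]
    have : 0 < Complex.normSq x := Complex.normSq_pos.2 (by rintro rfl; simp at hx)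
    simp only [Complex.ofReal_im, Complex.ofReal_re, zero_mul, zero_div, zero_sub]
    have := div_pos (mul_pos hk hx) this
    linarith
  have key : ((ϱ * f * x - k / x) * conj (1 - ϱ * f)).im
      = ϱ * ((f * x - k / x) * conj (1 - f)).im + (ϱ - 1) * ((k : ℂ) / x).im
        - ϱ * (ϱ - 1) * (Complex.normSq f * x.im) := by
    generalize (k : ℂ) / x = v
    simp [Complex.normSq_apply]
    ring
  rw [key]
  have h1 := mul_nonneg (Complex.normSq_nonneg f) hx.le
  have h2 : 0 ≤ ϱ - 1 := by linarith
  have h3 : ϱ * ((f * x - k / x) * conj (1 - f)).im ≤ 0 :=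
    mul_nonpos_of_nonneg_of_nonpos (by linarith) h
  have h4 : (ϱ - 1) * ((k : ℂ) / x).im ≤ 0 := mul_nonpos_of_nonneg_of_nonpos h2 hkx.le
  have h5 : 0 ≤ ϱ * (ϱ - 1) * (Complex.normSq f * x.im) := by positivity
  linarith

theorem div_im_nonpos_iff {z d : ℂ} (hd : d ≠ 0) : (z / d).im ≤ 0 ↔ (z * conj d).im ≤ 0 := by
  have h1 : z / d = (z * conj d) * ((Complex.normSq d)⁻¹ : ℝ) := by
    rw [div_eq_mul_inv, Complex.inv_def, mul_assoc]
  have h2 : 0 < (Complex.normSq d)⁻¹ := inv_pos.2 (Complex.normSq_pos.2 hd)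
  rw [h1, Complex.im_mul_ofReal]
  constructor
  · intro h; by_contra h3; push Not at h3; linarith [mul_pos h3 h2]
  · intro h; exact mul_nonpos_of_nonpos_of_nonneg h h2.le

/-- The kernels at s and u share the numerator L(x - p/x), so the orientation of their values as
plane vectors is governed by Im w and the order of the nodes. -/
theorem ker_re_mul_im_sub {x : ℂ} (hx : x.im ≠ 0) (s u : ℝ) :
    (ker L p x s).re * (ker L p x u).im - (ker L p x u).re * (ker L p x s).im
      = Complex.normSq (L * dk p x) / (Complex.normSq (jk p x - node L p s) *
          Complex.normSq (jk p x - node L p u)) * ((jk p x).im * (node L p s - node L p u)) := by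
  have h1 := Complex.normSq_pos.2 (jk_sub_node_ne_zero_of_im (L := L) (p := p) hx s)
  have h2 := Complex.normSq_pos.2 (jk_sub_node_ne_zero_of_im (L := L) (p := p) hx u)
  simp only [ker]
  rw [Complex.div_re, Complex.div_im, Complex.div_re, Complex.div_im]
  generalize (L : ℂ) * dk p x = d
  rw [Complex.normSq_apply d]
  have h3 : ∀ s, (jk p x - node L p s).im = (jk p x).im := by intro s; simp
  have h4 : ∀ s, (jk p x - node L p s).re = (jk p x).re - node L p s := by intro s; simp
  rw [h3, h3, h4, h4]
  generalize Complex.normSq (jk p x - node L p s) = n1 at *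
  generalize Complex.normSq (jk p x - node L p u) = n2 at *
  field_simp
  ring

theorem node_lt_node (hL : 0 < L) {s u : ℝ} (hsu : s < u)
    (hp : Real.exp (L * u) * Real.exp (L * u) < p) : node L p u < node L p s := by
  have h1 : Real.exp (L * s) < Real.exp (L * u) := Real.exp_lt_exp.2 (by nlinarith)
  have h2 := Real.exp_pos (L * s)
  have h3 := Real.exp_pos (L * u)
  have : node L p s - node L p u = (Real.exp (L * u) - Real.exp (L * s)) *
      (p - Real.exp (L * s) * Real.exp (L * u)) / (Real.exp (L * s) * Real.exp (L * u)) := by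
    rw [node, node]; field_simp; ring
  have h4 : 0 < node L p s - node L p u := by
    rw [this]
    have : 0 < p - Real.exp (L * s) * Real.exp (L * u) := by nlinarith
    have := sub_pos.2 h1
    positivity
  linarith

end

/-! ### The extremal density and the sign of Im S_0. -/

section

variable {L p lo hi R : ℝ} {h : ℝ → ℝ}

/-- Bathtub principle: at fixed imaginary part of the exponent, the indicator of [lo, s₁] makes its
real part smallest. The point s₁ comes from the intermediate value theorem, so that the imaginary
parts agree and the difference δ is real. -/
theorem exists_extremal (hL : 0 < L) (hp : 0 < p) (hh : IsDensity h) (hlR : lo ≤ R)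
    (hA : Real.exp (L * R) * Real.exp (L * R) < p) {x : ℂ} (hx : 0 < x.im)
    (hw : (jk p x).im < 0) :
    ∃ s₁ ∈ Icc lo R, ∃ δ : ℝ, 0 ≤ δ ∧
      expo L p lo R h x = -(∫ s in lo..s₁, ker L p x s) + δ := by
  have hk : Continuous (ker L p x) :=
    continuousOn_univ.1 (continuousOn_ker fun u _ => jk_sub_node_ne_zero_of_im hx.ne' u)
  have hwc := continuous_wt (L := L) (p := p) hx.ne'
  have hwp := fun s => wt_pos (s := s) hL hp hx.ne'
  have hhw : ∀ u v, IntervalIntegrable (fun s => h s * wt L p x s) volume u v := fun u v =>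
    hh.intervalIntegrable_mul_real hwc.continuousOn
  have hhk : ∀ u v, IntervalIntegrable (fun s => (h s : ℂ) * ker L p x s) volume u v :=
    fun u v => hh.intervalIntegrable_mul hk.continuousOn
  have hcont : ContinuousOn (fun s => ∫ u in lo..s, wt L p x u) (Icc lo R) :=
    (intervalIntegral.continuous_primitive (fun _ _ => hwc.intervalIntegrable _ _) lo).continuousOn
  obtain ⟨s₁, hs₁, hmass⟩ : ∃ s₁ ∈ Icc lo R,
      ∫ u in lo..s₁, wt L p x u = ∫ u in lo..R, h u * wt L p x u := by
    refine intermediate_value_Icc hlR hcont ⟨?_, ?_⟩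
    · simp only [intervalIntegral.integral_same]
      exact intervalIntegral.integral_nonneg hlR fun s _ => mul_nonneg (hh.nonneg s) (hwp s).le
    · refine intervalIntegral.integral_mono_on hlR (hhw _ _) (hwc.intervalIntegrable _ _)
        fun s _ => ?_
      have := hh.le_one s
      nlinarith [hwp s]
  set G : ℂ := (∫ s in lo..R, (h s : ℂ) * ker L p x s) - ∫ s in lo..s₁, ker L p x s with hG
  have hGim : G.im = 0 := by
    have h1 := expo_im (L := L) (p := p) (lo := lo) (hi := R) hh hx.ne'
    have h2 : (∫ s in lo..s₁, ker L p x s).im = -(x.im * ∫ s in lo..s₁, wt L p x s) := by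
      rw [← Complex.imCLM_apply,
        ← ContinuousLinearMap.intervalIntegral_comp_comm _ (hk.intervalIntegrable _ _),
        ← intervalIntegral.integral_const_mul, ← intervalIntegral.integral_neg]
      congr 1; ext s
      rw [Complex.imCLM_apply, ker_im hx.ne']
    rw [expo_eq_integral_ker, Complex.neg_im] at h1
    rw [hG, Complex.sub_im, h2, hmass]
    linarith
  set kr := (ker L p x s₁).re
  set ki := (ker L p x s₁).im
  have hki : ki < 0 := by
    have h1 : ki = -(x.im * wt L p x s₁) := ker_im hx.ne' s₁
    rw [h1]
    linarith [mul_pos hx (hwp s₁)]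
  -- Λ is a linear functional vanishing on the kernel at s₁. Both h - 1_{[lo, s₁]} and Λ(ker) are
  -- nonpositive to the left of s₁ and nonnegative to the right, so Λ G ≥ 0.
  set Λ : ℂ →L[ℝ] ℝ := ki • Complex.reCLM - kr • Complex.imCLM with hΛ
  have hΛa : ∀ z : ℂ, Λ z = z.re * ki - kr * z.im := fun z => by simp [hΛ, mul_comm]
  have hcross : ∀ s, ∃ c : ℝ, 0 ≤ c ∧ Λ (ker L p x s)
      = c * ((jk p x).im * (node L p s - node L p s₁)) := fun s => by
    rw [hΛa, ker_re_mul_im_sub hx.ne' s s₁]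
    refine ⟨_, div_nonneg (Complex.normSq_nonneg _)
      (mul_nonneg (Complex.normSq_nonneg _) (Complex.normSq_nonneg _)), rfl⟩
  have hys : ∀ u ≤ R, Real.exp (L * u) * Real.exp (L * u) < p := fun u hu => by
    have h1 : Real.exp (L * u) ≤ Real.exp (L * R) :=
      Real.exp_le_exp.2 (mul_le_mul_of_nonneg_left hu hL.le)
    have := Real.exp_pos (L * u)
    nlinarith
  have hleft : ∀ s, s ≤ s₁ → Λ (ker L p x s) ≤ 0 := by
    intro s hs
    obtain ⟨c, hc, h1⟩ := hcross s
    rw [h1]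
    have h2 : node L p s₁ ≤ node L p s := by
      rcases hs.eq_or_lt with rfl | hs
      · exact le_rfl
      · exact (node_lt_node hL hs (hys _ hs₁.2)).le
    exact mul_nonpos_of_nonneg_of_nonpos hc (mul_nonpos_of_nonpos_of_nonneg hw.le (by linarith))
  have hright : ∀ s ∈ Icc s₁ R, 0 ≤ Λ (ker L p x s) := by
    intro s hs
    obtain ⟨c, hc, h1⟩ := hcross s
    rw [h1]
    have h2 : node L p s ≤ node L p s₁ := by
      rcases hs.1.eq_or_lt with rfl | hs'
      · exact le_rfl
      · exact (node_lt_node hL hs' (hys _ hs.2)).le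
    exact mul_nonneg hc (mul_nonneg_of_nonpos_of_nonpos hw.le (by linarith))
  have hGsplit : G = (∫ s in lo..s₁, ((h s : ℂ) * ker L p x s - ker L p x s))
      + ∫ s in s₁..R, (h s : ℂ) * ker L p x s := by
    rw [intervalIntegral.integral_sub (hhk _ _) (hk.intervalIntegrable _ _), hG,
      ← intervalIntegral.integral_add_adjacent_intervals (hhk lo s₁) (hhk s₁ R)]
    ring
  have hΛG : 0 ≤ Λ G := by
    rw [hGsplit, map_add, ← ContinuousLinearMap.intervalIntegral_comp_comm _
      ((hhk _ _).sub (hk.intervalIntegrable _ _)),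
      ← ContinuousLinearMap.intervalIntegral_comp_comm _ (hhk _ _)]
    refine add_nonneg (intervalIntegral.integral_nonneg hs₁.1 fun s hs => ?_)
      (intervalIntegral.integral_nonneg hs₁.2 fun s hs => ?_)
    · have h1 : (h s : ℂ) * ker L p x s - ker L p x s = (h s - 1) • ker L p x s := by
        rw [Complex.real_smul]; push_cast; ring
      rw [h1, map_smul, smul_eq_mul]
      exact mul_nonneg_of_nonpos_of_nonpos (by linarith [hh.le_one s]) (hleft s hs.2)
    · rw [← Complex.real_smul, map_smul, smul_eq_mul]
      exact mul_nonneg (hh.nonneg s) (hright s hs)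
  have hGre : G.re ≤ 0 := by
    rw [hΛa, hGim, mul_zero, sub_zero] at hΛG
    by_contra hcon
    push Not at hcon
    nlinarith
  refine ⟨s₁, hs₁, -G.re, by linarith, ?_⟩
  have h3 : G = (G.re : ℂ) := Complex.ext rfl (by simp [hGim])
  have h4 : (∫ s in lo..R, (h s : ℂ) * ker L p x s) = G + ∫ s in lo..s₁, ker L p x s := by
    rw [hG]; ring
  rw [expo_eq_integral_ker, h4]
  push_cast
  rw [← h3]
  ring

/-- The block of ones on (R, hi] is kept and the density on [lo, R] is replaced by the extremal one.
The argument of f is unchanged and |f| drops by the factor e^{-δ}. For the new f₁ the transform is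
rational in w, and `im_numerator_nonpos` carries its sign back to f. -/
theorem transform_im_nonpos (hreg : Regular L p lo R hi h)
    (hAb : Real.exp (L * R) * Real.exp (L * hi) < p) {x : ℂ} (hx : 0 < x.im)
    (hw : (jk p x).im < 0) :
    (-x + dk p x / (1 - Complex.exp (expo L p lo hi h x))).im ≤ 0 := by
  obtain ⟨hL, hp, hh, hlR, hRh, h1, hm, -⟩ := hreg
  have hx0 : x ≠ 0 := by rintro rfl; simp at hx
  have hmono : ∀ {u v : ℝ}, u ≤ v → Real.exp (L * u) ≤ Real.exp (L * v) := fun huv =>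
    Real.exp_le_exp.2 (mul_le_mul_of_nonneg_left huv hL.le)
  have hA0 := Real.exp_pos (L * R)
  obtain ⟨s₁, hs₁, δ, hδ, hex⟩ := exists_extremal hL hp hh hlR
    (lt_of_le_of_lt (mul_le_mul_of_nonneg_left (hmono hRh) hA0.le) hAb) hx hw
  have hne := fun s => jk_sub_node_ne_zero_of_im (L := L) (p := p) hx.ne' s
  set Φ := expo L p lo hi h x with hΦ
  set Φ₁ : ℂ := -(∫ s in lo..s₁, ker L p x s) + -(∫ s in R..hi, ker L p x s) with hΦ₁
  have hΦδ : Φ = δ + Φ₁ := by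
    rw [hΦ, ct_split hh hlR hRh h1 (notMem_nodes_of_im hx.ne'), hex, hΦ₁]; ring
  obtain ⟨-, hr2, hr3⟩ := expo_im_range (L := L) (p := p) (lo := lo) (hi := hi) hL hp hh
    (hlR.trans hRh) hx.ne'
  have hr3 := hr3 hm
  rw [← hΦ] at hr2 hr3
  have hf : Complex.exp Φ ≠ 1 := exp_ne_one_of_abs_im (right_ne_zero_of_mul hr3.ne') hr2
  have him : Φ₁.im = Φ.im := by rw [hΦδ]; simp
  have hf₁ : Complex.exp Φ₁ ≠ 1 :=
    exp_ne_one_of_abs_im (by rw [him]; exact right_ne_zero_of_mul hr3.ne') (by rwa [him])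
  set f₁ := Complex.exp Φ₁ with hf₁d
  have hff₁ : Complex.exp Φ = (Real.exp δ : ℂ) * f₁ := by
    rw [hΦδ, Complex.exp_add, Complex.ofReal_exp]
  have hc1 := exp_integral_ker (L := L) (p := p) hx0 hs₁.1 fun s _ => hne s
  have hc2 := exp_integral_ker (L := L) (p := p) hx0 hRh fun s _ => hne s
  set a := Real.exp (L * lo)
  set y := Real.exp (L * s₁)
  set A := Real.exp (L * R)
  set b := Real.exp (L * hi)
  have ha : 0 < a := Real.exp_pos _
  have hay : a ≤ y := hmono hs₁.1
  have hyA : y ≤ A := hmono hs₁.2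
  have hAb' : A ≤ b := hmono hRh
  have hnb : ∀ s u : ℝ, nb p (Real.exp (L * s)) (Real.exp (L * u)) x ≠ 0 := fun s u =>
    nb_ne_zero hx0 rfl rfl (hne s) (hne u)
  set N1 : ℂ := (x - y) * (p - x * a) * ((x - b) * (p - x * A)) with hN1
  set D1 : ℂ := (x - a) * (p - x * y) * ((x - A) * (p - x * b)) with hD1
  have hD1' : D1 ≠ 0 := by
    have h2 := mul_ne_zero (hnb s₁ lo) (hnb hi R)
    intro h0
    apply h2
    simp only [nb]
    rw [hD1] at h0
    linear_combination h0
  have hfN : f₁ * D1 = N1 := by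
    rw [hf₁d, hΦ₁, Complex.exp_add, hD1, hN1, ← hc1, ← hc2]; ring
  -- Equality would require A = b and y = a; then N1 = D1 and f₁ = 1, which is excluded.
  have hm1 : 0 < b * y - a * A := by
    rcases hAb'.eq_or_lt with h2 | h2
    · rcases hay.eq_or_lt with h3 | h3
      · exfalso
        apply hf₁
        have : N1 = D1 := by rw [hN1, hD1, ← h2, ← h3]
        rw [this] at hfN
        exact mul_right_cancel₀ hD1' (hfN.trans (one_mul _).symm)
      · rw [← h2]; nlinarith
    · nlinarith
  have h1f : 1 - f₁ ≠ 0 := sub_ne_zero.2 (Ne.symm hf₁)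
  set S₁ : ℂ := (f₁ * x - p / x) / (1 - f₁) with hS₁
  have hS₁N : S₁ * ((b * y - a * A : ℝ) * jk p x - ((y - a) * (p + A * b) + (b - A) * (p + a * y) : ℝ))
      = (a * jk p x - (p + a * y)) * (A * jk p x - (p + A * b)) - p * (y - a) * (b - A) := by
    have h2 : S₁ * (1 - f₁) = f₁ * x - p / x := by rw [hS₁, div_mul_cancel₀ _ h1f]
    have h3 : S₁ * (D1 - N1) = N1 * x - p / x * D1 := by
      rw [← hfN]; linear_combination D1 * h2
    have h4 : D1 - N1 ≠ 0 := by
      rw [← hfN]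
      have : D1 - f₁ * D1 = (1 - f₁) * D1 := by ring
      rw [this]; exact mul_ne_zero h1f hD1'
    refine mul_right_cancel₀ h4 ?_
    rw [mul_right_comm, h3, hN1, hD1, jk]
    push_cast
    field_simp
    ring
  have hS₁im := extremal_im_nonpos ha hay hyA hAb' hAb hm1 hw hS₁N
  rw [hS₁, div_im_nonpos_iff h1f] at hS₁im
  have hfin := im_numerator_nonpos hp hx (Real.one_le_exp hδ) hS₁im
  have h1F : 1 - Complex.exp Φ ≠ 0 := sub_ne_zero.2 (Ne.symm hf)
  have hSeq : -x + dk p x / (1 - Complex.exp Φ)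
      = (Complex.exp Φ * x - p / x) / (1 - Complex.exp Φ) := by
    rw [dk]; field_simp; ring
  rw [hSeq, div_im_nonpos_iff h1F, hff₁]
  exact hfin

end

/-! ### Inverses at infinity, and the family S_t. -/

section

open Bornology in
/-- A function asymptotic to `w / c` at infinity has a functional inverse there. -/
theorem exists_inverse_at_infinity {K : Set ℂ} (hK : IsCompact K) {S : ℂ → ℂ} {c : ℂ}
    (hc : c ≠ 0) (hS : DifferentiableOn ℂ S Kᶜ)
    (hlim : Tendsto (fun w => S w / w) (cobounded ℂ) (𝓝 (1 / c))) :
    ∃ G : ℂ → ℂ, IsInverseAtInfinity S G c := by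
  classical
  -- In reciprocal coordinates σ(ξ) = 1/S(1/ξ) extends by σ(0) = 0 with derivative c, and the
  -- inverse function theorem applies at 0.
  set σ : ℂ → ℂ := Function.update (fun ξ => (S ξ⁻¹)⁻¹) 0 0 with hσ
  have hσne : ∀ ξ : ℂ, ξ ≠ 0 → σ ξ = (S ξ⁻¹)⁻¹ := fun ξ h => by
    rw [hσ, Function.update_of_ne h]
  have hσ0 : σ 0 = 0 := by simp [hσ]
  have hinv : Tendsto (fun ξ : ℂ => ξ⁻¹) (𝓝[≠] 0) (cobounded ℂ) := tendsto_inv₀_nhdsNE_zero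
  have hinv' : Tendsto (fun w : ℂ => w⁻¹) (cobounded ℂ) (𝓝[≠] 0) := tendsto_inv₀_cobounded'
  have hslope : Tendsto (_root_.slope σ 0) (𝓝[≠] 0) (𝓝 c) := by
    have h1 := (hlim.comp hinv).inv₀ (one_div_ne_zero hc)
    rw [one_div, inv_inv] at h1
    refine h1.congr' ?_
    filter_upwards [self_mem_nhdsWithin] with ξ hξ
    rw [slope_def_field, hσ0, hσne ξ hξ, Function.comp_apply]
    simp [div_eq_mul_inv, mul_comm]
  have hder0 : HasDerivAt σ c 0 := hasDerivAt_iff_tendsto_slope.2 hslope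
  have hSne : ∀ᶠ ξ in 𝓝[≠] (0 : ℂ), S ξ⁻¹ ≠ 0 := by
    filter_upwards [(hlim.comp hinv).eventually_ne (one_div_ne_zero hc)] with ξ h1 h2
    apply h1
    rw [Function.comp_apply, h2, zero_div]
  have hdiff : ∀ᶠ ξ in 𝓝[≠] (0 : ℂ), DifferentiableAt ℂ σ ξ := by
    filter_upwards [hinv (eventually_notMem_of_isCompact hK), self_mem_nhdsWithin, hSne]
      with ξ h1 h2 h4
    have h3 : DifferentiableAt ℂ (fun ξ => (S ξ⁻¹)⁻¹) ξ :=
      (DifferentiableAt.comp (f := fun ξ : ℂ => ξ⁻¹) ξ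
        ((hS _ h1).differentiableAt (hK.isClosed.isOpen_compl.mem_nhds h1))
        (differentiableAt_inv h2)).inv h4
    refine h3.congr_of_eventuallyEq ?_
    filter_upwards [isOpen_ne.mem_nhds h2] with η hη using hσne η hη
  have han := Complex.analyticAt_of_differentiable_on_punctured_nhds_of_continuousAt hdiff
    hder0.continuousAt
  have hs : HasStrictDerivAt σ c 0 := by
    have := han.hasStrictDerivAt
    rwa [hder0.deriv] at this
  set τ := hs.localInverse σ _ _ hc
  have hτd : HasStrictDerivAt τ c⁻¹ (σ 0) := hs.to_localInverse hc
  have hτr : ∀ᶠ η in 𝓝 (σ 0), σ (τ η) = η :=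
    (hs.hasStrictFDerivAt_equiv hc).eventually_right_inverse
  have hτl : ∀ᶠ ξ in 𝓝 (0 : ℂ), τ (σ ξ) = ξ :=
    (hs.hasStrictFDerivAt_equiv hc).eventually_left_inverse
  have hτ0 : τ 0 = 0 := by
    have := (hs.hasStrictFDerivAt_equiv hc).localInverse_apply_image
    rwa [hσ0] at this
  rw [hσ0] at hτd hτr
  have hτne : ∀ᶠ η in 𝓝[≠] (0 : ℂ), σ (τ η) = η ∧ τ η ≠ 0 := by
    filter_upwards [nhdsWithin_le_nhds hτr, self_mem_nhdsWithin] with η h1 h2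
    refine ⟨h1, fun h3 => h2 ?_⟩
    rw [h3, hσ0] at h1
    exact h1.symm
  refine ⟨fun v => (τ v⁻¹)⁻¹, ?_, ?_, ?_⟩
  · filter_upwards [hinv' hτne] with v hv
    have h1 := hσne _ hv.2
    rw [hv.1] at h1
    exact (inv_injective h1).symm
  · filter_upwards [hinv' (nhdsWithin_le_nhds hτl), eventually_ne_cobounded 0] with w h1 h2
    have h1 : τ (σ w⁻¹) = w⁻¹ := h1
    rw [hσne _ (inv_ne_zero h2), inv_inv] at h1
    rw [h1, inv_inv]
  · have h1 := ((hasDerivAt_iff_tendsto_slope.1 hτd.hasDerivAt).comp hinv').inv₀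
      (inv_ne_zero hc)
    rw [inv_inv] at h1
    refine (isLittleO_iff_tendsto' ?_).2 ?_
    · filter_upwards [eventually_ne_cobounded 0] with v hv h0 using absurd h0 hv
    · have h2 := h1.sub_const c
      rw [sub_self] at h2
      refine h2.congr' ?_
      filter_upwards [eventually_ne_cobounded 0] with v hv
      rw [Function.comp_apply, slope_def_field, hτ0]
      field_simp
      simp

/-! ### The family of transforms -/

/-- The parameter `κ² q^{-t}`. -/
noncomputable def pt (L k t : ℝ) : ℝ := k * Real.exp (L * t)

@[simp] theorem pt_zero (L k : ℝ) : pt L k 0 = k := by simp [pt]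

/-- The complex slope in the coordinate `x = q^{-z}`. -/
noncomputable def fx (L k T N : ℝ) (h : ℝ → ℝ → ℝ) (t : ℝ) (x : ℂ) : ℂ :=
  Complex.exp (expo L (pt L k t) (t - T) N (h t) x)

/-- The standing assumptions on the complementary densities `h = 1 - ρ`. -/
structure Setting (L k T N R : ℝ) (h : ℝ → ℝ → ℝ) : Prop where
  hL : 0 < L
  hk : 0 < k
  hT : 0 < T
  hN : 0 < N
  hTR : -T < R
  hRN : R ≤ N
  hAb : Real.exp (L * R) * Real.exp (L * N) < k
  dens : ∀ t ∈ Icc 0 T, IsDensity (h t)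
  mass : ∀ t ∈ Icc 0 T, ∫ s in (t - T)..N, h t s = T - t
  one : ∀ s ∈ Ioc R N, h 0 s = 1

/-- The holomorphic functions `S_t`. -/
structure TransformFamily (L k T N R : ℝ) (h : ℝ → ℝ → ℝ) (S : ℝ → ℂ → ℂ) : Prop where
  diff : ∀ t ∈ Ico 0 T, DifferentiableOn ℂ (S t) (nodes L (pt L k t) (t - T) N)ᶜ
  symm : ∀ t ∈ Ico 0 T, ∀ w, w ∉ nodes L (pt L k t) (t - T) N → S t (conj w) = conj (S t w)
  val : ∀ t ∈ Ico 0 T, ∀ x : ℂ, x ≠ 0 → jk (pt L k t) x ∉ nodes L (pt L k t) (t - T) N →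
    dk (pt L k t) x ≠ 0 → fx L k T N h t x ≠ 1 ∧ S t (jk (pt L k t) x)
      = Real.exp (-(L * t)) * (-x + dk (pt L k t) x / (1 - fx L k T N h t x))
  lim : ∀ t ∈ Ico 0 T, Tendsto (fun w => S t w / w) (Bornology.cobounded ℂ)
    (𝓝 ((1 / (Real.exp (L * T) - Real.exp (L * t)) : ℝ) : ℂ))
  -- At time 0 the cut is only the set of nodes over [-T, R]: S_0 is holomorphic across the
  -- remaining nodes, which the study of the region above the fold needs.
  val0 : ∀ x : ℂ, x ≠ 0 → jk k x ∉ nodes L k (-T) R →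
    S 0 (jk k x) = -x + nb k (Real.exp (L * N)) (Real.exp (L * R)) x /
      den L k (Real.exp (L * R)) (Real.exp (L * N)) (ct L k (-T) R (h 0) (jk k x)) x
  nev0 : ∃ (A B C : ℝ) (μ : Measure ℝ), IsFiniteMeasure μ ∧ μ (Icc A B)ᶜ = 0 ∧
    nodes L k (-T) R = seg A B ∧
    ∀ w, w ∉ seg A B → S 0 w = nev (Real.exp (L * T) - 1) C μ w

variable {L k T N R : ℝ} {h : ℝ → ℝ → ℝ}

theorem pt_pos (hk : 0 < k) (t : ℝ) : 0 < pt L k t := mul_pos hk (Real.exp_pos _)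

theorem Setting.regular (hs : Setting L k T N R h) {t : ℝ} (ht : t ∈ Ico 0 T) :
    Regular L (pt L k t) (t - T) N N (h t) := by
  have ht' : t ∈ Icc 0 T := ⟨ht.1, ht.2.le⟩
  refine ⟨hs.hL, pt_pos hs.hk t, hs.dens t ht', by linarith [hs.hN, ht.2], le_rfl, ?_, ?_,
    Or.inl rfl⟩
  · intro s hs'; exact absurd hs'.2 (not_le.2 hs'.1)
  · rw [hs.mass t ht']; linarith [ht.2]

theorem Setting.regular_zero (hs : Setting L k T N R h) : Regular L k (-T) R N (h 0) := by
  have h0 : (0 : ℝ) ∈ Icc 0 T := ⟨le_rfl, hs.hT.le⟩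
  refine ⟨hs.hL, hs.hk, hs.dens 0 h0, hs.hTR.le, hs.hRN, hs.one, ?_, Or.inr hs.hAb⟩
  have := hs.mass 0 h0
  rw [zero_sub] at this
  rw [this]; linarith [hs.hT]

open Bornology in
-- For w in the lower half-plane the root with ‖x‖² ≤ k lies in the upper one, so
-- `transform_im_nonpos` gives the sign required by `herglotz_repr`.
theorem Setting.exists_nev (hs : Setting L k T N R h) {S : ℂ → ℂ}
    (hS : DifferentiableOn ℂ S (nodes L k (-T) R)ᶜ)
    (hconj : ∀ w, w ∉ nodes L k (-T) R → S (conj w) = conj (S w))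
    (hval : ∀ x, x ≠ 0 → jk k x ∉ nodes L k (-T) N → dk k x ≠ 0 →
        S (jk k x) = -x + dk k x / (1 - Complex.exp (expo L k (-T) N (h 0) x)))
    (hlim : Tendsto (fun w => S w / w) (cobounded ℂ)
      (𝓝 ((1 / (Real.exp (L * T) - 1) : ℝ) : ℂ))) :
    ∃ (A B C : ℝ) (μ : Measure ℝ), IsFiniteMeasure μ ∧ μ (Icc A B)ᶜ = 0 ∧
    nodes L k (-T) R = seg A B ∧
    ∀ w, w ∉ seg A B → S w = nev (Real.exp (L * T) - 1) C μ w := by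
  obtain ⟨A, B, -, hseg, hAB⟩ := exists_nodes_eq_seg (p := k) hs.hL.ne' hs.hTR.le
  obtain ⟨C, hC⟩ := exists_affine_at_infinity isCompact_nodes hS hconj hlim
  have hlow : ∀ w : ℂ, w.im < 0 → (S w).im ≤ 0 := by
    intro w hw
    obtain ⟨x, hx, hxw, hn⟩ := exists_joukowski_root w hs.hk
    have hxw : jk k x = w := hxw
    have h1 : x.im * (1 - k / ‖x‖ ^ 2) < 0 := by
      rw [← joukowski_im]; exact lt_of_eq_of_lt (congrArg Complex.im hxw) hw
    have h2 : 0 < ‖x‖ ^ 2 := by positivity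
    have h3 : 1 - k / ‖x‖ ^ 2 ≤ 0 := by
      rw [sub_nonpos, one_le_div h2]; exact hn
    have h4 : 0 < x.im := by
      by_contra h5
      push Not at h5
      nlinarith
    have h6 : dk k x ≠ 0 := fun h7 => h4.ne' (im_of_dk_eq_zero hs.hk hx h7)
    rw [← hxw, hval x hx (notMem_nodes_of_im h4.ne') h6]
    exact transform_im_nonpos hs.regular_zero hs.hAb h4 (by rw [hxw]; exact hw)
  rw [hseg] at hS hconj
  obtain ⟨μ, h1, h2, h3⟩ := herglotz_repr (hAB hs.hTR) hS hconj (fun w hw => by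
    have h4 := hlow (conj w) (by simpa using hw)
    rw [hconj w (notMem_seg_of_im_ne hw.ne'), Complex.conj_im] at h4
    linarith) hC
  refine ⟨A, B, C, μ, h1, h2, hseg, fun w hw => ?_⟩
  rw [h3 w hw, nev]
  push_cast
  ring

open Bornology in
theorem Setting.exists_family (hs : Setting L k T N R h) :
    ∃ S, TransformFamily L k T N R h S := by
  classical
  have hex := fun t (ht : t ∈ Ico 0 T) => exists_transform (hs.regular ht)
  choose! F hF1 hF2 hF3 hF4 using hex
  obtain ⟨S₀, h1, h2, h3, h4⟩ := exists_transform hs.regular_zero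
  have hsub := nodes_subset (L := L) (p := k) (lo := -T) hs.hRN
  have h3' : ∀ x, x ≠ 0 → jk k x ∉ nodes L k (-T) N → dk k x ≠ 0 →
        S₀ (jk k x) = -x + dk k x / (1 - Complex.exp (expo L k (-T) N (h 0) x)) :=
    fun x hx hK hd => (h3 x hx hK hd).2
  have hlim0 := tendsto_transform hs.regular_zero h3'
  have h0 : (0 : ℝ) ∈ Icc 0 T := ⟨le_rfl, hs.hT.le⟩
  have hm0 := hs.mass 0 h0
  rw [zero_sub, sub_zero] at hm0
  rw [hm0] at hlim0
  -- Time 0 is treated separately, so that S_0 comes from the construction with the smaller cut.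
  set S : ℝ → ℂ → ℂ := fun t w => if t = 0 then S₀ w else Real.exp (-(L * t)) * F t w with hS
  have hS0 : S 0 = S₀ := by ext w; simp [hS]
  have hSt : ∀ t ≠ 0, S t = fun w => Real.exp (-(L * t)) * F t w := fun t ht => by
    ext w; simp [hS, ht]
  refine ⟨S, ?_, ?_, ?_, ?_, ?_, ?_⟩
  · intro t ht
    by_cases h0 : t = 0
    · subst h0
      rw [hS0, pt_zero, zero_sub]
      exact h1.mono (compl_subset_compl.2 hsub)
    · rw [hSt t h0]
      exact (hF1 t ht).const_mul _
  · intro t ht w hw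
    by_cases h0 : t = 0
    · subst h0
      rw [pt_zero, zero_sub] at hw
      rw [hS0]
      exact h2 w fun h => hw (hsub h)
    · rw [hSt t h0]
      simp only [map_mul, Complex.conj_ofReal, hF2 t ht w hw]
  · intro t ht x hx hK hd
    by_cases h0 : t = 0
    · subst h0
      rw [hS0]
      simp only [pt_zero, zero_sub] at hK hd ⊢
      have := h3 x hx hK hd
      refine ⟨by simpa [fx] using this.1, ?_⟩
      rw [this.2]; simp [fx]
    · rw [hSt t h0]
      have := hF3 t ht x hx hK hd
      exact ⟨this.1, by simp only [this.2, fx]⟩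
  · intro t ht
    by_cases h0 : t = 0
    · subst h0
      rw [hS0]
      simpa using hlim0
    · have h5 := (tendsto_transform (hs.regular ht) fun x hx hK hd => (hF3 t ht x hx hK hd).2
        ).const_mul ((Real.exp (-(L * t)) : ℝ) : ℂ)
      rw [hs.mass t ⟨ht.1, ht.2.le⟩, ← Complex.ofReal_mul] at h5
      have h6 : Real.exp (-(L * t)) * (1 / (Real.exp (L * (T - t)) - 1))
          = 1 / (Real.exp (L * T) - Real.exp (L * t)) := by
        rw [mul_sub, Real.exp_sub, Real.exp_neg]
        have := (Real.exp_pos (L * t)).ne'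
        field_simp
      rw [h6] at h5
      refine h5.congr fun w => ?_
      rw [hSt t h0]
      ring
  · rw [hS0]; exact h4
  · rw [hS0]
    exact hs.exists_nev h1 h2 h3' hlim0

end

/-! ### Subordination, its semigroup form, and the inviscid equation. -/

section

variable {L k T N R : ℝ} {h : ℝ → ℝ → ℝ} {S : ℝ → ℂ → ℂ}

/-- Each `S_t` is subordinate to `S_0`. -/
def Subordinated (L T : ℝ) (S : ℝ → ℂ → ℂ) : Prop :=
  ∀ t ∈ Ico 0 T, ∀ w : ℂ, w.im ≠ 0 →
    0 < (w + ((Real.exp (L * t) - 1 : ℝ) : ℂ) * S t w).im * w.im ∧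
    S 0 (w + ((Real.exp (L * t) - 1 : ℝ) : ℂ) * S t w) = S t w

/-- The nodes depend continuously on time. -/
theorem eventually_notMem_nodes {t₀ : ℝ} {w₀ : ℂ} (ht : t₀ < T) (hN : 0 < N)
    (hw : w₀ ∉ nodes L (pt L k t₀) (t₀ - T) N) :
    ∀ᶠ y : ℝ × ℂ in 𝓝 (t₀, w₀), y.2 ∉ nodes L (pt L k y.1) (y.1 - T) N := by
  set Ψ : (ℝ × ℂ) → ℝ → ℂ := fun y θ =>
    y.2 - node L (pt L k y.1) (y.1 - T + θ * (N - (y.1 - T))) with hΨ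
  have hcont : Continuous fun z : (ℝ × ℂ) × ℝ => Ψ z.1 z.2 := by
    simp only [hΨ, node, pt]
    refine (by fun_prop : Continuous fun z : (ℝ × ℂ) × ℝ => z.1.2).sub
      (Complex.continuous_ofReal.comp ((by fun_prop : Continuous _).add
        ((by fun_prop : Continuous _).div (by fun_prop) fun z => (Real.exp_pos _).ne')))
  have h1 : ∀ θ ∈ Icc (0 : ℝ) 1, ∀ᶠ z : (ℝ × ℂ) × ℝ in 𝓝 ((t₀, w₀), θ), Ψ z.1 z.2 ≠ 0 := by
    intro θ hθ
    refine hcont.continuousAt.eventually_ne ?_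
    simp only [hΨ]
    intro h0
    refine hw ⟨t₀ - T + θ * (N - (t₀ - T)), ⟨?_, ?_⟩, (sub_eq_zero.1 h0).symm⟩
    · nlinarith [hθ.1]
    · nlinarith [hθ.2]
  have h2 := isCompact_Icc.eventually_forall_of_forall_eventually
    (P := fun z : (ℝ × ℂ) => fun θ : ℝ => Ψ z θ ≠ 0) h1
  have h3 : ∀ᶠ y : ℝ × ℂ in 𝓝 (t₀, w₀), y.1 < T :=
    continuous_fst.continuousAt.eventually_lt continuousAt_const ht
  filter_upwards [h2, h3] with y hy hyT
  rintro ⟨s, hs, hsy⟩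
  have hlen : 0 < N - (y.1 - T) := by linarith
  refine hy ((s - (y.1 - T)) / (N - (y.1 - T))) ⟨div_nonneg (by linarith [hs.1]) hlen.le, ?_⟩ ?_
  · rw [div_le_one hlen]; linarith [hs.2]
  · simp only [hΨ]
    rw [div_mul_cancel₀ _ hlen.ne', add_sub_cancel, ← hsy, sub_self]

theorem TransformFamily.analyticAt (hF : TransformFamily L k T N R h S) {t : ℝ} (ht : t ∈ Ico 0 T)
    {w : ℂ} (hw : w ∉ nodes L (pt L k t) (t - T) N) : AnalyticAt ℂ (S t) w :=
  (hF.diff t ht).analyticAt (isCompact_nodes.isClosed.isOpen_compl.mem_nhds hw)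

theorem notMem_nodes_of_im_ne {L p lo hi : ℝ} {w : ℂ} (hw : w.im ≠ 0) : w ∉ nodes L p lo hi := by
  rintro ⟨s, -, rfl⟩
  simp at hw

/-- Uniqueness of the subordination point for `S_0`. -/
theorem TransformFamily.unique (hF : TransformFamily L k T N R h S) {β : ℝ}
    (hβ0 : 0 ≤ β) {u v w : ℂ} (hu : 0 < u.im * w.im) (hv : 0 < v.im * w.im)
    (hHu : u - β * S 0 u = w) (hHv : v - β * S 0 v = w) : u = v := by
  obtain ⟨A, B, C, μ, hfin, hμ, -, hS⟩ := hF.nev0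
  have h1 : u ∉ seg A B := notMem_seg_of_im_ne (left_ne_zero_of_mul hu.ne')
  have h2 : v ∉ seg A B := notMem_seg_of_im_ne (left_ne_zero_of_mul hv.ne')
  rw [hS u h1] at hHu
  rw [hS v h2] at hHv
  exact subordination_unique hμ hβ0 hu hv hHu hHv

/-- Subordination determines `S_t` off the real axis. -/
theorem Subordinated.eq_of (hsub : Subordinated L T S) (hF : TransformFamily L k T N R h S)
    (hL : 0 < L) {t : ℝ} (ht : t ∈ Ico 0 T) {u w : ℂ} (hu : 0 < u.im * w.im)
    (hHu : u - ((Real.exp (L * t) - 1 : ℝ) : ℂ) * S 0 u = w) : S t w = S 0 u := by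
  have hw : w.im ≠ 0 := right_ne_zero_of_mul hu.ne'
  obtain ⟨h1, h2⟩ := hsub t ht w hw
  have hβ : 0 ≤ Real.exp (L * t) - 1 := by
    have := Real.one_le_exp (mul_nonneg hL.le ht.1); linarith
  have h3 := hF.unique hβ hu h1 hHu (by rw [h2]; ring)
  rw [h3, h2]

/-- The semigroup form of subordination. -/
theorem Subordinated.eq_shift (hsub : Subordinated L T S) (hF : TransformFamily L k T N R h S)
    (hL : 0 < L) {t₀ t : ℝ} (ht₀ : t₀ ∈ Ico 0 T) (ht : t ∈ Ico 0 T) {u w : ℂ}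
    (hu : 0 < u.im * w.im)
    (hHu : u - ((Real.exp (L * t) - Real.exp (L * t₀) : ℝ) : ℂ) * S t₀ u = w) :
    S t w = S t₀ u := by
  obtain ⟨h1, h2⟩ := hsub t₀ ht₀ u (left_ne_zero_of_mul hu.ne')
  rw [← h2]
  refine hsub.eq_of hF hL ht ?_ ?_
  · by_contra h3
    push Not at h3
    have h4 := mul_pos h1 hu
    have h5 : (u + ((Real.exp (L * t₀) - 1 : ℝ) : ℂ) * S t₀ u).im * w.im * (u.im * u.im) ≤ 0 :=
      mul_nonpos_of_nonpos_of_nonneg h3 (mul_self_nonneg _)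
    nlinarith
  · rw [h2, ← hHu]
    push_cast
    ring

/-- At a real base point, symmetry and the Lipschitz bound give |Im s(u)| ≤ M |Im u|; a small
multiple of s therefore cannot carry g y across the real axis. At a nonreal base point continuity
suffices. -/
theorem eventually_im_pos_of_lipschitz {s : ℂ → ℂ} {w₀ : ℂ} (hs : AnalyticAt ℂ s w₀)
    (hconj : w₀.im = 0 → ∀ᶠ u in 𝓝 w₀, s (conj u) = conj (s u)) {g : ℝ × ℂ → ℂ}
    (hg : ContinuousAt g (0, w₀)) (hg0 : g (0, w₀) = w₀)
    (hgs : ∀ᶠ y in 𝓝 ((0 : ℝ), w₀), g y - y.1 * s (g y) = y.2) :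
    ∀ᶠ y in 𝓝 ((0 : ℝ), w₀), y.2.im ≠ 0 → 0 < (g y).im * y.2.im := by
  by_cases him : w₀.im = 0
  · obtain ⟨M, U, hU, hM⟩ := hs.hasStrictDerivAt.hasStrictFDerivAt.exists_lipschitzOnWith
    have hcj : conj w₀ = w₀ := Complex.conj_eq_iff_im.2 him
    have hU' : ∀ᶠ u in 𝓝 w₀, conj u ∈ U := by
      have := Complex.continuous_conj.tendsto w₀
      rw [hcj] at this
      exact this hU
    have hLip : ∀ᶠ u in 𝓝 w₀, |(s u).im| ≤ M * |u.im| := by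
      filter_upwards [hU, hU', hconj him] with u h1 h2 h3
      have h4 := hM.dist_le_mul u h1 (conj u) h2
      rw [h3, dist_eq_norm, dist_eq_norm, Complex.sub_conj, Complex.sub_conj] at h4
      simp only [norm_mul, Complex.norm_I, Complex.norm_real, Real.norm_eq_abs, mul_one] at h4
      rw [abs_two] at h4
      linarith
    rw [ContinuousAt, hg0] at hg
    have hγ : ∀ᶠ y : ℝ × ℂ in 𝓝 ((0 : ℝ), w₀), |y.1| * M < 1 := by
      have h1 : Continuous fun y : ℝ × ℂ => |y.1| * (M : ℝ) := by fun_prop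
      exact h1.continuousAt.eventually_lt continuousAt_const (by simp)
    filter_upwards [hg.eventually hLip, hγ, hgs] with y h1 h2 h3 h4
    have h5 : (g y).im - y.1 * (s (g y)).im = y.2.im := by
      rw [← h3, Complex.sub_im, Complex.im_ofReal_mul]
    have h6 : |y.1 * (s (g y)).im| ≤ |y.1| * M * |(g y).im| := by
      rw [abs_mul, mul_assoc]; gcongr
    have h7 : (g y).im ≠ 0 := by
      intro h8
      rw [h8, abs_zero, mul_zero] at h6
      have h9 := abs_nonpos_iff.1 h6
      rw [h8, h9] at h5
      exact h4 (by linarith)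
    have h8 := abs_pos.2 h7
    have h9 : y.1 * (s (g y)).im * (g y).im < (g y).im * (g y).im := by
      calc y.1 * (s (g y)).im * (g y).im ≤ |y.1 * (s (g y)).im * (g y).im| := le_abs_self _
        _ = |y.1 * (s (g y)).im| * |(g y).im| := abs_mul _ _
        _ ≤ |y.1| * M * |(g y).im| * |(g y).im| := by gcongr
        _ < 1 * |(g y).im| * |(g y).im| := by gcongr
        _ = (g y).im * (g y).im := by rw [one_mul, abs_mul_abs_self]
    rw [← h5]
    nlinarith
  · have h1 : ContinuousAt (fun y : ℝ × ℂ => (g y).im * y.2.im) (0, w₀) :=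
      (Complex.continuous_im.continuousAt.comp hg).mul (by fun_prop)
    have h2 : (0 : ℝ) < (g (0, w₀)).im * ((0 : ℝ), w₀).2.im := by
      rw [hg0]; exact mul_self_pos.2 him
    filter_upwards [h1.eventually_const_lt h2] with y hy _ using hy

/-- Under subordination `S` is jointly differentiable and solves the inviscid equation
`∂_t S = L e^{L t} S ∂_w S`. -/
theorem Subordinated.hasFDerivWithinAt (hsub : Subordinated L T S)
    (hF : TransformFamily L k T N R h S) (hset : Setting L k T N R h) {t₀ : ℝ}
    (ht₀ : t₀ ∈ Ico 0 T) {w₀ : ℂ} (hw₀ : w₀ ∉ nodes L (pt L k t₀) (t₀ - T) N) :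
    HasFDerivWithinAt (fun y : ℝ × ℂ => S y.1 y.2)
      (linPair (L * Real.exp (L * t₀) * S t₀ w₀ * deriv (S t₀) w₀) (deriv (S t₀) w₀))
      (Ico 0 T ×ˢ univ) (t₀, w₀) := by
  set s := S t₀ with hs
  have hL := hset.hL
  have han := hF.analyticAt ht₀ hw₀
  obtain ⟨g, g1, g2, g3⟩ := exists_subordination_chart (β := 0) han (by simp)
  simp only [Complex.ofReal_zero, zero_mul, sub_zero, div_one] at g1 g2 g3
  have hsign := eventually_im_pos_of_lipschitz han (fun _ => by
    filter_upwards [isCompact_nodes.isClosed.isOpen_compl.mem_nhds hw₀] with u hu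
      using hF.symm t₀ ht₀ u hu) g2.hasFDerivAt.continuousAt g1 g3
  obtain ⟨Mg, Ug, hUg, hMg⟩ := g2.exists_lipschitzOnWith
  have hana : ∀ᶠ u in 𝓝 w₀, ContinuousAt s u :=
    han.eventually_analyticAt.mono fun u hu => hu.continuousAt
  have hgc : ContinuousAt g (0, w₀) := g2.hasFDerivAt.continuousAt
  have hgc' := hgc
  rw [ContinuousAt, g1] at hgc'
  -- In the time e^{Lt} - e^{Lt₀} the characteristics issuing from time t₀ are straight lines; near
  -- the base point S is s∘g∘Γ, and the derivative follows by the chain rule.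
  set Γ : ℝ × ℂ → ℝ × ℂ := fun y => (Real.exp (L * y.1) - Real.exp (L * t₀), y.2) with hΓ
  have hΓc : Continuous Γ := by fun_prop
  have hΓ0 : Γ (t₀, w₀) = (0, w₀) := by simp [hΓ]
  have hall : ∀ᶠ y : ℝ × ℂ in 𝓝 (t₀, w₀),
      (y.2 ∉ nodes L (pt L k y.1) (y.1 - T) N) ∧ ContinuousAt g (Γ y) ∧
      ContinuousAt s (g (Γ y)) ∧ (y.2.im ≠ 0 → 0 < (g (Γ y)).im * y.2.im) ∧
      g (Γ y) - (Γ y).1 * s (g (Γ y)) = y.2 := by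
    have hΓt : Tendsto Γ (𝓝 (t₀, w₀)) (𝓝 (0, w₀)) := by rw [← hΓ0]; exact hΓc.continuousAt
    have hgcont : ∀ᶠ y in 𝓝 ((0 : ℝ), w₀), ContinuousAt g y := by
      filter_upwards [eventually_mem_nhds_iff.2 hUg] with y hy
        using hMg.continuousOn.continuousAt hy
    filter_upwards [eventually_notMem_nodes ht₀.2 hset.hN hw₀, hΓt.eventually hgcont,
      hΓt.eventually (hgc'.eventually hana), hΓt.eventually hsign, hΓt.eventually g3]
      with y h1 h2 h3 h4 h5 using ⟨h1, h2, h3, h4, h5⟩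
  obtain ⟨δ, hδ, hball⟩ := Metric.eventually_nhds_iff_ball.1 hall
  have hnr : ∀ y ∈ Metric.ball (t₀, w₀) δ, y.1 ∈ Ico 0 T → y.2.im ≠ 0 → S y.1 y.2 = s (g (Γ y)) := by
    intro y hy hyt him
    obtain ⟨-, -, -, h4, h5⟩ := hball y hy
    exact hsub.eq_shift hF hL ht₀ hyt (h4 him) h5
  -- Subordination speaks only of nonreal w; real points off the cut are reached by a vertical
  -- limit.
  have hloc : ∀ y ∈ Metric.ball (t₀, w₀) δ, y.1 ∈ Ico 0 T → S y.1 y.2 = s (g (Γ y)) := by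
    intro y hy hyt
    by_cases him : y.2.im = 0
    · obtain ⟨h1, h2, h3, -, -⟩ := hball y hy
      set ℓ : ℝ → ℝ × ℂ := fun ε => (y.1, y.2 + ε * Complex.I) with hℓ
      have hℓc : Continuous ℓ := by fun_prop
      have hℓ0 : ℓ 0 = y := by simp [hℓ]
      have hℓt : Tendsto ℓ (𝓝[≠] 0) (𝓝 y) := by
        have := hℓc.tendsto 0
        rw [hℓ0] at this
        exact this.mono_left nhdsWithin_le_nhds
      have hc1 : Tendsto (fun ε => S y.1 (ℓ ε).2) (𝓝[≠] 0) (𝓝 (S y.1 y.2)) :=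
        ((hF.analyticAt hyt h1).continuousAt.tendsto).comp ((continuous_snd.tendsto _).comp hℓt)
      have hc2 : Tendsto (fun ε => s (g (Γ (ℓ ε)))) (𝓝[≠] 0) (𝓝 (s (g (Γ y)))) :=
        (h3.tendsto.comp (h2.tendsto.comp (hΓc.continuousAt.tendsto.comp hℓt)))
      refine tendsto_nhds_unique (hc1.congr' ?_) hc2
      filter_upwards [hℓt (Metric.isOpen_ball.mem_nhds hy), self_mem_nhdsWithin] with ε h4 h5
      exact hnr (ℓ ε) h4 hyt (by simpa [hℓ, him] using h5)
    · exact hnr y hy hyt him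
  have hder : HasFDerivAt (fun y => s (g (Γ y)))
      (linPair (L * Real.exp (L * t₀) * s w₀ * deriv s w₀) (deriv s w₀)) (t₀, w₀) := by
    have e1 : HasFDerivAt (fun y : ℝ × ℂ => Real.exp (L * y.1) - Real.exp (L * t₀))
        ((L * Real.exp (L * t₀)) • ContinuousLinearMap.fst ℝ ℝ ℂ) (t₀, w₀) :=
      (HasDerivAt.comp_hasFDerivAt (h₂ := fun s => Real.exp (L * s)) (t₀, w₀)
      (hasDerivAt_exp_mul L t₀) hasFDerivAt_fst).sub_const _
    have e2 : HasFDerivAt Γ (((L * Real.exp (L * t₀)) • ContinuousLinearMap.fst ℝ ℝ ℂ).prod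
        (ContinuousLinearMap.snd ℝ ℝ ℂ)) (t₀, w₀) := e1.prodMk hasFDerivAt_snd
    have e3 := HasFDerivAt.comp (g := g) (t₀, w₀) (by rw [hΓ0]; exact g2.hasFDerivAt) e2
    have e4 := (han.differentiableAt.hasDerivAt.hasFDerivAt).restrictScalars ℝ
    have e5 := HasFDerivAt.comp (g := s) (t₀, w₀)
      (by rw [Function.comp_apply, hΓ0, g1]; exact e4) e3
    refine e5.congr_fderiv (linPair_ext fun t z => ?_)
    simp
    ring
  refine hder.hasFDerivWithinAt.congr_of_eventuallyEq ?_ ?_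
  · filter_upwards [nhdsWithin_le_nhds (Metric.ball_mem_nhds (t₀, w₀) hδ), self_mem_nhdsWithin]
      with y h1 h2 using hloc y h1 h2.1
  · exact hloc _ (Metric.mem_ball_self hδ) ht₀

end

/-! ### Joint differentiability from separate differentiability. -/

section

/-- Cauchy's formula at x and x₀. The bound uses the mean of |k| over the circle instead of its
supremum, because for k = f_t - f_{t₀} only the mean tends to 0 by dominated convergence. -/
theorem norm_sub_le_circle_average {k : ℂ → ℂ} {x₀ x : ℂ} {r : ℝ} (hr : 0 < r)
    (hk : DifferentiableOn ℂ k (Metric.closedBall x₀ r)) (hx : ‖x - x₀‖ ≤ r / 2) :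
    ‖k x - k x₀‖ ≤ ‖x - x₀‖ *
      ((1 / (Real.pi * r)) * ∫ θ in (0 : ℝ)..2 * Real.pi, ‖k (circleMap x₀ r θ)‖) := by
  have hd : DiffContOnCl ℂ k (Metric.ball x₀ r) :=
    DifferentiableOn.diffContOnCl (by rwa [closure_ball _ hr.ne'])
  have hcf : ∀ w ∈ Metric.ball x₀ r, (∮ z in C(x₀, r), (z - w)⁻¹ • k z)
      = (2 * Real.pi * Complex.I) • k w := fun w hw => by
    rw [← hd.two_pi_i_inv_smul_circleIntegral_sub_inv_smul hw, smul_smul, mul_inv_cancel₀, one_smul]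
    simp [Real.pi_ne_zero]
  have hxb : x ∈ Metric.ball x₀ r := by rw [mem_ball_iff_norm]; linarith
  have hcc : Continuous fun θ => k (circleMap x₀ r θ) :=
    hk.continuousOn.comp_continuous (continuous_circleMap _ _) fun θ =>
      Metric.sphere_subset_closedBall (circleMap_mem_sphere _ hr.le θ)
  have hne : ∀ w ∈ Metric.ball x₀ r, ∀ θ, circleMap x₀ r θ - w ≠ 0 := fun w hw θ h => by
    have h1 := circleMap_mem_sphere x₀ hr.le θ
    rw [sub_eq_zero.1 h, mem_sphere_iff_norm] at h1
    rw [mem_ball_iff_norm] at hw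
    linarith
  have hint : ∀ w ∈ Metric.ball x₀ r, IntervalIntegrable (fun θ => deriv (circleMap x₀ r) θ •
      ((circleMap x₀ r θ - w)⁻¹ • k (circleMap x₀ r θ))) volume 0 (2 * Real.pi) := by
    intro w hw
    refine Continuous.intervalIntegrable ?_ _ _
    have h1 : Continuous fun θ => deriv (circleMap x₀ r) θ := by
      simp only [deriv_circleMap]
      exact (continuous_circleMap 0 r).mul continuous_const
    exact h1.smul ((((continuous_circleMap _ _).sub continuous_const).inv₀ (hne w hw)).smul hcc)
  have h0b : x₀ ∈ Metric.ball x₀ r := Metric.mem_ball_self hr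
  have h1 : (2 * Real.pi * Complex.I) • (k x - k x₀) = ∫ θ in (0 : ℝ)..2 * Real.pi,
      (deriv (circleMap x₀ r) θ • ((circleMap x₀ r θ - x)⁻¹ • k (circleMap x₀ r θ))
        - deriv (circleMap x₀ r) θ • ((circleMap x₀ r θ - x₀)⁻¹ • k (circleMap x₀ r θ))) := by
    rw [smul_sub, ← hcf x hxb, ← hcf x₀ h0b, circleIntegral, circleIntegral,
      intervalIntegral.integral_sub (hint x hxb) (hint x₀ h0b)]
  have h2pi : (0 : ℝ) ≤ 2 * Real.pi := by positivity
  have h2 : ‖(2 * Real.pi * Complex.I) • (k x - k x₀)‖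
      ≤ ∫ θ in (0 : ℝ)..2 * Real.pi, ‖x - x₀‖ * (2 / r) * ‖k (circleMap x₀ r θ)‖ := by
    rw [h1]
    refine intervalIntegral.norm_integral_le_of_norm_le h2pi (Eventually.of_forall fun θ _ => ?_)
      ((continuous_const.mul hcc.norm).intervalIntegrable _ _)
    have hA := hne x hxb θ
    have hB := hne x₀ h0b θ
    have e0 : ‖circleMap x₀ r θ - x₀‖ = r := by
      have := circleMap_mem_sphere x₀ hr.le θ
      rwa [mem_sphere_iff_norm] at this
    have e1 : r / 2 ≤ ‖circleMap x₀ r θ - x‖ := by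
      have := norm_sub_norm_le (circleMap x₀ r θ - x₀) (x - x₀)
      rw [sub_sub_sub_cancel_right, e0] at this
      linarith
    have e2 : ‖deriv (circleMap x₀ r) θ‖ = r := by
      rw [deriv_circleMap]; simp [abs_of_pos hr]
    have e3 : deriv (circleMap x₀ r) θ • ((circleMap x₀ r θ - x)⁻¹ • k (circleMap x₀ r θ))
        - deriv (circleMap x₀ r) θ • ((circleMap x₀ r θ - x₀)⁻¹ • k (circleMap x₀ r θ))
        = deriv (circleMap x₀ r) θ * ((x - x₀) * (circleMap x₀ r θ - x)⁻¹ *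
          (circleMap x₀ r θ - x₀)⁻¹) * k (circleMap x₀ r θ) := by
      simp only [smul_eq_mul]
      field_simp
      ring
    rw [e3, norm_mul, norm_mul, norm_mul, norm_mul, norm_inv, norm_inv, e0, e2]
    refine mul_le_mul_of_nonneg_right ?_ (norm_nonneg _)
    have e4 : ‖circleMap x₀ r θ - x‖⁻¹ ≤ 2 / r := by
      rw [inv_le_comm₀ (by linarith) (by positivity), inv_div]; exact e1
    calc r * (‖x - x₀‖ * ‖circleMap x₀ r θ - x‖⁻¹ * r⁻¹)
        = ‖x - x₀‖ * ‖circleMap x₀ r θ - x‖⁻¹ := by field_simp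
      _ ≤ _ := by gcongr
  rw [intervalIntegral.integral_const_mul] at h2
  have e5 : ‖(2 * Real.pi * Complex.I : ℂ)‖ = 2 * Real.pi := by
    simp [abs_of_pos Real.pi_pos]
  rw [norm_smul, e5] at h2
  have hpi := Real.pi_pos
  have h3 : ‖k x - k x₀‖ ≤ (‖x - x₀‖ * (2 / r) *
      ∫ θ in (0 : ℝ)..2 * Real.pi, ‖k (circleMap x₀ r θ)‖) / (2 * Real.pi) := by
    rw [le_div_iff₀ (by positivity)]; linarith
  refine h3.trans (le_of_eq ?_)
  field_simp

/-- A locally bounded family of holomorphic functions, pointwise continuous in the parameter and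
differentiable in it at one point, is jointly differentiable at that point. -/
theorem hasFDerivWithinAt_of_bounded {f : ℝ → ℂ → ℂ} {I : Set ℝ} {t₀ : ℝ} {x₀ a : ℂ} {r M : ℝ}
    (hr : 0 < r) (ht₀ : t₀ ∈ I)
    (hf : ∀ᶠ t in 𝓝[I] t₀, DifferentiableOn ℂ (f t) (Metric.closedBall x₀ r) ∧
      ∀ x ∈ Metric.closedBall x₀ r, ‖f t x‖ ≤ M)
    (hc : ∀ x ∈ Metric.closedBall x₀ r, ContinuousWithinAt (fun t => f t x) I t₀)
    (hd : HasDerivWithinAt (fun t => f t x₀) a I t₀) :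
    HasFDerivWithinAt (fun y : ℝ × ℂ => f y.1 y.2) (linPair a (deriv (f t₀) x₀))
      (I ×ˢ univ) (t₀, x₀) := by
  set c := deriv (f t₀) x₀
  obtain ⟨hft₀, hbt₀⟩ := hf.self_of_nhdsWithin ht₀
  set J : ℝ → ℝ := fun t => ∫ θ in (0 : ℝ)..2 * Real.pi,
    ‖f t (circleMap x₀ r θ) - f t₀ (circleMap x₀ r θ)‖ with hJ
  have hcm : ∀ θ, circleMap x₀ r θ ∈ Metric.closedBall x₀ r := fun θ =>
    Metric.sphere_subset_closedBall (circleMap_mem_sphere _ hr.le θ)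
  have hJ0 : Tendsto J (𝓝[I] t₀) (𝓝 0) := by
    have h1 : Tendsto J (𝓝[I] t₀) (𝓝 (∫ θ in (0 : ℝ)..2 * Real.pi, (0 : ℝ))) := by
      refine intervalIntegral.tendsto_integral_filter_of_dominated_convergence
        (fun _ => M + M) ?_ ?_ intervalIntegrable_const ?_
      · filter_upwards [hf] with t ht
        refine Continuous.aestronglyMeasurable ?_
        exact ((ht.1.continuousOn.comp_continuous (continuous_circleMap _ _) hcm).sub
          (hft₀.continuousOn.comp_continuous (continuous_circleMap _ _) hcm)).norm
      · filter_upwards [hf] with t ht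
        refine Eventually.of_forall fun θ _ => ?_
        rw [norm_norm]
        exact (norm_sub_le _ _).trans (add_le_add (ht.2 _ (hcm θ)) (hbt₀ _ (hcm θ)))
      · refine Eventually.of_forall fun θ _ => ?_
        have := ((hc _ (hcm θ)).sub_const (f t₀ (circleMap x₀ r θ))).norm
        simpa using this
    simpa using h1
  have hx₀ : HasDerivAt (f t₀) c x₀ :=
    (hft₀.differentiableAt (Metric.closedBall_mem_nhds x₀ hr)).hasDerivAt
  have e1 := hasDerivWithinAt_iff_isLittleO.1 hd
  have e2 := hasDerivAt_iff_isLittleO.1 hx₀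
  rw [hasFDerivWithinAt_iff_isLittleO]
  have hfst : Tendsto (Prod.fst : ℝ × ℂ → ℝ) (𝓝[I ×ˢ univ] (t₀, x₀)) (𝓝[I] t₀) := by
    rw [nhdsWithin_prod_eq]; exact tendsto_fst
  have hsnd : Tendsto (Prod.snd : ℝ × ℂ → ℂ) (𝓝[I ×ˢ univ] (t₀, x₀)) (𝓝 x₀) := by
    rw [nhdsWithin_prod_eq, nhdsWithin_univ]; exact tendsto_snd
  have hO1 : (fun y : ℝ × ℂ => y.1 - t₀) =O[𝓝[I ×ˢ univ] (t₀, x₀)] fun y => y - (t₀, x₀) :=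
    isBigO_of_le _ fun y => by
      rw [Prod.norm_def]; exact le_max_left _ _
  have hO2 : (fun y : ℝ × ℂ => y.2 - x₀) =O[𝓝[I ×ˢ univ] (t₀, x₀)] fun y => y - (t₀, x₀) :=
    isBigO_of_le _ fun y => by
      rw [Prod.norm_def]; exact le_max_right _ _
  have a1 := (e1.comp_tendsto hfst).trans_isBigO hO1
  have a2 := (e2.comp_tendsto hsnd).trans_isBigO hO2
  -- The mixed increment is at most ‖y.2 - x₀‖ times a multiple of J(y.1), and J tends to 0; the two
  -- one-variable expansions then add up to a joint one.
  have a3 : (fun y : ℝ × ℂ => (f y.1 y.2 - f t₀ y.2) - (f y.1 x₀ - f t₀ x₀))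
      =o[𝓝[I ×ˢ univ] (t₀, x₀)] fun y => y - (t₀, x₀) := by
    have h1 : (fun y : ℝ × ℂ => (1 / (Real.pi * r)) * J y.1)
        =o[𝓝[I ×ˢ univ] (t₀, x₀)] fun _ => (1 : ℝ) := by
      rw [isLittleO_one_iff]
      have := (hJ0.comp hfst).const_mul (1 / (Real.pi * r))
      rwa [mul_zero] at this
    have h2 := (hO2.norm_norm).mul_isLittleO h1
    have h3 : (fun y : ℝ × ℂ => (f y.1 y.2 - f t₀ y.2) - (f y.1 x₀ - f t₀ x₀))
        =O[𝓝[I ×ˢ univ] (t₀, x₀)]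
        fun y => ‖y.2 - x₀‖ * ((1 / (Real.pi * r)) * J y.1) := by
      refine IsBigO.of_bound' ?_
      filter_upwards [hfst.eventually hf, hsnd (Metric.closedBall_mem_nhds x₀ (half_pos hr))]
        with y hy hy2
      have h4 := norm_sub_le_circle_average (k := fun x => f y.1 x - f t₀ x) hr (hy.1.sub hft₀)
        (by rwa [mem_preimage, mem_closedBall_iff_norm] at hy2)
      exact h4.trans (le_abs_self _)
    have h5 := h3.trans_isLittleO h2
    exact IsLittleO.of_norm_right (h5.congr_right fun y => mul_one _)
  refine ((a3.add a1).add a2).congr_left fun y => ?_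
  simp only [Function.comp_apply, linPair_apply, Prod.fst_sub, Prod.snd_sub, Complex.real_smul,
    smul_eq_mul, Complex.ofReal_sub]
  ring

end

/-! ### The Burgers-type equation in the coordinate x. -/

section

variable {L k T N R : ℝ} {h : ℝ → ℝ → ℝ} {S : ℝ → ℂ → ℂ}

/-- The Burgers-type description in the coordinate `x = q^{-z}`. -/
def BurgersX (L k T N : ℝ) (h : ℝ → ℝ → ℝ) : Prop :=
  ∀ t ∈ Ico 0 T, ∀ x : ℂ, x ≠ 0 → jk (pt L k t) x ∉ nodes L (pt L k t) (t - T) N →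
    dk (pt L k t) x ≠ 0 →
    fx L k T N h t x ≠ 1 ∧
    DifferentiableWithinAt ℝ (fun τ => fx L k T N h τ x) (Ico 0 T) t ∧
    derivWithin (fun τ => fx L k T N h τ x) (Ico 0 T) t / fx L k T N h t x
      - L * x * deriv (fx L k T N h t) x / (1 - fx L k T N h t x)
      = L * jk (pt L k t) x / dk (pt L k t) x

theorem subordinated_of_lower (hF : TransformFamily L k T N R h S)
    (hsub : ∀ t ∈ Ico 0 T, ∀ w : ℂ, w.im < 0 →
      (w + ((Real.exp (L * t) - 1 : ℝ) : ℂ) * S t w).im < 0 ∧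
      S 0 (w + ((Real.exp (L * t) - 1 : ℝ) : ℂ) * S t w) = S t w) : Subordinated L T S := by
  intro t ht w hw
  rcases lt_or_gt_of_ne hw with hw | hw
  · obtain ⟨h1, h2⟩ := hsub t ht w hw
    exact ⟨mul_pos_of_neg_of_neg h1 hw, h2⟩
  · obtain ⟨h1, h2⟩ := hsub t ht (conj w) (by simpa using hw)
    have h3 : conj w + ((Real.exp (L * t) - 1 : ℝ) : ℂ) * S t (conj w)
        = conj (w + ((Real.exp (L * t) - 1 : ℝ) : ℂ) * S t w) := by
      rw [hF.symm t ht w (notMem_nodes_of_im_ne hw.ne'), map_add, map_mul, Complex.conj_ofReal]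
    rw [h3] at h1 h2
    have h4 : 0 < (w + ((Real.exp (L * t) - 1 : ℝ) : ℂ) * S t w).im := by
      rw [Complex.conj_im] at h1; linarith
    refine ⟨mul_pos h4 hw, ?_⟩
    have h0 : (0 : ℝ) ∈ Ico 0 T := ⟨le_rfl, ht.1.trans_lt ht.2⟩
    rw [hF.symm 0 h0 _ (notMem_nodes_of_im_ne h4.ne'),
      hF.symm t ht w (notMem_nodes_of_im_ne hw.ne')] at h2
    exact star_injective h2

theorem norm_ct_le {p lo hi : ℝ} {h : ℝ → ℝ} (hh : IsDensity h) {w : ℂ}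
    (hw : w.im ≠ 0) : ‖ct L p lo hi h w‖ ≤ (1 / |w.im|) * |hi - lo| := by
  refine intervalIntegral.norm_integral_le_of_norm_le_const fun s _ => ?_
  have h1 : |w.im| ≤ ‖w - node L p s‖ := by
    have := Complex.abs_im_le_norm (w - node L p s)
    simpa using this
  have h2 : 0 < |w.im| := abs_pos.2 hw
  rw [norm_mul, Complex.norm_real, Real.norm_of_nonneg (hh.nonneg s), norm_div, norm_one]
  have h3 : 1 / ‖w - node L p s‖ ≤ 1 / |w.im| := one_div_le_one_div_of_le h2 h1
  have h4 : 0 ≤ 1 / ‖w - node L p s‖ := by positivity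
  have := hh.le_one s
  have := hh.nonneg s
  nlinarith

theorem differentiableAt_fx (hs : Setting L k T N R h) {t : ℝ} (ht : t ∈ Ico 0 T) {x : ℂ}
    (hx : x ≠ 0) (hK : jk (pt L k t) x ∉ nodes L (pt L k t) (t - T) N) :
    DifferentiableAt ℂ (fx L k T N h t) x := by
  have hreg := hs.regular ht
  have h1 : DifferentiableAt ℂ (fun x => ct L (pt L k t) (t - T) N (h t) (jk (pt L k t) x)) x :=
    (differentiableAt_ct hreg.hL.ne' hreg.dens hreg.hlR hK).comp x
      (hasStrictDerivAt_jk _ hx).hasDerivAt.differentiableAt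
  have h2 : DifferentiableAt ℂ (dk (pt L k t)) x := by
    unfold dk
    exact differentiableAt_id.sub ((differentiableAt_const _).div differentiableAt_id hx)
  unfold fx expo
  fun_prop

theorem im_ne_zero_of_jk_im {p : ℝ} {x : ℂ} (h : (jk p x).im ≠ 0) : x.im ≠ 0 := by
  intro h0
  apply h
  have h1 : x = (x.re : ℂ) := Complex.ext rfl (by simp [h0])
  rw [h1, jk_ofReal, Complex.ofReal_im]

theorem hasStrictFDerivAt_jk_pt (L k t : ℝ) {x : ℂ} (hx : x ≠ 0) :
    HasStrictFDerivAt (fun y : ℝ × ℂ => jk (pt L k y.1) y.2)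
      (linPair (L * pt L k t / x) (dk (pt L k t) x / x)) (t, x) := by
  have h1 : HasStrictFDerivAt (fun y : ℝ × ℂ => ((pt L k y.1 : ℝ) : ℂ))
      (linPair (L * pt L k t) 0) (t, x) := by
    have e0 : HasStrictDerivAt (fun s => Real.exp (L * s)) (L * Real.exp (L * t)) t := by
      have := ((hasStrictDerivAt_id t).const_mul L).exp
      simpa [mul_comm] using this
    have e1 := Complex.ofRealCLM.hasStrictFDerivAt.comp (t, x)
      ((e0.const_mul k).hasStrictFDerivAt.comp (t, x)
        (hasStrictFDerivAt_fst (𝕜 := ℝ) (E := ℝ) (F := ℂ) (p := (t, x))))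
    refine e1.congr_fderiv (linPair_ext fun u z => ?_)
    simp [pt]
    left
    ring
  have h2 : HasStrictFDerivAt (fun y : ℝ × ℂ => (y.2)⁻¹) (linPair 0 (-(x ^ 2)⁻¹)) (t, x) := by
    have e1 := (((hasStrictDerivAt_inv hx).hasStrictFDerivAt).restrictScalars ℝ).comp (t, x)
      (hasStrictFDerivAt_snd (𝕜 := ℝ) (E := ℝ) (F := ℂ) (p := (t, x)))
    refine e1.congr_fderiv (linPair_ext fun u z => ?_)
    simp
    ring
  have h3 := (hasStrictFDerivAt_snd (𝕜 := ℝ) (E := ℝ) (F := ℂ) (p := (t, x))).add (h1.mul h2)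
  have h4 : (fun y : ℝ × ℂ => jk (pt L k y.1) y.2)
      = fun y : ℝ × ℂ => y.2 + ((pt L k y.1 : ℝ) : ℂ) * (y.2)⁻¹ := by
    ext y; rw [jk, div_eq_mul_inv]
  rw [h4]
  refine h3.congr_fderiv (linPair_ext fun u z => ?_)
  simp [dk]
  field_simp
  ring

/-- Joint differentiability of the slope at points with non-real image. -/
theorem BurgersX.hasFDerivWithinAt_fx (hB : BurgersX L k T N h) (hs : Setting L k T N R h)
    {t₀ : ℝ} (ht₀ : t₀ ∈ Ico 0 T) {x₀ : ℂ} (hw₀ : (jk (pt L k t₀) x₀).im ≠ 0) :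
    HasFDerivWithinAt (fun y : ℝ × ℂ => fx L k T N h y.1 y.2)
      (linPair (derivWithin (fun τ => fx L k T N h τ x₀) (Ico 0 T) t₀)
        (deriv (fx L k T N h t₀) x₀)) (Ico 0 T ×ˢ univ) (t₀, x₀) := by
  have hxim := im_ne_zero_of_jk_im hw₀
  have hx₀ : x₀ ≠ 0 := by rintro rfl; simp at hxim
  have hjc := (hasStrictFDerivAt_jk_pt L k t₀ hx₀).hasFDerivAt.continuousAt
  set m := |(jk (pt L k t₀) x₀).im| / 2 with hm
  have hm0 : 0 < m := half_pos (abs_pos.2 hw₀)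
  have hev1 : ∀ᶠ y : ℝ × ℂ in 𝓝 (t₀, x₀), m < |(jk (pt L k y.1) y.2).im| := by
    have h1 : ContinuousAt (fun y : ℝ × ℂ => |(jk (pt L k y.1) y.2).im|) (t₀, x₀) :=
      (Complex.continuous_im.continuousAt.comp hjc).abs
    exact h1.eventually_const_lt (by simp only [hm]; linarith [abs_pos.2 hw₀])
  have hev2 : ∀ᶠ y : ℝ × ℂ in 𝓝 (t₀, x₀), ‖dk (pt L k y.1) y.2‖ < ‖dk (pt L k t₀) x₀‖ + 1 := by
    have h1 : ContinuousAt (fun y : ℝ × ℂ => dk (pt L k y.1) y.2) (t₀, x₀) := by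
      have h2 : ContinuousAt (fun y : ℝ × ℂ => 2 * y.2 - jk (pt L k y.1) y.2) (t₀, x₀) :=
        (by fun_prop : ContinuousAt (fun y : ℝ × ℂ => 2 * y.2) (t₀, x₀)).sub hjc
      refine h2.congr (Eventually.of_forall fun y => ?_)
      simp only [jk, dk]; ring
    exact h1.norm.eventually_lt_const (by simp)
  obtain ⟨δ, hδ, hball⟩ := Metric.eventually_nhds_iff_ball.1 (hev1.and hev2)
  set r := δ / 2 with hr
  have hr0 : 0 < r := half_pos hδ
  have hin : ∀ t, |t - t₀| < δ → ∀ x ∈ Metric.closedBall x₀ r,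
      m < |(jk (pt L k t) x).im| ∧ ‖dk (pt L k t) x‖ < ‖dk (pt L k t₀) x₀‖ + 1 := by
    intro t ht x hx
    refine hball (t, x) ?_
    rw [Metric.mem_ball, Prod.dist_eq, max_lt_iff]
    exact ⟨ht, lt_of_le_of_lt hx (by simp only [hr]; linarith)⟩
  have him : ∀ t, |t - t₀| < δ → ∀ x ∈ Metric.closedBall x₀ r, (jk (pt L k t) x).im ≠ 0 := by
    intro t ht x hx h0
    have := (hin t ht x hx).1
    rw [h0, abs_zero] at this
    linarith
  have hne0 : ∀ {t : ℝ} {x : ℂ}, (jk (pt L k t) x).im ≠ 0 → x ≠ 0 ∧ dk (pt L k t) x ≠ 0 := by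
    intro t x hx
    have h1 := im_ne_zero_of_jk_im hx
    have h2 : x ≠ 0 := by rintro rfl; simp at h1
    exact ⟨h2, fun h3 => h1 (im_of_dk_eq_zero (pt_pos hs.hk t) h2 h3)⟩
  refine hasFDerivWithinAt_of_bounded (M := Real.exp (L * (‖dk (pt L k t₀) x₀‖ + 1) *
    ((1 / m) * (N + T)))) hr0 ht₀ ?_ ?_ ?_
  · have h1 : ∀ᶠ t in 𝓝[Ico 0 T] t₀, |t - t₀| < δ :=
      nhdsWithin_le_nhds (Metric.ball_mem_nhds t₀ hδ)
    filter_upwards [h1, self_mem_nhdsWithin] with t ht htI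
    refine ⟨fun x hx => ?_, fun x hx => ?_⟩
    · have h2 := him t ht x hx
      exact (differentiableAt_fx hs htI (hne0 h2).1
        (notMem_nodes_of_im_ne h2)).differentiableWithinAt
    · obtain ⟨h2, h3⟩ := hin t ht x hx
      have hreg := hs.regular htI
      rw [fx, Complex.norm_exp]
      refine Real.exp_le_exp.2 ((Complex.re_le_norm _).trans ?_)
      rw [expo, norm_neg, norm_mul, norm_mul, Complex.norm_real, Real.norm_of_nonneg hs.hL.le]
      have h4 := norm_ct_le (L := L) (p := pt L k t) (lo := t - T) (hi := N) hreg.dens (him t ht x hx)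
      have h5 : |N - (t - T)| ≤ N + T := by
        rw [abs_of_nonneg (by linarith [hreg.hlR])]; linarith [htI.1]
      have hL := hs.hL
      refine mul_le_mul (by gcongr) (h4.trans ?_) (norm_nonneg _) (by positivity)
      gcongr
  · intro x hx
    have h2 := him t₀ (by simpa using hδ) x hx
    exact (hB t₀ ht₀ x (hne0 h2).1 (notMem_nodes_of_im_ne h2) (hne0 h2).2).2.1.continuousWithinAt
  · exact (hB t₀ ht₀ x₀ (hne0 hw₀).1 (notMem_nodes_of_im_ne hw₀)
      (hne0 hw₀).2).2.1.hasDerivWithinAt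

end

/-! ### The transform along moving points. -/

section

variable {L k T N R : ℝ} {h : ℝ → ℝ → ℝ} {S : ℝ → ℂ → ℂ}

/-- A local inverse of `x ↦ x + p_t / x`, smooth in `t`. -/
theorem exists_jk_chart (L k t₀ : ℝ) {x₀ : ℂ} (hx₀ : x₀ ≠ 0)
    (hd : dk (pt L k t₀) x₀ ≠ 0) :
    ∃ g : ℝ × ℂ → ℂ, g (t₀, jk (pt L k t₀) x₀) = x₀ ∧
      HasFDerivAt g (linPair (-(L * pt L k t₀) / dk (pt L k t₀) x₀) (x₀ / dk (pt L k t₀) x₀))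
        (t₀, jk (pt L k t₀) x₀) ∧
      ∀ᶠ y in 𝓝 (t₀, jk (pt L k t₀) x₀), jk (pt L k y.1) (g y) = y.2 := by
  obtain ⟨g, g1, g2, g3⟩ := exists_implicit (hasStrictFDerivAt_jk_pt L k t₀ hx₀)
    (div_ne_zero hd hx₀)
  refine ⟨g, g1, g2.hasFDerivAt.congr_fderiv (linPair_ext fun u z => ?_), g3⟩
  simp only [linPair_apply]
  field_simp

theorem exists_root_of_im (L : ℝ) (hk : 0 < k) (t : ℝ) {w : ℂ} (hw : w.im ≠ 0) :
    ∃ x : ℂ, x ≠ 0 ∧ jk (pt L k t) x = w ∧ dk (pt L k t) x ≠ 0 ∧ ‖x‖ ^ 2 ≤ pt L k t := by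
  obtain ⟨x, hx, hxw, hn⟩ := exists_joukowski_root w (pt_pos (L := L) hk t)
  have hxw : jk (pt L k t) x = w := hxw
  refine ⟨x, hx, hxw, fun h => ?_, hn⟩
  exact im_ne_zero_of_jk_im (by rw [hxw]; exact hw) (im_of_dk_eq_zero (pt_pos hk t) hx h)

theorem ne_zero_of_jk_im {p : ℝ} (hp : 0 < p) {x : ℂ} (h : (jk p x).im ≠ 0) :
    x ≠ 0 ∧ dk p x ≠ 0 := by
  have h1 := im_ne_zero_of_jk_im h
  have h2 : x ≠ 0 := by rintro rfl; simp at h1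
  exact ⟨h2, fun h3 => h1 (im_of_dk_eq_zero hp h2 h3)⟩

/-- In the local coordinate g the transform is an explicit expression in f. The continuity supplies
a uniform bound near a characteristic. -/
theorem BurgersX.continuousOn (hB : BurgersX L k T N h) (hs : Setting L k T N R h)
    (hF : TransformFamily L k T N R h S) :
    ContinuousOn (fun y : ℝ × ℂ => S y.1 y.2) (Ico 0 T ×ˢ {w : ℂ | w.im ≠ 0}) := by
  rintro ⟨t₀, w₀⟩ hy₀
  have ht₀ : t₀ ∈ Ico 0 T := hy₀.1
  have hw₀ : w₀.im ≠ 0 := hy₀.2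
  obtain ⟨x₀, hx₀, hxw, hd, -⟩ := exists_root_of_im L hs.hk t₀ hw₀
  obtain ⟨g, g1, g2, g3⟩ := exists_jk_chart L k t₀ hx₀ hd
  rw [hxw] at g1 g2 g3
  have hfc := (hB.hasFDerivWithinAt_fx hs ht₀ (x₀ := x₀) (by rw [hxw]; exact hw₀)).continuousWithinAt
  set Q := Ico (0 : ℝ) T ×ˢ {w : ℂ | w.im ≠ 0} with hQ
  have hgc : ContinuousWithinAt g Q (t₀, w₀) := g2.continuousAt.continuousWithinAt
  have hγ : ContinuousWithinAt (fun y : ℝ × ℂ => (y.1, g y)) Q (t₀, w₀) :=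
    continuousWithinAt_fst.prodMk hgc
  have hfc' : ContinuousWithinAt (fun y : ℝ × ℂ => fx L k T N h y.1 y.2) (Ico 0 T ×ˢ univ)
      ((fun y : ℝ × ℂ => (y.1, g y)) (t₀, w₀)) := by
    change ContinuousWithinAt _ _ (t₀, g (t₀, w₀))
    rw [g1]; exact hfc
  have hmaps : MapsTo (fun y : ℝ × ℂ => (y.1, g y)) Q (Ico 0 T ×ˢ univ) :=
    fun y hy => ⟨hy.1, mem_univ _⟩
  have hfg : ContinuousWithinAt (fun y : ℝ × ℂ => fx L k T N h y.1 (g y)) Q (t₀, w₀) :=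
    ContinuousWithinAt.comp (f := fun y : ℝ × ℂ => (y.1, g y)) hfc' hγ hmaps
  have hf1 := (hB t₀ ht₀ x₀ hx₀ (by rw [hxw]; exact notMem_nodes_of_im_ne hw₀) hd).1
  have hdk : ContinuousWithinAt (fun y : ℝ × ℂ => dk (pt L k y.1) (g y)) Q (t₀, w₀) := by
    unfold dk pt
    exact hgc.sub (ContinuousWithinAt.div (by fun_prop) hgc (by rw [g1]; exact hx₀))
  have hmain : ContinuousWithinAt (fun y : ℝ × ℂ => ((Real.exp (-(L * y.1)) : ℝ) : ℂ) *
      (-g y + dk (pt L k y.1) (g y) / (1 - fx L k T N h y.1 (g y)))) Q (t₀, w₀) := by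
    have h1 : ContinuousWithinAt (fun y : ℝ × ℂ => ((Real.exp (-(L * y.1)) : ℝ) : ℂ)) Q (t₀, w₀) := by
      fun_prop
    have h2 : 1 - fx L k T N h (t₀, w₀).1 (g (t₀, w₀)) ≠ 0 := by
      rw [g1]; exact sub_ne_zero.2 (Ne.symm hf1)
    exact h1.mul (hgc.neg.add (hdk.div (continuousWithinAt_const.sub hfg) h2))
  have hval : ∀ y ∈ Q, jk (pt L k y.1) (g y) = y.2 → S y.1 y.2 =
      ((Real.exp (-(L * y.1)) : ℝ) : ℂ) *
      (-g y + dk (pt L k y.1) (g y) / (1 - fx L k T N h y.1 (g y))) := by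
    intro y hy h1
    have hyi : (jk (pt L k y.1) (g y)).im ≠ 0 := by rw [h1]; exact hy.2
    obtain ⟨h2, h3⟩ := ne_zero_of_jk_im (pt_pos hs.hk y.1) hyi
    have := (hF.val y.1 hy.1 (g y) h2 (notMem_nodes_of_im_ne hyi) h3).2
    rwa [h1] at this
  have hev : ∀ᶠ y in 𝓝[Q] (t₀, w₀), S y.1 y.2 = ((Real.exp (-(L * y.1)) : ℝ) : ℂ) *
      (-g y + dk (pt L k y.1) (g y) / (1 - fx L k T N h y.1 (g y))) := by
    filter_upwards [nhdsWithin_le_nhds g3, self_mem_nhdsWithin] with y h1 h2 using hval y h2 h1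
  exact hmain.congr_of_eventuallyEq hev (hev.self_of_nhdsWithin hy₀)

/-- The derivative of `S` along a curve moving with velocity `-L e^{L t} v`. -/
theorem BurgersX.hasDerivWithinAt_curve (hB : BurgersX L k T N h) (hs : Setting L k T N R h)
    (hF : TransformFamily L k T N R h S) {t₀ : ℝ} (ht₀ : t₀ ∈ Ico 0 T) {w : ℝ → ℂ} {v : ℂ}
    (hw : HasDerivAt w (-(L * Real.exp (L * t₀) * v)) t₀) (hw₀ : (w t₀).im ≠ 0) :
    HasDerivWithinAt (fun t => S t (w t))
      (L * Real.exp (L * t₀) * deriv (S t₀) (w t₀) * (S t₀ (w t₀) - v)) (Ico 0 T) t₀ := by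
  obtain ⟨x₀, hx₀, hxw, hd, -⟩ := exists_root_of_im L hs.hk t₀ hw₀
  obtain ⟨g, g1, g2, g3⟩ := exists_jk_chart L k t₀ hx₀ hd
  rw [hxw] at g1 g2 g3
  have hxi : (jk (pt L k t₀) x₀).im ≠ 0 := by rw [hxw]; exact hw₀
  have hfd := hB.hasFDerivWithinAt_fx hs ht₀ hxi
  obtain ⟨hf1, -, hbur⟩ := hB t₀ ht₀ x₀ hx₀ (notMem_nodes_of_im_ne hxi) hd
  set a := derivWithin (fun τ => fx L k T N h τ x₀) (Ico 0 T) t₀ with ha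
  set f' := deriv (fx L k T N h t₀) x₀ with hf'
  set p := pt L k t₀ with hp
  set D := dk p x₀ with hD
  set E : ℂ := ((Real.exp (L * t₀) : ℝ) : ℂ) with hE
  have hE0 : E ≠ 0 := by simp [hE]
  -- the curve in the coordinate `x`
  set xc : ℝ → ℂ := fun t => g (t, w t) with hxc
  have hxc0 : xc t₀ = x₀ := g1
  set x' : ℂ := (-(L * E * v) - L * p / x₀) * x₀ / D with hx'
  have hxd : HasDerivAt xc x' t₀ := by
    have e1 : HasDerivAt (fun t => (t, w t)) ((1 : ℝ), -(L * E * v)) t₀ :=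
      (hasDerivAt_id t₀).prodMk hw
    have e2 := g2.comp_hasDerivAt t₀ e1
    refine e2.congr_deriv ?_
    simp only [linPair_apply, hx']
    push_cast
    field_simp
    ring
  have hpd : HasDerivAt (fun t => ((pt L k t : ℝ) : ℂ)) (L * p) t₀ := by
    have e1 := ((hasDerivAt_exp_mul L t₀).const_mul k).ofReal_comp
    refine e1.congr_deriv ?_
    simp only [hp, pt]; push_cast; ring
  have hDd : HasDerivAt (fun t => dk (pt L k t) (xc t))
      (x' - (L * p * x₀ - p * x') / x₀ ^ 2) t₀ := by
    have := hxd.fun_sub (hpd.fun_div hxd (by rw [hxc0]; exact hx₀))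
    rw [hxc0] at this
    exact this
  have hfdd : HasDerivWithinAt (fun t => fx L k T N h t (xc t)) (a + f' * x') (Ico 0 T) t₀ := by
    have e1 : HasDerivWithinAt (fun t => (t, xc t)) ((1 : ℝ), x') (Ico 0 T) t₀ :=
      ((hasDerivAt_id t₀).prodMk hxd).hasDerivWithinAt
    have e2 := HasFDerivWithinAt.comp_hasDerivWithinAt (t := Ico 0 T ×ˢ univ)
      (l := fun y : ℝ × ℂ => fx L k T N h y.1 y.2) t₀ (by rw [hxc0]; exact hfd) e1
      fun t ht => ⟨ht, mem_univ _⟩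
    refine e2.congr_deriv ?_
    simp
  have hed : HasDerivAt (fun t => ((Real.exp (-(L * t)) : ℝ) : ℂ)) (-L * E⁻¹) t₀ := by
    have e1 := (hasDerivAt_exp_mul (-L) t₀).ofReal_comp
    simp only [neg_mul] at e1
    refine e1.congr_deriv ?_
    simp only [hE, Real.exp_neg]; push_cast; ring
  have hm0 : 1 - fx L k T N h t₀ (xc t₀) ≠ 0 := by
    rw [hxc0]; exact sub_ne_zero.2 (Ne.symm hf1)
  have htot := hed.hasDerivWithinAt (s := Ico 0 T) |>.fun_mul
    ((hxd.hasDerivWithinAt (s := Ico 0 T)).fun_neg.fun_add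
      ((hDd.hasDerivWithinAt (s := Ico 0 T)).fun_div (hfdd.const_sub 1) hm0))
  -- the spatial derivative
  set c := deriv (S t₀) (w t₀) with hc
  have hSval : ∀ x : ℂ, (jk p x).im ≠ 0 → S t₀ (jk p x)
      = E⁻¹ * (-x + dk p x / (1 - fx L k T N h t₀ x)) := by
    intro x hx
    obtain ⟨h2, h3⟩ := ne_zero_of_jk_im (pt_pos hs.hk t₀) hx
    rw [(hF.val t₀ ht₀ x h2 (notMem_nodes_of_im_ne hx) h3).2, hE, Real.exp_neg]
    push_cast; rfl
  set m := 1 - fx L k T N h t₀ x₀ with hm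
  have hm1 : m ≠ 0 := sub_ne_zero.2 (Ne.symm hf1)
  -- Differentiating S_{t₀}(x + p/x) in x in two ways relates ∂_w S to ∂_x f.
  have hcc : c * (D / x₀) = E⁻¹ * (-1 + ((1 + p / x₀ ^ 2) * m + D * f') / m ^ 2) := by
    have e1 : HasDerivAt (S t₀) c (jk p x₀) := by
      rw [hxw]
      exact (hF.analyticAt ht₀ (notMem_nodes_of_im_ne hw₀)).differentiableAt.hasDerivAt
    have e2 := e1.comp x₀ (hasStrictDerivAt_jk p hx₀).hasDerivAt
    have e3 : HasDerivAt (fx L k T N h t₀) f' x₀ :=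
      (differentiableAt_fx hs ht₀ hx₀ (notMem_nodes_of_im_ne hxi)).hasDerivAt
    have e4 : HasDerivAt (dk p) (1 + p / x₀ ^ 2) x₀ := by
      have := (hasDerivAt_id x₀).fun_sub ((hasDerivAt_const x₀ (p : ℂ)).fun_div (hasDerivAt_id x₀) hx₀)
      refine this.congr_deriv ?_
      simp; ring
    have e5 := ((hasDerivAt_id x₀).fun_neg.fun_add (e4.fun_div (e3.const_sub 1) hm1)).const_mul E⁻¹
    have hev : ∀ᶠ x in 𝓝 x₀, (jk p x).im ≠ 0 := by
      have : ContinuousAt (fun x => (jk p x).im) x₀ := Complex.continuous_im.continuousAt.comp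
        (hasStrictDerivAt_jk p hx₀).hasDerivAt.continuousAt
      exact this.eventually_ne hxi
    have e6 := e5.congr_of_eventuallyEq (f₁ := S t₀ ∘ jk p) (by
      filter_upwards [hev] with x hx using hSval x hx)
    have e7 := e2.unique e6
    rw [e7]
    simp only [hm]
    ring
  have hev : ∀ᶠ t in 𝓝[Ico 0 T] t₀, S t (w t) = ((Real.exp (-(L * t)) : ℝ) : ℂ) *
      (-xc t + dk (pt L k t) (xc t) / (1 - fx L k T N h t (xc t))) := by
    have hwc : ContinuousAt (fun t => (t, w t)) t₀ := continuousAt_id.prodMk hw.continuousAt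
    have h1 := hwc.tendsto.eventually g3
    have h2 : ∀ᶠ t in 𝓝 t₀, (w t).im ≠ 0 :=
      (Complex.continuous_im.continuousAt.comp hw.continuousAt).eventually_ne hw₀
    filter_upwards [nhdsWithin_le_nhds h1, nhdsWithin_le_nhds h2, self_mem_nhdsWithin]
      with t h1 h2 h3
    have h1 : jk (pt L k t) (xc t) = w t := h1
    have h4 : (jk (pt L k t) (xc t)).im ≠ 0 := by rw [h1]; exact h2
    obtain ⟨h5, h6⟩ := ne_zero_of_jk_im (pt_pos hs.hk t) h4
    rw [← h1, (hF.val t h3 (xc t) h5 (notMem_nodes_of_im_ne h4) h6).2]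
  have hfin := htot.congr_of_eventuallyEq hev (hev.self_of_nhdsWithin ht₀)
  refine hfin.congr_deriv ?_
  have hS0 : S t₀ (w t₀) = E⁻¹ * (-x₀ + D / m) := by
    rw [← hxw, hSval x₀ hxi]
  have hf0 : fx L k T N h t₀ x₀ ≠ 0 := Complex.exp_ne_zero _
  have hfm : fx L k T N h t₀ x₀ = 1 - m := by rw [hm]; ring
  have hfm0 : (1 : ℂ) - m ≠ 0 := by rw [← hfm]; exact hf0
  -- The Burgers equation solved for ∂_t f. With `hc'` inserted as well, the claim is a rational
  -- identity.
  have ha' : a = (1 - m) * (L * jk p x₀ / D + L * x₀ * f' / m) := by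
    rw [← hfm, ← hbur]; field_simp; ring
  have hjk : jk p x₀ = x₀ + p / x₀ := rfl
  have hDx : D = x₀ - p / x₀ := rfl
  have hc' : c = E⁻¹ * (-1 + ((1 + p / x₀ ^ 2) * m + D * f') / m ^ 2) * x₀ / D := by
    rw [← hcc]; field_simp
  have e0 : ((Real.exp (-(L * t₀)) : ℝ) : ℂ) = E⁻¹ := by rw [hE, Real.exp_neg]; push_cast; rfl
  rw [hS0, hxc0, e0]
  have hD0 : D ≠ 0 := hd
  change -L * E⁻¹ * (-x₀ + D / m) + E⁻¹ * (-x' + ((x' - (L * p * x₀ - p * x') / x₀ ^ 2) * m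
    - D * -(a + f' * x')) / m ^ 2) = _
  rw [hc', ha', hx', hjk]
  have hp' : (p : ℂ) = (x₀ - D) * x₀ := by rw [hDx]; field_simp; ring
  rw [hp']
  field_simp
  ring

end

/-! ### The Burgers-type equation is equivalent to subordination. -/

section

variable {L k T N R : ℝ} {h : ℝ → ℝ → ℝ} {S : ℝ → ℂ → ℂ}

/-- The bound t < T enters here: it makes β = e^{Lt} - 1 smaller than the constant c = e^{LT} - 1 of
S_0. -/
theorem TransformFamily.exists_subordinate (hF : TransformFamily L k T N R h S)
    (hs : Setting L k T N R h) {t : ℝ} (ht : t ∈ Ico 0 T) {w : ℂ} (hw : w.im < 0) :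
    ∃ u : ℂ, u.im < 0 ∧ u - ((Real.exp (L * t) - 1 : ℝ) : ℂ) * S 0 u = w := by
  obtain ⟨A, B, C, μ, hfin, hμ, -, hS⟩ := hF.nev0
  have h1 : 0 ≤ Real.exp (L * t) - 1 := by
    have := Real.one_le_exp (mul_nonneg hs.hL.le ht.1); linarith
  have h2 : Real.exp (L * t) < Real.exp (L * T) :=
    Real.exp_lt_exp.2 (mul_lt_mul_of_pos_left ht.2 hs.hL)
  obtain ⟨u, hu, hHu⟩ := subordination_exists (C := C) hμ (c := Real.exp (L * T) - 1)
    (by linarith) h1 (by linarith) hw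
  exact ⟨u, hu, by rw [hS u (notMem_seg_of_im_ne hu.ne)]; exact hHu⟩

/-- The Burgers-type equation implies subordination, by the method of characteristics. -/
theorem BurgersX.subordinated (hB : BurgersX L k T N h) (hs : Setting L k T N R h)
    (hF : TransformFamily L k T N R h S) : Subordinated L T S := by
  refine subordinated_of_lower hF fun t₁ ht₁ w₁ hw₁ => ?_
  obtain ⟨u, hu, hHu⟩ := hF.exists_subordinate hs ht₁ hw₁
  set v := S 0 u with hv
  set w : ℝ → ℂ := fun t => u - ((Real.exp (L * t) - 1 : ℝ) : ℂ) * v with hw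
  have hwd : ∀ t, HasDerivAt w (-(L * Real.exp (L * t) * v)) t := fun t => by
    have := ((((hasDerivAt_exp_mul L t).sub_const 1).ofReal_comp).mul_const v).const_sub u
    refine this.congr_deriv ?_
    push_cast; ring
  have hwc : Continuous w := continuous_iff_continuousAt.2 fun t => (hwd t).continuousAt
  have hwt₁ : w t₁ = w₁ := hHu
  -- Im w is affine in e^{Lt} and negative at both ends.
  have hwim : ∀ t ∈ Icc 0 t₁, (w t).im < 0 := by
    intro t ht
    have h1 : ∀ t, (w t).im = u.im - (Real.exp (L * t) - 1) * v.im := fun t => by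
      simp only [hw, Complex.sub_im, Complex.im_ofReal_mul]
    have h2 := h1 t₁
    rw [hwt₁] at h2
    rw [h1]
    have h3 : 0 ≤ Real.exp (L * t) - 1 := by
      have := Real.one_le_exp (mul_nonneg hs.hL.le ht.1); linarith
    have h4 : Real.exp (L * t) ≤ Real.exp (L * t₁) :=
      Real.exp_le_exp.2 (mul_le_mul_of_nonneg_left ht.2 hs.hL.le)
    rcases le_or_gt 0 v.im with h5 | h5
    · nlinarith [mul_nonneg h3 h5]
    · nlinarith
  have hIcc : Icc 0 t₁ ⊆ Ico 0 T := fun t ht => ⟨ht.1, ht.2.trans_lt ht₁.2⟩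
  -- a uniform tube around the characteristic
  obtain ⟨δ, hδ, hδw⟩ : ∃ δ > 0, ∀ t ∈ Icc 0 t₁, δ < -(w t).im := by
    obtain ⟨s, hs, hmin⟩ := isCompact_Icc.exists_isMinOn (nonempty_Icc.2 ht₁.1)
      ((Complex.continuous_im.comp hwc).neg.continuousOn (s := Icc 0 t₁))
    refine ⟨-(w s).im / 2, by linarith [hwim s hs], fun t ht => ?_⟩
    have h1 : -(w s).im ≤ -(w t).im := hmin ht
    linarith [hwim s hs]
  have htube : ∀ t ∈ Icc 0 t₁, ∀ z : ℂ, ‖z‖ ≤ δ → (w t + z).im < 0 := by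
    intro t ht z hz
    have h1 := hδw t ht
    have h2 := (Complex.abs_im_le_norm z).trans hz
    rw [Complex.add_im]
    linarith [le_abs_self z.im]
  have hScont := hB.continuousOn hs hF
  obtain ⟨M, hM⟩ := ((isCompact_Icc (a := (0 : ℝ)) (b := t₁)).prod
    (isCompact_closedBall (0 : ℂ) δ)).exists_bound_of_continuousOn
    (f := fun y : ℝ × ℂ => S y.1 (w y.1 + y.2)) (by
      refine ContinuousOn.comp (g := fun y : ℝ × ℂ => S y.1 y.2)
        (f := fun y : ℝ × ℂ => (y.1, w y.1 + y.2)) hScont ?_ ?_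
      · exact (by fun_prop : Continuous fun y : ℝ × ℂ => (y.1, w y.1 + y.2)).continuousOn
      · rintro ⟨t, z⟩ ⟨ht, hz⟩
        exact ⟨hIcc ht, (htube t ht z (by simpa using hz)).ne⟩)
  have hderiv : ∀ t ∈ Icc 0 t₁, ‖deriv (S t) (w t)‖ ≤ M / δ := by
    intro t ht
    refine Complex.norm_deriv_le_of_forall_mem_sphere_norm_le hδ ?_ fun z hz => ?_
    · refine DifferentiableOn.diffContOnCl ?_
      rw [closure_ball _ hδ.ne']
      refine (hF.diff t (hIcc ht)).mono fun z hz => ?_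
      have h1 := htube t ht (z - w t) (by rwa [mem_closedBall_iff_norm] at hz)
      rw [add_sub_cancel] at h1
      exact notMem_nodes_of_im_ne h1.ne
    · have h1 := hM (t, z - w t) ⟨ht, by
        rw [mem_sphere_iff_norm] at hz
        simp [hz]⟩
      simpa using h1
  have hM0 : 0 ≤ M / δ := (norm_nonneg _).trans (hderiv 0 ⟨le_rfl, ht₁.1⟩)
  set φ : ℝ → ℂ := fun t => S t (w t) - v with hφ
  have hφd : ∀ t ∈ Icc 0 t₁, HasDerivWithinAt φ
      (L * Real.exp (L * t) * deriv (S t) (w t) * (S t (w t) - v)) (Ico 0 T) t := fun t ht =>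
    (hB.hasDerivWithinAt_curve hs hF (hIcc ht) (hwd t) (hwim t ht).ne).sub_const v
  have hφ0 : φ 0 = 0 := by simp [hφ, hw, hv]
  -- φ vanishes at 0 and satisfies φ' = L e^{Lt} S'(w) φ with a bounded coefficient, the bound on S'
  -- being a Cauchy estimate in the tube.
  have hgr := norm_le_gronwallBound_of_norm_deriv_right_le (f := φ)
    (f' := fun t => L * Real.exp (L * t) * deriv (S t) (w t) * (S t (w t) - v))
    (δ := 0) (K := L * Real.exp (L * t₁) * (M / δ)) (ε := 0) (a := 0) (b := t₁)
    (fun t ht => (hφd t ht).continuousWithinAt.mono hIcc)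
    (fun t ht => by
      refine (hφd t ⟨ht.1, ht.2.le⟩).mono_of_mem_nhdsWithin ?_
      refine mem_nhdsWithin.2 ⟨Iio T, isOpen_Iio, ht.2.trans ht₁.2, fun s hs => ?_⟩
      exact ⟨ht.1.trans hs.2, hs.1⟩)
    (by rw [hφ0, norm_zero])
    (fun t ht => by
      have h1 := hderiv t ⟨ht.1, ht.2.le⟩
      have h2 : Real.exp (L * t) ≤ Real.exp (L * t₁) :=
        Real.exp_le_exp.2 (mul_le_mul_of_nonneg_left ht.2.le hs.hL.le)
      have hL := hs.hL
      rw [add_zero, norm_mul, norm_mul, norm_mul, Complex.norm_real, Complex.norm_real,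
        Real.norm_of_nonneg hL.le, Real.norm_of_nonneg (Real.exp_pos _).le]
      gcongr) t₁ ⟨ht₁.1, le_rfl⟩
  rw [gronwallBound_ε0_δ0] at hgr
  have h1 : S t₁ w₁ = v := by
    have := norm_le_zero_iff.1 hgr
    simp only [hφ, hwt₁] at this
    exact sub_eq_zero.1 this
  have h2 : w₁ + ((Real.exp (L * t₁) - 1 : ℝ) : ℂ) * S t₁ w₁ = u := by
    rw [h1, ← hHu]; ring
  rw [h2]
  exact ⟨hu, h1.symm⟩

/-- The slope in terms of the transform. -/
theorem TransformFamily.fx_eq (hF : TransformFamily L k T N R h S) {t : ℝ} (ht : t ∈ Ico 0 T)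
    {x : ℂ} (hx : x ≠ 0) (hK : jk (pt L k t) x ∉ nodes L (pt L k t) (t - T) N)
    (hd : dk (pt L k t) x ≠ 0) :
    Real.exp (L * t) * S t (jk (pt L k t) x) + x ≠ 0 ∧
    fx L k T N h t x = (Real.exp (L * t) * S t (jk (pt L k t) x) + pt L k t / x) /
      (Real.exp (L * t) * S t (jk (pt L k t) x) + x) := by
  obtain ⟨h1, h2⟩ := hF.val t ht x hx hK hd
  have h3 : 1 - fx L k T N h t x ≠ 0 := sub_ne_zero.2 (Ne.symm h1)
  have h4 : (Real.exp (L * t) : ℂ) * S t (jk (pt L k t) x) + x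
      = dk (pt L k t) x / (1 - fx L k T N h t x) := by
    have : (Real.exp (L * t) : ℂ) * ((Real.exp (-(L * t)) : ℝ) : ℂ) = 1 := by
      rw [← Complex.ofReal_mul, ← Real.exp_add]; simp
    rw [h2, ← mul_assoc, this]; ring
  have h5 : (Real.exp (L * t) : ℂ) * S t (jk (pt L k t) x) + x ≠ 0 := by
    rw [h4]; exact div_ne_zero hd h3
  refine ⟨h5, ?_⟩
  rw [eq_div_iff h5]
  have h6 : ((Real.exp (L * t) : ℂ) * S t (jk (pt L k t) x) + x) * (1 - fx L k T N h t x)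
      = dk (pt L k t) x := by rw [h4, div_mul_cancel₀ _ h3]
  have h7 : dk (pt L k t) x = x - pt L k t / x := rfl
  linear_combination -h6 - h7

/-- Subordination implies the Burgers-type equation. -/
theorem Subordinated.burgersX (hsub : Subordinated L T S) (hs : Setting L k T N R h)
    (hF : TransformFamily L k T N R h S) : BurgersX L k T N h := by
  intro t₀ ht₀ x hx hK hd
  have hjb := hsub.hasFDerivWithinAt hF hs ht₀ hK
  set p := pt L k t₀ with hp
  set w₀ := jk p x with hw₀
  set c := deriv (S t₀) w₀ with hc
  set v := S t₀ w₀ with hv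
  set E : ℂ := ((Real.exp (L * t₀) : ℝ) : ℂ) with hE
  set D := dk p x with hD
  have hjk : w₀ = x + p / x := rfl
  have hDx : D = x - p / x := rfl
  refine ⟨(hF.val t₀ ht₀ x hx hK hd).1, ?_⟩
  -- f is a fractional linear function of S_t(x + p/x), so both of its derivatives follow from
  -- `hjb`; in the combination required, the terms containing ∂_w S cancel.
  obtain ⟨hM0, hfx⟩ := hF.fx_eq ht₀ hx hK hd
  have hpd : HasDerivAt (fun t => ((pt L k t : ℝ) : ℂ)) (L * p) t₀ := by
    have e1 := ((hasDerivAt_exp_mul L t₀).const_mul k).ofReal_comp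
    refine e1.congr_deriv ?_
    simp only [hp, pt]; push_cast; ring
  have hEd : HasDerivAt (fun t => ((Real.exp (L * t) : ℝ) : ℂ)) (L * E) t₀ := by
    refine ((hasDerivAt_exp_mul L t₀).ofReal_comp).congr_deriv ?_
    rw [Complex.ofReal_mul]
  have hjd : HasDerivAt (fun t => jk (pt L k t) x) (L * p / x) t₀ := (hpd.div_const x).const_add x
  have hvd : HasDerivWithinAt (fun t => S t (jk (pt L k t) x))
      (L * E * v * c + c * (L * p / x)) (Ico 0 T) t₀ := by
    have e1 : HasDerivWithinAt (fun t => (t, jk (pt L k t) x)) ((1 : ℝ), (L * p / x : ℂ))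
        (Ico 0 T) t₀ := ((hasDerivAt_id t₀).prodMk hjd).hasDerivWithinAt
    have e2 := HasFDerivWithinAt.comp_hasDerivWithinAt (t := Ico 0 T ×ˢ univ)
      (l := fun y : ℝ × ℂ => S y.1 y.2) t₀ hjb e1 fun t ht => ⟨ht, mem_univ _⟩
    refine e2.congr_deriv ?_
    simp
  have hnum := ((hEd.hasDerivWithinAt (s := Ico 0 T)).fun_mul hvd).fun_add
    ((hpd.div_const x).hasDerivWithinAt (s := Ico 0 T))
  have hden := ((hEd.hasDerivWithinAt (s := Ico 0 T)).fun_mul hvd).add_const x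
  have hft := hnum.fun_div hden hM0
  have hev : ∀ᶠ t in 𝓝[Ico 0 T] t₀, fx L k T N h t x
      = (Real.exp (L * t) * S t (jk (pt L k t) x) + pt L k t / x) /
      (Real.exp (L * t) * S t (jk (pt L k t) x) + x) := by
    have h1 : ContinuousAt (fun t => (t, jk (pt L k t) x)) t₀ := continuousAt_id.prodMk hjd.continuousAt
    have h2 := h1.tendsto.eventually (eventually_notMem_nodes ht₀.2 hs.hN hK)
    have h3 : ∀ᶠ t in 𝓝 t₀, dk (pt L k t) x ≠ 0 :=
      ((hpd.div_const x).const_sub x).continuousAt.eventually_ne hd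
    filter_upwards [nhdsWithin_le_nhds h2, nhdsWithin_le_nhds h3, self_mem_nhdsWithin]
      with t h2 h3 h4 using (hF.fx_eq h4 hx h2 h3).2
  have hft' := hft.congr_of_eventuallyEq hev (hev.self_of_nhdsWithin ht₀)
  refine ⟨hft'.differentiableWithinAt, ?_⟩
  have hud : UniqueDiffWithinAt ℝ (Ico 0 T) t₀ := uniqueDiffOn_Ico 0 T t₀ ht₀
  rw [hft'.derivWithin hud]
  -- the spatial derivative
  have hSx : HasDerivAt (fun x => S t₀ (jk p x)) (c * (D / x)) x :=
    HasDerivAt.comp x (hF.analyticAt ht₀ hK).differentiableAt.hasDerivAt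
      (hasStrictDerivAt_jk p hx).hasDerivAt
  have hnx := ((hSx.const_mul E).fun_add ((hasDerivAt_const x (p : ℂ)).fun_div (hasDerivAt_id x) hx)).fun_div
    ((hSx.const_mul E).fun_add (hasDerivAt_id x)) hM0
  have hevx : ∀ᶠ y in 𝓝 x, fx L k T N h t₀ y
      = (E * S t₀ (jk p y) + p / y) / (E * S t₀ (jk p y) + y) := by
    have h1 := (hasStrictDerivAt_jk p hx).hasDerivAt.continuousAt
    have h2 := h1.eventually (isCompact_nodes.isClosed.isOpen_compl.mem_nhds hK)
    have h3 : ∀ᶠ y in 𝓝 x, dk p y ≠ 0 := by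
      have : ContinuousAt (dk p) x := by
        unfold dk
        exact continuousAt_id.sub (continuousAt_const.div continuousAt_id hx)
      exact this.eventually_ne hd
    filter_upwards [h2, h3, isOpen_ne.mem_nhds hx] with y h2 h3 h4
      using (hF.fx_eq ht₀ h4 h2 h3).2
  have hnx' := hnx.congr_of_eventuallyEq hevx
  rw [hnx'.deriv, hfx]
  change (((L * E * v + E * (L * E * v * c + c * (L * p / x)) + L * p / x) * (E * v + x)
    - (E * v + p / x) * (L * E * v + E * (L * E * v * c + c * (L * p / x)))) / (E * v + x) ^ 2)
    / ((E * v + p / x) / (E * v + x)) - L * x *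
    (((E * (c * (D / x)) + (0 * x - p * 1) / x ^ 2) * (E * v + x)
      - (E * v + p / x) * (E * (c * (D / x)) + 1)) / (E * v + x) ^ 2)
    / (1 - (E * v + p / x) / (E * v + x)) = L * w₀ / D
  have hM0' : E * v + x ≠ 0 := hM0
  have hn0 : E * v + p / x ≠ 0 := by
    intro h0
    have h1 : fx L k T N h t₀ x = (E * v + p / x) / (E * v + x) := hfx
    rw [h0, zero_div] at h1
    exact Complex.exp_ne_zero _ h1
  have h1m : 1 - (E * v + p / x) / (E * v + x) = D / (E * v + x) := by
    rw [hDx]; field_simp; ring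
  have hp' : (p : ℂ) / x = x - D := by rw [hDx]; ring
  have hpp : (p : ℂ) = (x - D) * x := by rw [hDx]; field_simp; ring
  have hD0 : D ≠ 0 := hd
  rw [h1m, hjk]
  rw [show (L : ℂ) * p / x = L * (x - D) by rw [mul_div_assoc, hp'], hp',
    show (0 * x - (p : ℂ) * 1) / x ^ 2 = -(x - D) / x by rw [hpp]; field_simp; ring]
  rw [hp'] at hn0
  field_simp
  ring

end

section

variable {q κ T N : ℝ} {ρ : ℝ → ℝ → ℝ}

/-! ### The coordinate `x = q^{-z}` -/

theorem cpow_eq_exp (hq : 0 < q) (w : ℂ) :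
    (q : ℂ) ^ w = Complex.exp (-(((-Real.log q : ℝ) : ℂ) * w)) := by
  rw [Complex.cpow_def_of_ne_zero (by exact_mod_cast hq.ne'), ← Complex.ofReal_log hq.le]
  push_cast
  congr 1; ring

theorem cpow_neg_eq_exp (hq : 0 < q) (w : ℂ) :
    (q : ℂ) ^ (-w) = Complex.exp (((-Real.log q : ℝ) : ℂ) * w) := by
  rw [cpow_eq_exp hq]; congr 1; ring

theorem pt_div_exp (hq : 0 < q) (κ t : ℝ) (z : ℂ) :
    (κ : ℂ) ^ 2 * (q : ℂ) ^ (z - t)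
      = pt (-Real.log q) (κ ^ 2) t / Complex.exp (((-Real.log q : ℝ) : ℂ) * z) := by
  rw [cpow_eq_exp hq, pt, mul_sub, neg_sub, Complex.exp_sub]
  push_cast
  ring

theorem b_eq_jk (hq : 0 < q) (κ t : ℝ) (z : ℂ) : b q κ t z
    = jk (pt (-Real.log q) (κ ^ 2) t) (Complex.exp (((-Real.log q : ℝ) : ℂ) * z)) := by
  rw [b, jk, cpow_neg_eq_exp hq, pt_div_exp hq]

theorem b_ofReal (hq : 0 < q) (κ t s : ℝ) :
    b q κ t s = node (-Real.log q) (pt (-Real.log q) (κ ^ 2) t) s := by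
  rw [b_eq_jk hq, jk, node]; push_cast; rfl

theorem cut_eq_nodes (hq : 0 < q) (κ T N t : ℝ) : cut q κ T N t
    = nodes (-Real.log q) (pt (-Real.log q) (κ ^ 2) t) (t - T) N := by
  simp only [cut, nodes, b_ofReal hq]

theorem hasDerivAt_cexp_mul (L : ℝ) (z : ℂ) :
    HasDerivAt (fun z : ℂ => Complex.exp (L * z)) (L * Complex.exp (L * z)) z := by
  have := ((hasDerivAt_id z).const_mul (L : ℂ)).cexp
  simpa [mul_comm] using this

theorem deriv_b (hq : 0 < q) (κ t : ℝ) (z : ℂ) : deriv (b q κ t) z = ((-Real.log q : ℝ) : ℂ) *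
    dk (pt (-Real.log q) (κ ^ 2) t) (Complex.exp (((-Real.log q : ℝ) : ℂ) * z)) := by
  have h0 := Complex.exp_ne_zero (((-Real.log q : ℝ) : ℂ) * z)
  have h1 := (hasStrictDerivAt_jk (pt (-Real.log q) (κ ^ 2) t) h0).hasDerivAt.comp z
    (hasDerivAt_cexp_mul (-Real.log q) z)
  have h2 : b q κ t = jk (pt (-Real.log q) (κ ^ 2) t) ∘
      fun z : ℂ => Complex.exp (((-Real.log q : ℝ) : ℂ) * z) := funext fun z => b_eq_jk hq κ t z
  rw [h2, h1.deriv]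
  field_simp

theorem slope_eq_fx (hq : 0 < q) (κ T N : ℝ) (ρ : ℝ → ℝ → ℝ) (t : ℝ) (z : ℂ) :
    slope q κ T N ρ t z = fx (-Real.log q) (κ ^ 2) T N (fun t s => 1 - ρ t s) t
      (Complex.exp (((-Real.log q : ℝ) : ℂ) * z)) := by
  rw [slope, fx, expo, ct, ← intervalIntegral.integral_const_mul]
  congr 2
  refine intervalIntegral.integral_congr fun s _ => ?_
  simp only [deriv_b hq, b_eq_jk hq κ t z, b_ofReal hq]
  ring

theorem firstIntegral_eq (hq : 0 < q) (κ t : ℝ) (z f : ℂ) : firstIntegral q κ t z f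
    = ((Real.exp (-(-Real.log q * t)) : ℝ) : ℂ) *
      (f * Complex.exp (((-Real.log q : ℝ) : ℂ) * z)
        - pt (-Real.log q) (κ ^ 2) t / Complex.exp (((-Real.log q : ℝ) : ℂ) * z)) / (1 - f) := by
  rw [firstIntegral, pt_div_exp hq, cpow_neg_eq_exp hq, cpow_eq_exp hq (t : ℂ)]
  push_cast
  rfl

theorem exists_exp_eq {L : ℝ} (hL : 0 < L) {x : ℂ} (hx : x ≠ 0) :
    ∃ z : ℂ, Complex.exp (L * z) = x ∧ z.im = x.arg / L := by
  refine ⟨Complex.log x / L, ?_, ?_⟩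
  · rw [mul_div_cancel₀ _ (by exact_mod_cast hL.ne'), Complex.exp_log hx]
  · rw [Complex.div_ofReal_im, Complex.log_im]

/-- Chain rule for x = e^{Lz}, which turns ∂_z into L x ∂_x. Differentiability in z is automatic by
`differentiableAt_fx`, so `BurgersX` omits it. -/
theorem burgersDescription_iff (hq : 0 < q) (hq1 : q < 1) {k R : ℝ} (hk : k = κ ^ 2)
    (hs : Setting (-Real.log q) k T N R (fun t s => 1 - ρ t s)) :
    BurgersDescription q κ T N ρ ↔
      BurgersX (-Real.log q) k T N (fun t s => 1 - ρ t s) := by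
  subst hk
  have hL : 0 < -Real.log q := neg_pos.2 (Real.log_neg hq hq1)
  have hL' : ((-Real.log q : ℝ) : ℂ) ≠ 0 := by exact_mod_cast hL.ne'
  set L := -Real.log q with hLd
  have hlogq : ((Real.log q : ℝ) : ℂ) = -(L : ℂ) := by rw [hLd]; push_cast; ring
  have key : ∀ t ∈ Ico 0 T, ∀ z : ℂ, b q κ t z ∉ cut q κ T N t →
      ((slope q κ T N ρ t z ≠ 1 ∧
      DifferentiableWithinAt ℝ (fun τ => slope q κ T N ρ τ z) (Ico 0 T) t ∧
      DifferentiableAt ℂ (slope q κ T N ρ t) z ∧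
      derivWithin (fun τ => slope q κ T N ρ τ z) (Ico 0 T) t / slope q κ T N ρ t z
          + logDeriv (fun ζ => 1 - slope q κ T N ρ t ζ) z
        = Real.log q * ((κ : ℂ) ^ 2 * (q : ℂ) ^ (z - t) + (q : ℂ) ^ (-z))
            / ((κ : ℂ) ^ 2 * (q : ℂ) ^ (z - t) - (q : ℂ) ^ (-z))) ↔
      (fx L (κ ^ 2) T N (fun t s => 1 - ρ t s) t (Complex.exp (L * z)) ≠ 1 ∧
      DifferentiableWithinAt ℝ (fun τ => fx L (κ ^ 2) T N (fun t s => 1 - ρ t s) τ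
        (Complex.exp (L * z))) (Ico 0 T) t ∧
      derivWithin (fun τ => fx L (κ ^ 2) T N (fun t s => 1 - ρ t s) τ
        (Complex.exp (L * z))) (Ico 0 T) t / fx L (κ ^ 2) T N (fun t s => 1 - ρ t s) t
          (Complex.exp (L * z))
        - L * Complex.exp (L * z) * deriv (fx L (κ ^ 2) T N (fun t s => 1 - ρ t s) t)
          (Complex.exp (L * z)) / (1 - fx L (κ ^ 2) T N (fun t s => 1 - ρ t s) t
          (Complex.exp (L * z)))
        = L * jk (pt L (κ ^ 2) t) (Complex.exp (L * z)) /
          dk (pt L (κ ^ 2) t) (Complex.exp (L * z)))) := by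
    intro t ht z hz
    rw [b_eq_jk hq, cut_eq_nodes hq, ← hLd] at hz
    have hd := (differentiableAt_fx hs ht (Complex.exp_ne_zero _) hz).hasDerivAt.comp z
      (hasDerivAt_cexp_mul L z)
    have hfun : slope q κ T N ρ t = fx L (κ ^ 2) T N (fun t s => 1 - ρ t s) t ∘
        fun z : ℂ => Complex.exp (L * z) := funext fun z => slope_eq_fx hq κ T N ρ t z
    have hfunt : (fun τ => slope q κ T N ρ τ z) = fun τ => fx L (κ ^ 2) T N
        (fun t s => 1 - ρ t s) τ (Complex.exp (L * z)) :=
      funext fun τ => slope_eq_fx hq κ T N ρ τ z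
    have hld : logDeriv (fun ζ => 1 - slope q κ T N ρ t ζ) z
        = -(L * Complex.exp (L * z) * deriv (fx L (κ ^ 2) T N (fun t s => 1 - ρ t s) t)
          (Complex.exp (L * z)) / (1 - fx L (κ ^ 2) T N (fun t s => 1 - ρ t s) t
          (Complex.exp (L * z)))) := by
      rw [logDeriv_apply, hfun, (hd.const_sub 1).deriv, Function.comp_apply]
      ring
    have hR : (Real.log q : ℂ) * ((κ : ℂ) ^ 2 * (q : ℂ) ^ (z - t) + (q : ℂ) ^ (-z))
            / ((κ : ℂ) ^ 2 * (q : ℂ) ^ (z - t) - (q : ℂ) ^ (-z))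
        = L * jk (pt L (κ ^ 2) t) (Complex.exp (L * z)) /
          dk (pt L (κ ^ 2) t) (Complex.exp (L * z)) := by
      rw [pt_div_exp hq, cpow_neg_eq_exp hq, ← hLd, hlogq, jk, dk,
        ← neg_sub (Complex.exp (L * z)) (((pt L (κ ^ 2) t : ℝ) : ℂ) / _), div_neg]
      ring
    rw [hld, hR, hfunt, slope_eq_fx hq, ← hLd, ← sub_eq_add_neg]
    have hdz : DifferentiableAt ℂ (slope q κ T N ρ t) z := by
      rw [hfun]; exact hd.differentiableAt
    simp only [hdz, true_and]
  constructor
  · intro hA t ht x hx hK hd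
    obtain ⟨z, hz, -⟩ := exists_exp_eq hL hx
    have hK' : b q κ t z ∉ cut q κ T N t := by
      rw [b_eq_jk hq, cut_eq_nodes hq, ← hLd, hz]; exact hK
    have h1 := (key t ht z hK').1 (hA t ht z hK' (by
      rw [deriv_b hq, ← hLd, hz]; exact mul_ne_zero hL' hd))
    rwa [hz] at h1
  · intro hB t ht z hK hd
    refine (key t ht z hK).2 (hB t ht _ (Complex.exp_ne_zero _) ?_ ?_)
    · rwa [b_eq_jk hq, cut_eq_nodes hq] at hK
    · rw [deriv_b hq] at hd; exact right_ne_zero_of_mul hd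

theorem mem_halfStrip_iff (hq : 0 < q) (hq1 : q < 1) (hκ : 0 < κ) {t : ℝ} {z : ℂ} :
    z ∈ halfStrip q κ t ↔ 0 < z.im ∧ z.im < Real.pi / (-Real.log q) ∧
      ‖Complex.exp (((-Real.log q : ℝ) : ℂ) * z)‖ ^ 2 < pt (-Real.log q) (κ ^ 2) t := by
  have hL : 0 < -Real.log q := neg_pos.2 (Real.log_neg hq hq1)
  rw [halfStrip, mem_ofPred_eq, neg_div, ← div_neg, Complex.norm_exp]
  refine and_congr_right fun _ => and_congr_right fun _ => ?_
  set L := -Real.log q with hLd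
  have h1 : (L * z : ℂ).re = L * z.re := by simp
  have h2 : κ ^ 2 = Real.exp (2 * Real.log κ) := by
    rw [mul_comm, Real.exp_mul, Real.exp_log hκ]; norm_num
  rw [h1, pt, h2, ← Real.exp_add, ← Real.exp_nat_mul, Real.exp_lt_exp, Real.logb,
    show Real.log q = -L by rw [hLd]; ring, div_neg, sub_neg_eq_add]
  push_cast
  constructor
  · intro h
    have := mul_lt_mul_of_pos_left h hL
    rw [mul_add, mul_div_cancel₀ _ hL.ne'] at this
    linarith
  · intro h
    refine lt_of_mul_lt_mul_left ?_ hL.le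
    rw [mul_add, mul_div_cancel₀ _ hL.ne']
    linarith

theorem im_exp_pos {L : ℝ} (hL : 0 < L) {z : ℂ} (h0 : 0 < z.im) (h1 : z.im < Real.pi / L) :
    0 < (Complex.exp (L * z)).im := by
  rw [Complex.exp_im]
  have h2 : (L * z : ℂ).im = L * z.im := by simp
  rw [h2]
  refine mul_pos (Real.exp_pos _) (Real.sin_pos_of_pos_of_lt_pi (mul_pos hL h0) ?_)
  rw [lt_div_iff₀ hL] at h1; linarith

theorem jk_im_neg {p : ℝ} {x : ℂ} (hx : 0 < x.im) (hn : ‖x‖ ^ 2 < p) : (jk p x).im < 0 := by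
  have h1 : (jk p x).im = x.im * (1 - p / ‖x‖ ^ 2) := joukowski_im x p
  have hx0 : x ≠ 0 := by rintro rfl; simp at hx
  have h2 : 0 < ‖x‖ ^ 2 := by positivity
  have h3 : 1 < p / ‖x‖ ^ 2 := by rwa [one_lt_div h2]
  rw [h1]; nlinarith

/-- `b_t` maps the half-strip bijectively onto the lower half-plane. -/
theorem b_im_neg (hq : 0 < q) (hq1 : q < 1) (hκ : 0 < κ) {t : ℝ} {z : ℂ}
    (hz : z ∈ halfStrip q κ t) : (b q κ t z).im < 0 := by
  obtain ⟨h1, h2, h3⟩ := (mem_halfStrip_iff hq hq1 hκ).1 hz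
  have hL : 0 < -Real.log q := neg_pos.2 (Real.log_neg hq hq1)
  rw [b_eq_jk hq]
  exact jk_im_neg (im_exp_pos hL h1 h2) h3

theorem exists_halfStrip (hq : 0 < q) (hq1 : q < 1) (hκ : 0 < κ) (t : ℝ) {w : ℂ}
    (hw : w.im < 0) : ∃ z ∈ halfStrip q κ t, b q κ t z = w := by
  have hL : 0 < -Real.log q := neg_pos.2 (Real.log_neg hq hq1)
  set L := -Real.log q with hLd
  obtain ⟨x, hx, hxw, -, hn⟩ := exists_root_of_im L (pow_pos hκ 2) t hw.ne
  obtain ⟨z, hz, hzi⟩ := exists_exp_eq hL hx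
  have h1 : (jk (pt L (κ ^ 2) t) x).im = x.im * (1 - pt L (κ ^ 2) t / ‖x‖ ^ 2) := joukowski_im x _
  rw [hxw] at h1
  have h2 : 0 < ‖x‖ ^ 2 := by positivity
  have h3 : ‖x‖ ^ 2 < pt L (κ ^ 2) t := by
    refine lt_of_le_of_ne hn fun h4 => ?_
    rw [← h4, div_self h2.ne'] at h1
    linarith
  have h4 : 1 < pt L (κ ^ 2) t / ‖x‖ ^ 2 := by rwa [one_lt_div h2]
  have h5 : 0 < x.im := by
    by_contra h6
    push Not at h6
    nlinarith
  refine ⟨z, (mem_halfStrip_iff hq hq1 hκ).2 ⟨?_, ?_, by rw [← hLd, hz]; exact h3⟩, ?_⟩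
  · rw [hzi]
    refine div_pos (lt_of_le_of_ne (Complex.arg_nonneg_iff.2 h5.le) fun h6 => ?_) hL
    have := (Complex.arg_eq_zero_iff.1 h6.symm).2
    linarith
  · rw [hzi, ← hLd]
    refine div_lt_div_of_pos_right (lt_of_le_of_ne (Complex.arg_le_pi x) fun h6 => ?_) hL
    have := (Complex.arg_eq_pi_iff.1 h6).2
    linarith
  · rw [b_eq_jk hq, ← hLd, hz, hxw]

theorem halfStrip_injOn (hq : 0 < q) (hq1 : q < 1) (hκ : 0 < κ) {t : ℝ} {z u : ℂ}
    (hz : z ∈ halfStrip q κ t) (hu : u ∈ halfStrip q κ t) (h : b q κ t z = b q κ t u) : z = u := by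
  obtain ⟨z1, z2, z3⟩ := (mem_halfStrip_iff hq hq1 hκ).1 hz
  obtain ⟨u1, u2, u3⟩ := (mem_halfStrip_iff hq hq1 hκ).1 hu
  have hL : 0 < -Real.log q := neg_pos.2 (Real.log_neg hq hq1)
  rw [b_eq_jk hq, b_eq_jk hq] at h
  set L := -Real.log q with hLd
  have hp := pt_pos (L := L) (pow_pos hκ 2) t
  have h1 : Complex.exp (L * z) = Complex.exp (L * u) := by
    rcases (jk_eq_iff hp (Complex.exp_ne_zero _) (Complex.exp_ne_zero _)).1 h with h2 | h2
    · exact h2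
    -- The other root has the reciprocal position: the two norms would multiply to p, while both
    -- squares are smaller than p.
    · exfalso
      have h3 := congrArg norm h2
      rw [norm_div, Complex.norm_real, Real.norm_of_nonneg hp.le] at h3
      have hz0 : 0 < ‖Complex.exp (L * z)‖ := norm_pos_iff.2 (Complex.exp_ne_zero _)
      have hu0 : 0 < ‖Complex.exp (L * u)‖ := norm_pos_iff.2 (Complex.exp_ne_zero _)
      rw [eq_div_iff hu0.ne'] at h3
      nlinarith [sq_nonneg (‖Complex.exp (L * z)‖ - ‖Complex.exp (L * u)‖)]
  obtain ⟨n, hn⟩ := Complex.exp_eq_exp_iff_exists_int.1 h1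
  have hi := congrArg Complex.im hn
  simp only [Complex.im_ofReal_mul, Complex.add_im] at hi
  have h4 : ((n : ℂ) * (2 * Real.pi * Complex.I)).im = n * (2 * Real.pi) := by simp
  rw [h4] at hi
  have hpi := Real.pi_pos
  rw [lt_div_iff₀ hL] at z2 u2
  have h5 : (n : ℝ) < 1 := by
    have h6 : 0 < u.im * L := mul_pos u1 hL
    by_contra h7
    push Not at h7
    nlinarith
  have h6 : (-1 : ℝ) < n := by
    have h6 : 0 < z.im * L := mul_pos z1 hL
    by_contra h7
    push Not at h7
    nlinarith
  have h7 : n = 0 := by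
    have a1 : n < 1 := by exact_mod_cast h5
    have a2 : -1 < n := by exact_mod_cast h6
    omega
  rw [h7] at hn
  have hL' : (L : ℂ) ≠ 0 := by exact_mod_cast hL.ne'
  exact mul_left_cancel₀ hL' (by simpa using hn)

end

/-! ### The implicit description is equivalent to subordination. -/

section

variable {q κ T N R : ℝ} {ρ : ℝ → ℝ → ℝ} {S : ℝ → ℂ → ℂ}

theorem exp_coord_of_halfStrip (hq : 0 < q) (hq1 : q < 1) (hκ : 0 < κ) {t : ℝ} {z : ℂ}
    (hz : z ∈ halfStrip q κ t) :
    Complex.exp (((-Real.log q : ℝ) : ℂ) * z) ≠ 0 ∧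
    dk (pt (-Real.log q) (κ ^ 2) t) (Complex.exp (((-Real.log q : ℝ) : ℂ) * z)) ≠ 0 := by
  refine ne_zero_of_jk_im (pt_pos (pow_pos hκ 2) t) ?_
  rw [← b_eq_jk hq]
  exact (b_im_neg hq hq1 hκ hz).ne

/-- Both expressions in `IsBranch` equal b_0(u) - (e^{Lt} - 1) S_0(b_0(u)). The sign condition then
follows from the equation, since b_t(z) lies in the lower half-plane. -/
theorem isBranch_iff (hq : 0 < q) (hq1 : q < 1) (hκ : 0 < κ)
    (hs : Setting (-Real.log q) (κ ^ 2) T N R (fun t s => 1 - ρ t s))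
    (hF : TransformFamily (-Real.log q) (κ ^ 2) T N R (fun t s => 1 - ρ t s) S) {t : ℝ} {z u : ℂ}
    (hz : z ∈ halfStrip q κ t) :
    IsBranch q κ (slope q κ T N ρ 0) t z u ↔ u ∈ halfStrip q κ 0 ∧
      b q κ 0 u - ((Real.exp (-Real.log q * t) - 1 : ℝ) : ℂ) * S 0 (b q κ 0 u) = b q κ t z := by
  have hw := b_im_neg hq hq1 hκ hz
  have main : u ∈ halfStrip q κ 0 →
      (((q : ℂ) ^ (-u) - slope q κ T N ρ 0 u * (κ : ℂ) ^ 2 * (q : ℂ) ^ u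
          - (q : ℂ) ^ (-t : ℂ) * (slope q κ T N ρ 0 u * (q : ℂ) ^ (-u) - (κ : ℂ) ^ 2 * (q : ℂ) ^ u))
        / (1 - slope q κ T N ρ 0 u)
        = b q κ 0 u - ((Real.exp (-Real.log q * t) - 1 : ℝ) : ℂ) * S 0 (b q κ 0 u)) ∧
      (q : ℂ) ^ (-u) + (κ : ℂ) ^ 2 * (q : ℂ) ^ u
      - ((q : ℂ) ^ (-t : ℂ) - 1)
        * ((slope q κ T N ρ 0 u * (q : ℂ) ^ (-u) - (κ : ℂ) ^ 2 * (q : ℂ) ^ u)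
          / (1 - slope q κ T N ρ 0 u))
        = b q κ 0 u - ((Real.exp (-Real.log q * t) - 1 : ℝ) : ℂ) * S 0 (b q κ 0 u) := by
    intro hu
    obtain ⟨hx, hd⟩ := exp_coord_of_halfStrip hq hq1 hκ hu
    have hU := b_im_neg hq hq1 hκ hu
    rw [b_eq_jk hq] at hU
    obtain ⟨h1, h2⟩ := hF.val 0 ⟨le_rfl, hs.hT⟩ _ hx (notMem_nodes_of_im_ne hU.ne) hd
    rw [b_eq_jk hq, h2, slope_eq_fx hq, cpow_neg_eq_exp hq, cpow_neg_eq_exp hq, cpow_eq_exp hq u,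
      Complex.exp_neg]
    set ξ := Complex.exp (((-Real.log q : ℝ) : ℂ) * u)
    set f := fx (-Real.log q) (κ ^ 2) T N (fun t s => 1 - ρ t s) 0 ξ
    have h3 : 1 - f ≠ 0 := sub_ne_zero.2 (Ne.symm h1)
    simp only [pt_zero, jk, dk, mul_zero, neg_zero, Real.exp_zero]
    push_cast
    constructor <;> field_simp <;> ring
  constructor
  · rintro ⟨h1, h2, -⟩
    exact ⟨h2, by rw [h1]; exact (main h2).1.symm⟩
  · rintro ⟨h1, h2⟩
    refine ⟨by rw [(main h1).1, h2], h1, ?_⟩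
    rw [(main h1).2, h2]
    exact hw

/-- Along a characteristic the numerator and denominator share the factor β / e^{Lt}; this is why t
= 0 is excluded. -/
theorem branch_ratio_eq (hq : 0 < q) {t β : ℝ} {z u v : ℂ}
    (hβ : β = Real.exp (-Real.log q * t) - 1) (hβ0 : β ≠ 0)
    (hv : b q κ 0 u - β * v = b q κ t z) :
    (((q : ℂ) ^ (-u) + (κ : ℂ) ^ 2 * (q : ℂ) ^ u)
            - ((q : ℂ) ^ (-z) + (κ : ℂ) ^ 2 * (q : ℂ) ^ z))
          / (((q : ℂ) ^ (-u) + (κ : ℂ) ^ 2 * (q : ℂ) ^ u)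
            - ((q : ℂ) ^ (-z + t) + (κ : ℂ) ^ 2 * (q : ℂ) ^ (z - t)))
      = (Real.exp (-Real.log q * t) * v + pt (-Real.log q) (κ ^ 2) t /
          Complex.exp (((-Real.log q : ℝ) : ℂ) * z)) /
        (Real.exp (-Real.log q * t) * v + Complex.exp (((-Real.log q : ℝ) : ℂ) * z)) := by
  have h0 : (q : ℂ) ^ (-u) + (κ : ℂ) ^ 2 * (q : ℂ) ^ u = b q κ 0 u := by simp [b]
  have h1 : b q κ 0 u = b q κ t z + β * v := by rw [← hv]; ring
  rw [h0, h1, b_eq_jk hq, pt_div_exp hq, cpow_neg_eq_exp hq, cpow_eq_exp hq z,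
    cpow_eq_exp hq (-z + t), Complex.exp_neg (_ * z), mul_add, mul_neg, neg_add, neg_neg,
    Complex.exp_add, Complex.exp_neg]
  have hE : ((Real.exp (-Real.log q * t) : ℝ) : ℂ) = Complex.exp (((-Real.log q : ℝ) : ℂ) * t) := by
    push_cast; rfl
  have hβ' : (β : ℂ) = Complex.exp (((-Real.log q : ℝ) : ℂ) * t) - 1 := by
    rw [hβ, Complex.ofReal_sub, hE, Complex.ofReal_one]
  have hβ0' : (β : ℂ) ≠ 0 := by exact_mod_cast hβ0
  rw [hE]
  have hp : ((pt (-Real.log q) (κ ^ 2) t : ℝ) : ℂ)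
      = (κ : ℂ) ^ 2 * Complex.exp (((-Real.log q : ℝ) : ℂ) * t) := by
    rw [pt, Complex.ofReal_mul, hE]; push_cast; rfl
  rw [jk, hp]
  have hx := Complex.exp_ne_zero (((-Real.log q : ℝ) : ℂ) * z)
  have hE0 := Complex.exp_ne_zero (((-Real.log q : ℝ) : ℂ) * t)
  set x := Complex.exp (((-Real.log q : ℝ) : ℂ) * z)
  set E := Complex.exp (((-Real.log q : ℝ) : ℂ) * t)
  have e1 : x + (κ : ℂ) ^ 2 * E / x + β * v - (x + (κ : ℂ) ^ 2 * x⁻¹)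
      = (β / E) * (E * v + (κ : ℂ) ^ 2 * E / x) := by
    rw [hβ']; field_simp; ring
  have e2 : x + (κ : ℂ) ^ 2 * E / x + β * v - (x * E⁻¹ + (κ : ℂ) ^ 2 * E / x)
      = (β / E) * (E * v + x) := by
    rw [hβ']; field_simp; ring
  rw [e1, e2, mul_div_mul_left _ _ (div_ne_zero hβ0' hE0)]

/-- The implicit description is equivalent to subordination. -/
theorem implicitDescription_iff (hq : 0 < q) (hq1 : q < 1) (hκ : 0 < κ)
    (hs : Setting (-Real.log q) (κ ^ 2) T N R (fun t s => 1 - ρ t s))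
    (hF : TransformFamily (-Real.log q) (κ ^ 2) T N R (fun t s => 1 - ρ t s) S) :
    ImplicitDescription q κ T N ρ ↔ Subordinated (-Real.log q) T S := by
  have hL := hs.hL
  have hβ : ∀ t ∈ Ioo 0 T, 0 < Real.exp (-Real.log q * t) - 1 := fun t ht => by
    have := Real.one_lt_exp_iff.2 (mul_pos hL ht.1); linarith
  have hslope : ∀ t ∈ Ioo 0 T, ∀ z ∈ halfStrip q κ t,
      Real.exp (-Real.log q * t) * S t (b q κ t z) + Complex.exp (((-Real.log q : ℝ) : ℂ) * z) ≠ 0 ∧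
      slope q κ T N ρ t z = (Real.exp (-Real.log q * t) * S t (b q κ t z)
        + pt (-Real.log q) (κ ^ 2) t / Complex.exp (((-Real.log q : ℝ) : ℂ) * z)) /
        (Real.exp (-Real.log q * t) * S t (b q κ t z)
          + Complex.exp (((-Real.log q : ℝ) : ℂ) * z)) := by
    intro t ht z hz
    obtain ⟨hx, hd⟩ := exp_coord_of_halfStrip hq hq1 hκ hz
    have hw := b_im_neg hq hq1 hκ hz
    rw [b_eq_jk hq] at hw
    rw [slope_eq_fx hq, b_eq_jk hq]
    exact hF.fx_eq ⟨ht.1.le, ht.2⟩ hx (notMem_nodes_of_im_ne hw.ne) hd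
  constructor
  · intro hB
    refine subordinated_of_lower hF fun t ht w hw => ?_
    rcases ht.1.eq_or_lt with rfl | ht0
    · simpa using hw
    have ht' : t ∈ Ioo 0 T := ⟨ht0, ht.2⟩
    obtain ⟨z, hz, rfl⟩ := exists_halfStrip hq hq1 hκ t hw
    obtain ⟨⟨u, hu, -⟩, h2⟩ := hB t ht' z hz
    have hr := h2 u hu
    obtain ⟨hu0, hHu⟩ := (isBranch_iff hq hq1 hκ hs hF hz).1 hu
    rw [branch_ratio_eq hq rfl (hβ t ht').ne' hHu] at hr
    obtain ⟨hne, hsl⟩ := hslope t ht' z hz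
    obtain ⟨hx, hd⟩ := exp_coord_of_halfStrip hq hq1 hκ hz
    have hf0 : slope q κ T N ρ t z ≠ 0 := Complex.exp_ne_zero _
    have hne0 : Real.exp (-Real.log q * t) * S 0 (b q κ 0 u)
        + Complex.exp (((-Real.log q : ℝ) : ℂ) * z) ≠ 0 := fun h0 => by
      rw [h0, div_zero] at hr; exact hf0 hr
    have hE : ((Real.exp (-Real.log q * t) : ℝ) : ℂ) ≠ 0 := by
      exact_mod_cast (Real.exp_pos _).ne'
    -- The fractional linear map v ↦ (E v + p/x)/(E v + x) is injective because x - p/x ≠ 0, so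
    -- equal slopes give equal transforms.
    have hv : S t (b q κ t z) = S 0 (b q κ 0 u) := by
      rw [hsl, div_eq_div_iff hne hne0] at hr
      refine sub_eq_zero.1 ?_
      have h3 : (((Real.exp (-Real.log q * t) : ℝ) : ℂ) *
          dk (pt (-Real.log q) (κ ^ 2) t) (Complex.exp (((-Real.log q : ℝ) : ℂ) * z))) *
          (S t (b q κ t z) - S 0 (b q κ 0 u)) = 0 := by
        rw [dk]; linear_combination hr
      exact (mul_eq_zero.1 h3).resolve_left (mul_ne_zero hE hd)
    have h4 : b q κ t z + ((Real.exp (-Real.log q * t) - 1 : ℝ) : ℂ) * S t (b q κ t z)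
        = b q κ 0 u := by rw [hv, ← hHu]; ring
    rw [h4]
    exact ⟨b_im_neg hq hq1 hκ hu0, hv.symm⟩
  · intro hsub t ht z hz
    have ht' : t ∈ Ico 0 T := ⟨ht.1.le, ht.2⟩
    have hw := b_im_neg hq hq1 hκ hz
    refine ⟨?_, fun u hu => ?_⟩
    · obtain ⟨U, hU, hHU⟩ := hF.exists_subordinate hs ht' hw
      obtain ⟨u, hu, rfl⟩ := exists_halfStrip hq hq1 hκ 0 hU
      refine ⟨u, (isBranch_iff hq hq1 hκ hs hF hz).2 ⟨hu, hHU⟩, fun u' hu' => ?_⟩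
      obtain ⟨hu'0, hHu'⟩ := (isBranch_iff hq hq1 hκ hs hF hz).1 hu'
      exact halfStrip_injOn hq hq1 hκ hu'0 hu (hF.unique (hβ t ht).le
        (mul_pos_of_neg_of_neg (b_im_neg hq hq1 hκ hu'0) hw) (mul_pos_of_neg_of_neg hU hw)
        hHu' hHU)
    · obtain ⟨hu0, hHu⟩ := (isBranch_iff hq hq1 hκ hs hF hz).1 hu
      rw [branch_ratio_eq hq rfl (hβ t ht).ne' hHu, (hslope t ht z hz).2,
        hsub.eq_of hF hL ht' (mul_pos_of_neg_of_neg (b_im_neg hq hq1 hκ hu0) hw) hHu]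

end

/-! ### The functional relation is equivalent to subordination. -/

section

variable {q κ L k T N R : ℝ} {h ρ : ℝ → ℝ → ℝ} {S : ℝ → ℂ → ℂ}

open Bornology in
theorem tendsto_cobounded_of_tendsto_div {g : ℂ → ℂ} {a : ℂ} (ha : a ≠ 0)
    (hg : Tendsto (fun w => g w / w) (cobounded ℂ) (𝓝 a)) :
    Tendsto g (cobounded ℂ) (cobounded ℂ) := by
  rw [← tendsto_norm_atTop_iff_cobounded]
  refine (hg.norm.pos_mul_atTop (norm_pos_iff.2 ha) tendsto_norm_cobounded_atTop).congr' ?_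
  filter_upwards [eventually_ne_cobounded 0] with w hw
  rw [norm_div, div_mul_cancel₀ _ (norm_ne_zero_iff.2 hw)]

open Bornology in
theorem tendsto_add_mul_div {g : ℂ → ℂ} {a : ℂ} (β : ℂ)
    (hg : Tendsto (fun w => g w / w) (cobounded ℂ) (𝓝 a)) :
    Tendsto (fun w => (w + β * g w) / w) (cobounded ℂ) (𝓝 (1 + β * a)) := by
  refine ((hg.const_mul β).const_add 1).congr' ?_
  filter_upwards [eventually_ne_cobounded 0] with w hw
  rw [add_div, div_self hw, mul_div_assoc]

theorem exp_sub_exp_pos (hL : 0 < L) {t : ℝ} (ht : t ∈ Ico 0 T) :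
    0 < Real.exp (L * T) - Real.exp (L * t) :=
  sub_pos.2 (Real.exp_lt_exp.2 (mul_lt_mul_of_pos_left ht.2 hL))

theorem exp_sub_one_nonneg (hL : 0 < L) {t : ℝ} (ht : t ∈ Ico 0 T) : 0 ≤ Real.exp (L * t) - 1 := by
  have := Real.one_le_exp (mul_nonneg hL.le ht.1); linarith

/-- Under subordination each `S_t` has a Nevanlinna form. -/
theorem Subordinated.exists_nev (hsub : Subordinated L T S) (hF : TransformFamily L k T N R h S)
    (hs : Setting L k T N R h) {t : ℝ} (ht : t ∈ Ico 0 T) :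
    ∃ (A B C : ℝ) (μ : Measure ℝ), IsFiniteMeasure μ ∧ μ (Icc A B)ᶜ = 0 ∧
    nodes L (pt L k t) (t - T) N = seg A B ∧
    ∀ w, w ∉ seg A B → S t w = nev (Real.exp (L * T) - Real.exp (L * t)) C μ w := by
  have hlt : t - T < N := by linarith [hs.hN, ht.2]
  obtain ⟨A, B, -, hseg, hAB⟩ := exists_nodes_eq_seg (p := pt L k t) hs.hL.ne' hlt.le
  obtain ⟨C, hC⟩ := exists_affine_at_infinity isCompact_nodes (hF.diff t ht) (hF.symm t ht)
    (hF.lim t ht)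
  have hpos : ∀ w : ℂ, 0 < w.im → 0 ≤ (S t w).im := by
    intro w hw
    obtain ⟨h1, h2⟩ := hsub t ht w hw.ne'
    have hu := pos_of_mul_pos_left h1 hw.le
    obtain ⟨A', B', C', μ', hfin, hμ', -, hS⟩ := hF.nev0
    rw [← h2, hS _ (notMem_seg_of_im_ne hu.ne'), nev_im hμ' (notMem_seg_of_im_ne hu.ne')]
    have h3 := exp_sub_exp_pos hs.hL (t := 0) ⟨le_rfl, hs.hT⟩
    rw [mul_zero, Real.exp_zero] at h3
    have h4 := energy_nonneg μ' (w + ((Real.exp (L * t) - 1 : ℝ) : ℂ) * S t w)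
    positivity
  have hd := hF.diff t ht
  have hsy := hF.symm t ht
  rw [hseg] at hd hsy
  obtain ⟨μ, h1, h2, h3⟩ := herglotz_repr (hAB hlt) hd hsy hpos hC
  refine ⟨A, B, C, μ, h1, h2, hseg, fun w hw => ?_⟩
  rw [h3 w hw, nev]
  push_cast
  ring

open Bornology in
-- Functional inverses live on a full neighbourhood of infinity, so the relation is extended to
-- large real w by continuity.
theorem Subordinated.eventually_eq (hsub : Subordinated L T S)
    (hF : TransformFamily L k T N R h S) (hs : Setting L k T N R h) {t : ℝ} (ht : t ∈ Ico 0 T) :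
    ∀ᶠ w in cobounded ℂ, S 0 (w + ((Real.exp (L * t) - 1 : ℝ) : ℂ) * S t w) = S t w := by
  have hc := exp_sub_exp_pos hs.hL ht
  have hβ := exp_sub_one_nonneg hs.hL ht
  have h1 := tendsto_cobounded_of_tendsto_div (by
    have : 0 < 1 + (Real.exp (L * t) - 1) * (1 / (Real.exp (L * T) - Real.exp (L * t))) := by
      positivity
    exact_mod_cast this.ne') (tendsto_add_mul_div ((Real.exp (L * t) - 1 : ℝ) : ℂ) (hF.lim t ht))
  filter_upwards [eventually_notMem_of_isCompact (isCompact_nodes (L := L) (p := pt L k t)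
    (lo := t - T) (hi := N)), h1.eventually (eventually_notMem_of_isCompact
    (isCompact_nodes (L := L) (p := pt L k 0) (lo := 0 - T) (hi := N)))] with w h2 h3
  have hc1 : ContinuousAt (S t) w := (hF.analyticAt ht h2).continuousAt
  have hc2 : ContinuousAt (S 0) (w + ((Real.exp (L * t) - 1 : ℝ) : ℂ) * S t w) :=
    (hF.analyticAt ⟨le_rfl, hs.hT⟩ h3).continuousAt
  by_cases him : w.im = 0
  · set ℓ : ℝ → ℂ := fun ε => w + ε * Complex.I with hℓ
    have hℓt : Tendsto ℓ (𝓝[≠] 0) (𝓝 w) := by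
      have : Continuous ℓ := by fun_prop
      have := this.tendsto 0
      rw [show ℓ 0 = w by simp [hℓ]] at this
      exact this.mono_left nhdsWithin_le_nhds
    have e1 := hc1.tendsto.comp hℓt
    have e2 := hc2.tendsto.comp (hℓt.add (e1.const_mul ((Real.exp (L * t) - 1 : ℝ) : ℂ)))
    refine tendsto_nhds_unique (e2.congr' ?_) e1
    filter_upwards [self_mem_nhdsWithin] with ε hε
    exact (hsub t ht (ℓ ε) (by simpa [hℓ, him] using hε)).2
  · exact (hsub t ht w him).2

theorem TransformFamily.firstIntegral_eq (hq : 0 < q) {t : ℝ} {x z f : ℂ}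
    (hx : Complex.exp (((-Real.log q : ℝ) : ℂ) * z) = x) (hf : f ≠ 1) :
    firstIntegral q κ t z f = Real.exp (-(-Real.log q * t)) *
      (-x + dk (pt (-Real.log q) (κ ^ 2) t) x / (1 - f)) := by
  have h1 : 1 - f ≠ 0 := sub_ne_zero.2 (Ne.symm hf)
  have hx0 : x ≠ 0 := by rw [← hx]; exact Complex.exp_ne_zero _
  rw [LimitShape.firstIntegral_eq hq, hx, dk]
  field_simp
  ring

theorem TransformFamily.isTransform (hq : 0 < q)
    (hF : TransformFamily (-Real.log q) (κ ^ 2) T N R (fun t s => 1 - ρ t s) S) {t : ℝ}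
    (ht : t ∈ Ico 0 T) : IsTransform q κ T N ρ t (S t) := by
  rw [IsTransform, cut_eq_nodes hq]
  refine ⟨hF.diff t ht, fun z hz hd => ?_⟩
  rw [b_eq_jk hq] at hz ⊢
  rw [deriv_b hq] at hd
  obtain ⟨h1, h2⟩ := hF.val t ht _ (Complex.exp_ne_zero _) hz (right_ne_zero_of_mul hd)
  rw [slope_eq_fx hq]
  exact ⟨h1, by rw [h2, TransformFamily.firstIntegral_eq hq rfl h1]⟩

/-- Any transform agrees with the constructed one off the real axis. -/
theorem TransformFamily.eq_of_isTransform (hq : 0 < q) (hq1 : q < 1) (hκ : 0 < κ)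
    (hF : TransformFamily (-Real.log q) (κ ^ 2) T N R (fun t s => 1 - ρ t s) S) {t : ℝ}
    (ht : t ∈ Ico 0 T) {S' : ℂ → ℂ} (hS' : IsTransform q κ T N ρ t S') {w : ℂ} (hw : w.im ≠ 0) :
    S' w = S t w := by
  have hL : 0 < -Real.log q := neg_pos.2 (Real.log_neg hq hq1)
  obtain ⟨x, hx, rfl, hd, -⟩ := exists_root_of_im (-Real.log q) (pow_pos hκ 2) t hw
  obtain ⟨z, hz, -⟩ := exists_exp_eq hL hx
  have hK := notMem_nodes_of_im_ne (L := -Real.log q) (p := pt (-Real.log q) (κ ^ 2) t)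
    (lo := t - T) (hi := N) hw
  have hK' := hK
  rw [← hz, ← b_eq_jk hq, ← cut_eq_nodes hq] at hK
  have hd' : deriv (b q κ t) z ≠ 0 := by
    rw [deriv_b hq, hz]; exact mul_ne_zero (by exact_mod_cast hL.ne') hd
  obtain ⟨h1, h2⟩ := hS'.2 z hK hd'
  rw [TransformFamily.firstIntegral_eq hq hz h1, b_eq_jk hq, slope_eq_fx hq, hz] at h2
  rw [h2, (hF.val t ht x hx hK' hd).2]

theorem cpow_neg_ofReal (hq : 0 < q) (t : ℝ) :
    (q : ℂ) ^ (-t : ℂ) = ((Real.exp (-Real.log q * t) : ℝ) : ℂ) := by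
  rw [cpow_neg_eq_exp hq]; push_cast; rfl

open Bornology in
-- At w = G_t(v), subordination reads S_0(G_t(v) + (e^{Lt} - 1) v) = v; applying G_0 gives the
-- functional relation.
theorem Subordinated.invariantDescription (hq : 0 < q)
    (hs : Setting (-Real.log q) (κ ^ 2) T N R (fun t s => 1 - ρ t s))
    (hF : TransformFamily (-Real.log q) (κ ^ 2) T N R (fun t s => 1 - ρ t s) S)
    (hsub : Subordinated (-Real.log q) T S) : InvariantDescription q κ T N ρ := by
  have hL := hs.hL
  have hcne : ∀ t ∈ Ico 0 T, ((Real.exp (-Real.log q * T) - Real.exp (-Real.log q * t) : ℝ) : ℂ) ≠ 0 :=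
    fun t ht => by exact_mod_cast (exp_sub_exp_pos hL ht).ne'
  have hex : ∀ t ∈ Ico 0 T, ∃ G : ℂ → ℂ, IsInverseAtInfinity (S t) G
      ((Real.exp (-Real.log q * T) - Real.exp (-Real.log q * t) : ℝ) : ℂ) := fun t ht => by
    refine exists_inverse_at_infinity isCompact_nodes (hcne t ht) (hF.diff t ht) ?_
    have := hF.lim t ht
    rwa [Complex.ofReal_div, Complex.ofReal_one] at this
  choose! G hG using hex
  have h0 : (0 : ℝ) ∈ Ico 0 T := ⟨le_rfl, hs.hT⟩
  refine ⟨S, G, fun t ht => ⟨hF.isTransform hq ht, ?_, ?_, ?_⟩⟩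
  · obtain ⟨A, B, C, μ, h1, h2, h3, h4⟩ := hsub.exists_nev hF hs ht
    refine ⟨μ, C, h1, ?_, fun w hw => ?_⟩
    · rw [cut_eq_nodes hq, h3]
      simp only [ofReal_mem_seg]
      exact h2
    · rw [cut_eq_nodes hq, h3] at hw
      rw [h4 w hw, nev, cpow_neg_ofReal hq, cpow_neg_ofReal hq, Complex.ofReal_sub]
  · rw [cpow_neg_ofReal hq, cpow_neg_ofReal hq, ← Complex.ofReal_sub]
    exact hG t ht
  · obtain ⟨g1, g2, g3⟩ := hG t ht
    obtain ⟨-, g5, -⟩ := hG 0 h0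
    set c := ((Real.exp (-Real.log q * T) - Real.exp (-Real.log q * t) : ℝ) : ℂ) with hc
    set β := ((Real.exp (-Real.log q * t) - 1 : ℝ) : ℂ) with hβ
    have hGdiv : Tendsto (fun v => G t v / v) (cobounded ℂ) (𝓝 c) := by
      have := (g3.tendsto_div_nhds_zero).add_const c
      rw [zero_add] at this
      refine this.congr' ?_
      filter_upwards [eventually_ne_cobounded 0] with v hv
      field_simp
      ring
    have hGc := tendsto_cobounded_of_tendsto_div (hcne t ht) hGdiv
    have hXc : Tendsto (fun v => G t v + β * v) (cobounded ℂ) (cobounded ℂ) := by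
      refine tendsto_cobounded_of_tendsto_div (a := c + β) ?_ ?_
      · have h1 := exp_sub_exp_pos hL ht
        have h2 := exp_sub_one_nonneg hL ht
        rw [hc, hβ, ← Complex.ofReal_add]
        exact_mod_cast (by positivity : (0 : ℝ) < _ + _).ne'
      · refine (hGdiv.add_const β).congr' ?_
        filter_upwards [eventually_ne_cobounded 0] with v hv
        field_simp
    filter_upwards [g1, hGc.eventually (hsub.eventually_eq hF hs ht), hXc.eventually g5]
      with v h1 h2 h3
    rw [h1] at h2
    rw [h2] at h3
    rw [h3, cpow_neg_ofReal hq, hβ]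
    push_cast
    ring

open Bornology in
-- The Nevanlinna form of S_t shows that w + (e^{Lt} - 1) S_t(w) keeps the lower half-plane. There
-- the functional relation gives subordination for large w, and the identity theorem extends it to
-- the whole half-plane.
theorem InvariantDescription.subordinated (hq : 0 < q) (hq1 : q < 1) (hκ : 0 < κ)
    (hs : Setting (-Real.log q) (κ ^ 2) T N R (fun t s => 1 - ρ t s))
    (hF : TransformFamily (-Real.log q) (κ ^ 2) T N R (fun t s => 1 - ρ t s) S)
    (hC : InvariantDescription q κ T N ρ) : Subordinated (-Real.log q) T S := by
  have hL := hs.hL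
  obtain ⟨S', G, hSG⟩ := hC
  have h0 : (0 : ℝ) ∈ Ico 0 T := ⟨le_rfl, hs.hT⟩
  refine subordinated_of_lower hF fun t ht => ?_
  obtain ⟨h1, ⟨μ, C, hfin, hμ, hform⟩, ⟨g1, g2, -⟩, hrel⟩ := hSG t ht
  obtain ⟨h1', -, ⟨g1', -, -⟩, -⟩ := hSG 0 h0
  have heq := fun (w : ℂ) (hw : w.im ≠ 0) => hF.eq_of_isTransform hq hq1 hκ ht h1 hw
  have heq0 := fun (w : ℂ) (hw : w.im ≠ 0) => hF.eq_of_isTransform hq hq1 hκ h0 h1' hw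
  have hc := exp_sub_exp_pos hL ht
  have hβ := exp_sub_one_nonneg hL ht
  have hneg : ∀ w : ℂ, w.im < 0 → (w + ((Real.exp (-Real.log q * t) - 1 : ℝ) : ℂ) * S t w).im < 0 := by
    intro w hw
    have hlt : t - T < N := by linarith [hs.hN, ht.2]
    obtain ⟨A, B, -, hseg, -⟩ := exists_nodes_eq_seg
      (p := pt (-Real.log q) (κ ^ 2) t) hL.ne' hlt.le
    rw [cut_eq_nodes hq, hseg] at hμ hform
    simp only [ofReal_mem_seg] at hμ
    have h2 : S t w = nev (Real.exp (-Real.log q * T) - Real.exp (-Real.log q * t)) C μ w := by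
      rw [← heq w hw.ne, hform w (notMem_seg_of_im_ne hw.ne), nev, cpow_neg_ofReal hq,
        cpow_neg_ofReal hq, Complex.ofReal_sub]
    rw [Complex.add_im, Complex.im_ofReal_mul, h2, nev_im hμ (notMem_seg_of_im_ne hw.ne)]
    have h3 := energy_nonneg μ w
    have h4 : 0 ≤ (Real.exp (-Real.log q * t) - 1) *
      (1 / (Real.exp (-Real.log q * T) - Real.exp (-Real.log q * t)) + energy μ w) := by positivity
    nlinarith
  have hSt : Tendsto (S t) (cobounded ℂ) (cobounded ℂ) :=
    tendsto_cobounded_of_tendsto_div (by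
      have : 0 < 1 / (Real.exp (-Real.log q * T) - Real.exp (-Real.log q * t)) := by positivity
      exact_mod_cast this.ne') (hF.lim t ht)
  have hfar : ∀ᶠ w in cobounded ℂ, w.im < 0 →
      S 0 (w + ((Real.exp (-Real.log q * t) - 1 : ℝ) : ℂ) * S t w) = S t w := by
    filter_upwards [g2, hSt.eventually hrel, hSt.eventually g1'] with w e1 e2 e3 hw
    rw [heq w hw.ne] at e1
    rw [e1, cpow_neg_ofReal hq] at e2
    have e4 : G 0 (S t w) = w + ((Real.exp (-Real.log q * t) - 1 : ℝ) : ℂ) * S t w := by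
      push_cast
      push_cast at e2
      linear_combination -e2
    rw [e4, heq0 _ (hneg w hw).ne] at e3
    exact e3
  obtain ⟨M, -, hM⟩ := (Metric.hasBasis_cobounded_compl_closedBall (0 : ℂ)).eventually_iff.1 hfar
  set w₀ : ℂ := -((|M| + 1 : ℝ) : ℂ) * Complex.I with hw₀
  have hw₀im : w₀.im < 0 := by
    have := abs_nonneg M
    simp [hw₀]; linarith
  have hw₀n : w₀ ∈ (Metric.closedBall (0 : ℂ) M)ᶜ := by
    rw [mem_compl_iff, mem_closedBall_zero_iff, hw₀, norm_mul, norm_neg, Complex.norm_real,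
      Complex.norm_I, mul_one, not_le]
    exact lt_of_lt_of_le (lt_of_le_of_lt (le_abs_self M) (lt_add_one _)) (le_abs_self _)
  have hopen : IsOpen {w : ℂ | w.im < 0} := isOpen_lt Complex.continuous_im continuous_const
  have han1 : AnalyticOnNhd ℂ (S t) {w : ℂ | w.im < 0} := fun w hw =>
    hF.analyticAt ht (notMem_nodes_of_im_ne (ne_of_lt hw))
  have han2 : AnalyticOnNhd ℂ
      (fun w => S 0 (w + ((Real.exp (-Real.log q * t) - 1 : ℝ) : ℂ) * S t w))
      {w : ℂ | w.im < 0} := fun w hw =>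
    AnalyticAt.comp (g := S 0) (hF.analyticAt h0 (notMem_nodes_of_im_ne (hneg w hw).ne))
      (analyticAt_id.add (analyticAt_const.mul (han1 w hw)))
  have hid := han2.eqOn_of_preconnected_of_eventuallyEq han1 isPreconnected_lowerHalfPlane hw₀im (by
    filter_upwards [hopen.mem_nhds hw₀im, Metric.isClosed_closedBall.isOpen_compl.mem_nhds hw₀n]
      with w e1 e2 using hM e2 e1)
  exact fun w hw => ⟨hneg w hw, hid hw⟩

end

/-! ### Moments determine a bounded density. -/

section

variable {lo hi : ℝ} {δ m : ℝ → ℝ}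

theorem intervalIntegrable_mul_of_bounded (hδ : Measurable δ) (hδ1 : ∀ s, |δ s| ≤ 1) {k : ℝ → ℝ}
    (hk : ContinuousOn k (uIcc lo hi)) : IntervalIntegrable (fun s => δ s * k s) volume lo hi := by
  refine IntervalIntegrable.mul_continuousOn ?_ hk
  rw [intervalIntegrable_iff]
  exact Measure.integrableOn_of_bounded (M := 1) (by simp) hδ.aestronglyMeasurable
    (Eventually.of_forall hδ1)

/-- A bounded function with vanishing Cauchy transform along `m` has vanishing moments. -/
theorem moments_eq_zero_of_transform (hlh : lo ≤ hi) (hδ : Measurable δ) (hδ1 : ∀ s, |δ s| ≤ 1)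
    (hm : Continuous m)
    (h0 : ∀ w : ℂ, w.im ≠ 0 → ∫ s in lo..hi, (δ s : ℂ) * (1 / (w - m s)) = 0) (n : ℕ) :
    ∫ s in lo..hi, δ s * m s ^ n = 0 := by
  have hint : ∀ n : ℕ, IntervalIntegrable (fun s => ((δ s * m s ^ n : ℝ) : ℂ)) volume lo hi :=
    fun n => by
      have := intervalIntegrable_mul_of_bounded (lo := lo) (hi := hi) hδ hδ1
        (hm.pow n).continuousOn
      exact ⟨this.1.ofReal, this.2.ofReal⟩
  have hne : ∀ w : ℂ, w.im ≠ 0 → ∀ s : ℝ, w - m s ≠ 0 := fun w hw s h => hw (by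
    rw [sub_eq_zero.1 h, Complex.ofReal_im])
  have hd : ∀ n : ℕ, ∀ w : ℂ, w.im ≠ 0 →
      ∫ s in lo..hi, ((δ s * m s ^ n : ℝ) : ℂ) * (1 / (w - m s)) = 0 := by
    intro n
    induction n with
    | zero => simpa using h0
    | succ n ih =>
      -- From m^{n+1}/(w - m) = w m^n/(w - m) - m^n and the induction hypothesis, the next transform
      -- does not depend on w; letting w = iY go to infinity shows that it is 0.
      have hstep : ∀ w : ℂ, w.im ≠ 0 →
          ∫ s in lo..hi, ((δ s * m s ^ (n + 1) : ℝ) : ℂ) * (1 / (w - m s))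
            = -∫ s in lo..hi, ((δ s * m s ^ n : ℝ) : ℂ) := by
        intro w hw
        have hc : ContinuousOn (fun s : ℝ => 1 / (w - m s)) (uIcc lo hi) :=
          continuousOn_const.div (by fun_prop) fun s _ => hne w hw s
        have h1 := (hint n).mul_continuousOn hc
        have h2 : ∀ s : ℝ, ((δ s * m s ^ (n + 1) : ℝ) : ℂ) * (1 / (w - m s))
            = w * (((δ s * m s ^ n : ℝ) : ℂ) * (1 / (w - m s))) - ((δ s * m s ^ n : ℝ) : ℂ) := by
          intro s
          have := hne w hw s
          field_simp
          push_cast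
          ring
        simp_rw [h2]
        rw [intervalIntegral.integral_sub (h1.const_mul w) (hint n),
          intervalIntegral.integral_const_mul, ih w hw, mul_zero, zero_sub]
      obtain ⟨K, hK⟩ := (isCompact_Icc (a := lo) (b := hi)).exists_bound_of_continuousOn
        (f := fun s => m s ^ (n + 1)) (hm.pow _).continuousOn
      have hbound : ∀ Y : ℝ, 0 < Y →
          ‖∫ s in lo..hi, ((δ s * m s ^ n : ℝ) : ℂ)‖ ≤ |K| * |hi - lo| * Y⁻¹ := by
        intro Y hY
        have hw : (Y * Complex.I).im ≠ 0 := by simpa using hY.ne'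
        rw [← norm_neg, ← hstep _ hw]
        refine (intervalIntegral.norm_integral_le_of_norm_le_const (C := |K| * Y⁻¹)
          fun s hs => ?_).trans_eq (by ring)
        rw [uIoc_of_le hlh] at hs
        have h3 : Y ≤ ‖Y * Complex.I - m s‖ := by
          have := Complex.abs_im_le_norm (Y * Complex.I - m s)
          simp only [Complex.sub_im, Complex.mul_im, Complex.I_re, Complex.I_im, Complex.ofReal_re,
            Complex.ofReal_im] at this
          rw [mul_zero, mul_one, add_zero, sub_zero] at this
          exact (le_abs_self Y).trans this
        rw [norm_mul, Complex.norm_real, norm_mul, norm_div, norm_one, one_div]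
        have h4 := hK s ⟨hs.1.le, hs.2⟩
        have h5 := hδ1 s
        have h6 : ‖Y * Complex.I - m s‖⁻¹ ≤ Y⁻¹ := inv_anti₀ hY h3
        rw [Real.norm_eq_abs (δ s)]
        calc |δ s| * ‖m s ^ (n + 1)‖ * ‖Y * Complex.I - m s‖⁻¹
            ≤ 1 * |K| * Y⁻¹ := by
              gcongr
              exact h4.trans (le_abs_self K)
          _ = |K| * Y⁻¹ := by rw [one_mul]
      have hzero : ‖∫ s in lo..hi, ((δ s * m s ^ n : ℝ) : ℂ)‖ ≤ 0 := by
        refine ge_of_tendsto (f := fun Y : ℝ => |K| * |hi - lo| * Y⁻¹) (x := atTop) ?_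
          ((eventually_gt_atTop 0).mono hbound)
        simpa using tendsto_inv_atTop_zero.const_mul (|K| * |hi - lo|)
      intro w hw
      rw [hstep w hw, norm_le_zero_iff.1 hzero, neg_zero]
  have h1 : ∫ s in lo..hi, ((δ s * m s ^ n : ℝ) : ℂ) = 0 := by
    have hw : (Complex.I).im ≠ 0 := by simp
    have hc : ContinuousOn (fun s : ℝ => 1 / (Complex.I - m s)) (uIcc lo hi) :=
      continuousOn_const.div (by fun_prop) fun s _ => hne _ hw s
    have h2 : ∀ s : ℝ, ((δ s * m s ^ n : ℝ) : ℂ)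
        = Complex.I * (((δ s * m s ^ n : ℝ) : ℂ) * (1 / (Complex.I - m s)))
          - ((δ s * m s ^ (n + 1) : ℝ) : ℂ) * (1 / (Complex.I - m s)) := by
      intro s
      have := hne _ hw s
      field_simp
      push_cast
      ring
    rw [intervalIntegral.integral_congr fun s _ => h2 s,
      intervalIntegral.integral_sub (((hint n).mul_continuousOn hc).const_mul _)
      ((hint (n + 1)).mul_continuousOn hc), intervalIntegral.integral_const_mul, hd n _ hw,
      hd (n + 1) _ hw, mul_zero, sub_zero]
  rw [intervalIntegral.integral_ofReal] at h1
  exact_mod_cast h1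

open Polynomial in
/-- Moments along an injective function determine a bounded density. -/
theorem ae_eq_zero_of_moments (hδ : Measurable δ) (hδ1 : ∀ s, |δ s| ≤ 1)
    (hm : Continuous m) (hinj : InjOn m (Icc lo hi))
    (h0 : ∀ n : ℕ, ∫ s in lo..hi, δ s * m s ^ n = 0) : ∀ᵐ s, s ∈ Ioo lo hi → δ s = 0 := by
  rcases le_or_gt hi lo with hle | hlt
  · exact Eventually.of_forall fun s hs => absurd (hs.1.trans hs.2) (not_lt.2 hle)
  have hint : ∀ {k : ℝ → ℝ}, Continuous k →
      IntervalIntegrable (fun s => δ s * k s) volume lo hi :=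
    fun hk => intervalIntegrable_mul_of_bounded hδ hδ1 hk.continuousOn
  have hpoly : ∀ P : ℝ[X], ∫ s in lo..hi, δ s * P.eval (m s) = 0 := by
    intro P
    induction P using Polynomial.induction_on' with
    | add P Q hP hQ =>
      simp only [Polynomial.eval_add, mul_add]
      rw [intervalIntegral.integral_add (hint (k := fun s => P.eval (m s)) (P.continuous.comp hm))
        (hint (k := fun s => Q.eval (m s)) (Q.continuous.comp hm)),
        hP, hQ, add_zero]
    | monomial n a =>
      simp only [Polynomial.eval_monomial, mul_left_comm _ a]
      rw [intervalIntegral.integral_const_mul, h0, mul_zero]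
  have hcont : ∀ g : ℝ → ℝ, Continuous g → ∫ s in lo..hi, δ s * g s = 0 := by
    intro g hg
    set M : C(Icc lo hi, ℝ) := ⟨fun s => m s, hm.comp continuous_subtype_val⟩
    -- Injectivity of m makes polynomials in m separate points, so the Stone–Weierstrass theorem
    -- applies.
    have hsep : (Polynomial.aeval (R := ℝ) M).range.SeparatesPoints := by
      intro s u hsu
      refine ⟨M, ⟨M, ⟨X, by simp⟩, rfl⟩, fun h => hsu ?_⟩
      exact Subtype.ext (hinj s.2 u.2 h)
    rw [← norm_le_zero_iff]
    refine le_of_forall_gt fun ε hε => ?_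
    obtain ⟨⟨_, P, rfl⟩, hP⟩ :=
      ContinuousMap.exists_mem_subalgebra_near_continuous_of_separatesPoints _ hsep
        (fun s : Icc lo hi => g s) (hg.comp continuous_subtype_val) (ε / (2 * (hi - lo)))
        (div_pos hε (by linarith))
    have h1 : ∫ s in lo..hi, δ s * g s = ∫ s in lo..hi, δ s * (g s - P.eval (m s)) := by
      simp only [mul_sub]
      rw [intervalIntegral.integral_sub (hint hg) (hint (k := fun s => P.eval (m s)) (P.continuous.comp hm)),
        hpoly, sub_zero]
    rw [h1]
    have h2 : ‖∫ s in lo..hi, δ s * (g s - P.eval (m s))‖ ≤ ε / (2 * (hi - lo)) * |hi - lo| := by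
      refine intervalIntegral.norm_integral_le_of_norm_le_const fun s hs => ?_
      rw [uIoc_of_le hlt.le] at hs
      have h3 := hP ⟨s, hs.1.le, hs.2⟩
      have h4 : (((Polynomial.aeval (R := ℝ) M).rangeRestrict P : C(Icc lo hi, ℝ)) : Icc lo hi → ℝ)
          ⟨s, hs.1.le, hs.2⟩ = P.eval (m s) := by
        simp [M]
      have h5 : ‖P.eval (m s) - g s‖ < ε / (2 * (hi - lo)) := by
        rw [← h4]; exact h3
      rw [norm_mul, norm_sub_rev]
      calc ‖δ s‖ * ‖P.eval (m s) - g s‖ ≤ 1 * (ε / (2 * (hi - lo))) := by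
            gcongr
            exact hδ1 s
        _ = _ := one_mul _
    refine lt_of_le_of_lt h2 ?_
    rw [abs_of_pos (by linarith)]
    have : 0 < hi - lo := by linarith
    field_simp
    linarith
  refine isOpen_Ioo.ae_eq_zero_of_integral_contDiff_smul_eq_zero ?_ fun g hg _ hsupp => ?_
  · refine LocallyIntegrable.locallyIntegrableOn ?_ _
    rw [locallyIntegrable_iff]
    intro K hK
    exact Measure.integrableOn_of_bounded (M := 1) hK.measure_lt_top.ne hδ.aestronglyMeasurable
      (Eventually.of_forall hδ1)
  · rw [← hcont g hg.continuous, intervalIntegral.integral_of_le hlt.le,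
      setIntegral_eq_integral_of_forall_compl_eq_zero]
    · simp only [smul_eq_mul, mul_comm]
    · intro s hs
      have : g s = 0 := image_eq_zero_of_notMem_tsupport fun h => hs (Ioo_subset_Ioc_self (hsupp h))
      rw [this, mul_zero]

end

/-! ### Boundary values of the exponent and frozen regions. -/

section

variable {L p lo hi : ℝ} {h : ℝ → ℝ}

theorem im_ofReal_add_mul_I (a ε : ℝ) : ((a : ℂ) + ε * Complex.I).im = ε := by simp

theorem re_ofReal_add_mul_I (a ε : ℝ) : ((a : ℂ) + ε * Complex.I).re = a := by simp

/-- At height ε above e^{Lσ} the weight is at least of order ε⁻² on [σ, σ + ε]. Hence the mean of h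
over this interval is at most a constant times the imaginary part of the exponent. -/
theorem wt_ge (hL : 0 < L) (hp : 0 < p) {σ s ε M : ℝ} (hε : 0 < ε) (hσs : σ ≤ s)
    (hsε : s ≤ σ + ε) (hM : L * Real.exp (L * s) ≤ M) :
    L * Real.exp (L * σ) / ((M ^ 2 + 1) * ε ^ 2)
      ≤ wt L p (Real.exp (L * σ) + ε * Complex.I) s := by
  set x : ℂ := Real.exp (L * σ) + ε * Complex.I with hx
  set y := Real.exp (L * s) with hy
  have h1 : Real.exp (L * σ) ≤ y := Real.exp_le_exp.2 (mul_le_mul_of_nonneg_left hσs hL.le)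
  have h2 : y - Real.exp (L * σ) ≤ M * ε := by
    have e1 : Real.exp (L * σ) = y * Real.exp (-(L * (s - σ))) := by
      rw [hy, ← Real.exp_add]; congr 1; ring
    have e2 := Real.add_one_le_exp (-(L * (s - σ)))
    have e3 : 0 < y := Real.exp_pos _
    have e4 : L * (s - σ) ≤ L * ε := mul_le_mul_of_nonneg_left (by linarith) hL.le
    calc y - Real.exp (L * σ) ≤ y * (L * (s - σ)) := by rw [e1]; nlinarith
      _ ≤ y * (L * ε) := by gcongr
      _ = (L * y) * ε := by ring
      _ ≤ M * ε := by gcongr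
  have h3 : Complex.normSq (x - y) = (y - Real.exp (L * σ)) ^ 2 + ε ^ 2 := by
    rw [Complex.normSq_apply, Complex.sub_re, Complex.sub_im, hx, im_ofReal_add_mul_I,
      re_ofReal_add_mul_I, Complex.ofReal_re, Complex.ofReal_im]
    ring
  have h4 : Complex.normSq (x - y) ≤ (M ^ 2 + 1) * ε ^ 2 := by
    rw [h3]
    have : (y - Real.exp (L * σ)) ^ 2 ≤ (M * ε) ^ 2 := pow_le_pow_left₀ (by linarith) h2 2
    nlinarith
  have h5 : 0 < Complex.normSq (x - y) := by rw [h3]; positivity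
  have h6 : 0 ≤ p / Complex.normSq x / Complex.normSq (p / x - y) :=
    div_nonneg (div_nonneg hp.le (Complex.normSq_nonneg _)) (Complex.normSq_nonneg _)
  calc L * Real.exp (L * σ) / ((M ^ 2 + 1) * ε ^ 2)
      ≤ L * y / Complex.normSq (x - y) := by gcongr
    _ = L * y * (1 / Complex.normSq (x - y)) := by ring
    _ ≤ L * y * (1 / Complex.normSq (x - y) + p / Complex.normSq x / Complex.normSq (p / x - y)) := by
        have : 0 ≤ L * y := by positivity
        nlinarith

/-- A density vanishes where the imaginary part of its exponent tends to zero. -/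
theorem ae_eq_zero_of_expo_im_tendsto (hL : 0 < L) (hp : 0 < p) (hh : IsDensity h) {α β : ℝ}
    (hlo : lo ≤ α) (hαβ : α < β) (hhi : β ≤ hi)
    (hlim : ∀ σ ∈ Ico α β, Tendsto
      (fun ε : ℝ => (expo L p lo hi h (Real.exp (L * σ) + ε * Complex.I)).im) (𝓝[>] 0) (𝓝 0)) :
    ∀ᵐ s, s ∈ Ioc α β → h s = 0 := by
  have hint := fun a b => hh.intervalIntegrable a b
  set M := L * Real.exp (L * β) with hM
  -- The right derivative of the primitive of h vanishes at every point, so the primitive is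
  -- constant.
  have hder : ∀ σ ∈ Ico α β, HasDerivWithinAt (fun s => ∫ u in α..s, h u) 0 (Ici σ) σ := by
    intro σ hσ
    have hc : 0 < L * Real.exp (L * σ) := by positivity
    rw [hasDerivWithinAt_iff_tendsto_slope, Ici_sdiff_left]
    have hsub : Tendsto (fun s : ℝ => s - σ) (𝓝[>] σ) (𝓝[>] 0) := by
      refine tendsto_nhdsWithin_iff.2 ⟨?_, ?_⟩
      · have : Continuous fun s : ℝ => s - σ := by fun_prop
        have := this.tendsto σ
        rw [sub_self] at this
        exact this.mono_left nhdsWithin_le_nhds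
      · filter_upwards [self_mem_nhdsWithin] with s hs using sub_pos.2 (mem_Ioi.1 hs)
    have hup := ((hlim σ hσ).comp hsub).const_mul ((M ^ 2 + 1) / (L * Real.exp (L * σ)))
    rw [mul_zero] at hup
    refine tendsto_of_tendsto_of_tendsto_of_le_of_le' tendsto_const_nhds hup ?_ ?_
    · filter_upwards [self_mem_nhdsWithin] with s (hs : σ < s)
      rw [slope_def_field, intervalIntegral.integral_interval_sub_left (hint _ _) (hint _ _)]
      exact div_nonneg (intervalIntegral.integral_nonneg hs.le fun u _ => hh.nonneg u)
        (by linarith)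
    · filter_upwards [self_mem_nhdsWithin, mem_nhdsWithin_of_mem_nhds (Iio_mem_nhds hσ.2)]
        with s (hs : σ < s) (hsβ : s < β)
      rw [slope_def_field, intervalIntegral.integral_interval_sub_left (hint _ _) (hint _ _),
        Function.comp_apply]
      have hε : 0 < s - σ := sub_pos.2 hs
      set ε := s - σ with hεd
      set x : ℂ := Real.exp (L * σ) + ε * Complex.I with hx
      have hxim : x.im = ε := im_ofReal_add_mul_I _ _
      have hxim' : x.im ≠ 0 := by rw [hxim]; exact hε.ne'
      rw [expo_im hh hxim', hxim]
      have hw := continuous_wt (L := L) (p := p) hxim'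
      have h1 : ∫ u in σ..s, h u * wt L p x u ≤ ∫ u in lo..hi, h u * wt L p x u := by
        refine intervalIntegral.integral_mono_interval (hlo.trans hσ.1) hs.le (hsβ.le.trans hhi)
          (Eventually.of_forall fun u => mul_nonneg (hh.nonneg u) (wt_pos hL hp hxim' u).le)
          (hh.intervalIntegrable_mul_real hw.continuousOn)
      have h2 : ∫ u in σ..s, h u * (L * Real.exp (L * σ) / ((M ^ 2 + 1) * ε ^ 2))
          ≤ ∫ u in σ..s, h u * wt L p x u := by
        refine intervalIntegral.integral_mono_on hs.le ((hint _ _).mul_const _)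
          (hh.intervalIntegrable_mul_real hw.continuousOn) fun u hu => ?_
        refine mul_le_mul_of_nonneg_left (wt_ge hL hp hε hu.1 (by linarith [hu.2]) ?_) (hh.nonneg u)
        rw [hM]
        have : Real.exp (L * u) ≤ Real.exp (L * β) :=
          Real.exp_le_exp.2 (mul_le_mul_of_nonneg_left (by linarith [hu.2]) hL.le)
        gcongr
      rw [intervalIntegral.integral_mul_const] at h2
      have h3 := h2.trans h1
      calc (∫ u in σ..s, h u) / ε
          = (M ^ 2 + 1) / (L * Real.exp (L * σ)) *
            (ε * ((∫ u in σ..s, h u) * (L * Real.exp (L * σ) / ((M ^ 2 + 1) * ε ^ 2)))) := by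
            field_simp
        _ ≤ _ := by gcongr
  have hconst := constant_of_has_deriv_right_zero
    (intervalIntegral.continuous_primitive hint α).continuousOn hder β ⟨hαβ.le, le_rfl⟩
  rw [intervalIntegral.integral_same,
    intervalIntegral.integral_eq_zero_iff_of_le_of_nonneg_ae hαβ.le
      (Eventually.of_forall hh.nonneg) (hint _ _)] at hconst
  exact (ae_restrict_iff' measurableSet_Ioc).1 hconst

theorem IsDensity.compl (hh : IsDensity h) : IsDensity (fun s => 1 - h s) :=
  ⟨measurable_const.sub hh.measurable, fun s => sub_nonneg.2 (hh.le_one s),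
    fun s => by linarith [hh.nonneg s]⟩

/-- The exponent of the complementary density. -/
theorem expo_im_compl (hL : 0 < L) (hp : 0 < p) (hh : IsDensity h) (hlh : lo ≤ hi) {x : ℂ}
    (hx : 0 < x.im) : 0 ≤ (expo L p lo hi (fun s => 1 - h s) x).im ∧
      (expo L p lo hi (fun s => 1 - h s) x).im < 2 * Real.pi - (expo L p lo hi h x).im := by
  have h1 : IsDensity (fun _ => (1 : ℝ)) := ⟨measurable_const, by simp, by simp⟩
  have h2 := (expo_im_range hL hp h1 hlh hx.ne').2.1
  have h3 := (expo_im_range hL hp hh.compl hlh hx.ne').1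
  have hw := continuous_wt (L := L) (p := p) hx.ne'
  have h4 : (expo L p lo hi (fun _ => 1) x).im
      = (expo L p lo hi h x).im + (expo L p lo hi (fun s => 1 - h s) x).im := by
    rw [expo_im h1 hx.ne', expo_im hh hx.ne', expo_im hh.compl hx.ne', ← mul_add,
      ← intervalIntegral.integral_add (hh.intervalIntegrable_mul_real hw.continuousOn)
        (hh.compl.intervalIntegrable_mul_real hw.continuousOn)]
    congr 2; ext s; ring
  exact ⟨nonneg_of_mul_nonneg_right h3 hx, by linarith [(abs_lt.1 h2).2]⟩

theorem ae_eq_one_of_expo_im_tendsto (hL : 0 < L) (hp : 0 < p) (hh : IsDensity h) (hlh : lo ≤ hi)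
    {α β : ℝ} (hlo : lo ≤ α) (hαβ : α < β) (hhi : β ≤ hi)
    (hlim : ∀ σ ∈ Ico α β, Tendsto
      (fun ε : ℝ => (expo L p lo hi h (Real.exp (L * σ) + ε * Complex.I)).im) (𝓝[>] 0)
      (𝓝 (2 * Real.pi))) :
    ∀ᵐ s, s ∈ Ioc α β → h s = 1 := by
  have := ae_eq_zero_of_expo_im_tendsto hL hp hh.compl hlo hαβ hhi fun σ hσ => by
    have h1 := (hlim σ hσ).const_sub (2 * Real.pi)
    rw [sub_self] at h1
    refine tendsto_of_tendsto_of_tendsto_of_le_of_le' tendsto_const_nhds h1 ?_ ?_ <;>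
    · filter_upwards [self_mem_nhdsWithin] with ε (hε : 0 < ε)
      have h2 := expo_im_compl hL hp hh hlh (x := Real.exp (L * σ) + ε * Complex.I)
        (by rwa [im_ofReal_add_mul_I])
      first | exact h2.1 | exact h2.2.le
  filter_upwards [this] with s hs hs'
  linarith [hs hs']

theorem expo_im_mem_Ioo (hL : 0 < L) (hp : 0 < p) (hh : IsDensity h) (hlh : lo ≤ hi)
    (hm : 0 < ∫ s in lo..hi, h s) {x : ℂ} (hx : 0 < x.im) :
    (expo L p lo hi h x).im ∈ Ioo 0 (2 * Real.pi) := by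
  obtain ⟨-, h1, h2⟩ := expo_im_range hL hp hh hlh hx.ne'
  exact ⟨pos_of_mul_pos_right (h2 hm) hx.le, (abs_lt.1 h1).2⟩

theorem continuousAt_expo (hL : 0 < L) (hh : IsDensity h) (hlh : lo ≤ hi) {x : ℂ}
    (hx : x.im ≠ 0) : ContinuousAt (expo L p lo hi h) x := by
  have hx0 : x ≠ 0 := by rintro rfl; simp at hx
  have h1 : ContinuousAt (fun x => ct L p lo hi h (jk p x)) x :=
    ContinuousAt.comp (f := jk p)
      (differentiableAt_ct hL.ne' hh hlh (notMem_nodes_of_im hx)).continuousAt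
      (hasStrictDerivAt_jk _ hx0).hasDerivAt.continuousAt
  have h2 : ContinuousAt (dk p) x := by
    unfold dk
    exact continuousAt_id.sub (continuousAt_const.div continuousAt_id hx0)
  exact ((continuousAt_const.mul h2).mul h1).neg

/-- If the real part of `f` is positive on a half-disc, the argument stays near one of `0`, `2π`. -/
theorem expo_im_lt_or_gt (hL : 0 < L) (hh : IsDensity h) (hlh : lo ≤ hi)
    {x₀ : ℂ} {r : ℝ}
    (hre : ∀ x ∈ Metric.ball x₀ r, 0 < x.im → 0 < (Complex.exp (expo L p lo hi h x)).re) :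
    (∀ x ∈ Metric.ball x₀ r, 0 < x.im → (expo L p lo hi h x).im < Real.pi) ∨
    (∀ x ∈ Metric.ball x₀ r, 0 < x.im → Real.pi < (expo L p lo hi h x).im) := by
  set U : Set ℂ := Metric.ball x₀ r ∩ {x | 0 < x.im} with hU
  have hconv : IsPreconnected U :=
    ((convex_ball x₀ r).inter (convex_halfSpace_im_gt 0)).isPreconnected
  have hc : ContinuousOn (fun x => (expo L p lo hi h x).im) U := fun x hx =>
    (Complex.continuous_im.continuousAt.comp
      (continuousAt_expo hL hh hlh (ne_of_gt hx.2))).continuousWithinAt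
  have hne : ∀ x ∈ U, (expo L p lo hi h x).im ≠ Real.pi := by
    intro x hx he
    have h1 := hre x hx.1 hx.2
    rw [Complex.exp_re, he, Real.cos_pi] at h1
    linarith [Real.exp_pos (expo L p lo hi h x).re]
  by_contra hcon
  push Not at hcon
  obtain ⟨⟨x₁, hx₁, hx₁i, h1⟩, x₂, hx₂, hx₂i, h2⟩ := hcon
  obtain ⟨x, hx, he⟩ := hconv.intermediate_value (a := x₂) (b := x₁) ⟨hx₂, hx₂i⟩ ⟨hx₁, hx₁i⟩ hc ⟨h2, h1⟩
  exact hne x hx he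

/-- The limit of the exponential fixes the argument only modulo 2π; arccos(cos θ) is the distance
from θ to 2πℤ. -/
theorem tendsto_im_of_tendsto_exp {l : Filter ℝ} {Φ : ℝ → ℂ} {F : ℝ} (hF : 0 < F)
    (hlim : Tendsto (fun ε => Complex.exp (Φ ε)) l (𝓝 F)) :
    Tendsto (fun ε => Real.arccos (Real.cos (Φ ε).im)) l (𝓝 0) := by
  have h1 := (Complex.continuous_re.tendsto _).comp hlim
  have h2 := hlim.norm
  have h3 := h1.div h2 (by rw [Complex.norm_real, Real.norm_of_nonneg hF.le]; exact hF.ne')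
  rw [Complex.ofReal_re, Complex.norm_real, Real.norm_of_nonneg hF.le, div_self hF.ne'] at h3
  have h4 := (Real.continuous_arccos.tendsto 1).comp h3
  rw [Real.arccos_one] at h4
  refine h4.congr fun ε => ?_
  simp only [Function.comp_apply, Pi.div_apply]
  rw [Complex.norm_exp, Complex.exp_re, mul_div_cancel_left₀ _ (Real.exp_pos _).ne']

/-- Boundary values of the exponent at points where `f` has positive boundary values. -/
theorem tendsto_expo_im_zero_or_two_pi (hL : 0 < L) (hp : 0 < p) (hh : IsDensity h) (hlh : lo ≤ hi)
    (hm : 0 < ∫ s in lo..hi, h s) {I : Set ℝ} (hI : IsOpen I)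
    (hlim : ∀ σ ∈ I, ∃ F : ℝ, 0 < F ∧ Tendsto (fun x => Complex.exp (expo L p lo hi h x))
      (𝓝[{x | 0 < x.im}] (Real.exp (L * σ) : ℂ)) (𝓝 F)) {σ₀ : ℝ} (hσ₀ : σ₀ ∈ I) :
    ∃ V ∈ 𝓝 σ₀,
    (∀ σ ∈ V, Tendsto (fun ε : ℝ => (expo L p lo hi h (Real.exp (L * σ) + ε * Complex.I)).im)
      (𝓝[>] 0) (𝓝 0)) ∨
    (∀ σ ∈ V, Tendsto (fun ε : ℝ => (expo L p lo hi h (Real.exp (L * σ) + ε * Complex.I)).im)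
      (𝓝[>] 0) (𝓝 (2 * Real.pi))) := by
  have hray : ∀ σ, Tendsto (fun ε : ℝ => (Real.exp (L * σ) + ε * Complex.I : ℂ)) (𝓝[>] 0)
      (𝓝[{x | 0 < x.im}] (Real.exp (L * σ) : ℂ)) := fun σ => by
    refine tendsto_nhdsWithin_iff.2 ⟨?_, ?_⟩
    · have : Continuous fun ε : ℝ => (Real.exp (L * σ) + ε * Complex.I : ℂ) := by fun_prop
      have := this.tendsto 0
      rw [Complex.ofReal_zero, zero_mul, add_zero] at this
      exact this.mono_left nhdsWithin_le_nhds
    · filter_upwards [self_mem_nhdsWithin] with ε hε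
      rwa [im_ofReal_add_mul_I]
  obtain ⟨F, hF, hFlim⟩ := hlim σ₀ hσ₀
  -- Near σ₀ the real part of f is positive, so the argument cannot cross π; hence the same
  -- alternative holds throughout a neighbourhood.
  have hpos : ∀ᶠ x in 𝓝[{x | 0 < x.im}] (Real.exp (L * σ₀) : ℂ),
      0 < (Complex.exp (expo L p lo hi h x)).re :=
    ((Complex.continuous_re.tendsto _).comp hFlim).eventually (lt_mem_nhds (by simpa using hF))
  obtain ⟨r, hr, hball⟩ := Metric.eventually_nhds_iff_ball.1 (eventually_nhdsWithin_iff.1 hpos)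
  have hexp : Continuous fun σ : ℝ => (Real.exp (L * σ) : ℂ) := by fun_prop
  refine ⟨I ∩ (fun σ : ℝ => (Real.exp (L * σ) : ℂ)) ⁻¹' Metric.ball (Real.exp (L * σ₀) : ℂ) r,
    inter_mem (hI.mem_nhds hσ₀) (hexp.continuousAt (Metric.ball_mem_nhds _ hr)), ?_⟩
  have hin : ∀ σ : ℝ, (Real.exp (L * σ) : ℂ) ∈ Metric.ball (Real.exp (L * σ₀) : ℂ) r →
      ∀ᶠ ε : ℝ in 𝓝[>] 0, (Real.exp (L * σ) + ε * Complex.I : ℂ) ∈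
        Metric.ball (Real.exp (L * σ₀) : ℂ) r ∧ 0 < (Real.exp (L * σ) + ε * Complex.I : ℂ).im :=
    fun σ hσ => (hray σ).eventually ((eventually_nhdsWithin_of_eventually_nhds
      (Metric.isOpen_ball.mem_nhds hσ)).and self_mem_nhdsWithin)
  refine (expo_im_lt_or_gt hL hh hlh (x₀ := (Real.exp (L * σ₀) : ℂ)) (r := r) hball).imp
    (fun h1 σ hσ => ?_) fun h1 σ hσ => ?_
  · obtain ⟨F', hF', hlim'⟩ := hlim σ hσ.1
    refine (tendsto_im_of_tendsto_exp hF' (hlim'.comp (hray σ))).congr' ?_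
    filter_upwards [hin σ hσ.2] with ε hε
    exact Real.arccos_cos (expo_im_mem_Ioo hL hp hh hlh hm hε.2).1.le (h1 _ hε.1 hε.2).le
  · obtain ⟨F', hF', hlim'⟩ := hlim σ hσ.1
    have h2 := (tendsto_im_of_tendsto_exp hF' (hlim'.comp (hray σ))).const_sub (2 * Real.pi)
    rw [sub_zero] at h2
    refine h2.congr' ?_
    filter_upwards [hin σ hσ.2] with ε hε
    have h3 := expo_im_mem_Ioo hL hp hh hlh hm hε.2
    have h4 := h1 _ hε.1 hε.2
    rw [← Real.cos_two_pi_sub, Real.arccos_cos (by linarith [h3.2]) (by linarith)]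
    ring

end

/-! ### The slope above the fold. -/

section

section Nev

variable {A B c C β : ℝ} {μ : Measure ℝ}

theorem energy_ofReal (u : ℝ) : energy μ u = ∫ s : ℝ, 1 / ((u - s) * (u - s)) ∂μ := by
  unfold energy
  congr 1; ext s
  rw [← Complex.ofReal_sub, Complex.norm_real, Real.norm_eq_abs, sq_abs, sq]

theorem integral_inv_mul_ofReal (u v : ℝ) : ∫ s : ℝ, 1 / (((u : ℂ) - s) * ((v : ℂ) - s)) ∂μ
    = ((∫ s : ℝ, 1 / ((u - s) * (v - s)) ∂μ : ℝ) : ℂ) := by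
  rw [← integral_complex_ofReal]
  congr 1; ext s
  push_cast
  rfl

variable [IsFiniteMeasure μ]

/-- To the left of the support, the increments of `u - β S(u)` bound its derivative. -/
theorem factor_pos_of_lt (hμ : μ (Icc A B)ᶜ = 0) (hβ : 0 ≤ β) {u₀ u₁ W₀ W₁ : ℝ} (h01 : u₀ < u₁)
    (h1A : u₁ < A) (hW₀ : (u₀ : ℂ) - β * nev c C μ u₀ = W₀)
    (hW₁ : (u₁ : ℂ) - β * nev c C μ u₁ = W₁) (hW : W₀ < W₁) :
    0 < 1 - β / c - β * energy μ u₀ := by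
  have hs0 : (u₀ : ℂ) ∉ seg A B := by rw [ofReal_mem_seg]; intro h; linarith [h.1]
  have hs1 : (u₁ : ℂ) ∉ seg A B := by rw [ofReal_mem_seg]; intro h; linarith [h.1]
  have h1 := nev_sub_nev (c := c) (C := C) hμ hs1 hs0
  rw [integral_inv_mul_ofReal] at h1
  set E := ∫ s : ℝ, 1 / ((u₁ - s) * (u₀ - s)) ∂μ with hE
  have h2 : W₁ - W₀ = (u₁ - u₀) * (1 - β / c - β * E) := by
    have : ((W₁ - W₀ : ℝ) : ℂ) = ((((u₁ - u₀) * (1 - β / c - β * E)) : ℝ) : ℂ) := by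
      push_cast
      rw [← hW₀, ← hW₁]
      linear_combination (-(β : ℂ)) * h1
    exact_mod_cast this
  have h3 : 0 < 1 - β / c - β * E := by
    refine pos_of_mul_pos_right (a := u₁ - u₀) ?_ (by linarith)
    rw [← h2]; linarith
  have hint : ∀ {u v : ℝ}, u < A → v < A →
      Integrable (fun s : ℝ => 1 / ((u - s) * (v - s))) μ := fun {u v} hu hv =>
    integrable_of_continuousOn_carrier hμ (continuousOn_const.div (by fun_prop) fun s hs =>
      mul_ne_zero (by linarith [hs.1]) (by linarith [hs.1]))
  have h4 : energy μ u₀ ≤ E := by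
    rw [energy_ofReal, hE]
    refine integral_mono_ae (hint (h01.trans h1A) (h01.trans h1A)) (hint h1A (h01.trans h1A)) ?_
    filter_upwards [ae_mem_of_carrier hμ] with s hs
    have e1 : 0 < s - u₁ := by linarith [hs.1]
    have e2 : (u₁ - s) * (u₀ - s) = (s - u₁) * (s - u₀) := by ring
    have e3 : (u₀ - s) * (u₀ - s) = (s - u₀) * (s - u₀) := by ring
    rw [e2, e3]
    refine one_div_le_one_div_of_le (mul_pos e1 (by linarith)) ?_
    exact mul_le_mul_of_nonneg_right (by linarith) (by linarith)
  nlinarith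

/-- The subordination function extends across real points at which the derivative is positive. -/
theorem exists_real_subordination (hμ : μ (Icc A B)ᶜ = 0) (hβ : 0 ≤ β)
    {u₀ u₁ W₀ W₁ : ℝ} (h01 : u₀ < u₁)
    (h1A : u₁ < A) (hW₀ : (u₀ : ℂ) - β * nev c C μ u₀ = W₀)
    (hW₁ : (u₁ : ℂ) - β * nev c C μ u₁ = W₁) (hW : W₀ < W₁) :
    ∃ G : ℂ → ℂ, Tendsto G (𝓝 W₀) (𝓝 u₀) ∧ ∀ᶠ w in 𝓝 (W₀ : ℂ),
      G w - β * nev c C μ (G w) = w ∧ (w.im ≠ 0 → 0 < (G w).im * w.im) := by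
  have hfac := factor_pos_of_lt hμ hβ h01 h1A hW₀ hW₁ hW
  have hs0 : (u₀ : ℂ) ∉ seg A B := by rw [ofReal_mem_seg]; intro h; linarith [h.1]
  have hder : deriv (nev c C μ) u₀ = ((1 / c + energy μ u₀ : ℝ) : ℂ) := by
    rw [(hasDerivAt_nev hμ hs0).deriv, integral_inv_mul_ofReal, ← energy_ofReal]
    push_cast
    rfl
  have hne : 1 - (β : ℂ) * deriv (nev c C μ) u₀ ≠ 0 := by
    rw [hder]
    have : 1 - β * (1 / c + energy μ u₀) ≠ 0 := by
      have : 1 - β * (1 / c + energy μ u₀) = 1 - β / c - β * energy μ u₀ := by ring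
      rw [this]; exact hfac.ne'
    exact_mod_cast this
  obtain ⟨g, g1, g2, g3⟩ := exists_subordination_chart (analyticAt_nev hμ hs0) hne
  rw [hW₀] at g1 g2 g3
  have hpair : Tendsto (fun w : ℂ => (β, w)) (𝓝 (W₀ : ℂ)) (𝓝 (β, (W₀ : ℂ))) :=
    (by fun_prop : Continuous fun w : ℂ => (β, w)).tendsto _
  have hG : Tendsto (fun w : ℂ => g (β, w)) (𝓝 (W₀ : ℂ)) (𝓝 (u₀ : ℂ)) := by
    have := g2.hasFDerivAt.continuousAt.tendsto.comp hpair
    rwa [g1] at this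
  refine ⟨fun w => g (β, w), hG, ?_⟩
  have hE : ∀ᶠ w in 𝓝 (W₀ : ℂ), 0 < 1 - β / c - β * energy μ (g (β, w)) :=
    ((((tendsto_energy hμ hs0).comp hG).const_mul β).const_sub (1 - β / c)).eventually
      (lt_mem_nhds hfac)
  have hseg := hG.eventually ((isCompact_seg A B).isClosed.isOpen_compl.mem_nhds hs0)
  filter_upwards [hpair.eventually g3, hE, hseg] with w h1 h2 h3
  refine ⟨h1, fun hw => ?_⟩
  have h4 := im_sub_nev (c := c) (C := C) (β := β) hμ h3
  rw [h1] at h4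
  rw [h4] at hw ⊢
  have h5 : (g (β, w)).im ≠ 0 := left_ne_zero_of_mul hw
  have h6 := mul_self_pos.2 h5
  calc 0 < ((g (β, w)).im * (g (β, w)).im) * (1 - β / c - β * energy μ (g (β, w))) :=
        mul_pos h6 h2
    _ = _ := by ring

end Nev

variable {L k T N R : ℝ} {h : ℝ → ℝ → ℝ} {S : ℝ → ℂ → ℂ}

/-- Points above the fold lie to the left of the initial nodes. -/
theorem Setting.lt_node (hs : Setting L k T N R h) {y s : ℝ} (hy : k < y ^ 2) (hy0 : 0 < y)
    (hyb : y ≤ Real.exp (L * N)) (hsR : s ≤ R) : y + k / y < node L k s := by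
  have h1 : Real.exp (L * s) ≤ Real.exp (L * R) :=
    Real.exp_le_exp.2 (mul_le_mul_of_nonneg_left hsR hs.hL.le)
  have h2 := Real.exp_pos (L * s)
  have h3 : Real.exp (L * s) * y < k := lt_of_le_of_lt (by gcongr) hs.hAb
  have h4 : Real.exp (L * s) < y := by nlinarith
  have h5 : node L k s - (y + k / y)
      = (k - Real.exp (L * s) * y) * (y - Real.exp (L * s)) / (Real.exp (L * s) * y) := by
    rw [node]; field_simp; ring
  have h6 : 0 < node L k s - (y + k / y) := by
    rw [h5]
    exact div_pos (mul_pos (by linarith) (by linarith)) (by positivity)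
  linarith

/-- The value is computed at the small root k/y, which lies strictly between A and k/A, where
`den_ofReal_neg` gives the sign of the denominator. The numerator vanishes at y = e^{LN}. -/
theorem TransformFamily.val0_fold (hF : TransformFamily L k T N R h S) (hs : Setting L k T N R h)
    {y : ℝ} (hy : k < y ^ 2) (hy0 : 0 < y) (hyb : y ≤ Real.exp (L * N)) :
    ∃ v : ℝ, S 0 ((y + k / y : ℝ) : ℂ) = v ∧ -(k / y) ≤ v ∧ (y < Real.exp (L * N) → -(k / y) < v) ∧
      (y = Real.exp (L * N) → v = -(k / y)) := by
  have hk := hs.hk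
  set A := Real.exp (L * R)
  set b := Real.exp (L * N)
  have hA : 0 < A := Real.exp_pos _
  have h1 : A * y < k := lt_of_le_of_lt (by gcongr) hs.hAb
  have h2 : A < y := by nlinarith
  have h3 : A < k / y := by rwa [lt_div_iff₀ hy0]
  have h4 : k / y * A < k := by
    rw [div_mul_eq_mul_div, div_lt_iff₀ hy0]; gcongr
  obtain ⟨d, hd, hden⟩ := den_ofReal_neg hs.regular_zero h3 h4
  have hjk : jk k ((k / y : ℝ) : ℂ) = ((y + k / y : ℝ) : ℂ) := by
    rw [jk_ofReal]
    congr 1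
    field_simp
    ring
  have hK : jk k ((k / y : ℝ) : ℂ) ∉ nodes L k (-T) R := by
    rw [hjk]
    rintro ⟨s, hs', he⟩
    have := hs.lt_node hy hy0 hyb hs'.2
    have he : node L k s = y + k / y := Complex.ofReal_injective he
    linarith
  have hx0 : ((k / y : ℝ) : ℂ) ≠ 0 := by exact_mod_cast (div_pos hk hy0).ne'
  have hval : S 0 (jk k ((k / y : ℝ) : ℂ)) = -((k / y : ℝ) : ℂ) + nb k b A ((k / y : ℝ) : ℂ) /
      den L k A b (ct L k (-T) R (h 0) (jk k ((k / y : ℝ) : ℂ))) ((k / y : ℝ) : ℂ) :=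
    hF.val0 _ hx0 hK
  rw [hden, hjk] at hval
  have hnb : (k / y - A) * (k - b * (k / y)) / d = (k / y - A) * k * ((b - y) / y) / (-d) := by
    field_simp; ring
  refine ⟨-(k / y) + (k / y - A) * (k - b * (k / y)) / d, ?_, ?_, ?_, ?_⟩
  · rw [hval, nb]; push_cast; rfl
  · have : 0 ≤ (k / y - A) * k * ((b - y) / y) / (-d) :=
      div_nonneg (mul_nonneg (mul_nonneg (by linarith) hk.le) (div_nonneg (by linarith) hy0.le))
        (by linarith)
    rw [hnb]; linarith
  · intro hlt
    have : 0 < (k / y - A) * k * ((b - y) / y) / (-d) :=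
      div_pos (mul_pos (mul_pos (by linarith) hk) (div_pos (by linarith) hy0)) (by linarith)
    rw [hnb]; linarith
  · rintro rfl
    rw [hnb, sub_self]; simp

theorem add_div_lt_add_div {k y z : ℝ} (hy : k < y ^ 2) (hy0 : 0 < y) (hyz : y < z) :
    y + k / y < z + k / z := by
  have hz : 0 < z := hy0.trans hyz
  have h1 : z + k / z - (y + k / y) = (z - y) * (y * z - k) / (y * z) := by field_simp; ring
  have h2 : 0 < z + k / z - (y + k / y) := by
    rw [h1]
    exact div_pos (mul_pos (by linarith) (by nlinarith)) (by positivity)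
  linarith

/-- Above the fold, the slope has positive boundary values on the real axis. -/
theorem Subordinated.exists_tendsto_fx (hsub : Subordinated L T S)
    (hF : TransformFamily L k T N R h S) (hs : Setting L k T N R h) {t : ℝ} (ht : t ∈ Ioo 0 T)
    {x₀ : ℝ} (hx₀ : 0 < x₀) (hp : pt L k t < x₀ ^ 2) (hb : x₀ < Real.exp (L * N)) :
    ∃ F : ℝ, 0 < F ∧ Tendsto (fx L k T N h t) (𝓝[{x | 0 < x.im}] (x₀ : ℂ)) (𝓝 F) := by
  have hk := hs.hk
  have ht' : t ∈ Ico 0 T := ⟨ht.1.le, ht.2⟩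
  set E := Real.exp (L * t) with hE
  set p := pt L k t with hpd
  have hpE : p = k * E := rfl
  set b := Real.exp (L * N) with hbd
  have hE1 : 1 < E := Real.one_lt_exp_iff.2 (mul_pos hs.hL ht.1)
  have hβ : 0 < E - 1 := by linarith
  have hkp : k < p := by rw [hpE]; nlinarith
  have hkx : ∀ y, x₀ ≤ y → k < y ^ 2 := fun y hy => by nlinarith
  have hpx : ∀ y, x₀ ≤ y → p < y ^ 2 := fun y hy => by nlinarith
  have hy0 : ∀ y, x₀ ≤ y → 0 < y := fun y hy => hx₀.trans_le hy
  obtain ⟨A, B, C, μ, hfin, hμ, hseg, hS⟩ := hF.nev0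
  have hA : ∃ s ∈ Icc (-T) R, node L k s = A := by
    have h1 : ((node L k (-T) : ℝ) : ℂ) ∈ seg A B := by
      rw [← hseg]; exact ⟨-T, ⟨le_rfl, hs.hTR.le⟩, rfl⟩
    rw [ofReal_mem_seg] at h1
    have h2 : (A : ℂ) ∈ seg A B := ofReal_mem_seg.2 ⟨le_rfl, h1.1.trans h1.2⟩
    rw [← hseg] at h2
    obtain ⟨s, hs', he⟩ := h2
    exact ⟨s, hs', Complex.ofReal_injective he⟩
  have hleft : ∀ y, x₀ ≤ y → y ≤ b → y + k / y < A := by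
    intro y h1 h2
    obtain ⟨s, hs', rfl⟩ := hA
    exact hs.lt_node (hkx y h1) (hy0 y h1) h2 hs'.2
  have hoff : ∀ y, x₀ ≤ y → y ≤ b → ((y + k / y : ℝ) : ℂ) ∉ seg A B := by
    intro y h1 h2
    rw [ofReal_mem_seg]
    intro h3
    linarith [h3.1, hleft y h1 h2]
  -- the real subordination point
  set φ : ℝ → ℝ := fun y => y + k / y - (E - 1) * (S 0 ((y + k / y : ℝ) : ℂ)).re with hφ
  have hφc : ContinuousOn φ (Icc x₀ b) := by
    intro y hy
    have h1 : ContinuousAt (fun y : ℝ => y + k / y) y :=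
      continuousAt_id.add (continuousAt_const.div continuousAt_id (hy0 y hy.1).ne')
    have h2 : ContinuousAt (S 0) ((y + k / y : ℝ) : ℂ) := by
      refine (analyticAt_nev (c := Real.exp (L * T) - 1) (C := C) hμ
        (hoff y hy.1 hy.2)).continuousAt.congr ?_
      filter_upwards [(isCompact_seg A B).isClosed.isOpen_compl.mem_nhds (hoff y hy.1 hy.2)]
        with w hw using (hS w hw).symm
    have h3 : ContinuousAt (fun y : ℝ => (S 0 ((y + k / y : ℝ) : ℂ)).re) y :=
      Complex.continuous_re.continuousAt.comp (ContinuousAt.comp (g := S 0)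
        (f := fun y : ℝ => ((y + k / y : ℝ) : ℂ)) h2
        (Complex.continuous_ofReal.continuousAt.comp h1))
    exact (h1.sub (continuousAt_const.mul h3)).continuousWithinAt
  obtain ⟨v₁, hv₁, -, hv₁', -⟩ := hF.val0_fold hs (hkx x₀ le_rfl) hx₀ hb.le
  obtain ⟨v₂, hv₂, -, -, hv₂'⟩ := hF.val0_fold hs (hkx b hb.le) (hy0 b hb.le) le_rfl
  have hv₁' := hv₁' hb
  have hv₂' := hv₂' rfl
  have hpdiv : ∀ y : ℝ, p / y = k / y + (E - 1) * (k / y) := fun y => by rw [hpE]; ring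
  have hφ1 : φ x₀ < x₀ + p / x₀ := by
    simp only [hφ]
    rw [hv₁, Complex.ofReal_re, hpdiv]
    nlinarith
  have hφ2 : φ b = b + p / b := by
    simp only [hφ]
    rw [hv₂, Complex.ofReal_re, hpdiv, hv₂']
    ring
  have hW : x₀ + p / x₀ < b + p / b := add_div_lt_add_div hp hx₀ hb
  -- Since φ(x₀) < x₀ + p/x₀ < b + p/b = φ(b), some y between x₀ and b gives a real point u₀ = y +
  -- k/y whose characteristic reaches x₀ + p/x₀.
  obtain ⟨y, hy, hφy⟩ := intermediate_value_Ioo hb.le hφc ⟨hφ1, by rw [hφ2]; exact hW⟩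
  obtain ⟨v₀, hv₀, -, -, -⟩ := hF.val0_fold hs (hkx y hy.1.le) (hy0 y hy.1.le) hy.2.le
  simp only [hφ] at hφy
  rw [hv₀, Complex.ofReal_re] at hφy
  set u₀ := y + k / y with hu₀
  set u₁ := b + k / b with hu₁
  -- (E - 1)(v₀ + k/x₀) equals (y + k/y) - (x₀ + k/x₀), positive by monotonicity above the fold.
  -- This is what makes the limit of f positive.
  have hv₀pos : 0 < v₀ + k / x₀ := by
    have h1 := add_div_lt_add_div (hkx x₀ le_rfl) hx₀ hy.1
    rw [hpdiv] at hφy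
    have h2 : 0 < (E - 1) * (v₀ + k / x₀) := by nlinarith
    exact pos_of_mul_pos_right h2 hβ.le
  have hN0 : S 0 (u₀ : ℂ) = nev (Real.exp (L * T) - 1) C μ u₀ := hS _ (hoff y hy.1.le hy.2.le)
  have hN1 : S 0 (u₁ : ℂ) = nev (Real.exp (L * T) - 1) C μ u₁ := hS _ (hoff b hb.le le_rfl)
  obtain ⟨G, hG, hGe⟩ := exists_real_subordination (c := Real.exp (L * T) - 1) (C := C)
    (u₀ := u₀) (u₁ := u₁) (W₀ := x₀ + p / x₀) (W₁ := b + p / b) hμ hβ.le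
    (add_div_lt_add_div (hkx y hy.1.le) (hy0 y hy.1.le) hy.2) (hleft b hb.le le_rfl)
    (by rw [← hN0, hv₀, ← hφy]; push_cast; rfl)
    (by rw [← hN1, hv₂, ← hφ2]; simp only [hφ]; rw [← hu₁, hv₂, Complex.ofReal_re]; push_cast; rfl)
    hW
  have hx₀' : (x₀ : ℂ) ≠ 0 := by exact_mod_cast hx₀.ne'
  have hjk : Tendsto (jk p) (𝓝[{x | 0 < x.im}] (x₀ : ℂ)) (𝓝 ((x₀ + p / x₀ : ℝ) : ℂ)) := by
    have := (hasStrictDerivAt_jk p hx₀').hasDerivAt.continuousAt.tendsto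
    rw [jk_ofReal] at this
    exact this.mono_left nhdsWithin_le_nhds
  have hlimv : Tendsto (fun x => nev (Real.exp (L * T) - 1) C μ (G (jk p x)))
      (𝓝[{x | 0 < x.im}] (x₀ : ℂ)) (𝓝 (v₀ : ℂ)) := by
    rw [← hv₀, hN0]
    exact ((analyticAt_nev hμ (hoff y hy.1.le hy.2.le)).continuousAt.tendsto.comp hG).comp hjk
  have hev : ∀ᶠ x in 𝓝[{x | 0 < x.im}] (x₀ : ℂ), fx L k T N h t x
      = (E * nev (Real.exp (L * T) - 1) C μ (G (jk p x)) + p / x) /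
        (E * nev (Real.exp (L * T) - 1) C μ (G (jk p x)) + x) := by
    have hnorm : ∀ᶠ x in 𝓝[{x : ℂ | 0 < x.im}] (x₀ : ℂ), p < ‖x‖ ^ 2 := by
      have h1 : Continuous fun x : ℂ => ‖x‖ ^ 2 := by fun_prop
      refine nhdsWithin_le_nhds (h1.continuousAt.eventually_const_lt ?_)
      show p < ‖(x₀ : ℂ)‖ ^ 2
      rwa [Complex.norm_real, Real.norm_of_nonneg hx₀.le]
    filter_upwards [hjk.eventually hGe, hnorm, self_mem_nhdsWithin] with x h1 h2 (h3 : 0 < x.im)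
    have h4 : (jk p x).im = x.im * (1 - p / ‖x‖ ^ 2) := joukowski_im x p
    have h5 : 0 < ‖x‖ ^ 2 := (pt_pos hk t).trans h2
    have h6 : p / ‖x‖ ^ 2 < 1 := by rwa [div_lt_one h5]
    have h7 : 0 < (jk p x).im := by rw [h4]; exact mul_pos h3 (by linarith)
    obtain ⟨hx, hd⟩ := ne_zero_of_jk_im (pt_pos hk t) h7.ne'
    have h8 := h1.2 h7.ne'
    have h9 : G (jk p x) ∉ seg A B := notMem_seg_of_im_ne (left_ne_zero_of_mul h8.ne')
    have h10 : S t (jk p x) = S 0 (G (jk p x)) :=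
      hsub.eq_of hF hs.hL ht' h8 (by rw [hS _ h9]; exact h1.1)
    rw [(hF.fx_eq ht' hx (notMem_nodes_of_im_ne h7.ne') hd).2, h10, hS _ h9]
  have hnum : 0 < E * v₀ + p / x₀ := by
    have : E * v₀ + p / x₀ = E * (v₀ + k / x₀) := by rw [hpE]; ring
    rw [this]; positivity
  have hden : 0 < E * v₀ + x₀ := by
    have : p / x₀ < x₀ := by rw [div_lt_iff₀ hx₀, ← sq]; exact hp
    linarith
  refine ⟨(E * v₀ + p / x₀) / (E * v₀ + x₀), div_pos hnum hden, ?_⟩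
  have hid : Tendsto (fun x : ℂ => x) (𝓝[{x | 0 < x.im}] (x₀ : ℂ)) (𝓝 x₀) :=
    tendsto_id.mono_left nhdsWithin_le_nhds
  have hfin := (((hlimv.const_mul (E : ℂ)).add ((tendsto_const_nhds (x := (p : ℂ))).div hid hx₀'))).div
    ((hlimv.const_mul (E : ℂ)).add hid) (by exact_mod_cast hden.ne')
  push_cast
  exact hfin.congr' (hev.mono fun x hx => hx.symm)

end

/-! ### Subordination determines the densities. -/

section

section Expo

variable {L p lo hi : ℝ} {h h' : ℝ → ℝ}

/-- Both imaginary parts have the sign of Im x and modulus less than 2π, so they cannot differ by a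
nonzero multiple of 2π. -/
theorem expo_eq_of_exp_eq (hL : 0 < L) (hp : 0 < p) (hh : IsDensity h) (hh' : IsDensity h')
    (hlh : lo ≤ hi) {x : ℂ} (hx : x.im ≠ 0)
    (he : Complex.exp (expo L p lo hi h x) = Complex.exp (expo L p lo hi h' x)) :
    expo L p lo hi h x = expo L p lo hi h' x := by
  obtain ⟨a1, a2, -⟩ := expo_im_range hL hp hh hlh hx
  obtain ⟨b1, b2, -⟩ := expo_im_range hL hp hh' hlh hx
  obtain ⟨n, hn⟩ := Complex.exp_eq_exp_iff_exists_int.1 he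
  have him : (expo L p lo hi h x).im = (expo L p lo hi h' x).im + n * (2 * Real.pi) := by
    rw [hn]; simp
  have hpi := Real.pi_pos
  rw [abs_lt] at a2 b2
  have key : |(n : ℝ) * (2 * Real.pi)| < 2 * Real.pi := by
    rw [show (n : ℝ) * (2 * Real.pi)
      = (expo L p lo hi h x).im - (expo L p lo hi h' x).im by rw [him]; ring, abs_lt]
    rcases lt_or_gt_of_ne hx with h1 | h1
    · have c1 : (expo L p lo hi h x).im ≤ 0 := by
        by_contra h2; push Not at h2; nlinarith
      have c2 : (expo L p lo hi h' x).im ≤ 0 := by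
        by_contra h2; push Not at h2; nlinarith
      constructor <;> linarith
    · have c1 := nonneg_of_mul_nonneg_right a1 h1
      have c2 := nonneg_of_mul_nonneg_right b1 h1
      constructor <;> linarith
  have hn0 : |(n : ℝ)| < 1 := by
    rw [abs_mul, abs_of_pos (by positivity : 0 < 2 * Real.pi)] at key
    by_contra h2
    push Not at h2
    nlinarith
  have : n = 0 := by
    have h3 : |n| < 1 := by exact_mod_cast hn0
    exact Int.abs_lt_one_iff.1 h3
  rw [hn, this]; simp

theorem injOn_node (hL : 0 < L) {c : ℝ} (hc : Real.exp (L * c) ^ 2 ≤ p) :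
    InjOn (node L p) (Icc lo c) := by
  intro s hs u hu he
  have hlt : ∀ {s u : ℝ}, s < u → u ≤ c → node L p s ≠ node L p u := by
    intro s u hsu huc h0
    have e1 : Real.exp (L * s) < Real.exp (L * u) := Real.exp_lt_exp.2 (by gcongr)
    have e2 : Real.exp (L * u) ≤ Real.exp (L * c) :=
      Real.exp_le_exp.2 (mul_le_mul_of_nonneg_left huc hL.le)
    have e3 := Real.exp_pos (L * s)
    have e4 := Real.exp_pos (L * u)
    have e5 : node L p s - node L p u = (Real.exp (L * u) - Real.exp (L * s)) *
        (p - Real.exp (L * s) * Real.exp (L * u)) / (Real.exp (L * s) * Real.exp (L * u)) := by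
      rw [node, node]; field_simp; ring
    have e6 : 0 < node L p s - node L p u := by
      rw [e5]
      exact div_pos (mul_pos (by linarith) (by nlinarith)) (by positivity)
    linarith
  rcases lt_trichotomy s u with h1 | h1 | h1
  · exact absurd he (hlt h1 hu.2)
  · exact h1
  · exact absurd he.symm (hlt h1 hs.2)

/-- A density is determined by its Cauchy transform, once it is known above the fold. -/
theorem ae_eq_of_ct_eq (hL : 0 < L) (hlh : lo ≤ hi) (hh : IsDensity h)
    (hh' : IsDensity h') (hct : ∀ w : ℂ, w.im ≠ 0 → ct L p lo hi h w = ct L p lo hi h' w)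
    {c : ℝ} (hc : Real.exp (L * c) ^ 2 ≤ p) (hch : c ≤ hi)
    (hup : ∀ᵐ s, s ∈ Ioo c hi → h s = h' s) : ∀ᵐ s, s ∈ Ioo lo hi → h s = h' s := by
  set δ : ℝ → ℝ := fun s => h s - h' s with hδ
  have hδm : Measurable δ := hh.measurable.sub hh'.measurable
  have hδ1 : ∀ s, |δ s| ≤ 1 := fun s => abs_le.2
    ⟨by simp only [hδ]; linarith [hh.nonneg s, hh'.le_one s],
      by simp only [hδ]; linarith [hh'.nonneg s, hh.le_one s]⟩
  have hmom := moments_eq_zero_of_transform hlh hδm hδ1 (continuous_node (L := L) (p := p))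
    (fun w hw => by
      have h1 := hct w hw
      have hc : ContinuousOn (fun s : ℝ => 1 / (w - node L p s)) (uIcc lo hi) :=
        continuousOn_const.div ((continuous_const.sub (Complex.continuous_ofReal.comp
          continuous_node)).continuousOn) fun s _ h0 => hw (by
            rw [sub_eq_zero.1 h0, Complex.ofReal_im])
      rw [ct, ct, ← sub_eq_zero, ← intervalIntegral.integral_sub (hh.intervalIntegrable_mul hc)
        (hh'.intervalIntegrable_mul hc)] at h1
      rw [← h1]
      congr 1; ext s
      simp only [hδ]; push_cast; ring)
  have hmom' : ∀ n : ℕ, ∫ s in lo..c, δ s * node L p s ^ n = 0 := by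
    intro n
    have hint : ∀ a b : ℝ, IntervalIntegrable (fun s => δ s * node L p s ^ n) volume a b :=
      fun a b => intervalIntegrable_mul_of_bounded hδm hδ1 (continuous_node.pow n).continuousOn
    have h1 := intervalIntegral.integral_add_adjacent_intervals (hint lo c) (hint c hi)
    have h2 : ∫ s in c..hi, δ s * node L p s ^ n = 0 := by
      rw [intervalIntegral.integral_of_le hch, integral_Ioc_eq_integral_Ioo]
      refine setIntegral_eq_zero_of_ae_eq_zero ?_
      filter_upwards [hup] with s hs hs'
      simp only [hδ]
      rw [hs hs', sub_self, zero_mul]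
    rw [hmom n, h2, add_zero] at h1
    exact h1
  have hlow := ae_eq_zero_of_moments hδm hδ1 continuous_node (injOn_node hL hc) hmom'
  filter_upwards [hlow, hup, Measure.ae_ne volume c] with s h1 h2 h3 hs
  rcases lt_or_gt_of_ne h3 with h4 | h4
  · exact sub_eq_zero.1 (h1 ⟨hs.1, h4⟩)
  · exact h2 ⟨h4, hs.2⟩

end Expo

variable {L k T N R : ℝ} {h h' : ℝ → ℝ → ℝ} {S S' : ℝ → ℂ → ℂ}

/-- S_0 depends only on the initial density, so a subordination point of one family solves the
equation of the other, and `eq_of` identifies the values. -/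
theorem Subordinated.transform_eq (hsub : Subordinated L T S) (hF : TransformFamily L k T N R h S)
    (hs : Setting L k T N R h) (hsub' : Subordinated L T S')
    (hF' : TransformFamily L k T N R h' S') (h0 : h 0 = h' 0)
    {t : ℝ} (ht : t ∈ Ico 0 T) {w : ℂ} (hw : w.im ≠ 0) : S t w = S' t w := by
  have hzero : ∀ u : ℂ, u.im ≠ 0 → S 0 u = S' 0 u := by
    intro u hu
    have ht0 : (0 : ℝ) ∈ Ico 0 T := ⟨le_rfl, hs.hT⟩
    obtain ⟨x, hx, rfl, hd, -⟩ := exists_root_of_im L hs.hk 0 hu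
    have hK := notMem_nodes_of_im_ne (L := L) (p := pt L k 0) (lo := 0 - T) (hi := N) hu
    rw [(hF.val 0 ht0 x hx hK hd).2, (hF'.val 0 ht0 x hx hK hd).2, fx, fx, h0]
  obtain ⟨h1, h2⟩ := hsub t ht w hw
  have h3 : (w + ((Real.exp (L * t) - 1 : ℝ) : ℂ) * S t w).im ≠ 0 := left_ne_zero_of_mul h1.ne'
  rw [hsub'.eq_of hF' hs.hL ht h1 (by rw [← hzero _ h3, h2]; ring), ← hzero _ h3, h2]

theorem Subordinated.expo_eq (hsub : Subordinated L T S) (hF : TransformFamily L k T N R h S)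
    (hs : Setting L k T N R h) (hsub' : Subordinated L T S')
    (hF' : TransformFamily L k T N R h' S') (hs' : Setting L k T N R h') (h0 : h 0 = h' 0)
    {t : ℝ} (ht : t ∈ Ico 0 T) {x : ℂ} (hx : (jk (pt L k t) x).im ≠ 0) :
    expo L (pt L k t) (t - T) N (h t) x = expo L (pt L k t) (t - T) N (h' t) x := by
  obtain ⟨hx0, hd⟩ := ne_zero_of_jk_im (pt_pos hs.hk t) hx
  have hreg := hs.regular ht
  refine expo_eq_of_exp_eq hs.hL hreg.hp hreg.dens (hs'.regular ht).dens hreg.hlR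
    (im_ne_zero_of_jk_im hx) ?_
  have h1 := (hF.fx_eq ht hx0 (notMem_nodes_of_im_ne hx) hd).2
  have h2 := (hF'.fx_eq ht hx0 (notMem_nodes_of_im_ne hx) hd).2
  rw [← hsub.transform_eq hF hs hsub' hF' h0 ht hx] at h2
  exact h1.trans h2.symm

/-- Subordination determines the densities at all intermediate times. -/
theorem Subordinated.ae_eq (hsub : Subordinated L T S) (hF : TransformFamily L k T N R h S)
    (hs : Setting L k T N R h) (hsub' : Subordinated L T S')
    (hF' : TransformFamily L k T N R h' S') (hs' : Setting L k T N R h') (h0 : h 0 = h' 0)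
    {t : ℝ} (ht : t ∈ Ioo 0 T) : ∀ᵐ s, s ∈ Ioo (t - T) N → h t s = h' t s := by
  have hL := hs.hL
  have ht' : t ∈ Ico 0 T := ⟨ht.1.le, ht.2⟩
  have hreg := hs.regular ht'
  have hdens' := (hs'.regular ht').dens
  set p := pt L k t with hp
  have hp0 : 0 < p := hreg.hp
  have hL' : (L : ℂ) ≠ 0 := by exact_mod_cast hL.ne'
  have hct : ∀ w : ℂ, w.im ≠ 0 → ct L p (t - T) N (h t) w = ct L p (t - T) N (h' t) w := by
    intro w hw
    obtain ⟨x, hx, rfl, hd, -⟩ := exists_root_of_im L hs.hk t hw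
    have h1 := hsub.expo_eq hF hs hsub' hF' hs' h0 ht' hw
    rw [expo, expo, neg_inj] at h1
    exact mul_left_cancel₀ (mul_ne_zero hL' hd) h1
  -- The fold: e^{L c₀} = √p, the critical point of the nodes.
  set c₀ := Real.log p / (2 * L) with hc₀
  have hexp : Real.exp (L * c₀) ^ 2 = p := by
    rw [← Real.exp_nat_mul, hc₀]
    have : ((2 : ℕ) : ℝ) * (L * (Real.log p / (2 * L))) = Real.log p := by
      push_cast; field_simp
    rw [this, Real.exp_log hp0]
  have hlow : t - T < c₀ := by
    have h1 : Real.exp (2 * L * (t - T)) < p := by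
      calc Real.exp (2 * L * (t - T)) ≤ Real.exp (L * R) * Real.exp (L * N) * Real.exp (L * t) := by
            rw [← Real.exp_add, ← Real.exp_add]
            refine Real.exp_le_exp.2 ?_
            have h2 : 2 * (t - T) ≤ R + N + t := by
              linarith [hs.hTR, hs.hN, ht.2]
            nlinarith
        _ < p := by
            rw [hp, pt]
            exact mul_lt_mul_of_pos_right hs.hAb (Real.exp_pos _)
    rw [hc₀, lt_div_iff₀ (by positivity), mul_comm]
    exact (Real.lt_log_iff_exp_lt hp0).2 h1
  set I : Set ℝ := {σ | p < Real.exp (L * σ) ^ 2 ∧ Real.exp (L * σ) < Real.exp (L * N)} with hI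
  have hIo : IsOpen I :=
    (isOpen_lt continuous_const
      (by fun_prop : Continuous fun σ : ℝ => Real.exp (L * σ) ^ 2)).inter
      (isOpen_lt (by fun_prop : Continuous fun σ : ℝ => Real.exp (L * σ)) continuous_const)
  have hm : 0 < ∫ s in (t - T)..N, h t s := by
    rw [hs.mass t ⟨ht.1.le, ht.2.le⟩]; linarith [ht.2]
  -- Above the fold the two families have the same exponent, whose imaginary part tends to 0
  -- throughout a neighbourhood or to 2π throughout it. Accordingly both densities are 0 there, or
  -- both are 1.
  have hloc : ∀ σ₀ ∈ I ∩ Ioo (t - T) N, ∃ V ∈ 𝓝 σ₀, ∀ᵐ s, s ∈ V → h t s = h' t s := by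
    intro σ₀ hσ₀
    obtain ⟨V, hV, halt⟩ := tendsto_expo_im_zero_or_two_pi hL hp0 hreg.dens hreg.hlR hm hIo
      (fun σ hσ => hsub.exists_tendsto_fx hF hs ht (Real.exp_pos _) hσ.1 hσ.2) hσ₀.1
    obtain ⟨η, hη, hball⟩ := Metric.mem_nhds_iff.1
      (inter_mem hV (inter_mem (hIo.mem_nhds hσ₀.1) (isOpen_Ioo.mem_nhds hσ₀.2)))
    have hsubset : Icc (σ₀ - η / 2) (σ₀ + η / 2) ⊆ V ∩ (I ∩ Ioo (t - T) N) := fun s hs =>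
      hball (by rw [Metric.mem_ball, Real.dist_eq, abs_lt]; constructor <;> linarith [hs.1, hs.2])
    have hαβ : σ₀ - η / 2 < σ₀ + η / 2 := by linarith
    have hlo := (hsubset ⟨le_rfl, hαβ.le⟩).2.2.1.le
    have hhi := (hsubset ⟨hαβ.le, le_rfl⟩).2.2.2.le
    have hcongr : ∀ σ ∈ I, ∀ᶠ ε : ℝ in 𝓝[>] 0,
        (expo L p (t - T) N (h t) (Real.exp (L * σ) + ε * Complex.I)).im
          = (expo L p (t - T) N (h' t) (Real.exp (L * σ) + ε * Complex.I)).im := by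
      intro σ hσ
      filter_upwards [self_mem_nhdsWithin] with ε (hε : 0 < ε)
      set x : ℂ := Real.exp (L * σ) + ε * Complex.I with hx
      have hxim : x.im = ε := im_ofReal_add_mul_I _ _
      have hxn : ‖x‖ ^ 2 = Real.exp (L * σ) ^ 2 + ε ^ 2 := by
        rw [← Complex.normSq_eq_norm_sq, Complex.normSq_apply, hxim, hx, re_ofReal_add_mul_I]
        ring
      have h1 : (jk p x).im = x.im * (1 - p / ‖x‖ ^ 2) := joukowski_im x p
      have h2 : p / ‖x‖ ^ 2 < 1 := by
        rw [div_lt_one (by rw [hxn]; positivity), hxn]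
        nlinarith [hσ.1, sq_nonneg ε]
      have h3 : (jk p x).im ≠ 0 := by
        rw [h1, hxim]; exact (mul_pos hε (by linarith)).ne'
      rw [hsub.expo_eq hF hs hsub' hF' hs' h0 ht' h3]
    refine ⟨Ioo (σ₀ - η / 2) (σ₀ + η / 2), Ioo_mem_nhds (by linarith) (by linarith), ?_⟩
    rcases halt with hz | hz
    · have h1 := ae_eq_zero_of_expo_im_tendsto hL hp0 hreg.dens hlo hαβ hhi
        fun σ hσ => hz σ (hsubset (Ico_subset_Icc_self hσ)).1
      have h2 := ae_eq_zero_of_expo_im_tendsto hL hp0 hdens' hlo hαβ hhi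
        fun σ hσ => (hz σ (hsubset (Ico_subset_Icc_self hσ)).1).congr'
          (hcongr σ (hsubset (Ico_subset_Icc_self hσ)).2.1)
      filter_upwards [h1, h2] with s e1 e2 hs
      rw [e1 (Ioo_subset_Ioc_self hs), e2 (Ioo_subset_Ioc_self hs)]
    · have h1 := ae_eq_one_of_expo_im_tendsto hL hp0 hreg.dens hreg.hlR hlo hαβ hhi
        fun σ hσ => hz σ (hsubset (Ico_subset_Icc_self hσ)).1
      have h2 := ae_eq_one_of_expo_im_tendsto hL hp0 hdens' hreg.hlR hlo hαβ hhi
        fun σ hσ => (hz σ (hsubset (Ico_subset_Icc_self hσ)).1).congr'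
          (hcongr σ (hsubset (Ico_subset_Icc_self hσ)).2.1)
      filter_upwards [h1, h2] with s e1 e2 hs
      rw [e1 (Ioo_subset_Ioc_self hs), e2 (Ioo_subset_Ioc_self hs)]
  -- A set that is null near each of its points is null.
  have hfold : ∀ᵐ s, s ∈ I ∩ Ioo (t - T) N → h t s = h' t s := by
    rw [ae_iff]
    refine measure_null_of_locally_null _ fun σ hσ => ?_
    simp only [mem_ofPred_eq, Classical.not_imp] at hσ
    obtain ⟨V, hV, hVae⟩ := hloc σ hσ.1
    refine ⟨{s | ¬(s ∈ I ∩ Ioo (t - T) N → h t s = h' t s)} ∩ V,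
      inter_mem self_mem_nhdsWithin (mem_nhdsWithin_of_mem_nhds hV),
      measure_mono_null (fun s hs => ?_) (ae_iff.1 hVae)⟩
    simp only [mem_inter_iff, mem_ofPred_eq, Classical.not_imp] at hs ⊢
    exact ⟨hs.2, hs.1.2⟩
  refine ae_eq_of_ct_eq (p := p) hL hreg.hlR hreg.dens hdens' hct (c := min c₀ N) ?_
    (min_le_right _ _) ?_
  · rw [← hexp]
    have : Real.exp (L * min c₀ N) ≤ Real.exp (L * c₀) :=
      Real.exp_le_exp.2 (mul_le_mul_of_nonneg_left (min_le_left _ _) hL.le)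
    gcongr
  · filter_upwards [hfold] with s hs hsc
    have h1 : c₀ < s := (min_lt_iff.1 hsc.1).resolve_right (not_lt.2 hsc.2.le)
    refine hs ⟨⟨?_, Real.exp_lt_exp.2 (mul_lt_mul_of_pos_left hsc.2 hL)⟩, hlow.trans h1, hsc.2⟩
    rw [← hexp]
    have : Real.exp (L * c₀) < Real.exp (L * s) :=
      Real.exp_lt_exp.2 (mul_lt_mul_of_pos_left h1 hL)
    gcongr

end

/-! ### From admissible families to the analytic setting. -/

section

variable {q κ T N r R : ℝ} {ρ σ : ℝ → ℝ → ℝ} {S : ℝ → ℂ → ℂ}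

theorem IsAdmissible.isDensity {t : ℝ} {ρ : ℝ → ℝ} (hρ : IsAdmissible T N t ρ) :
    IsDensity (fun s => 1 - ρ s) :=
  ⟨measurable_const.sub hρ.measurable, fun s => sub_nonneg.2 (hρ.le_one s),
    fun s => by linarith [hρ.nonneg s]⟩

theorem IsAdmissible.integral_compl {t : ℝ} {ρ : ℝ → ℝ} (hρ : IsAdmissible T N t ρ)
    (ht : t - T ≤ N) : ∫ s in (t - T)..N, (1 - ρ s) = T - t := by
  have hint := hρ.isDensity.intervalIntegrable (t - T) N
  have h1 : IntervalIntegrable ρ volume (t - T) N := by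
    have := (intervalIntegrable_const (c := (1 : ℝ))).sub hint
    exact this.congr fun s _ => by simp
  have h2 : ∫ s in (t - T)..N, ρ s = N := by
    rw [intervalIntegral.integral_of_le ht, ← integral_Icc_eq_integral_Ioc,
      setIntegral_eq_integral_of_forall_compl_eq_zero fun s hs => hρ.support s hs, hρ.mass]
  rw [intervalIntegral.integral_sub intervalIntegrable_const h1, h2]
  simp

theorem IsAdmissible.neg_lt {ρ : ℝ → ℝ} (hρ : IsAdmissible T N 0 ρ) (hN : 0 < N)
    (hr : ∀ s, r < s → ρ s = 0) : -T < r := by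
  by_contra hle
  push Not at hle
  have h1 : ρ =ᵐ[volume] 0 := by
    filter_upwards [Measure.ae_ne volume (-T)] with s hs
    rcases lt_or_gt_of_ne hs with h2 | h2
    · exact hρ.support s fun h3 => by linarith [h3.1]
    · exact hr s (hle.trans_lt h2)
  have h2 := hρ.mass
  rw [integral_congr_ae h1] at h2
  simp at h2
  linarith

/-- The truncation R = min r N is needed because r may exceed N; the hypothesis on κ only becomes
weaker when r decreases to R. -/
theorem setting_of_isAdmissible (hq : 0 < q) (hq1 : q < 1) (hκ : 0 < κ) (hT : 0 < T) (hN : 0 < N)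
    (hκr : q ^ (-N - r) < κ ^ 2) (hρ : ∀ t ∈ Icc 0 T, IsAdmissible T N t (ρ t))
    (hr : ∀ s, r < s → ρ 0 s = 0) :
    Setting (-Real.log q) (κ ^ 2) T N (min r N) (fun t s => 1 - ρ t s) := by
  have hL : 0 < -Real.log q := neg_pos.2 (Real.log_neg hq hq1)
  have h0 : (0 : ℝ) ∈ Icc 0 T := ⟨le_rfl, hT.le⟩
  refine ⟨hL, pow_pos hκ 2, hT, hN, lt_min ((hρ 0 h0).neg_lt hN hr) (by linarith),
    min_le_right _ _, ?_, fun t ht => (hρ t ht).isDensity,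
    fun t ht => (hρ t ht).integral_compl (by linarith [ht.2]), fun s hs => ?_⟩
  · refine lt_of_le_of_lt ?_ hκr
    rw [Real.rpow_def_of_pos hq, ← Real.exp_add]
    refine Real.exp_le_exp.2 ?_
    nlinarith [min_le_left r N]
  · rw [hr s ((min_lt_iff.1 hs.1).resolve_right (not_lt.2 hs.2)), sub_zero]

/-- Each of the three descriptions is equivalent to subordination. -/
theorem descriptions_iff_subordinated (hq : 0 < q) (hq1 : q < 1) (hκ : 0 < κ)
    (hs : Setting (-Real.log q) (κ ^ 2) T N R (fun t s => 1 - ρ t s))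
    (hF : TransformFamily (-Real.log q) (κ ^ 2) T N R (fun t s => 1 - ρ t s) S) :
    (BurgersDescription q κ T N ρ ↔ Subordinated (-Real.log q) T S) ∧
    (ImplicitDescription q κ T N ρ ↔ Subordinated (-Real.log q) T S) ∧
    (InvariantDescription q κ T N ρ ↔ Subordinated (-Real.log q) T S) :=
  ⟨(burgersDescription_iff hq hq1 rfl hs).trans
      ⟨fun hB => hB.subordinated hs hF, fun hsub => hsub.burgersX hs hF⟩,
    implicitDescription_iff hq hq1 hκ hs hF,
    fun hC => hC.subordinated hq hq1 hκ hs hF, fun hsub => hsub.invariantDescription hq hs hF⟩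

theorem ae_eq_of_ae_eq_Ioo {t : ℝ} {ρ σ : ℝ → ℝ} (hρ : IsAdmissible T N t ρ)
    (hσ : IsAdmissible T N t σ) (h : ∀ᵐ s, s ∈ Ioo (t - T) N → 1 - ρ s = 1 - σ s) :
    ρ =ᵐ[volume] σ := by
  filter_upwards [h, Measure.ae_ne volume (t - T), Measure.ae_ne volume N] with s h1 h2 h3
  by_cases hs : s ∈ Icc (t - T) N
  · have := h1 ⟨lt_of_le_of_ne hs.1 (Ne.symm h2), lt_of_le_of_ne hs.2 h3⟩
    linarith
  · rw [hρ.support s hs, hσ.support s hs]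

/-- At time T the interval has length N, equal to the mass, so a density bounded by 1 must be 1
almost everywhere on it. -/
theorem IsAdmissible.ae_eq_final {ρ : ℝ → ℝ} (hρ : IsAdmissible T N T ρ) (hN : 0 < N) :
    ∀ᵐ s, s ∈ Ioo (T - T) N → 1 - ρ s = 0 := by
  have h1 := hρ.integral_compl (by linarith)
  rw [sub_self, intervalIntegral.integral_eq_zero_iff_of_le_of_nonneg_ae hN.le
    (Eventually.of_forall hρ.isDensity.nonneg) (hρ.isDensity.intervalIntegrable _ _)] at h1
  filter_upwards [(ae_restrict_iff' measurableSet_Ioc).1 h1] with s hs hs'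
  rw [sub_self] at hs'
  exact hs (Ioo_subset_Ioc_self hs')

end

end LimitShape

open LimitShape in
theorem mainTheorem5 (q κ T N r : ℝ) (hq0 : 0 < q) (hq1 : q < 1) (hκ : 0 < κ)
    (hT : 0 < T) (hN : 0 < N) (hκr : q ^ (-N - r) < κ ^ 2)
    (ρ₀ : ℝ → ℝ) (hρ₀ : IsAdmissible T N 0 ρ₀) (hr : ∀ s, r < s → ρ₀ s = 0) :
    (∀ ρ : ℝ → ℝ → ℝ, (∀ t ∈ Set.Icc 0 T, IsAdmissible T N t (ρ t)) → ρ 0 = ρ₀ →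
      (BurgersDescription q κ T N ρ ↔ ImplicitDescription q κ T N ρ) ∧
      (BurgersDescription q κ T N ρ ↔ InvariantDescription q κ T N ρ)) ∧
    (∀ ρ σ : ℝ → ℝ → ℝ, (∀ t ∈ Set.Icc 0 T, IsAdmissible T N t (ρ t)) →
      (∀ t ∈ Set.Icc 0 T, IsAdmissible T N t (σ t)) → ρ 0 = ρ₀ → σ 0 = ρ₀ →
      (BurgersDescription q κ T N ρ ∨ ImplicitDescription q κ T N ρ ∨
        InvariantDescription q κ T N ρ) →
      (BurgersDescription q κ T N σ ∨ ImplicitDescription q κ T N σ ∨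
        InvariantDescription q κ T N σ) →
      ∀ t ∈ Set.Icc 0 T, ρ t =ᵐ[MeasureTheory.volume] σ t) := by
  refine ⟨fun ρ hρ h0 => ?_, fun ρ σ hρ hσ h0 h0' hdρ hdσ t ht => ?_⟩
  · have hs := setting_of_isAdmissible hq0 hq1 hκ hT hN hκr hρ (by rwa [h0])
    obtain ⟨S, hF⟩ := hs.exists_family
    obtain ⟨hA, hB, hC⟩ := descriptions_iff_subordinated hq0 hq1 hκ hs hF
    exact ⟨hA.trans hB.symm, hA.trans hC.symm⟩
  · have hs := setting_of_isAdmissible hq0 hq1 hκ hT hN hκr hρ (by rwa [h0])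
    have hs' := setting_of_isAdmissible hq0 hq1 hκ hT hN hκr hσ (by rwa [h0'])
    obtain ⟨S, hF⟩ := hs.exists_family
    obtain ⟨S', hF'⟩ := hs'.exists_family
    obtain ⟨hA, hB, hC⟩ := descriptions_iff_subordinated hq0 hq1 hκ hs hF
    obtain ⟨hA', hB', hC'⟩ := descriptions_iff_subordinated hq0 hq1 hκ hs' hF'
    have hsub : Subordinated (-Real.log q) T S := by
      rcases hdρ with h | h | h
      exacts [hA.1 h, hB.1 h, hC.1 h]
    have hsub' : Subordinated (-Real.log q) T S' := by
      rcases hdσ with h | h | h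
      exacts [hA'.1 h, hB'.1 h, hC'.1 h]
    -- The endpoints are separate: t = 0 holds by assumption, and t = T by the mass constraint
    -- alone.
    rcases ht.1.eq_or_lt with rfl | ht0
    · rw [h0, h0']
    rcases ht.2.eq_or_lt with rfl | htT
    · refine ae_eq_of_ae_eq_Ioo (hρ t ht) (hσ t ht) ?_
      filter_upwards [(hρ t ht).ae_eq_final hN, (hσ t ht).ae_eq_final hN] with s h1 h2 hs
      rw [h1 hs, h2 hs]
    · exact ae_eq_of_ae_eq_Ioo (hρ t ht) (hσ t ht)
        (hsub.ae_eq hF hs hsub' hF' hs' (by rw [h0, h0']) ⟨ht0, htT⟩)
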